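/- **Notation.** Fix integers $r\ge 0$, $d\ge 2$ and put $n=2r+2$, $D=2d+2$. Let $\Theta_n$ be the set of $\mathbb Z\times\mathbb Z$ matrices $T=(t_{ij})$ over $\mathbb N$ with finitely many nonzero entries in each row and $t_{i+n,j+n}=t_{ij}$; write $\mathrm{row}(T)_i=\sum_j t_{ij}$. Let $\Xi_{n,d}$ be the set of $A\in\Theta_n$ with $a_{-i,-j}=a_{ij}$, $a_{00},a_{r+1,r+1}$ odd and $\sum_{i=1}^n\mathrm{row}(A)_i=D$. Put $a'_{ii}=\frac12(a_{ii}-1)$ if $i\equiv 0,r+1 \pmod n$ and $a'_{ij}=a_{ij}$ otherwise. Let $\mathrm{row}_{\mathfrak c}(A)=(\lambda_0,\dots,\lambda_{r+1})$ with $\lambda_0=a'_{00}+\sum_{j\ge1}a_{0j}$, $\lambda_k=\mathrm{row}(A)_k$ $(1\le k\le r)$, $\lambda_{r+1}=a'_{r+1,r+1}+\sum_{j\le r}a_{r+1,j}$, and $\mathrm{col}_{\mathfrak c}(A)=\mathrm{row}_{\mathfrak c}(A^{\mathsf T})$. For matrices put $T_\theta=(t_{ij}+t_{-i,-j})$, $\widehat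 T=(t_{i+1,j})$, $\check T=(t_{i-1,j})$, $T^\dagger=(t_{1-i,-j})$. Let $W$ be the affine Weyl group of type $\widetilde C_d$, realised as the permutations $g$ of $\mathbb Z$ with $g(i+D)=g(i)+D$ and $g(-i)=-g(i)$, with simple reflections $s_0$ (swapping $kD\pm1$), $s_i$ (swapping $kD\pm i$ with $kD\pm(i+1)$, $1\le i<d$), $s_d$ (swapping $kD\pm d$ with $kD\pm(d+2)$) and length function $\ell$. For a weak composition $\lambda=(\lambda_0,\dots,\lambda_{r+1})$ of $d$ let $W_\lambda$ be generated by the $s_i$ with $i\notin\{\lambda_0+\dots+\lambda_k: 0\le k\le r\}$, and let $R^\lambda_0=[-\lambda_0,\lambda_0]$, $R^\lambda_k=(\lambda_0+\dots+\lambda_{k-1},\lambda_0+\dots+\lambda_k]$ $(1\le k\le r)$, $R^\lambda_{r+1}=[d+1-\lambda_{r+1},d+1+\lambda_{r+1}]$, $R^\lambda_{-i}=-R^\lambda_i$, $R^\lambda_{i+n}=R^\lambda_i+D$. For $A\in\Xi_{n,d}$ with $\lambda=\mathrm{row}_{\mathfrak c}(A)$, $\mu=\mathrm{col}_{\mathfrak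 c}(A)$ let $g_A\in W$ be the element of minimal length in its double coset $W_\lambda g_AW_\mu$ with $a_{ij}=|R^\lambda_i\cap g_AR^\mu_j|$ for all $i,j$, and put $\ell(A)=\ell(g_A)$. Let $v$ be an indeterminate, $[m]=\frac{v^{2m}-1}{v^2-1}$, $[m]^!=[m]\cdots[1]$, $\left[{m\atop k}\right]=\frac{[m][m-1]\cdots[m-k+1]}{[k]^!}$; this is the specialisation $q=v^{-1}$, $(q_0,q_1)=(1,q^2)$ of the three-parameter setting. Put $[T]^!=\prod_{i=1}^n\prod_j[t_{ij}]^!$ and $$[A]^!_{\mathfrak c}=\prod_{k=1}^{a'_{00}}[2k]\ \prod_{k=1}^{a'_{r+1,r+1}}[2k]\ \prod_{j>0}[a_{0j}]^!\ \prod_{1\le i\le r,\,j\in\mathbb Z}[a_{ij}]^!\ \prod_{j<r+1}[a_{r+1,j}]^!.$$ Let $\mathbb S$ be the $\mathbb Q(v)$-vector space with basis $\{e_C: C\in\Xi_{n,d}\}$ (the equal-parameter affine $q$-Schur algebra of type C over $\mathbb Q(v)$, with its basis $\{e_C\}$). **First right-hand side.** Let $A,B\in\Xi_{n,d}$ with $B$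 tridiagonal and $\mathrm{row}_{\mathfrak c}(A)=\mathrm{col}_{\mathfrak c}(B)$. Let $\Theta_{B,A}$ be the set of $T\in\Theta_n$ with $T_\theta\le A$ entrywise and $\mathrm{row}(T)_i=b_{i-1,i}$ for all $i$; for $T\in\Theta_{B,A}$ let $\Gamma_T$ be the set of $S\in\Theta_n$ with $S\le T$ entrywise and $\mathrm{row}(S)=\mathrm{row}(S^\dagger)$; put $A^{(T-S)}=A-(T-S)_\theta+(\widehat{T-S})_\theta$. Let $\delta=(b'_{00},b_{10};b_{01},b_{11},b_{21};\dots;b_{r-1,r},b_{rr},b_{r+1,r};b_{r,r+1},b'_{r+1,r+1})$, with associated blocks $R^\delta_i$ (defined as above with $3r+2$ in place of $r$), and let $w_{A,T}$ be the element of minimal length among the $w\in W_{\mathrm{row}_{\mathfrak c}(A)}$ that have minimal length in $W_\delta w$ and satisfy $|R^\delta_{3i-1}\cap wg_AR^{\mathrm{col}_{\mathfrak c}(A)}_j|=t_{ij}$ for all $i,j$. Put $\ell(A,B,S,T)=\ell(A)+\ell(B)-\ell(A^{(T-S)})+\ell(w_{A,T})$, $n(S)=\sum_{i=1}^{r+1}\mathrm{row}(S)_i$,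 $$h(S,T)=\sum_{i=1}^{r+1}\sum_{j}s_{ij}\Big(\sum_{k\le j}t_{ik}-\tfrac{s_{ij}+1}2\Big)+\sum_{i=1}^{r+1}\sum_j(t_{1-i,-j}-s_{1-i,-j})\Big(\sum_{k<j}t_{ik}+\sum_{k\ge j}s_{ik}-\sum_{k>j}s_{1-i,-k}\Big),$$ $$[\![S]\!]=\prod_{i=1}^{r+1}\prod_{j}\left[{\sum_{k\le j}(S-S^\dagger)_{ik}\atop s^\dagger_{i,j+1}}\right][s^\dagger_{i,j+1}]^!,\qquad [\![A;S;T]\!]=\frac{[A^{(T-S)}]^!_{\mathfrak c}\,[\![S]\!]}{[A-T_\theta]^!_{\mathfrak c}[S]^![T-S]^!},$$ $$\mathrm{RHS}_1=\sum_{T\in\Theta_{B,A},\,S\in\Gamma_T}(v^2-1)^{n(S)}v^{2(\ell(A,B,S,T)-n(S)-h(S,T))}[\![A;S;T]\!]\,e_{A^{(T-S)}}.$$ **Second right-hand side.** Let $\alpha=(\alpha_i)_{i\in\mathbb Z}\in\mathbb N^{\mathbb Z}$ be $n$-periodic with $B-\sum_{i=1}^n\alpha_iE^{i,i+1}_\theta$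 diagonal, where $E^{i,i+1}_\theta$ has entries $1$ at $(i+kn,i+1+kn)$ and $(-i+kn,-i-1+kn)$, $k\in\mathbb Z$, and $0$ elsewhere. For $X,Y\in\Theta_n$ put $A_{X,Y}=A+X-Y-(\check X-\check Y)=(a^*_{ij})$ and $$\left[{A_{X,Y}\atop X}\right]=\prod_{(i,j)\in\mathscr I}\left[{a^*_{ij}\atop x_{ij}}\right]\left[{a^*_{ij}-x_{ij}\atop x_{-i,-j}}\right]\prod_{i\in\{0,-r-1\}}\prod_{k=0}^{x_{ii}-1}\frac{[a^*_{ii}-2k-1]}{[k+1]},$$ $\mathscr I=(\{-r-1\}\times(-r-1,\infty))\cup([-r,-1]\times\mathbb Z)\cup(\{0\}\times(-\infty,0))$. For finitely supported $a,c,b\in\mathbb N^{\mathbb Z}$ put $$n(a,c,b)=\sum_\sigma v^{2(\sum_{l>p}\sigma_{kl}a_p+\sum_k\sigma_{kk}a_k+\sum_{k>p,\,l<m}\sigma_{kl}\sigma_{pm})}\,\frac{\prod_k[b_k]^!}{\prod_{k,l}[\sigma_{kl}]^!}\prod_{l\in\mathbb Z}\ \prod_{m=0}^{c_l-\sigma_{ll}-1}(v^{2a_l}-v^{2m}),$$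 summed over the finitely supported upper triangular (diagonal allowed) matrices $\sigma$ over $\mathbb N$ with row sums $b$ and column sums $c$; let $n(X,Y)=\prod_{i=0}^r n\big((x_{ij})_j,(y_{ij})_j,(x_{-i-1,-j})_j\big)$ and $$\xi_{A,X,Y}=\sum_{\substack{-r-1\le i\le r\\ j>l}}(a^*_{ij}-x_{ij})x_{il}-\Big(\sum_{\substack{-r\le i\le -1\\ j>l}}+\sum_{\substack{i\in\{-r-1,0\}\\ 2i-l>j>l}}\Big)x_{-i,-j}x_{il}-\sum_{\substack{i\in\{-r-1,0\}\\ j<i}}\frac{x_{ij}(x_{ij}+1)}2.$$ Then $$\mathrm{RHS}_2=\sum_{X,Y}v^{2\xi_{A,X,Y}}\,n(X,Y)\left[{A_{X,Y}\atop X}\right]e_{A_{X,Y}},$$ summed over $X,Y\in\Theta_n$ with $x_{ij}+x_{-i-1,-j}=y_{ij}+y_{-i-1,-j}$, $\mathrm{row}(X)_i=\alpha_i$ and $\mathrm{row}(Y)_i=\alpha_{-i-1}$ for all $i,j$, $A-Y+\check Y\in\Theta_n$ and $A_{X,Y}\in\Xi_{n,d}$. **Proposition.** Let $r\ge0$, $d\ge2$,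 and let $A,B\in\Xi_{n,d}$ with $B$ tridiagonal and $\mathrm{row}_{\mathfrak c}(A)=\mathrm{col}_{\mathfrak c}(B)$. Then a sequence $\alpha$ as above exists, and for every such $\alpha$ both sums are finite, every $A^{(T-S)}$ occurring in the first lies in $\Xi_{n,d}$, and $$\mathrm{RHS}_1=\mathrm{RHS}_2\quad\text{in }\mathbb S.$$ -/

import Mathlib

namespace AffineC

noncomputable section

/-! ### The affine Weyl group of type C as permutations of the integers, and its length -/

/-- Permutations `g` of `ℤ` with `g (i + D) = g i + D` and `g (-i) = - g i`, where `D = 2 d + 2`. -/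
def weyl (d : ℕ) : Subgroup (Equiv.Perm ℤ) where
  carrier := {g | (∀ i : ℤ, g (i + (2 * d + 2)) = g i + (2 * d + 2)) ∧ ∀ i : ℤ, g (-i) = -g i}
  mul_mem' := by
    rintro a b ⟨ha, ha'⟩ ⟨hb, hb'⟩
    refine ⟨fun i => ?_, fun i => ?_⟩
    · simp only [Equiv.Perm.mul_apply, hb, ha]
    · simp only [Equiv.Perm.mul_apply, hb', ha']
  one_mem' := ⟨fun _ => rfl, fun _ => rfl⟩
  inv_mem' := by
    rintro a ⟨ha, ha'⟩
    refine ⟨fun i => ?_, fun i => ?_⟩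
    · rw [Equiv.Perm.inv_eq_iff_eq, ha]; simp
    · rw [Equiv.Perm.inv_eq_iff_eq, ha']; simp

/-- `g` is the transposition `(i, j)_c`: it swaps `k D + i` with `k D + j` and `k D - i` with
`k D - j` for all `k`, and fixes every other integer. -/
def IsTransposition (d : ℕ) (i j : ℤ) (g : Equiv.Perm ℤ) : Prop :=
  (∀ k : ℤ, g (k * (2 * d + 2) + i) = k * (2 * d + 2) + j ∧
    g (k * (2 * d + 2) + j) = k * (2 * d + 2) + i ∧
    g (k * (2 * d + 2) - i) = k * (2 * d + 2) - j ∧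
    g (k * (2 * d + 2) - j) = k * (2 * d + 2) - i) ∧
  ∀ x : ℤ, (∀ k : ℤ, x ≠ k * (2 * d + 2) + i ∧ x ≠ k * (2 * d + 2) + j ∧
    x ≠ k * (2 * d + 2) - i ∧ x ≠ k * (2 * d + 2) - j) → g x = x

/-- `g` is the simple reflection `s_i`, for `0 ≤ i ≤ d`:
`s_0 = (1, -1)_c`, `s_d = (d, d + 2)_c`, and `s_i = (i, i + 1)_c` otherwise. -/
def IsSimpleReflection (d i : ℕ) (g : Equiv.Perm ℤ) : Prop :=
  if i = 0 then IsTransposition d 1 (-1) g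
  else if i = d then IsTransposition d d (d + 2) g
  else IsTransposition d i (i + 1) g

/-- The length function of the Weyl group: the least number of simple reflections in a word
for `g`. -/
def len (d : ℕ) (g : Equiv.Perm ℤ) : ℕ :=
  sInf {m | ∃ l : List (Equiv.Perm ℤ),
    (∀ s ∈ l, ∃ i ≤ d, IsSimpleReflection d i s) ∧ l.prod = g ∧ l.length = m}

/-- For a weak composition `c = (c_0, …, c_{r+1})` of `d`, the parabolic subgroup `W_c` generated
by all `s_i` (`0 ≤ i ≤ d`) with `i` not one of `c_0 + ⋯ + c_k`, `0 ≤ k ≤ r`. -/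
def parabolic (r d : ℕ) (c : ℕ → ℤ) : Subgroup (Equiv.Perm ℤ) :=
  Subgroup.closure {g | ∃ i ≤ d,
    (∀ k ≤ r, (i : ℤ) ≠ ∑ l ∈ Finset.range (k + 1), c l) ∧ IsSimpleReflection d i g}

/-- The intervals `R_0^c = [-c_0, c_0]`, `R_k^c = (c_0 + ⋯ + c_{k-1}, c_0 + ⋯ + c_k]` for
`1 ≤ k ≤ r`, and `R_{r+1}^c = [d + 1 - c_{r+1}, d + 1 + c_{r+1}]`. -/
def baseBlock (r d : ℕ) (c : ℕ → ℤ) (k : ℕ) : Set ℤ :=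
  if k = 0 then Set.Icc (-c 0) (c 0)
  else if k = r + 1 then Set.Icc (d + 1 - c (r + 1)) (d + 1 + c (r + 1))
  else Set.Ioc (∑ l ∈ Finset.range k, c l) (∑ l ∈ Finset.range (k + 1), c l)

/-- The blocks `R_i^c` for all integers `i`, extended from `0 ≤ i ≤ r + 1` by `R_{-i} = -R_i` and
`R_{i+n} = R_i + D`, where `n = 2 r + 2` and `D = 2 d + 2`. -/
def block (r d : ℕ) (c : ℕ → ℤ) (i : ℤ) : Set ℤ :=
  {x | ∃ k ≤ r + 1, ∃ m : ℤ,
    (i = k + m * (2 * r + 2) ∧ x - m * (2 * d + 2) ∈ baseBlock r d c k) ∨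
    (i = -k + m * (2 * r + 2) ∧ -(x - m * (2 * d + 2)) ∈ baseBlock r d c k)}

/-! ### Periodic matrices -/

/-- The set `Θ_n`, `n = 2 r + 2`: nonnegative integer `ℤ × ℤ` matrices, `n`-periodic along the
diagonal, with finitely many nonzero entries in each row (so that row sums make sense). -/
structure IsTheta (r : ℕ) (T : ℤ → ℤ → ℤ) : Prop where
  nonneg : ∀ i j, 0 ≤ T i j
  periodic : ∀ i j, T (i + (2 * r + 2)) (j + (2 * r + 2)) = T i j
  finite_row : ∀ i, {j | T i j ≠ 0}.Finite

/-- The sum of the `i`-th row. -/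
def rowSum (T : ℤ → ℤ → ℤ) (i : ℤ) : ℤ := ∑ᶠ j, T i j

/-- The set `Ξ_{n,d}`, `n = 2 r + 2`. -/
structure IsXi (r d : ℕ) (A : ℤ → ℤ → ℤ) : Prop extends IsTheta r A where
  symm : ∀ i j, A (-i) (-j) = A i j
  odd_zero : Odd (A 0 0)
  odd_last : Odd (A (r + 1) (r + 1))
  total : ∑ i ∈ Finset.Icc (1 : ℤ) (2 * r + 2), rowSum A i = 2 * d + 2

/-- The modified entries `a'_{ij}`: equal to `(a_{ii} - 1) / 2` if `i = j ≡ 0, r + 1` modulo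
`n = 2 r + 2`, and to `a_{ij}` otherwise. -/
def entry (r : ℕ) (A : ℤ → ℤ → ℤ) (i j : ℤ) : ℤ :=
  if i = j ∧ ((2 * r + 2 : ℤ) ∣ i ∨ (2 * r + 2 : ℤ) ∣ i - (r + 1)) then (A i j - 1) / 2 else A i j

/-- The weak composition `row_c(A)`, with entries indexed by `0 ≤ k ≤ r + 1`. -/
def rowC (r : ℕ) (A : ℤ → ℤ → ℤ) (k : ℕ) : ℤ :=
  if k = 0 then entry r A 0 0 + ∑ᶠ j ∈ Set.Ici (1 : ℤ), A 0 j
  else if k = r + 1 then entry r A (r + 1) (r + 1) + ∑ᶠ j ∈ Set.Iic (r : ℤ), A (r + 1) j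
  else if k ≤ r then rowSum A k
  else 0

/-- The weak composition `col_c(A)`. -/
def colC (r : ℕ) (A : ℤ → ℤ → ℤ) : ℕ → ℤ := rowC r (fun i j => A j i)

/-- `B` is tridiagonal. -/
def IsTridiagonal (B : ℤ → ℤ → ℤ) : Prop := ∀ i j, 1 < |i - j| → B i j = 0

/-- For tridiagonal `B`, the weak composition `δ(B)`
`= (b'_{00}, b_{10}; b_{01}, b_{11}, b_{21}; …; b_{r-1,r}, b_{rr}, b_{r+1,r}; b_{r,r+1},
b'_{r+1,r+1})` of `d` into `3 r + 4` parts. -/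
def delta (r : ℕ) (B : ℤ → ℤ → ℤ) (m : ℕ) : ℤ :=
  if m % 3 = 0 then entry r B (m / 3 : ℕ) (m / 3 : ℕ)
  else if m % 3 = 1 then B ((m / 3 : ℕ) + 1) (m / 3 : ℕ)
  else B (m / 3 : ℕ) ((m / 3 : ℕ) + 1)

/-- `g` is the element with `A = κ(λ, g, μ)`, for `λ = row_c(A)` and `μ = col_c(A)`: it has
minimal length in its double coset `W_λ g W_μ`, and `a_{ij} = |R_i^λ ∩ g R_j^μ|`. -/
def IsRep (r d : ℕ) (A : ℤ → ℤ → ℤ) (g : Equiv.Perm ℤ) : Prop :=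
  g ∈ weyl d ∧
  (∀ x ∈ parabolic r d (rowC r A), ∀ y ∈ parabolic r d (colC r A), len d g ≤ len d (x * g * y)) ∧
  ∀ i j, A i j = ((block r d (rowC r A) i ∩ g '' block r d (colC r A) j).ncard : ℤ)

/-- `ℓ(A) = ℓ(g)` for `A = κ(λ, g, μ)`. -/
def lenMat (r d : ℕ) (A : ℤ → ℤ → ℤ) : ℕ := sInf {m | ∃ g, IsRep r d A g ∧ len d g = m}

/-- `T_θ = (t_{ij} + t_{-i,-j})`. -/
def theta (T : ℤ → ℤ → ℤ) (i j : ℤ) : ℤ := T i j + T (-i) (-j)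

/-- `T̂ = (t_{i+1,j})`. -/
def hat (T : ℤ → ℤ → ℤ) (i j : ℤ) : ℤ := T (i + 1) j

/-- `T^† = (t_{1-i,-j})`. -/
def dagger (T : ℤ → ℤ → ℤ) (i j : ℤ) : ℤ := T (1 - i) (-j)

/-- `Ť = (t_{i-1,j})`. -/
def check (T : ℤ → ℤ → ℤ) (i j : ℤ) : ℤ := T (i - 1) j

/-- The set `Θ_{B,A}`. -/
def ThetaSet (r : ℕ) (B A : ℤ → ℤ → ℤ) : Set (ℤ → ℤ → ℤ) :=
  {T | IsTheta r T ∧ (∀ i j, theta T i j ≤ A i j) ∧ ∀ i, rowSum T i = B (i - 1) i}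

/-- The set `Γ_T`. -/
def GammaSet (r : ℕ) (T : ℤ → ℤ → ℤ) : Set (ℤ → ℤ → ℤ) :=
  {S | IsTheta r S ∧ (∀ i j, S i j ≤ T i j) ∧ ∀ i, rowSum S i = rowSum (dagger S) i}

/-- With `δ = δ(B)`, `μ = row_c(A)`, `ν = col_c(A)` and `A = κ(μ, g₂, ν)`: `w` is an element of
`𝒟_δ ∩ W_μ` (where `𝒟_δ` is the set of minimal length representatives of the cosets `W_δ w`) such
that `|R_{3i-1}^δ ∩ w g₂ R_j^ν| = t_{ij}` for all `i, j`. -/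
def InFibre (r d : ℕ) (B A T : ℤ → ℤ → ℤ) (g₂ w : Equiv.Perm ℤ) : Prop :=
  w ∈ parabolic r d (rowC r A) ∧
  (∀ x ∈ parabolic (3 * r + 2) d (delta r B), len d w ≤ len d (x * w)) ∧
  ∀ i j, T i j =
    ((block (3 * r + 2) d (delta r B) (3 * i - 1) ∩
      (w * g₂) '' block r d (colC r A) j).ncard : ℤ)

/-- `ℓ(w_{A,T})`, where `w_{A,T}` is the element of minimal length among the elements `w` as in
`InFibre`. -/
def lenFibre (r d : ℕ) (B A T : ℤ → ℤ → ℤ) : ℕ :=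
  sInf {m | ∃ g₂ w, IsRep r d A g₂ ∧ InFibre r d B A T g₂ w ∧ len d w = m}

/-! ### Quantum combinatorics at `(q, q₀, q₁) = (v⁻¹, 1, q²)` -/

/-- The coefficient field `ℚ(v)`, which contains `ℤ[v, v⁻¹]`. -/
abbrev K : Type := RatFunc ℚ

/-- The indeterminate `v`. -/
def v : K := RatFunc.X

/-- The parameter `q = v⁻¹`. -/
def q : K := v⁻¹

/-- The parameter `q₀ = 1`. -/
def q₀ : K := 1

/-- The parameter `q₁ = q²`. -/
def q₁ : K := q ^ 2

/-- `[m] = (q^{-2m} - 1) / (q^{-2} - 1)`, that is, `(v^{2m} - 1) / (v^2 - 1)`. -/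
def qint (m : ℤ) : K := (q ^ (-2 * m) - 1) / (q ^ (-2 : ℤ) - 1)

/-- `[m]^! = [m] [m-1] ⋯ [1]` (used for `m ≥ 0` only). -/
def qfact (m : ℤ) : K := ∏ k ∈ Finset.range m.toNat, qint (k + 1)

/-- The Gaussian binomial `[m] [m-1] ⋯ [m-k+1] / [k]^!` (used for `k ≥ 0` only). -/
def qbinom (m k : ℤ) : K := (∏ l ∈ Finset.range k.toNat, qint (m - l)) / qfact k

/-- `[2k]_{c_0} = [k] (1 + q₀⁻¹ q₁⁻¹ q^{-2(k-1)})`. -/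
def qevenZero (k : ℤ) : K := qint k * (1 + q₀⁻¹ * q₁⁻¹ * q ^ (-2 * (k - 1)))

/-- `[2k]_{c_1} = [k] (1 + q₀ q₁⁻¹ q^{-2(k-1)})`. -/
def qevenOne (k : ℤ) : K := qint k * (1 + q₀ * q₁⁻¹ * q ^ (-2 * (k - 1)))

/-- `[T]^!`, the product of `[t_{ij}]^!` over `1 ≤ i ≤ n` and `j ∈ ℤ`. -/
def matFact (r : ℕ) (T : ℤ → ℤ → ℤ) : K :=
  ∏ i ∈ Finset.Icc (1 : ℤ) (2 * r + 2), ∏ᶠ j, qfact (T i j)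

/-- The index set `I_𝔞^+`. -/
def IPlus (r : ℕ) : Set (ℤ × ℤ) :=
  {p | (p.1 = 0 ∧ 0 < p.2) ∨ (1 ≤ p.1 ∧ p.1 ≤ r) ∨ (p.1 = r + 1 ∧ p.2 < r + 1)}

/-- `[A]_c^!`. -/
def matFactC (r : ℕ) (A : ℤ → ℤ → ℤ) : K :=
  (∏ k ∈ Finset.range (entry r A 0 0).toNat, qevenZero (k + 1)) *
  (∏ k ∈ Finset.range (entry r A (r + 1) (r + 1)).toNat, qevenOne (k + 1)) *
  ∏ᶠ p ∈ IPlus r, qfact (A p.1 p.2)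

/-- `⟦S⟧`, the product over `1 ≤ i ≤ r + 1` of the `⟦S⟧_i`. -/
def dbrack (r : ℕ) (S : ℤ → ℤ → ℤ) : K :=
  ∏ i ∈ Finset.Icc (1 : ℤ) (r + 1), ∏ᶠ j : ℤ,
    qbinom (∑ᶠ k ∈ Set.Iic j, (S i k - dagger S i k)) (dagger S i (j + 1)) *
      qfact (dagger S i (j + 1))

/-! ### The formula indexed by `T, S` -/

/-- `A^{(T-S)} = A - (T - S)_θ + (hat (T - S))_θ`. -/
def moveTS (A T S : ℤ → ℤ → ℤ) (i j : ℤ) : ℤ :=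
  A i j - theta (T - S) i j + theta (hat (T - S)) i j

/-- `n(S)`. -/
def nS (r : ℕ) (S : ℤ → ℤ → ℤ) : ℤ := ∑ i ∈ Finset.Icc (1 : ℤ) (r + 1), rowSum S i

/-- `h(S,T)`. -/
def hST (r : ℕ) (S T : ℤ → ℤ → ℤ) : ℤ :=
  ∑ i ∈ Finset.Icc (1 : ℤ) (r + 1), ∑ᶠ j : ℤ,
    (S i j * (∑ᶠ k ∈ Set.Iic j, T i k) - S i j * (S i j + 1) / 2) +
  ∑ i ∈ Finset.Icc (1 : ℤ) (r + 1), ∑ᶠ j : ℤ,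
    (T (1 - i) (-j) - S (1 - i) (-j)) *
      ((∑ᶠ k ∈ Set.Iic (j - 1), T i k) + (∑ᶠ k ∈ Set.Ici j, S i k)
        - ∑ᶠ k ∈ Set.Ici (j + 1), S (1 - i) (-k))

/-- `ℓ(A,B,S,T) = ℓ(A) + ℓ(B) - ℓ(A^{(T-S)}) + ℓ(w_{A,T})`. -/
def lenABST (r d : ℕ) (A B S T : ℤ → ℤ → ℤ) : ℤ :=
  lenMat r d A + lenMat r d B - lenMat r d (moveTS A T S) + lenFibre r d B A T

/-- `⟦A;S;T⟧ = [A^{(T-S)}]_c^! ⟦S⟧ / ([A - T_θ]_c^! [S]^! [T-S]^!)`. -/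
def brackAST (r : ℕ) (A S T : ℤ → ℤ → ℤ) : K :=
  matFactC r (moveTS A T S) * dbrack r S /
    (matFactC r (A - theta T) * matFact r S * matFact r (T - S))

/-- The free `ℚ(v)`-module with basis `{e_C : C ∈ Ξ_{n,d}}`: the underlying module of the affine
`q`-Schur algebra with respect to its basis `{e_C}`, after extension of scalars to `ℚ(v)`. -/
abbrev Schur (r d : ℕ) : Type := {C : ℤ → ℤ → ℤ // IsXi r d C} →₀ K

open Classical in
/-- The basis element `e_C` for `C ∈ Ξ_{n,d}` (and zero for all other matrices `C`). -/
def e (r d : ℕ) (C : ℤ → ℤ → ℤ) : Schur r d :=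
  if h : IsXi r d C then Finsupp.single ⟨C, h⟩ 1 else 0

/-- The pairs `(T, S)` with `T ∈ Θ_{B,A}` and `S ∈ Γ_T`. -/
def indexTS (r : ℕ) (B A : ℤ → ℤ → ℤ) : Set ((ℤ → ℤ → ℤ) × (ℤ → ℤ → ℤ)) :=
  {p | p.1 ∈ ThetaSet r B A ∧ p.2 ∈ GammaSet r p.1}

/-- The right-hand side of the formula indexed by `T, S`. -/
def rhsTS (r d : ℕ) (B A : ℤ → ℤ → ℤ) : Schur r d :=
  ∑ᶠ p ∈ indexTS r B A,
    ((v ^ 2 - 1) ^ nS r p.2 *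
      v ^ (2 * (lenABST r d A B p.2 p.1 - nS r p.2 - hST r p.2 p.1)) *
      brackAST r A p.2 p.1) • e r d (moveTS A p.1 p.2)

/-! ### The formula indexed by `X, Y` -/

/-- `A_{X,Y} = A + X - Y - (X̌ - Y̌)`. -/
def moveXY (A X Y : ℤ → ℤ → ℤ) (i j : ℤ) : ℤ :=
  A i j + X i j - Y i j - (check X i j - check Y i j)

/-- The index set `ℐ`. -/
def IMinus (r : ℕ) : Set (ℤ × ℤ) :=
  {p | (p.1 = -r - 1 ∧ -r - 1 < p.2) ∨ (-r ≤ p.1 ∧ p.1 ≤ -1) ∨ (p.1 = 0 ∧ p.2 < 0)}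

/-- The symbol `[A_{X,Y}; X]`, as a function of `C = A_{X,Y}` and `X`. -/
def brackXY (r : ℕ) (C X : ℤ → ℤ → ℤ) : K :=
  (∏ᶠ p ∈ IMinus r, qbinom (C p.1 p.2) (X p.1 p.2) *
    qbinom (C p.1 p.2 - X p.1 p.2) (X (-p.1) (-p.2))) *
  ∏ i ∈ ({0, -(r : ℤ) - 1} : Finset ℤ), ∏ k ∈ Finset.range (X i i).toNat,
    qint (C i i - 2 * k - 1) / qint (k + 1)

/-- The upper triangular matrices `σ` over `ℕ`, with finitely many nonzero entries, whose row sums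
are `b` and whose column sums are `c`. -/
def UpperSet (b c : ℤ → ℤ) : Set (ℤ × ℤ →₀ ℕ) :=
  {σ | (∀ k l, l < k → σ (k, l) = 0) ∧
    (∀ k, ∑ᶠ l, (σ (k, l) : ℤ) = b k) ∧ ∀ l, ∑ᶠ k, (σ (k, l) : ℤ) = c l}

/-- Half of the exponent of `v` in the summand of `n(a,c,b)` at `σ`. -/
def sigmaExp (a : ℤ → ℤ) (σ : ℤ × ℤ →₀ ℕ) : ℤ :=
  (∑ s ∈ σ.support, σ s * ∑ᶠ p ∈ Set.Iio s.2, a p) +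
  (∑ᶠ k, σ (k, k) * a k) +
  ∑ s ∈ σ.support, ∑ t ∈ σ.support with t.1 < s.1 ∧ s.2 < t.2, (σ s : ℤ) * σ t

/-- `n(a,c,b)`, for finitely supported sequences `a`, `c`, `b` of nonnegative integers. -/
def nSeq (a c b : ℤ → ℤ) : K :=
  ∑ᶠ σ ∈ UpperSet b c,
    v ^ (2 * sigmaExp a σ) * ((∏ᶠ k, qfact (b k)) / ∏ s ∈ σ.support, qfact (σ s)) *
      ∏ᶠ l : ℤ, ∏ m ∈ Finset.range (c l - σ (l, l)).toNat, (v ^ (2 * a l) - v ^ (2 * m))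

/-- `n(X,Y)`, the product of `n(X_i, Y_i, (X_{-i-1})^J)` over `0 ≤ i ≤ r`. -/
def nXY (r : ℕ) (X Y : ℤ → ℤ → ℤ) : K :=
  ∏ i ∈ Finset.Icc (0 : ℤ) r, nSeq (X i) (Y i) (fun j => X (-i - 1) (-j))

/-- `ξ_{A,X,Y}`, as a function of `C = A_{X,Y}` and `X`. -/
def xi (r : ℕ) (C X : ℤ → ℤ → ℤ) : ℤ :=
  (∑ i ∈ Finset.Icc (-r - 1 : ℤ) r, ∑ᶠ p ∈ {p : ℤ × ℤ | p.2 < p.1},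
    (C i p.1 - X i p.1) * X i p.2) -
  ((∑ i ∈ Finset.Icc (-r : ℤ) (-1), ∑ᶠ p ∈ {p : ℤ × ℤ | p.2 < p.1},
      X (-i) (-p.1) * X i p.2) +
    ∑ i ∈ ({-(r : ℤ) - 1, 0} : Finset ℤ), ∑ᶠ p ∈ {p : ℤ × ℤ | p.2 < p.1 ∧ p.1 < 2 * i - p.2},
      X (-i) (-p.1) * X i p.2) -
  ∑ i ∈ ({-(r : ℤ) - 1, 0} : Finset ℤ), ∑ᶠ j ∈ Set.Iio i, X i j * (X i j + 1) / 2

/-- The matrix `E_θ^{i,i+1}`, whose entries are `1` at the places `(i + k n, i + 1 + k n)` and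
`(-i + k n, -i - 1 + k n)`, `k ∈ ℤ`, and `0` elsewhere. -/
def ETheta (r : ℕ) (i : ℤ) (a b : ℤ) : ℤ :=
  open Classical in
  if ∃ k : ℤ, (a = i + k * (2 * r + 2) ∧ b = i + 1 + k * (2 * r + 2)) ∨
    (a = -i + k * (2 * r + 2) ∧ b = -i - 1 + k * (2 * r + 2)) then 1 else 0

/-- `α` is `n`-periodic and `B - ∑_{1 ≤ i ≤ n} α_i E_θ^{i,i+1}` is diagonal. -/
def IsOffDiag (r : ℕ) (B : ℤ → ℤ → ℤ) (α : ℤ → ℕ) : Prop :=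
  (∀ i, α (i + (2 * r + 2)) = α i) ∧
  ∀ a b, a ≠ b → B a b - ∑ i ∈ Finset.Icc (1 : ℤ) (2 * r + 2), α i * ETheta r i a b = 0

/-- The pairs `(X, Y)` over which the second formula is summed. -/
def indexXY (r d : ℕ) (A : ℤ → ℤ → ℤ) (α : ℤ → ℕ) : Set ((ℤ → ℤ → ℤ) × (ℤ → ℤ → ℤ)) :=
  {p | IsTheta r p.1 ∧ IsTheta r p.2 ∧
    (∀ i j, p.1 i j + p.1 (-i - 1) (-j) = p.2 i j + p.2 (-i - 1) (-j)) ∧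
    (∀ i, rowSum p.1 i = α i) ∧ (∀ i, rowSum p.2 i = α (-i - 1)) ∧
    IsTheta r (A - p.2 + check p.2) ∧ IsXi r d (moveXY A p.1 p.2)}

/-- The right-hand side of the formula indexed by `X, Y`. -/
def rhsXY (r d : ℕ) (A : ℤ → ℤ → ℤ) (α : ℤ → ℕ) : Schur r d :=
  ∑ᶠ p ∈ indexXY r d A α,
    (v ^ (2 * xi r (moveXY A p.1 p.2) p.1) * nXY r p.1 p.2 *
      brackXY r (moveXY A p.1 p.2) p.1) • e r d (moveXY A p.1 p.2)

end

end AffineC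

/-! ### Lengths in the affine Weyl group through inversions -/

namespace AffineC

/-! The two sums are matched by grouping the first one. Send `(T, S)` to `(X, Y)`, where `X i j = T
(i + 1) j - S (i + 1) j + S (-i) (-j)` (`moveX`) and `Y i j = T (-i) (-j)` (`negMat`). Then
`A^{(T-S)} = A_{X,Y}`, so it suffices that for each `(X, Y)` the first coefficients over the fibre
add up to the second coefficient (`sum_fibre`). When `T_θ ≤ A`, the fibre is a product over the rows
`0 ≤ k ≤ r`: the free datum in row `k` is the sequence `s'_j = S (-k) (-j)`, subject to inequalities
that involve only that row (`rowIndex`, `bijOn_fibre`). When `T_θ ≤ A` fails the fibre is empty, and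
since `A_{X,Y} - X_θ = A - T_θ` the symbol `[A_{X,Y}; X]` vanishes as well (`brackXY_eq_zero`).

Powers of `v`. Four times the length of a Weyl group element is the number of its inversions up to
translation plus the number of those that avoid the multiples of `d + 1` (`four_mul_len`). For a
minimal double coset representative this depends only on its matrix, through sums over corners
(`fourLen_of_blockMono`). The sum `ℓ(A) + ℓ(w_{A,T})` is the length of a minimal element whose
matrix is the refinement of `A` with rows `T_i`, `M_i`, `(T_{-i,-j})_j`, where `M = A - T_θ`
(`lenMat_add_lenFibre`). Such a refinement can be coarsened in two ways: grouping rows `3i-1, 3i,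
3i+1` gives `A`, while grouping `3i, 3i+1, 3i+2` gives another matrix `V`. Refining `M` by
`(X_{-i,-j})` instead of `T` gives the same `V`, but its first coarsening is `A^{(T-S)}`. Passing
through `V`, the difference of lengths becomes a sum of inversion forms of single rows and central
corrections; comparison with `ξ` (`four_mul_xi`) and a bilinear identity in each row
(`row_exponent`) yield `lenABST_sub`.

Coefficients. In `n(a,c,b)` group the triangular matrices `σ` by `s'_l = c_l - σ_{ll}`, the column
sums off the diagonal. The strictly upper triangular parts with given row and column sums have a
weighted sum equal to a product of Gaussian binomials over factorials, proved by opening one matrix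
entry at a time and applying the `q`-Vandermonde identity (`sum_strictSet_aux`, `sum_strictUpper`).
These binomials are those of `⟦S⟧`, so `n(a,c,b)` is a sum of row terms of the first formula
(`nSeq_eq`). The remaining factorials agree by `brackXY_mul`, and `coef_eq` collects everything. -/

theorem perm_apply_inv {α : Type*} (g : Equiv.Perm α) (x : α) : g (g⁻¹ x) = x :=
  g.apply_symm_apply x

theorem perm_inv_apply {α : Type*} (g : Equiv.Perm α) (x : α) : g⁻¹ (g x) = x :=
  g.symm_apply_apply x

/-! ### Windows of translation-invariant sets -/

theorem apply_zpow_add {α : Type*} (τ : Equiv.Perm α) (f : α → ℤ) (n : ℤ)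
    (hf : ∀ p, f (τ p) = f p + n) (k : ℤ) (p : α) : f ((τ ^ k) p) = f p + k * n := by
  induction k using Int.induction_on generalizing p with
  | zero => simp
  | succ k ih => rw [zpow_add_one, Equiv.Perm.mul_apply, ih, hf]; ring
  | pred k ih =>
    have h := hf (τ⁻¹ p)
    rw [perm_apply_inv] at h
    rw [zpow_sub_one, Equiv.Perm.mul_apply, ih]; linarith

theorem mem_zpow_iff {α : Type*} (τ : Equiv.Perm α) (Q : Set α) (hQ : ∀ p, τ p ∈ Q ↔ p ∈ Q)
    (k : ℤ) (p : α) : (τ ^ k) p ∈ Q ↔ p ∈ Q := by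
  induction k using Int.induction_on generalizing p with
  | zero => simp
  | succ k ih => rw [zpow_add_one, Equiv.Perm.mul_apply, ih, hQ]
  | pred k ih =>
    rw [zpow_sub_one, Equiv.Perm.mul_apply, ih, ← hQ, perm_apply_inv]

/-- Since `τ` raises `f` by `n`, every `τ`-orbit meets the window `0 ≤ f < n` exactly once, and
likewise for `f'`. The map moves a point along its orbit from one window to the other by dividing
`f'` by `n'`. -/
theorem window_bijOn {α : Type*} (τ : Equiv.Perm α) (Q : Set α) (hQ : ∀ p, τ p ∈ Q ↔ p ∈ Q)
    (f f' : α → ℤ) {n n' : ℤ} (hn : 0 < n) (hn' : 0 < n')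
    (hf : ∀ p, f (τ p) = f p + n) (hf' : ∀ p, f' (τ p) = f' p + n') :
    Set.BijOn (fun p => (τ ^ (-(f' p / n'))) p) {p | p ∈ Q ∧ 0 ≤ f p ∧ f p < n}
      {p | p ∈ Q ∧ 0 ≤ f' p ∧ f' p < n'} := by
  refine ⟨?_, ?_, ?_⟩
  · rintro p ⟨hp, -, -⟩
    refine ⟨(mem_zpow_iff τ Q hQ _ _).2 hp, ?_⟩
    simp only
    rw [apply_zpow_add τ f' n' hf']
    have h1 := Int.emod_add_mul_ediv (f' p) n'
    have h2 := Int.emod_nonneg (f' p) hn'.ne'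
    have h3 := Int.emod_lt_of_pos (f' p) hn'
    constructor <;> linarith
  · rintro p ⟨-, h1, h2⟩ p' ⟨-, h3, h4⟩ h
    have h5 := congrArg f h
    simp only [apply_zpow_add τ f n hf] at h5
    have h6 : -(f' p / n') = -(f' p' / n') := by
      by_contra hne
      rcases lt_or_gt_of_ne hne with hlt | hlt
      · have := mul_le_mul_of_nonneg_right (Int.add_one_le_iff.2 hlt) hn.le
        linarith
      · have := mul_le_mul_of_nonneg_right (Int.add_one_le_iff.2 hlt) hn.le
        linarith
    simp only [h6] at h
    exact (τ ^ (-(f' p' / n'))).injective h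
  · rintro p' ⟨hp', h1, h2⟩
    refine ⟨(τ ^ (-(f p' / n))) p', ⟨(mem_zpow_iff τ Q hQ _ _).2 hp', ?_⟩, ?_⟩
    · rw [apply_zpow_add τ f n hf]
      have h1 := Int.emod_add_mul_ediv (f p') n
      have h2 := Int.emod_nonneg (f p') hn.ne'
      have h3 := Int.emod_lt_of_pos (f p') hn
      constructor <;> linarith
    · simp only
      rw [apply_zpow_add τ f' n' hf', Int.add_mul_ediv_right _ _ hn'.ne',
        Int.ediv_eq_zero_of_lt h1 h2, ← Equiv.Perm.mul_apply, ← zpow_add]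
      simp

theorem ncard_window {α : Type*} (τ : Equiv.Perm α) (Q : Set α) (hQ : ∀ p, τ p ∈ Q ↔ p ∈ Q)
    (f f' : α → ℤ) {n n' : ℤ} (hn : 0 < n) (hn' : 0 < n')
    (hf : ∀ p, f (τ p) = f p + n) (hf' : ∀ p, f' (τ p) = f' p + n') :
    {p | p ∈ Q ∧ 0 ≤ f p ∧ f p < n}.ncard = {p | p ∈ Q ∧ 0 ≤ f' p ∧ f' p < n'}.ncard := by
  have h := window_bijOn τ Q hQ f f' hn hn' hf hf'
  rw [← h.image_eq, h.injOn.ncard_image]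

theorem finsum_window {α : Type*} (τ : Equiv.Perm α) (G : α → ℤ) (hG : ∀ p, G (τ p) = G p)
    (f f' : α → ℤ) {n n' : ℤ} (hn : 0 < n) (hn' : 0 < n')
    (hf : ∀ p, f (τ p) = f p + n) (hf' : ∀ p, f' (τ p) = f' p + n') :
    ∑ᶠ p ∈ {p | 0 ≤ f p ∧ f p < n}, G p = ∑ᶠ p ∈ {p | 0 ≤ f' p ∧ f' p < n'}, G p := by
  have h := window_bijOn τ Set.univ (fun _ => Iff.rfl) f f' hn hn' hf hf'
  simp only [Set.mem_univ, true_and] at h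
  refine finsum_mem_eq_of_bijOn _ h fun p _ => ?_
  have hz : ∀ (k : ℤ) p, G ((τ ^ k) p) = G p := fun k p => by
    have := mem_zpow_iff τ {q | G q = G p} (fun q => by simp [hG]) k p
    exact this.2 rfl
  exact (hz _ _).symm

/-- The translation of `ℤ × ℤ` by `(D, D)`. -/
def shiftPair (D : ℤ) : Equiv.Perm (ℤ × ℤ) := (Equiv.addRight D).prodCongr (Equiv.addRight D)

/-- The number of translation orbits of a translation-invariant set of pairs. -/
noncomputable def orbitCount (D : ℤ) (Q : Set (ℤ × ℤ)) : ℕ := {p | p ∈ Q ∧ 0 ≤ p.1 ∧ p.1 < D}.ncard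

/-- Invariance under simultaneous translation by `D`. -/
def ShiftInv (D : ℤ) (Q : Set (ℤ × ℤ)) : Prop := ∀ x y, (x + D, y + D) ∈ Q ↔ (x, y) ∈ Q

/-- Frees the count of orbits from the first coordinate: later the window is taken along the second
member of a pair, or along the block index of its image. -/
theorem orbitCount_eq {D : ℤ} (hD : 0 < D) {Q : Set (ℤ × ℤ)} (hQ : ShiftInv D Q)
    (f : ℤ × ℤ → ℤ) {n : ℤ} (hn : 0 < n) (hf : ∀ x y, f (x + D, y + D) = f (x, y) + n) :
    orbitCount D Q = {p | p ∈ Q ∧ 0 ≤ f p ∧ f p < n}.ncard :=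
  ncard_window (shiftPair D) Q (fun p => hQ p.1 p.2) (fun p => p.1) f hD hn
    (fun _ => rfl) (fun p => hf p.1 p.2)

/-! ### Elements of the Weyl group -/

section weyl

variable {d : ℕ} {g : Equiv.Perm ℤ}

theorem weyl_add (hg : g ∈ weyl d) (i : ℤ) : g (i + (2 * d + 2)) = g i + (2 * d + 2) := hg.1 i

theorem weyl_neg (hg : g ∈ weyl d) (i : ℤ) : g (-i) = -g i := hg.2 i

theorem weyl_add_mul (hg : g ∈ weyl d) (i k : ℤ) :
    g (i + k * (2 * d + 2)) = g i + k * (2 * d + 2) := by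
  induction k using Int.induction_on generalizing i with
  | zero => simp
  | succ k ih =>
    rw [show i + ((k : ℤ) + 1) * (2 * d + 2) = i + k * (2 * d + 2) + (2 * d + 2) by ring,
      weyl_add hg, ih]; ring
  | pred k ih =>
    have := weyl_add hg (i + (-(k : ℤ) - 1) * (2 * d + 2))
    rw [show i + (-(k : ℤ) - 1) * (2 * d + 2) + (2 * d + 2) = i + -(k : ℤ) * (2 * d + 2) by ring,
      ih] at this
    linarith

theorem weyl_zero (hg : g ∈ weyl d) : g 0 = 0 := by
  have := weyl_neg hg 0
  simp only [neg_zero] at this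
  omega

theorem weyl_mid (hg : g ∈ weyl d) : g (d + 1) = d + 1 := by
  have h1 := weyl_neg hg (d + 1)
  have h2 := weyl_add hg (-(d + 1))
  rw [show -((d : ℤ) + 1) + (2 * d + 2) = d + 1 by ring] at h2
  omega

/-- Oddness fixes `0`, oddness with periodicity fixes `d + 1`, and translation gives the other
multiples. These central points belong to no simple transposition, and their inversions must be
corrected for in the length. -/
theorem weyl_central (hg : g ∈ weyl d) {x : ℤ} (hx : (d : ℤ) + 1 ∣ x) : g x = x := by
  obtain ⟨m, rfl⟩ := hx
  obtain ⟨k, rfl | rfl⟩ := Int.even_or_odd' m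
  · have := weyl_add_mul hg 0 k
    rw [weyl_zero hg] at this
    rw [show ((d : ℤ) + 1) * (2 * k) = 0 + k * (2 * d + 2) by ring, this]
  · have := weyl_add_mul hg (d + 1) k
    rw [weyl_mid hg] at this
    rw [show ((d : ℤ) + 1) * (2 * k + 1) = d + 1 + k * (2 * d + 2) by ring, this]

theorem weyl_central_iff (hg : g ∈ weyl d) (x : ℤ) : (d : ℤ) + 1 ∣ g x ↔ (d : ℤ) + 1 ∣ x := by
  refine ⟨fun h => ?_, fun h => by rwa [weyl_central hg h]⟩
  have := weyl_central hg h
  rwa [g.injective this] at h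

/-- The displacement `g x - x` is periodic, hence bounded by the sum of its absolute values over one
period. This makes every count of inversions finite. -/
theorem weyl_bounded (hg : g ∈ weyl d) : ∃ M : ℤ, ∀ x, |g x - x| ≤ M := by
  refine ⟨∑ x ∈ Finset.Ico (0 : ℤ) (2 * d + 2), |g x - x|, fun x => ?_⟩
  have hD : (0 : ℤ) < 2 * d + 2 := by positivity
  have h1 : |g x - x| = |g (x % (2 * d + 2)) - x % (2 * d + 2)| := by
    have h := weyl_add_mul hg (x % (2 * d + 2)) (x / (2 * d + 2))
    rw [mul_comm (x / _), Int.emod_add_mul_ediv] at h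
    have h' := Int.emod_add_mul_ediv x (2 * d + 2)
    rw [h]
    congr 1
    linarith
  rw [h1]
  exact Finset.single_le_sum (f := fun x => |g x - x|) (fun _ _ => abs_nonneg _)
    (Finset.mem_Ico.2 ⟨Int.emod_nonneg _ hD.ne', Int.emod_lt_of_pos _ hD⟩)

/-- The inversions of `g`. -/
def inversions (g : Equiv.Perm ℤ) : Set (ℤ × ℤ) := {p | p.1 < p.2 ∧ g p.2 < g p.1}

/-- The pairs of integers none of which is a multiple of `d + 1`. -/
def noncentral (d : ℕ) : Set (ℤ × ℤ) := {p | ¬ (d : ℤ) + 1 ∣ p.1 ∧ ¬ (d : ℤ) + 1 ∣ p.2}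

/-- Invariance of a set of pairs under the Weyl group. -/
def WeylInv (d : ℕ) (Z : Set (ℤ × ℤ)) : Prop :=
  ∀ g ∈ weyl d, ∀ x y, (g x, g y) ∈ Z ↔ (x, y) ∈ Z

theorem weylInv_univ (d : ℕ) : WeylInv d Set.univ := fun _ _ _ _ => Iff.rfl

theorem weylInv_noncentral (d : ℕ) : WeylInv d (noncentral d) := fun g hg x y => by
  simp only [noncentral, Set.mem_ofPred_eq, weyl_central_iff hg]

theorem shiftInv_univ (D : ℤ) : ShiftInv D Set.univ := fun _ _ => Iff.rfl

theorem central_add (d : ℕ) (x : ℤ) : (d : ℤ) + 1 ∣ x + (2 * d + 2) ↔ (d : ℤ) + 1 ∣ x :=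
  dvd_add_left ⟨2, by ring⟩

theorem shiftInv_noncentral (d : ℕ) : ShiftInv (2 * d + 2) (noncentral d) := fun x y => by
  simp only [noncentral, Set.mem_ofPred_eq, central_add]

theorem shiftInv_inversions (hg : g ∈ weyl d) : ShiftInv (2 * d + 2) (inversions g) := fun x y => by
  simp only [inversions, Set.mem_ofPred_eq, weyl_add hg, add_lt_add_iff_right]

theorem ShiftInv.inter {D : ℤ} {Q Z : Set (ℤ × ℤ)} (hQ : ShiftInv D Q) (hZ : ShiftInv D Z) :
    ShiftInv D (Q ∩ Z) := fun x y => and_congr (hQ x y) (hZ x y)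

theorem finite_window_inversions (hg : g ∈ weyl d) :
    {p | p ∈ inversions g ∧ 0 ≤ p.1 ∧ p.1 < 2 * (d : ℤ) + 2}.Finite := by
  obtain ⟨M, hM⟩ := weyl_bounded hg
  refine ((Set.finite_Icc (0 : ℤ) (2 * d + 2)).prod
    (Set.finite_Icc (0 : ℤ) (2 * d + 2 + 2 * M))).subset ?_
  rintro ⟨x, y⟩ ⟨⟨h1, h2⟩, h3, h4⟩
  have hx := abs_le.1 (hM x)
  have hy := abs_le.1 (hM y)
  simp only [Set.mem_prod, Set.mem_Icc] at *
  omega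

theorem orbitCount_comap (hg : g ∈ weyl d) {Q : Set (ℤ × ℤ)} (hQ : ShiftInv (2 * d + 2) Q) :
    orbitCount (2 * d + 2) {p | (g p.1, g p.2) ∈ Q} = orbitCount (2 * d + 2) Q := by
  rw [orbitCount_eq (by positivity) hQ (fun p => g⁻¹ p.1) (n := 2 * d + 2) (by positivity)
    (fun x y => weyl_add (inv_mem hg) x)]
  refine Set.ncard_congr (fun p _ => (g p.1, g p.2)) ?_ ?_ ?_
  · rintro ⟨x, y⟩ ⟨h1, h2⟩
    exact ⟨h1, by simpa using h2⟩
  · rintro ⟨x, y⟩ ⟨x', y'⟩ _ _ h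
    simpa using h
  · rintro ⟨x, y⟩ ⟨h1, h2⟩
    exact ⟨(g⁻¹ x, g⁻¹ y), ⟨by simpa using h1, h2⟩, by simp⟩

/-- The inversions in `Z`, counted up to translation. -/
noncomputable def invCount (d : ℕ) (Z : Set (ℤ × ℤ)) (g : Equiv.Perm ℤ) : ℕ :=
  orbitCount (2 * d + 2) (inversions g ∩ Z)

/-- Four times the length of an element of the Weyl group. -/
noncomputable def fourLen (d : ℕ) (g : Equiv.Perm ℤ) : ℕ :=
  invCount d Set.univ g + invCount d (noncentral d) g

theorem orbitCount_mono {D : ℤ} {Q Q' : Set (ℤ × ℤ)} (h : Q ⊆ Q')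
    (hfin : {p | p ∈ Q' ∧ 0 ≤ p.1 ∧ p.1 < D}.Finite) : orbitCount D Q ≤ orbitCount D Q' :=
  Set.ncard_le_ncard (fun _ hp => ⟨h hp.1, hp.2⟩) hfin

theorem finite_window_inter (hg : g ∈ weyl d) (Z : Set (ℤ × ℤ)) :
    {p | p ∈ inversions g ∩ Z ∧ 0 ≤ p.1 ∧ p.1 < 2 * (d : ℤ) + 2}.Finite :=
  (finite_window_inversions hg).subset fun _ hp => ⟨hp.1.1, hp.2⟩

theorem fourLen_le_of_subset {h : Equiv.Perm ℤ} (hh : h ∈ weyl d)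
    (hsub : inversions g ⊆ inversions h) : fourLen d g ≤ fourLen d h :=
  add_le_add (orbitCount_mono (Set.inter_subset_inter_left _ hsub) (finite_window_inter hh _))
    (orbitCount_mono (Set.inter_subset_inter_left _ hsub) (finite_window_inter hh _))

/-- A pair inverted by `g * s` is either carried by `s` to an inversion of `g` or inverted by `s`
itself. The disjointness hypothesis excludes pairs whose order is reversed twice, so nothing cancels
and the two kinds are disjoint. -/
theorem invCount_mul (hg : g ∈ weyl d) {s : Equiv.Perm ℤ} (hs : s ∈ weyl d) (hss : s * s = 1)
    {Z : Set (ℤ × ℤ)} (hZ : WeylInv d Z) (hZ' : ShiftInv (2 * d + 2) Z)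
    (hdis : ∀ p ∈ inversions s, p ∉ inversions g) :
    invCount d Z (g * s) = invCount d Z g + invCount d Z s := by
  have hinv : ∀ x, s (s x) = x := fun x => by
    rw [← Equiv.Perm.mul_apply, hss, Equiv.Perm.one_apply]
  have key : inversions (g * s) ∩ Z =
      {p | (s p.1, s p.2) ∈ inversions g ∩ Z} ∪ (inversions s ∩ Z) := by
    ext ⟨x, y⟩
    simp only [Set.mem_union, Set.mem_inter_iff, Set.mem_ofPred_eq, hZ s hs x y, ← or_and_right]
    refine and_congr_left fun _ => ?_
    simp only [inversions, Set.mem_ofPred_eq, Equiv.Perm.mul_apply]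
    constructor
    · rintro ⟨h1, h2⟩
      rcases lt_trichotomy (s x) (s y) with h | h | h
      · exact Or.inl ⟨h, h2⟩
      · exact absurd (s.injective h) h1.ne
      · exact Or.inr ⟨h1, h⟩
    · rintro (⟨h1, h2⟩ | ⟨h1, h2⟩)
      · refine ⟨?_, h2⟩
        by_contra hxy
        rcases (not_lt.1 hxy).lt_or_eq with h | h
        · exact hdis (s x, s y) ⟨h1, by rw [hinv, hinv]; exact h⟩ ⟨h1, h2⟩
        · rw [h] at h1; exact lt_irrefl _ h1
      · refine ⟨h1, ?_⟩
        by_contra hxy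
        rcases (not_lt.1 hxy).lt_or_eq with h | h
        · exact hdis (s y, s x) ⟨h2, by rw [hinv, hinv]; exact h1⟩ ⟨h2, h⟩
        · exact h2.ne' (g.injective h)
  have hQ := (shiftInv_inversions hg).inter hZ'
  rw [invCount, key]
  have e1 := orbitCount_comap hs hQ
  rw [invCount, ← e1, invCount, orbitCount, orbitCount, orbitCount, ← Set.ncard_union_eq ?_ ?_ ?_]
  · congr 1
    ext p
    simp only [Set.mem_union, Set.mem_ofPred_eq, or_and_right]
  · rw [Set.disjoint_left]
    rintro ⟨x, y⟩ ⟨⟨⟨h1, -⟩, -⟩, -⟩ ⟨⟨⟨-, h2⟩, -⟩, -⟩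
    exact lt_asymm h1 h2
  · refine Set.Finite.subset (finite_window_inversions (mul_mem hg hs)) ?_
    rintro p ⟨h, h'⟩
    exact ⟨((Set.ext_iff.1 key p).2 (Or.inl h)).1, h'⟩
  · exact finite_window_inter hs Z

theorem fourLen_mul (hg : g ∈ weyl d) {s : Equiv.Perm ℤ} (hs : s ∈ weyl d) (hss : s * s = 1)
    (hdis : ∀ p ∈ inversions s, p ∉ inversions g) :
    fourLen d (g * s) = fourLen d g + fourLen d s := by
  rw [fourLen, invCount_mul hg hs hss (weylInv_univ d) (shiftInv_univ _) hdis,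
    invCount_mul hg hs hss (weylInv_noncentral d) (shiftInv_noncentral d) hdis, fourLen, fourLen]
  ring

end weyl

/-! ### Simple reflections -/

/-- The displacement of the residue `m` under the simple reflection `s_i`. -/
def simpleShift (d i : ℕ) (m : ℤ) : ℤ :=
  if i = 0 then (if m = 1 then -2 else if m = 2 * d + 1 then 2 else 0)
  else if i = d then (if m = d then 2 else if m = d + 2 then -2 else 0)
  else (if m = i then 1 else if m = i + 1 then -1 else if m = 2 * d + 1 - i then 1
    else if m = 2 * d + 2 - i then -1 else 0)

/-- The simple reflection `s_i` as a function. -/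
def simpleFun (d i : ℕ) (x : ℤ) : ℤ := x + simpleShift d i (x % (2 * d + 2))

theorem simpleFun_add_mul (d i : ℕ) (x k : ℤ) :
    simpleFun d i (x + k * (2 * d + 2)) = simpleFun d i x + k * (2 * d + 2) := by
  simp only [simpleFun, Int.add_mul_emod_self_right]; ring

theorem simpleFun_of_mem {d : ℕ} (i : ℕ) {x : ℤ} (h0 : 0 ≤ x) (h1 : x < 2 * d + 2) :
    simpleFun d i x = x + simpleShift d i x := by
  rw [simpleFun, Int.emod_eq_of_lt h0 h1]

theorem exists_window (D : ℤ) (hD : 0 < D) (x : ℤ) : ∃ k m : ℤ, x = m + k * D ∧ 0 ≤ m ∧ m < D :=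
  ⟨x / D, x % D, by rw [mul_comm]; exact (Int.emod_add_mul_ediv x D).symm,
    Int.emod_nonneg _ hD.ne', Int.emod_lt_of_pos _ hD⟩

theorem simpleShift_zero (d : ℕ) (m : ℤ) :
    simpleShift d 0 m = if m = 1 then -2 else if m = 2 * d + 1 then 2 else 0 := rfl

theorem simpleShift_last {d : ℕ} (hd : 2 ≤ d) (m : ℤ) :
    simpleShift d d m = if m = d then 2 else if m = d + 2 then -2 else 0 := by
  rw [simpleShift, if_neg (by omega), if_pos rfl]

theorem simpleShift_mid {d i : ℕ} (h0 : i ≠ 0) (hi : i ≠ d) (m : ℤ) :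
    simpleShift d i m = if m = i then 1 else if m = i + 1 then -1 else
      if m = 2 * d + 1 - i then 1 else if m = 2 * d + 2 - i then -1 else 0 := by
  rw [simpleShift, if_neg h0, if_neg hi]

theorem simpleFun_involutive {d i : ℕ} (hd : 2 ≤ d) (hi : i ≤ d) :
    Function.Involutive (simpleFun d i) := by
  intro x
  obtain ⟨k, m, rfl, h0, h1⟩ := exists_window (2 * d + 2) (by positivity) x
  rw [simpleFun_add_mul, simpleFun_add_mul, add_left_inj, simpleFun_of_mem i h0 h1]
  by_cases hi0 : i = 0
  · subst hi0
    have a1 := simpleFun_of_mem (d := d) 0 (x := 1) (by omega) (by omega)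
    have a2 := simpleFun_of_mem (d := d) 0 (x := 2 * d + 1) (by omega) (by omega)
    have a3 := simpleFun_of_mem (d := d) 0 h0 h1
    -- For `i = 0` the images `-1` of `1` and `2 * d + 3` of `2 * d + 1` leave the window, so their
    -- values are brought back by periodicity. For `i ≠ 0` the window is preserved.
    have a4 := simpleFun_add_mul d 0 1 1
    have a5 := simpleFun_add_mul d 0 (2 * d + 1) (-1)
    rw [show (1 : ℤ) + 1 * (2 * d + 2) = 2 * d + 3 by ring] at a4
    rw [show (2 * d + 1 : ℤ) + -1 * (2 * d + 2) = -1 by ring] at a5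
    simp only [simpleShift_zero, if_true] at a1 a2 a3 ⊢
    rcases eq_or_ne m 1 with rfl | hm
    · simp only [if_true]
      rw [show (1 : ℤ) + -2 = -1 by norm_num, a5, a2]
      split_ifs <;> omega
    rcases eq_or_ne m (2 * d + 1) with rfl | hm'
    · simp only [hm, if_true, if_false]
      rw [show (2 * d + 1 : ℤ) + 2 = 2 * d + 3 by ring, a4, a1]
      ring
    · simp only [hm, hm', if_false, add_zero] at a3 ⊢
      exact a3
  by_cases hid : i = d
  · subst hid
    have hb : 0 ≤ m + simpleShift i i m ∧ m + simpleShift i i m < 2 * i + 2 := by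
      rw [simpleShift_last hd]; split_ifs <;> omega
    rw [simpleFun_of_mem _ hb.1 hb.2]
    simp only [simpleShift_last hd]
    split_ifs <;> omega
  · have hb : 0 ≤ m + simpleShift d i m ∧ m + simpleShift d i m < 2 * d + 2 := by
      rw [simpleShift_mid hi0 hid]; split_ifs <;> omega
    rw [simpleFun_of_mem _ hb.1 hb.2]
    have e := simpleShift_mid hi0 hid m
    rcases eq_or_ne m i with rfl | h1
    · simp only [if_true] at e
      rw [e, simpleShift_mid hi0 hid, if_neg (by omega), if_pos rfl]; ring
    rcases eq_or_ne m (i + 1) with rfl | h2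
    · simp only [h1, if_true, if_false] at e
      rw [e, simpleShift_mid hi0 hid, if_pos (by omega)]; ring
    rcases eq_or_ne m (2 * d + 1 - i) with rfl | h3
    · simp only [h1, h2, if_true, if_false] at e
      rw [e, simpleShift_mid hi0 hid, if_neg (by omega), if_neg (by omega), if_neg (by omega),
        if_pos (by omega)]; ring
    rcases eq_or_ne m (2 * d + 2 - i) with rfl | h4
    · simp only [h1, h2, h3, if_true, if_false] at e
      rw [e, simpleShift_mid hi0 hid, if_neg (by omega), if_neg (by omega), if_pos (by omega)]
      ring
    · simp only [h1, h2, h3, h4, if_false] at e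
      rw [e, add_zero, e, add_zero]

/-- The simple reflection `s_i`. -/
def simpleRefl {d i : ℕ} (hd : 2 ≤ d) (hi : i ≤ d) : Equiv.Perm ℤ :=
  (simpleFun_involutive hd hi).toPerm

theorem simpleRefl_apply {d i : ℕ} (hd : 2 ≤ d) (hi : i ≤ d) (x : ℤ) :
    simpleRefl hd hi x = simpleFun d i x := rfl

theorem simpleRefl_mul_self {d i : ℕ} (hd : 2 ≤ d) (hi : i ≤ d) :
    simpleRefl hd hi * simpleRefl hd hi = 1 := by
  ext x
  exact simpleFun_involutive hd hi x

theorem simpleFun_neg {d i : ℕ} (hd : 2 ≤ d) (hi : i ≤ d) (x : ℤ) :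
    simpleFun d i (-x) = -simpleFun d i x := by
  obtain ⟨k, m, rfl, h0, h1⟩ := exists_window (2 * d + 2) (by positivity) x
  rw [simpleFun_add_mul, simpleFun_of_mem i h0 h1]
  rcases h0.eq_or_lt with rfl | h0
  · rw [show -(0 + k * (2 * (d : ℤ) + 2)) = 0 + -k * (2 * d + 2) by ring, simpleFun_add_mul,
      simpleFun_of_mem i le_rfl h1]
    have : simpleShift d i 0 = 0 := by simp only [simpleShift]; split_ifs <;> omega
    rw [this]; ring
  · rw [show -(m + k * (2 * (d : ℤ) + 2)) = (2 * d + 2 - m) + (-k - 1) * (2 * d + 2) by ring,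
      simpleFun_add_mul, simpleFun_of_mem i (by omega) (by omega)]
    have : simpleShift d i (2 * d + 2 - m) = - simpleShift d i m := by
      simp only [simpleShift]
      split_ifs <;> omega
    rw [this]; ring

theorem simpleRefl_mem {d i : ℕ} (hd : 2 ≤ d) (hi : i ≤ d) : simpleRefl hd hi ∈ weyl d :=
  ⟨fun x => by
    have := simpleFun_add_mul d i x 1
    rwa [one_mul] at this, fun x => simpleFun_neg hd hi x⟩

theorem isSimpleReflection_simpleRefl {d i : ℕ} (hd : 2 ≤ d) (hi : i ≤ d) :
    IsSimpleReflection d i (simpleRefl hd hi) := by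
  have hadd : ∀ k y : ℤ, simpleFun d i (k * (2 * d + 2) + y) = k * (2 * d + 2) + simpleFun d i y :=
    fun k y => by rw [add_comm, simpleFun_add_mul, add_comm]
  have hsub : ∀ k y : ℤ, simpleFun d i (k * (2 * d + 2) - y) = k * (2 * d + 2) - simpleFun d i y :=
    fun k y => by rw [sub_eq_add_neg, hadd, simpleFun_neg hd hi]; ring
  -- By periodicity, oddness and involutivity, one value and the fixed points inside one window
  -- determine the transposition.
  have key : ∀ a b : ℤ, simpleFun d i a = b → (∀ m : ℤ, 0 ≤ m → m < 2 * d + 2 →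
      (∀ k : ℤ, m ≠ k * (2 * d + 2) + a ∧ m ≠ k * (2 * d + 2) + b ∧
        m ≠ k * (2 * d + 2) - a ∧ m ≠ k * (2 * d + 2) - b) → simpleShift d i m = 0) →
      IsTransposition d a b (simpleRefl hd hi) := by
    intro a b hab hz
    have hba : simpleFun d i b = a := by rw [← hab]; exact simpleFun_involutive hd hi a
    refine ⟨fun k => ⟨?_, ?_, ?_, ?_⟩, fun x hx => ?_⟩
    · rw [simpleRefl_apply, hadd, hab]
    · rw [simpleRefl_apply, hadd, hba]
    · rw [simpleRefl_apply, hsub, hab]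
    · rw [simpleRefl_apply, hsub, hba]
    · obtain ⟨k, m, rfl, h0, h1⟩ := exists_window (2 * d + 2) (by positivity) x
      rw [simpleRefl_apply, simpleFun_add_mul, simpleFun_of_mem i h0 h1, hz m h0 h1, add_zero]
      intro k'
      have := hx (k + k')
      refine ⟨fun h => this.1 ?_, fun h => this.2.1 ?_, fun h => this.2.2.1 ?_,
        fun h => this.2.2.2 ?_⟩ <;> rw [h] <;> ring
  rw [IsSimpleReflection]
  split_ifs with h h'
  · subst h
    refine key 1 (-1) ?_ fun m h0 h1 hm => ?_
    · rw [simpleFun_of_mem 0 (by omega) (by omega)]; simp [simpleShift]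
    · have a1 := (hm 0).1
      have a2 := (hm 1).2.2.1
      simp only [simpleShift]
      split_ifs <;> omega
  · subst h'
    refine key _ _ ?_ fun m h0 h1 hm => ?_
    · rw [simpleFun_of_mem i (by omega) (by omega)]
      simp only [simpleShift]
      split_ifs
      omega
    · have a1 := (hm 0).1
      have a2 := (hm 0).2.1
      simp only [simpleShift]
      split_ifs <;> omega
  · refine key _ _ ?_ fun m h0 h1 hm => ?_
    · rw [simpleFun_of_mem i (by omega) (by omega)]
      simp only [simpleShift]
      split_ifs
      omega
    · have a1 := (hm 0).1
      have a2 := (hm 0).2.1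
      have a3 := (hm 1).2.2.1
      have a4 := (hm 1).2.2.2
      simp only [simpleShift]
      split_ifs <;> omega

theorem IsTransposition.unique {d : ℕ} {i j : ℤ} {g h : Equiv.Perm ℤ}
    (hg : IsTransposition d i j g) (hh : IsTransposition d i j h) : g = h := by
  ext x
  by_cases hx : ∀ k : ℤ, x ≠ k * (2 * d + 2) + i ∧ x ≠ k * (2 * d + 2) + j ∧
    x ≠ k * (2 * d + 2) - i ∧ x ≠ k * (2 * d + 2) - j
  · rw [hg.2 x hx, hh.2 x hx]
  · simp only [not_forall, not_and_or, not_not, ne_eq] at hx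
    obtain ⟨k, rfl | rfl | rfl | rfl⟩ := hx
    · rw [(hg.1 k).1, (hh.1 k).1]
    · rw [(hg.1 k).2.1, (hh.1 k).2.1]
    · rw [(hg.1 k).2.2.1, (hh.1 k).2.2.1]
    · rw [(hg.1 k).2.2.2, (hh.1 k).2.2.2]

theorem isSimpleReflection_iff {d i : ℕ} (hd : 2 ≤ d) (hi : i ≤ d) (g : Equiv.Perm ℤ) :
    IsSimpleReflection d i g ↔ g = simpleRefl hd hi := by
  refine ⟨fun h => ?_, fun h => h ▸ isSimpleReflection_simpleRefl hd hi⟩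
  have h' := isSimpleReflection_simpleRefl hd hi
  rw [IsSimpleReflection] at h h'
  split_ifs at h h' with h0 h1
  · exact h.unique h'
  · exact h.unique h'
  · exact h.unique h'

/-- The smaller of the two integers swapped by `s_i`. -/
def loIdx (i : ℕ) : ℤ := if i = 0 then -1 else i

/-- The larger of the two integers swapped by `s_i`. -/
def hiIdx (d i : ℕ) : ℤ := if i = 0 then 1 else if i = d then d + 2 else i + 1

theorem simpleFun_lo {d i : ℕ} (hd : 2 ≤ d) (hi : i ≤ d) : simpleFun d i (loIdx i) = hiIdx d i := by
  rcases eq_or_ne i 0 with rfl | h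
  · simp only [loIdx, if_true, hiIdx]
    rw [simpleFun_neg hd hi, simpleFun_of_mem 0 (by omega) (by omega)]
    simp [simpleShift]
  · rw [loIdx, if_neg h, simpleFun_of_mem i (by omega) (by omega)]
    simp only [simpleShift, hiIdx]; split_ifs <;> omega

theorem simpleFun_of_mem_next {d : ℕ} (i : ℕ) {x : ℤ} (h0 : 2 * d + 2 ≤ x)
    (h1 : x < 2 * (2 * d + 2)) : simpleFun d i x = x + simpleShift d i (x - (2 * d + 2)) := by
  rw [simpleFun, ← Int.sub_emod_right x, Int.emod_eq_of_lt (by omega) (by omega)]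

-- A simple reflection moves every point by at most `2`, so an inverted pair has distance less than
-- `4` and a finite check remains. For `i = 0` and `i = d` a central point sits between the two
-- swapped points, which is why three pairs per period are inverted instead of one.
set_option maxHeartbeats 1000000 in
theorem mem_inversions_simpleRefl {d i : ℕ} (hd : 2 ≤ d) (hi : i ≤ d) {x y : ℤ} (h0 : 0 ≤ x)
    (h1 : x < 2 * d + 2) : (x, y) ∈ inversions (simpleRefl hd hi) ↔
      (i = 0 ∧ (x = 0 ∧ y = 1 ∨ x = 2 * d + 1 ∧ y = 2 * d + 2 ∨ x = 2 * d + 1 ∧ y = 2 * d + 3)) ∨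
      (i ≠ 0 ∧ i = d ∧ (x = d ∧ y = d + 1 ∨ x = d ∧ y = d + 2 ∨ x = d + 1 ∧ y = d + 2)) ∨
      (i ≠ 0 ∧ i ≠ d ∧ (x = i ∧ y = i + 1 ∨ x = 2 * d + 1 - i ∧ y = 2 * d + 2 - i)) := by
  simp only [inversions, Set.mem_ofPred_eq, simpleRefl_apply]
  rw [simpleFun_of_mem i h0 h1]
  by_cases hy : x < y ∧ y < x + 4
  · have e : simpleFun d i y = y + simpleShift d i y ∧ y < 2 * d + 2 ∨
        simpleFun d i y = y + simpleShift d i (y - (2 * d + 2)) ∧ 2 * d + 2 ≤ y := by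
      rcases lt_or_ge y (2 * d + 2) with hy' | hy'
      · exact Or.inl ⟨simpleFun_of_mem i (by omega) hy', hy'⟩
      · exact Or.inr ⟨simpleFun_of_mem_next i hy' (by omega), hy'⟩
    obtain ⟨m, hm, e⟩ : ∃ m : ℤ, (m = y ∧ y < 2 * d + 2 ∨ m = y - (2 * d + 2) ∧ 2 * d + 2 ≤ y) ∧
        simpleFun d i y = y + simpleShift d i m := by
      rcases e with ⟨e, hy'⟩ | ⟨e, hy'⟩
      · exact ⟨_, Or.inl ⟨rfl, hy'⟩, e⟩
      · exact ⟨_, Or.inr ⟨rfl, hy'⟩, e⟩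
    rw [e]
    clear e
    by_cases hi0 : i = 0
    · subst hi0
      have hs : ∀ m : ℤ, m = 1 ∧ simpleShift d 0 m = -2 ∨ m = 2 * d + 1 ∧ simpleShift d 0 m = 2 ∨
          m ≠ 1 ∧ m ≠ 2 * d + 1 ∧ simpleShift d 0 m = 0 := by
        intro m
        rw [simpleShift_zero]; split_ifs <;> omega
      have hx := hs x
      have hyy := hs m
      clear hs
      simp only [true_and, ne_eq, not_true_eq_false, false_and, or_false]
      constructor
      · rintro ⟨-, h⟩
        rcases hx with hx | hx | hx <;> rcases hyy with hyy | hyy | hyy <;> omega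
      · intro h
        refine ⟨by omega, ?_⟩
        rcases hx with hx | hx | hx <;> rcases hyy with hyy | hyy | hyy <;> omega
    by_cases hid : i = d
    · subst hid
      have hs : ∀ m : ℤ, m = i ∧ simpleShift i i m = 2 ∨ m = i + 2 ∧ simpleShift i i m = -2 ∨
          m ≠ i ∧ m ≠ i + 2 ∧ simpleShift i i m = 0 := by
        intro m
        rw [simpleShift_last hd]; split_ifs <;> omega
      have hx := hs x
      have hyy := hs m
      clear hs
      simp only [hi0, true_and, ne_eq, not_true_eq_false, not_false_eq_true, false_and, or_false,
        false_or]
      constructor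
      · rintro ⟨-, h⟩
        rcases hx with hx | hx | hx <;> rcases hyy with hyy | hyy | hyy <;> omega
      · intro h
        refine ⟨by omega, ?_⟩
        rcases hx with hx | hx | hx <;> rcases hyy with hyy | hyy | hyy <;> omega
    · simp only [hi0, hid, false_and, false_or, ne_eq, not_false_eq_true, true_and]
      have hs : ∀ m : ℤ, m = i ∧ simpleShift d i m = 1 ∨ m = 2 * d + 1 - i ∧ simpleShift d i m = 1 ∨
          m = i + 1 ∧ simpleShift d i m = -1 ∨ m = 2 * d + 2 - i ∧ simpleShift d i m = -1 ∨
          m ≠ i ∧ m ≠ 2 * d + 1 - i ∧ m ≠ i + 1 ∧ m ≠ 2 * d + 2 - i ∧ simpleShift d i m = 0 := by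
        intro m
        rw [simpleShift_mid hi0 hid]; split_ifs <;> omega
      have hx := hs x
      have hyy := hs m
      clear hs
      constructor
      · rintro ⟨-, h⟩
        rcases hx with hx | hx | hx | hx | hx <;> rcases hyy with hyy | hyy | hyy | hyy | hyy <;>
          omega
      · intro h
        have e1 : simpleShift d i x = 1 := by clear hyy; omega
        have e2 : simpleShift d i m = -1 := by clear hx; omega
        omega
  · have hsh : ∀ m, -2 ≤ simpleShift d i m ∧ simpleShift d i m ≤ 2 := fun m => by
      simp only [simpleShift]
      split_ifs <;> omega
    have := hsh x
    have := hsh (y % (2 * d + 2))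
    have e : simpleFun d i y = y + simpleShift d i (y % (2 * d + 2)) := rfl
    rw [e]
    constructor
    · omega
    · intro h
      omega

theorem mul_central_eq {c x : ℤ} (hc : 0 < c) (h : c ∣ x) (h0 : 0 ≤ x) (h1 : x < 3 * c) :
    x = 0 ∨ x = c ∨ x = 2 * c := by
  obtain ⟨k, rfl⟩ := h
  have : 0 ≤ k := by by_contra hk; nlinarith
  have : k < 3 := by by_contra hk; nlinarith
  interval_cases k
  · left; ring
  · right; left; ring
  · right; right; ring

theorem central_iff_of_small {d : ℕ} {x : ℤ} (h0 : 0 ≤ x) (h1 : x < 2 * d + 4) (hd : 2 ≤ d) :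
    (d : ℤ) + 1 ∣ x ↔ x = 0 ∨ x = d + 1 ∨ x = 2 * d + 2 := by
  refine ⟨fun h => ?_, ?_⟩
  · have := mul_central_eq (by positivity) h h0 (by omega)
    omega
  · rintro (rfl | rfl | rfl)
    · exact dvd_zero _
    · exact dvd_refl _
    · exact ⟨2, by ring⟩

theorem invCount_simpleRefl {d i : ℕ} (hd : 2 ≤ d) (hi : i ≤ d) (Z : Set (ℤ × ℤ))
    (E : Finset (ℤ × ℤ)) (h : ∀ x y : ℤ, 0 ≤ x → x < 2 * d + 2 →
      ((x, y) ∈ inversions (simpleRefl hd hi) ∧ (x, y) ∈ Z ↔ (x, y) ∈ E))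
    (h' : ∀ p ∈ E, 0 ≤ p.1 ∧ p.1 < 2 * d + 2) : invCount d Z (simpleRefl hd hi) = E.card := by
  rw [invCount, orbitCount, ← Set.ncard_coe_finset]
  congr 1
  ext ⟨x, y⟩
  constructor
  · rintro ⟨h1, h2, h3⟩
    exact (h x y h2 h3).1 h1
  · intro hp
    have := h' _ hp
    exact ⟨(h x y this.1 this.2).2 hp, this⟩

theorem invCount_noncentral_simpleRefl {d i : ℕ} (hd : 2 ≤ d) (hi : i ≤ d)
    (E : Finset (ℤ × ℤ)) (h : ∀ x y : ℤ, 0 ≤ x → x < 2 * d + 2 →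
      ((x, y) ∈ inversions (simpleRefl hd hi) ∧ (¬ (x = 0 ∨ x = d + 1 ∨ x = 2 * d + 2) ∧
        ¬ (y = 0 ∨ y = d + 1 ∨ y = 2 * d + 2)) ↔ (x, y) ∈ E))
    (h' : ∀ p ∈ E, 0 ≤ p.1 ∧ p.1 < 2 * d + 2) :
    invCount d (noncentral d) (simpleRefl hd hi) = E.card := by
  refine invCount_simpleRefl hd hi _ E (fun x y h0 h1 => ?_) h'
  rw [← h x y h0 h1]
  refine and_congr_right fun hxy => ?_
  rw [mem_inversions_simpleRefl hd hi h0 h1] at hxy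
  simp only [noncentral, Set.mem_ofPred_eq]
  rw [central_iff_of_small h0 (by omega) hd, central_iff_of_small (by omega) (by omega) hd]

/-- This fixes the normalisation. The reflections `s_0` and `s_d` invert three pairs per period, two
of them with a central member, and contribute `3 + 1`; every other `s_i` inverts two noncentral
pairs and contributes `2 + 2`. -/
theorem fourLen_simpleRefl {d i : ℕ} (hd : 2 ≤ d) (hi : i ≤ d) :
    fourLen d (simpleRefl hd hi) = 4 := by
  rw [fourLen]
  by_cases h0 : i = 0
  · rw [invCount_simpleRefl hd hi Set.univ
        {(0, 1), (2 * (d : ℤ) + 1, 2 * (d : ℤ) + 2), (2 * (d : ℤ) + 1, 2 * (d : ℤ) + 3)},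
      invCount_noncentral_simpleRefl hd hi {(2 * (d : ℤ) + 1, 2 * (d : ℤ) + 3)},
      Finset.card_singleton,
      Finset.card_insert_of_notMem, Finset.card_insert_of_notMem, Finset.card_singleton]
    · simp
    · simp; omega
    · intro x y hx hx'
      simp only [mem_inversions_simpleRefl hd hi hx hx', Finset.mem_singleton, Prod.mk.injEq]
      subst h0
      simp only [true_and, ne_eq, not_true_eq_false, false_and, or_false]
      constructor <;> intro h <;> omega
    · simp; omega
    · intro x y hx hx'
      simp only [mem_inversions_simpleRefl hd hi hx hx', Finset.mem_insert,
        Finset.mem_singleton, Prod.mk.injEq, Set.mem_univ, and_true]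
      subst h0
      simp only [true_and, ne_eq, not_true_eq_false, false_and, or_false]
    · simp; omega
  by_cases h1 : i = d
  · rw [invCount_simpleRefl hd hi Set.univ
        {((d : ℤ), (d : ℤ) + 1), ((d : ℤ), (d : ℤ) + 2), ((d : ℤ) + 1, (d : ℤ) + 2)},
      invCount_noncentral_simpleRefl hd hi {((d : ℤ), (d : ℤ) + 2)}, Finset.card_singleton,
      Finset.card_insert_of_notMem, Finset.card_insert_of_notMem, Finset.card_singleton]
    · simp
    · simp
    · intro x y hx hx'
      simp only [mem_inversions_simpleRefl hd hi hx hx', Finset.mem_singleton, Prod.mk.injEq]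
      subst h1
      simp only [h0, false_and, true_and, ne_eq, not_true_eq_false, not_false_eq_true, false_or, or_false]
      constructor <;> intro h <;> omega
    · simp; omega
    · intro x y hx hx'
      simp only [mem_inversions_simpleRefl hd hi hx hx', Finset.mem_insert,
        Finset.mem_singleton, Prod.mk.injEq, Set.mem_univ, and_true]
      omega
    · simp; omega
  · rw [invCount_simpleRefl hd hi Set.univ
        {((i : ℤ), (i : ℤ) + 1), (2 * (d : ℤ) + 1 - i, 2 * (d : ℤ) + 2 - i)},
      invCount_noncentral_simpleRefl hd hi
        {((i : ℤ), (i : ℤ) + 1), (2 * (d : ℤ) + 1 - i, 2 * (d : ℤ) + 2 - i)},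
      Finset.card_insert_of_notMem, Finset.card_singleton]
    · simp; omega
    · intro x y hx hx'
      simp only [mem_inversions_simpleRefl hd hi hx hx', Finset.mem_insert,
        Finset.mem_singleton, Prod.mk.injEq]
      simp only [h0, h1, false_and, ne_eq, not_false_eq_true, true_and, false_or]
      constructor <;> intro h <;> omega
    · simp; omega
    · intro x y hx hx'
      simp only [mem_inversions_simpleRefl hd hi hx hx', Finset.mem_insert,
        Finset.mem_singleton, Prod.mk.injEq, Set.mem_univ, and_true]
      simp only [h0, h1, false_and, ne_eq, not_false_eq_true, true_and, false_or]
    · simp; omega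

/-- After translation into one window only the listed inversions of `s_i` remain. For each of them
the ascent of `g` at `s_i`, together with oddness and the fixed central points, forces `g` to keep
the order. -/
theorem not_mem_inversions_of_ascent {d i : ℕ} (hd : 2 ≤ d) (hi : i ≤ d) {g : Equiv.Perm ℤ}
    (hg : g ∈ weyl d) (hasc : g (loIdx i) < g (hiIdx d i)) :
    ∀ p ∈ inversions (simpleRefl hd hi), p ∉ inversions g := by
  rintro ⟨x, y⟩ hp hp'
  obtain ⟨k, m, rfl, h0, h1⟩ := exists_window (2 * d + 2) (by positivity) x
  obtain ⟨z, rfl⟩ : ∃ z, y = z + k * (2 * d + 2) := ⟨y - k * (2 * d + 2), by ring⟩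
  have hp2 : (m, z) ∈ inversions (simpleRefl hd hi) := by
    have h2 := weyl_add_mul (simpleRefl_mem hd hi) m k
    have h3 := weyl_add_mul (simpleRefl_mem hd hi) z k
    simp only [inversions, Set.mem_ofPred_eq] at hp ⊢
    omega
  have hp3 : (m, z) ∈ inversions g := by
    have h2 := weyl_add_mul hg m k
    have h3 := weyl_add_mul hg z k
    simp only [inversions, Set.mem_ofPred_eq] at hp' ⊢
    omega
  rw [mem_inversions_simpleRefl hd hi h0 h1] at hp2
  have hrefl : ∀ y : ℤ, g (2 * d + 2 - y) = 2 * d + 2 - g y := fun y => by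
    have h1 := weyl_add hg (-y)
    rw [weyl_neg hg y] at h1
    rw [show (2 : ℤ) * d + 2 - y = -y + (2 * d + 2) by ring, h1]
    ring
  obtain ⟨-, hlt⟩ := hp3
  simp only at hlt
  have g0 := weyl_zero hg
  have gm := weyl_mid hg
  have g1 := weyl_neg hg 1
  have a1 := hrefl 0
  have a2 := hrefl 1
  have a3 := hrefl (-1)
  have a4 := hrefl i
  have a5 := hrefl (i + 1)
  have a6 := hrefl d
  rw [show (2 : ℤ) * d + 2 - 0 = 2 * d + 2 by ring] at a1
  rw [show (2 : ℤ) * d + 2 - 1 = 2 * d + 1 by ring] at a2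
  rw [show (2 : ℤ) * d + 2 - -1 = 2 * d + 3 by ring] at a3
  rw [show (2 : ℤ) * d + 2 - (i + 1) = 2 * d + 1 - i by ring] at a5
  rw [show (2 : ℤ) * d + 2 - d = d + 2 by ring] at a6
  simp only [loIdx, hiIdx] at hasc
  rcases hp2 with ⟨hi0, h⟩ | ⟨hi0, hid, h⟩ | ⟨hi0, hid, h⟩
  · simp only [hi0, if_true] at hasc
    rcases h with ⟨rfl, rfl⟩ | ⟨rfl, rfl⟩ | ⟨rfl, rfl⟩ <;> omega
  · simp only [hid, if_true] at hasc
    have hd0 : ¬ d = 0 := by omega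
    simp only [hd0, if_false] at hasc
    rcases h with ⟨rfl, rfl⟩ | ⟨rfl, rfl⟩ | ⟨rfl, rfl⟩ <;> omega
  · simp only [hi0, hid, if_false] at hasc
    rcases h with ⟨rfl, rfl⟩ | ⟨rfl, rfl⟩ <;> omega

theorem fourLen_mul_of_ascent {d i : ℕ} (hd : 2 ≤ d) (hi : i ≤ d) {g : Equiv.Perm ℤ}
    (hg : g ∈ weyl d) (hasc : g (loIdx i) < g (hiIdx d i)) :
    fourLen d (g * simpleRefl hd hi) = fourLen d g + 4 := by
  rw [fourLen_mul hg (simpleRefl_mem hd hi) (simpleRefl_mul_self hd hi)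
    (not_mem_inversions_of_ascent hd hi hg hasc), fourLen_simpleRefl]

theorem loIdx_lt_hiIdx (d i : ℕ) : loIdx i < hiIdx d i := by
  simp only [loIdx, hiIdx]; split_ifs <;> omega

theorem fourLen_of_descent {d i : ℕ} (hd : 2 ≤ d) (hi : i ≤ d) {g : Equiv.Perm ℤ}
    (hg : g ∈ weyl d) (hdesc : g (hiIdx d i) < g (loIdx i)) :
    fourLen d g = fourLen d (g * simpleRefl hd hi) + 4 := by
  have h1 : simpleRefl hd hi (loIdx i) = hiIdx d i := simpleFun_lo hd hi
  have h2 : simpleRefl hd hi (hiIdx d i) = loIdx i := by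
    rw [← simpleFun_lo hd hi]; exact simpleFun_involutive hd hi _
  rw [← fourLen_mul_of_ascent hd hi (mul_mem hg (simpleRefl_mem hd hi)), mul_assoc,
    simpleRefl_mul_self, mul_one]
  rw [Equiv.Perm.mul_apply, Equiv.Perm.mul_apply, h1, h2]
  exact hdesc

/-- Without descents `g` is strictly increasing on `0, …, d + 1`; at the two ends this uses the
symmetry about `0` and `d + 1`. Both end points are fixed, so `g` is the identity there, and
reflection and translation give the rest. -/
theorem eq_one_of_no_descent {d : ℕ} (hd : 2 ≤ d) {g : Equiv.Perm ℤ} (hg : g ∈ weyl d)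
    (h : ∀ i ≤ d, g (loIdx i) < g (hiIdx d i)) : g = 1 := by
  have hstep : ∀ i : ℕ, i ≤ d → g i < g (i + 1) := by
    intro i hi
    have := h i hi
    simp only [loIdx, hiIdx] at this
    split_ifs at this with h0 h1
    · subst h0
      have := weyl_neg hg 1
      have := weyl_zero hg
      simp only [Nat.cast_zero, zero_add]
      omega
    · have h2 := weyl_add hg (-d)
      rw [weyl_neg hg d, show -(d : ℤ) + (2 * d + 2) = d + 2 by ring] at h2
      have := weyl_mid hg
      subst h1
      omega
    · exact this
  have hup : ∀ i : ℕ, i ≤ d + 1 → (i : ℤ) ≤ g i := by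
    intro i
    induction i with
    | zero => intro _; simp [weyl_zero hg]
    | succ i ih =>
      intro hi
      have := ih (by omega)
      have := hstep i (by omega)
      push_cast
      omega
  have hdown : ∀ k : ℕ, k ≤ d + 1 → g ((d + 1 : ℕ) - (k : ℤ)) ≤ (d + 1 : ℕ) - (k : ℤ) := by
    intro k
    induction k with
    | zero => intro _; have := weyl_mid hg; push_cast; rw [sub_zero]; omega
    | succ k ih =>
      intro hk
      have h1 := ih (by omega)
      have h2 := hstep (d - k) (by omega)
      have e1 : ((d - k : ℕ) : ℤ) = (d + 1 : ℕ) - ((k + 1 : ℕ) : ℤ) := by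
        push_cast [Nat.cast_sub (show k ≤ d by omega)]; ring
      rw [e1, show ((d + 1 : ℕ) : ℤ) - ((k + 1 : ℕ) : ℤ) + 1 = (d + 1 : ℕ) - (k : ℤ) by
        push_cast; ring] at h2
      omega
  have hid : ∀ m : ℤ, 0 ≤ m → m ≤ d + 1 → g m = m := by
    intro m h0 h1
    obtain ⟨i, rfl⟩ := Int.eq_ofNat_of_zero_le h0
    have a1 := hup i (by omega)
    have a2 := hdown (d + 1 - i) (by omega)
    have e : ((d + 1 : ℕ) : ℤ) - ((d + 1 - i : ℕ) : ℤ) = i := by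
      rw [Nat.cast_sub (by omega)]; ring
    rw [e] at a2
    omega
  ext x
  obtain ⟨k, m, rfl, h0, h1⟩ := exists_window (2 * d + 2) (by positivity) x
  rw [weyl_add_mul hg, Equiv.Perm.one_apply, add_left_inj]
  rcases le_or_gt m (d + 1) with hm | hm
  · exact hid m h0 hm
  · have h2 := weyl_add hg (-(2 * d + 2 - m))
    rw [weyl_neg hg, hid (2 * d + 2 - m) (by omega) (by omega)] at h2
    have e : -(2 * (d : ℤ) + 2 - m) + (2 * d + 2) = m := by ring
    rwa [e] at h2

theorem inversions_one : inversions 1 = ∅ := by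
  ext p
  simp only [inversions, Set.mem_ofPred_eq, Equiv.Perm.one_apply, Set.mem_empty_iff_false, iff_false]
  exact fun h => lt_asymm h.1 h.2

theorem fourLen_one (d : ℕ) : fourLen d 1 = 0 := by
  simp [fourLen, invCount, orbitCount, inversions_one]

theorem exists_descent {d : ℕ} (hd : 2 ≤ d) {g : Equiv.Perm ℤ} (hg : g ∈ weyl d) (h1 : g ≠ 1) :
    ∃ i ≤ d, g (hiIdx d i) < g (loIdx i) := by
  by_contra hcon
  push Not at hcon
  refine h1 (eq_one_of_no_descent hd hg fun i hi => (hcon i hi).lt_of_ne fun h => ?_)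
  exact (loIdx_lt_hiIdx d i).ne (g.injective h)

theorem exists_word {d : ℕ} (hd : 2 ≤ d) (m : ℕ) : ∀ g ∈ weyl d, fourLen d g ≤ m →
    ∃ l : List (Equiv.Perm ℤ), (∀ s ∈ l, ∃ i ≤ d, IsSimpleReflection d i s) ∧ l.prod = g ∧
      4 * l.length = fourLen d g := by
  induction m with
  | zero =>
    intro g hg h
    by_cases h1 : g = 1
    · exact ⟨[], by simp, by simp [h1], by simp [h1, fourLen_one]⟩
    · obtain ⟨i, hi, hdesc⟩ := exists_descent hd hg h1
      have := fourLen_of_descent hd hi hg hdesc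
      omega
  | succ m ih =>
    intro g hg h
    by_cases h1 : g = 1
    · exact ⟨[], by simp, by simp [h1], by simp [h1, fourLen_one]⟩
    · obtain ⟨i, hi, hdesc⟩ := exists_descent hd hg h1
      have h2 := fourLen_of_descent hd hi hg hdesc
      obtain ⟨l, hl, hl', hl''⟩ := ih (g * simpleRefl hd hi)
        (mul_mem hg (simpleRefl_mem hd hi)) (by omega)
      refine ⟨l ++ [simpleRefl hd hi], ?_, ?_, ?_⟩
      · intro s hs
        rcases List.mem_append.1 hs with hs | hs
        · exact hl s hs
        · rw [List.mem_singleton.1 hs]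
          exact ⟨i, hi, isSimpleReflection_simpleRefl hd hi⟩
      · rw [List.prod_append, hl', List.prod_singleton, mul_assoc, simpleRefl_mul_self, mul_one]
      · rw [List.length_append, List.length_singleton]
        omega

theorem fourLen_word_le {d : ℕ} (hd : 2 ≤ d) (l : List (Equiv.Perm ℤ)) :
    (∀ s ∈ l, ∃ i ≤ d, IsSimpleReflection d i s) →
    l.prod ∈ weyl d ∧ fourLen d l.prod ≤ 4 * l.length := by
  induction l using List.reverseRecOn with
  | nil => intro _; simp [fourLen_one, one_mem]
  | append_singleton l s ih =>
    intro h
    obtain ⟨h1, h2⟩ := ih fun s hs => h s (by simp [hs])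
    obtain ⟨i, hi, hs⟩ := h s (by simp)
    rw [isSimpleReflection_iff hd hi] at hs
    subst hs
    rw [List.prod_append, List.prod_singleton, List.length_append, List.length_singleton]
    refine ⟨mul_mem h1 (simpleRefl_mem hd hi), ?_⟩
    rcases lt_trichotomy (l.prod (loIdx i)) (l.prod (hiIdx d i)) with h | h | h
    · rw [fourLen_mul_of_ascent hd hi h1 h]; omega
    · exact absurd (l.prod.injective h) (loIdx_lt_hiIdx d i).ne
    · have := fourLen_of_descent hd hi h1 h; omega

/-- Removing descents one at a time yields a word of length `fourLen / 4`. Conversely, each simple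
reflection changes `fourLen` by exactly `4`, so no word can be shorter. -/
theorem four_mul_len {d : ℕ} (hd : 2 ≤ d) {g : Equiv.Perm ℤ} (hg : g ∈ weyl d) :
    4 * len d g = fourLen d g := by
  obtain ⟨l, hl, hl', hl''⟩ := exists_word hd _ g hg le_rfl
  have hle : len d g ≤ l.length := Nat.sInf_le ⟨l, hl, hl', rfl⟩
  obtain ⟨l', h1, h2, h3⟩ := Nat.sInf_mem (s := {m | ∃ l : List (Equiv.Perm ℤ),
    (∀ s ∈ l, ∃ i ≤ d, IsSimpleReflection d i s) ∧ l.prod = g ∧ l.length = m}) ⟨_, l, hl, hl', rfl⟩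
  have := (fourLen_word_le hd l' h1).2
  rw [h2, h3] at this
  change fourLen d g ≤ 4 * len d g at this
  omega

theorem len_inv_le {d : ℕ} (hd : 2 ≤ d) {g : Equiv.Perm ℤ} (hg : g ∈ weyl d) :
    len d g⁻¹ ≤ len d g := by
  obtain ⟨l, hl, hl', hl''⟩ := exists_word hd _ g hg le_rfl
  have h4 := four_mul_len hd hg
  have hle : len d g⁻¹ ≤ ((l.map (·⁻¹)).reverse).length := by
    refine Nat.sInf_le ⟨(l.map (·⁻¹)).reverse, ?_, ?_, rfl⟩
    rotate_left
    · rw [← hl', List.prod_inv_reverse]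
    · intro s hs
      simp only [List.mem_reverse, List.mem_map] at hs
      obtain ⟨t, ht, rfl⟩ := hs
      obtain ⟨i, hi, h⟩ := hl t ht
      rw [isSimpleReflection_iff hd hi] at h
      refine ⟨i, hi, ?_⟩
      rw [isSimpleReflection_iff hd hi, h]
      exact inv_eq_of_mul_eq_one_left (simpleRefl_mul_self hd hi)
  simp only [List.length_reverse, List.length_map] at hle
  omega

theorem len_inv {d : ℕ} (hd : 2 ≤ d) {g : Equiv.Perm ℤ} (hg : g ∈ weyl d) :
    len d g⁻¹ = len d g :=
  le_antisymm (len_inv_le hd hg) (by simpa using len_inv_le hd (inv_mem hg))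

theorem len_mul_lt_of_descent {d i : ℕ} (hd : 2 ≤ d) (hi : i ≤ d) {g : Equiv.Perm ℤ}
    (hg : g ∈ weyl d) (hdesc : g (hiIdx d i) < g (loIdx i)) :
    len d (g * simpleRefl hd hi) < len d g := by
  have h1 := fourLen_of_descent hd hi hg hdesc
  have h2 := four_mul_len hd hg
  have h3 := four_mul_len hd (mul_mem hg (simpleRefl_mem hd hi))
  omega

end AffineC

/-! ### Compositions, blocks and parabolic subgroups -/

namespace AffineC

/-! ### Blocks of a weak composition -/

/-- `c` is a weak composition `(c_0, …, c_{r+1})` of `d`. -/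
structure IsComp (r d : ℕ) (c : ℕ → ℤ) : Prop where
  nonneg : ∀ k ≤ r + 1, 0 ≤ c k
  total : ∑ l ∈ Finset.range (r + 2), c l = d

/-- The partial sums of a composition. -/
def psum (c : ℕ → ℤ) (k : ℕ) : ℤ := ∑ l ∈ Finset.range k, c l

/-- The number of walls strictly below `x`. -/
def wallCount (r : ℕ) (c : ℕ → ℤ) (x : ℤ) : ℤ :=
  ({k ∈ Finset.range (r + 1) | psum c (k + 1) < x}.card : ℤ)

/-- The index of the block containing `x`. -/
def blockIdx (r d : ℕ) (c : ℕ → ℤ) (x : ℤ) : ℤ :=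
  x / (2 * d + 2) * (2 * r + 2) + if x % (2 * d + 2) ≤ d + 1 then wallCount r c (x % (2 * d + 2))
    else 2 * r + 2 - wallCount r c (2 * d + 2 - x % (2 * d + 2))

section

variable {r d : ℕ} {c : ℕ → ℤ}

theorem IsComp.psum_mono (hc : IsComp r d c) {j k : ℕ} (hjk : j ≤ k) (hk : k ≤ r + 2) :
    psum c j ≤ psum c k :=
  Finset.sum_le_sum_of_subset_of_nonneg (Finset.range_mono hjk) fun i hi _ =>
    hc.nonneg i (by have := Finset.mem_range.1 hi; omega)

theorem IsComp.psum_nonneg (hc : IsComp r d c) {k : ℕ} (hk : k ≤ r + 2) : 0 ≤ psum c k := by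
  simpa [psum] using hc.psum_mono (Nat.zero_le k) hk

theorem IsComp.psum_last (hc : IsComp r d c) : psum c (r + 1) = d - c (r + 1) := by
  have h := hc.total
  rw [Finset.sum_range_succ] at h
  rw [psum]
  linarith

theorem wallCount_nonneg (r : ℕ) (c : ℕ → ℤ) (x : ℤ) : 0 ≤ wallCount r c x := Nat.cast_nonneg _

theorem wallCount_le (r : ℕ) (c : ℕ → ℤ) (x : ℤ) : wallCount r c x ≤ r + 1 := by
  have := Finset.card_filter_le (Finset.range (r + 1)) (fun k => psum c (k + 1) < x)
  rw [Finset.card_range] at this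
  rw [wallCount]
  exact_mod_cast this

theorem wallCount_mono (r : ℕ) (c : ℕ → ℤ) : Monotone (wallCount r c) := fun x y hxy => by
  rw [wallCount, wallCount]
  exact_mod_cast Finset.card_le_card
    (Finset.monotone_filter_right _ fun k _ (hk : psum c (k + 1) < x) => hk.trans_le hxy)

theorem IsComp.wallCount_eq_of (hc : IsComp r d c) {x : ℤ} {k : ℕ} (hk : k ≤ r + 1)
    (h1 : k = 0 ∨ psum c k < x) (h2 : k = r + 1 ∨ x ≤ psum c (k + 1)) : wallCount r c x = k := by
  have : {j ∈ Finset.range (r + 1) | psum c (j + 1) < x} = Finset.range k := by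
    ext j
    simp only [Finset.mem_filter, Finset.mem_range]
    constructor
    · rintro ⟨hj, hjx⟩
      by_contra hkj
      have := hc.psum_mono (show k + 1 ≤ j + 1 by omega) (by omega)
      rcases h2 with h2 | h2
      · omega
      · linarith
    · intro hj
      refine ⟨by omega, ?_⟩
      have := hc.psum_mono (show j + 1 ≤ k by omega) (by omega)
      rcases h1 with h1 | h1
      · omega
      · linarith
  rw [wallCount, this, Finset.card_range]

theorem IsComp.wallCount_eq_iff (hc : IsComp r d c) {x : ℤ} {k : ℕ} (hk : k ≤ r + 1) :
    wallCount r c x = k ↔ (k = 0 ∨ psum c k < x) ∧ (k = r + 1 ∨ x ≤ psum c (k + 1)) := by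
  classical
  refine ⟨fun h => ?_, fun h => hc.wallCount_eq_of hk h.1 h.2⟩
  have hex : ∃ j, j = r + 1 ∨ x ≤ psum c (j + 1) := ⟨r + 1, Or.inl rfl⟩
  have h2 := Nat.find_spec hex
  have hle : Nat.find hex ≤ r + 1 := Nat.find_min' hex (Or.inl rfl)
  have h1 : Nat.find hex = 0 ∨ psum c (Nat.find hex) < x := by
    rcases Nat.eq_zero_or_pos (Nat.find hex) with h0 | h0
    · exact Or.inl h0
    · right
      have := Nat.find_min hex (show Nat.find hex - 1 < Nat.find hex by omega)
      rw [not_or, not_le, Nat.sub_add_cancel h0] at this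
      exact this.2
  have := hc.wallCount_eq_of hle h1 h2
  have e : k = Nat.find hex := by exact_mod_cast h.symm.trans this
  rw [e]
  exact ⟨h1, h2⟩

theorem IsComp.wallCount_of_nonpos (hc : IsComp r d c) {x : ℤ} (hx : x ≤ 0) :
    wallCount r c x = 0 := by
  have := hc.wallCount_eq_of (x := x) (Nat.zero_le (r + 1)) (Or.inl rfl)
    (Or.inr (hx.trans (hc.psum_nonneg (by omega))))
  simpa using this

theorem IsComp.wallCount_of_gt (hc : IsComp r d c) {x : ℤ} (hx : (d : ℤ) < x) :
    wallCount r c x = r + 1 := by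
  have := hc.wallCount_eq_of (x := x) (le_refl (r + 1)) (Or.inr ?_) (Or.inl rfl)
  · simpa using this
  · have := hc.psum_last
    have := hc.nonneg (r + 1) le_rfl
    omega

theorem blockIdx_add_mul (r d : ℕ) (c : ℕ → ℤ) (x k : ℤ) :
    blockIdx r d c (x + k * (2 * d + 2)) = blockIdx r d c x + k * (2 * r + 2) := by
  simp only [blockIdx, Int.add_mul_emod_self_right]
  rw [Int.add_mul_ediv_right _ _ (by positivity)]
  ring

theorem blockIdx_add (r d : ℕ) (c : ℕ → ℤ) (x : ℤ) :
    blockIdx r d c (x + (2 * d + 2)) = blockIdx r d c x + (2 * r + 2) := by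
  have := blockIdx_add_mul r d c x 1
  rwa [one_mul, one_mul] at this

theorem blockIdx_of_le {x : ℤ} (h0 : 0 ≤ x) (h1 : x ≤ d + 1) :
    blockIdx r d c x = wallCount r c x := by
  rw [blockIdx, Int.emod_eq_of_lt h0 (by omega), if_pos h1,
    Int.ediv_eq_zero_of_lt h0 (by omega)]
  ring

theorem blockIdx_of_gt {x : ℤ} (h0 : (d : ℤ) + 1 < x) (h1 : x < 2 * d + 2) :
    blockIdx r d c x = 2 * r + 2 - wallCount r c (2 * d + 2 - x) := by
  rw [blockIdx, Int.emod_eq_of_lt (by omega) (by omega), if_neg (by omega),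
    Int.ediv_eq_zero_of_lt (by omega) (by omega)]
  ring

theorem IsComp.blockIdx_neg (hc : IsComp r d c) (x : ℤ) :
    blockIdx r d c (-x) = -blockIdx r d c x := by
  obtain ⟨k, m, rfl, h0, h1⟩ := exists_window (2 * d + 2) (by positivity) x
  rcases h0.eq_or_lt with rfl | h0
  · rw [show -(0 + k * (2 * (d : ℤ) + 2)) = 0 + -k * (2 * d + 2) by ring, blockIdx_add_mul,
      blockIdx_add_mul, blockIdx_of_le le_rfl (by omega), hc.wallCount_of_nonpos le_rfl]
    ring
  · rw [show -(m + k * (2 * (d : ℤ) + 2)) = (2 * d + 2 - m) + (-k - 1) * (2 * d + 2) by ring,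
      blockIdx_add_mul, blockIdx_add_mul]
    rcases lt_trichotomy m (d + 1) with hm | rfl | hm
    · rw [blockIdx_of_le h0.le hm.le, blockIdx_of_gt (by omega) (by omega),
        show 2 * (d : ℤ) + 2 - (2 * d + 2 - m) = m by ring]
      ring
    · rw [show 2 * (d : ℤ) + 2 - (d + 1) = d + 1 by ring, blockIdx_of_le h0.le le_rfl,
        hc.wallCount_of_gt (by omega)]
      ring
    · rw [blockIdx_of_gt hm h1, blockIdx_of_le (by omega) (by omega)]
      ring

theorem IsComp.blockIdx_mono (hc : IsComp r d c) : Monotone (blockIdx r d c) := by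
  refine monotone_int_of_le_succ fun x => ?_
  obtain ⟨k, m, rfl, h0, h1⟩ := exists_window (2 * d + 2) (by positivity) x
  rw [add_right_comm, blockIdx_add_mul, blockIdx_add_mul, add_le_add_iff_right]
  have w := wallCount_le r c
  have w' := wallCount_nonneg r c
  rcases lt_trichotomy m (d + 1) with hm | rfl | hm
  · rw [blockIdx_of_le h0 hm.le, blockIdx_of_le (by omega) (by omega)]
    exact wallCount_mono r c (by omega)
  -- For `d = 0` the successor of `d + 1` is already `2 * d + 2`, the start of the next window.
  · rcases Nat.eq_zero_or_pos d with hd | hd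
    · subst hd
      have := blockIdx_add r 0 c 0
      rw [show (0 : ℤ) + (2 * (0 : ℕ) + 2) = ((0 : ℕ) : ℤ) + 1 + 1 by norm_num] at this
      rw [this, blockIdx_of_le le_rfl (by simp), blockIdx_of_le (by simp) (by simp),
        hc.wallCount_of_nonpos le_rfl]
      have := w (((0 : ℕ) : ℤ) + 1)
      omega
    · rw [blockIdx_of_le h0 le_rfl, blockIdx_of_gt (by omega) (by omega)]
      have := w (d + 1)
      have := w (2 * d + 2 - (d + 1 + 1))
      omega
  · rw [blockIdx_of_gt hm h1]
    rcases eq_or_ne m (2 * d + 1) with rfl | hm'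
    · have := blockIdx_add r d c 0
      rw [show (0 : ℤ) + (2 * d + 2) = 2 * d + 1 + 1 by ring] at this
      rw [this, blockIdx_of_le le_rfl (by omega), hc.wallCount_of_nonpos le_rfl]
      have := w' (2 * d + 2 - (2 * d + 1))
      omega
    · rw [blockIdx_of_gt (by omega) (by omega)]
      have := wallCount_mono r c (show 2 * (d : ℤ) + 2 - (m + 1) ≤ 2 * d + 2 - m by omega)
      omega

theorem IsComp.mem_baseBlock_iff_of_le (hc : IsComp r d c) {k : ℕ} (hk : k ≤ r + 1) {y : ℤ}
    (h0 : 0 ≤ y) (h1 : y ≤ d + 1) : y ∈ baseBlock r d c k ↔ blockIdx r d c y = k := by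
  rw [blockIdx_of_le h0 h1, hc.wallCount_eq_iff hk, baseBlock]
  have hl := hc.psum_last
  have hn := hc.nonneg
  split_ifs with hk0 hk1
  · subst hk0
    have e : psum c (0 + 1) = c 0 := by simp [psum]
    have := hn 0 (by omega)
    rw [e, Set.mem_Icc]
    omega
  · subst hk1
    have := hn (r + 1) (by omega)
    rw [Set.mem_Icc, hl]
    omega
  · rw [Set.mem_Ioc]
    simp only [hk0, hk1, false_or]
    rfl

theorem IsComp.mem_baseBlock_iff (hc : IsComp r d c) {k : ℕ} (hk : k ≤ r + 1) (y : ℤ) :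
    y ∈ baseBlock r d c k ↔ blockIdx r d c y = k := by
  have hm := hc.blockIdx_mono
  have hn := hc.nonneg
  have b0 : blockIdx r d c 0 = 0 := by
    rw [blockIdx_of_le le_rfl (by omega), hc.wallCount_of_nonpos le_rfl]
  have b1 : blockIdx r d c (d + 1) = r + 1 := by
    rw [blockIdx_of_le (by omega) le_rfl, hc.wallCount_of_gt (by omega)]
  have hle : ∀ j ≤ r + 1, c j ≤ d := fun j hj => by
    have := Finset.single_le_sum (f := c) (s := Finset.range (r + 2))
      (fun i hi => hn i (by have := Finset.mem_range.1 hi; omega))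
      (Finset.mem_range.2 (show j < r + 2 by omega))
    rw [hc.total] at this
    exact this
  have hps : ∀ j ≤ r + 2, psum c j ≤ d := fun j hj => by
    have := hc.psum_mono hj le_rfl
    rw [psum, psum, hc.total] at this
    exact this
  rcases lt_trichotomy 0 y with h0 | rfl | h0
  · rcases le_or_gt y (d + 1) with h1 | h1
    · exact hc.mem_baseBlock_iff_of_le hk h0.le h1
    · by_cases hkr : k = r + 1
      · by_cases h2 : y < 2 * d + 2
        · have e : blockIdx r d c y = k ↔ blockIdx r d c (2 * d + 2 - y) = k := by
            have h3 := blockIdx_add r d c (-y)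
            rw [hc.blockIdx_neg, show -y + (2 * (d : ℤ) + 2) = 2 * d + 2 - y by ring] at h3
            rw [h3, hkr]
            push_cast
            constructor <;> intro h <;> linarith
          rw [e, ← hc.mem_baseBlock_iff_of_le hk (by omega) (by omega), hkr]
          simp only [baseBlock, Nat.add_eq_zero_iff, one_ne_zero, and_false, if_false, if_true,
            Set.mem_Icc]
          constructor <;> intro h <;> omega
        · have h3 := hm (show 0 + (2 * (d : ℤ) + 2) ≤ y by omega)
          rw [blockIdx_add, b0] at h3
          have := hle (r + 1) le_rfl
          simp only [hkr, baseBlock, Nat.add_eq_zero_iff, one_ne_zero, and_false, if_false, if_true,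
            Set.mem_Icc]
          constructor <;> intro h <;> omega
      · have h3 := hm h1.le
        rw [b1] at h3
        have hyk : ¬ blockIdx r d c y = k := by omega
        simp only [hyk, iff_false, baseBlock, hkr, if_false]
        have := hle 0 (by omega)
        have := hps (k + 1) (by omega)
        rw [psum] at this
        split_ifs
        · rw [Set.mem_Icc]; omega
        · rw [Set.mem_Ioc]; omega
  · exact hc.mem_baseBlock_iff_of_le hk le_rfl (by omega)
  · by_cases hk0 : k = 0
    · by_cases h2 : -(d + 1 : ℤ) ≤ y
      · have e : blockIdx r d c y = k ↔ blockIdx r d c (-y) = k := by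
          rw [hc.blockIdx_neg, hk0]
          push_cast
          constructor <;> intro h <;> linarith
        rw [e, ← hc.mem_baseBlock_iff_of_le hk (by omega) (by omega), hk0]
        simp only [baseBlock, if_true, Set.mem_Icc]
        constructor <;> intro h <;> omega
      · have h3 := hm (show y ≤ -(d + 1 : ℤ) by omega)
        rw [hc.blockIdx_neg, b1] at h3
        have := hle 0 (by omega)
        simp only [hk0, baseBlock, if_true, Set.mem_Icc]
        constructor <;> intro h <;> omega
    · have h3 := hm h0.le
      rw [b0] at h3
      have hyk : ¬ blockIdx r d c y = k := by omega
      simp only [hyk, iff_false, baseBlock, hk0, if_false]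
      have := hle (r + 1) le_rfl
      have := hc.psum_nonneg (show k ≤ r + 2 by omega)
      rw [psum] at this
      split_ifs
      · rw [Set.mem_Icc]; omega
      · rw [Set.mem_Ioc]; omega

/-- From here on the intervals `R_i` are the fibres of one monotone, odd and equivariant function,
and statements about blocks become statements about `blockIdx`. -/
theorem IsComp.mem_block_iff (hc : IsComp r d c) (i x : ℤ) :
    x ∈ block r d c i ↔ blockIdx r d c x = i := by
  have hx : ∀ m : ℤ, blockIdx r d c x = blockIdx r d c (x - m * (2 * d + 2)) + m * (2 * r + 2) :=
    fun m => by rw [← blockIdx_add_mul]; congr 1; ring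
  constructor
  · rintro ⟨k, hk, m, ⟨rfl, h⟩ | ⟨rfl, h⟩⟩
    · rw [hc.mem_baseBlock_iff hk] at h
      rw [hx m, h]
    · rw [hc.mem_baseBlock_iff hk, hc.blockIdx_neg] at h
      rw [hx m, ← h]; ring
  · intro h
    obtain ⟨m, j, rfl, h0, h1⟩ := exists_window (2 * r + 2) (by positivity) i
    rcases le_or_gt j (r + 1) with hj | hj
    · obtain ⟨k, rfl⟩ := Int.eq_ofNat_of_zero_le h0
      refine ⟨k, by omega, m, Or.inl ⟨rfl, ?_⟩⟩
      rw [hc.mem_baseBlock_iff (by omega)]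
      have := hx m
      linarith
    · obtain ⟨k, hk⟩ := Int.eq_ofNat_of_zero_le (show 0 ≤ 2 * (r : ℤ) + 2 - j by omega)
      refine ⟨k, by omega, m + 1, Or.inr ⟨by linarith, ?_⟩⟩
      rw [hc.mem_baseBlock_iff (by omega), hc.blockIdx_neg]
      have := hx (m + 1)
      linarith

/-! ### Parabolic subgroups -/

/-- The reflection `s_i` is a generator when no wall separates the two points that it swaps. At the
ends, `-1` and `1` have opposite indices, which agree only if both are `0`; the points `d` and `d +
2` are symmetric about index `r + 1` in the same way. -/
theorem IsComp.mem_generators_iff (hd : 2 ≤ d) (hc : IsComp r d c) {i : ℕ} (hi : i ≤ d) :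
    (∀ k ≤ r, (i : ℤ) ≠ ∑ l ∈ Finset.range (k + 1), c l) ↔
      blockIdx r d c (loIdx i) = blockIdx r d c (hiIdx d i) := by
  change (∀ k ≤ r, (i : ℤ) ≠ psum c (k + 1)) ↔ _
  have w := wallCount_le r c
  have w' := wallCount_nonneg r c
  have hn : ∀ k ≤ r, 0 ≤ psum c (k + 1) := fun k hk => hc.psum_nonneg (by omega)
  have hp : ∀ k ≤ r, psum c (k + 1) ≤ d := fun k hk => by
    have := hc.psum_mono (show k + 1 ≤ r + 2 by omega) le_rfl
    rw [psum, psum, hc.total] at this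
    exact this
  have hfull : ∀ x, wallCount r c x = r + 1 ↔ ∀ k ≤ r, psum c (k + 1) < x := by
    intro x
    rw [wallCount]
    have := Finset.filter_card_eq (s := Finset.range (r + 1)) (p := fun k => psum c (k + 1) < x)
    rw [Finset.card_range] at this
    constructor
    · intro h k hk
      exact this (by exact_mod_cast h) k (Finset.mem_range.2 (by omega))
    · intro h
      rw [Finset.filter_true_of_mem fun k hk => h k (by have := Finset.mem_range.1 hk; omega),
        Finset.card_range]
      push_cast; rfl
  have hempty : ∀ x, wallCount r c x = 0 ↔ ∀ k ≤ r, x ≤ psum c (k + 1) := by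
    intro x
    rw [wallCount, Nat.cast_eq_zero, Finset.card_eq_zero, Finset.filter_eq_empty_iff]
    simp only [Finset.mem_range, not_lt, Nat.lt_succ_iff]
  rcases eq_or_ne i 0 with rfl | h0
  · simp only [loIdx, hiIdx, if_true]
    rw [hc.blockIdx_neg, blockIdx_of_le (by omega) (by omega)]
    have : -wallCount r c 1 = wallCount r c 1 ↔ wallCount r c 1 = 0 := by omega
    rw [this, hempty]
    refine forall₂_congr fun k hk => ?_
    have := hn k hk
    push_cast
    omega
  rcases eq_or_ne i d with rfl | h1
  · simp only [loIdx, hiIdx, if_true, h0, if_false]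
    rw [blockIdx_of_le (by omega) (by omega), blockIdx_of_gt (by omega) (by omega),
      show 2 * (i : ℤ) + 2 - (i + 2) = i by ring]
    have : wallCount r c i = 2 * r + 2 - wallCount r c i ↔ wallCount r c i = r + 1 := by omega
    rw [this, hfull]
    refine forall₂_congr fun k hk => ?_
    have := hp k hk
    omega
  · simp only [loIdx, hiIdx, h0, h1, if_false]
    rw [blockIdx_of_le (by omega) (by omega), blockIdx_of_le (by omega) (by omega)]
    have hsub : {k ∈ Finset.range (r + 1) | psum c (k + 1) < i} ⊆
        {k ∈ Finset.range (r + 1) | psum c (k + 1) < i + 1} :=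
      Finset.monotone_filter_right _ fun k _ (hk : psum c (k + 1) < i) => by omega
    constructor
    · intro h
      rw [wallCount, wallCount]
      congr 2
      refine Finset.filter_congr fun k hk => ?_
      have := h k (by have := Finset.mem_range.1 hk; omega)
      omega
    · intro h k hk hik
      rw [wallCount, wallCount, Nat.cast_inj] at h
      have := Finset.eq_of_subset_of_card_le hsub h.ge
      have hk1 : k ∈ {k ∈ Finset.range (r + 1) | psum c (k + 1) < (i : ℤ) + 1} :=
        Finset.mem_filter.2 ⟨Finset.mem_range.2 (by omega), by omega⟩
      rw [← this] at hk1
      have := (Finset.mem_filter.1 hk1).2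
      omega

theorem IsTransposition.blockIdx_eq (hc : IsComp r d c) {a b : ℤ} {s : Equiv.Perm ℤ}
    (hs : IsTransposition d a b s) (hab : blockIdx r d c a = blockIdx r d c b) (x : ℤ) :
    blockIdx r d c (s x) = blockIdx r d c x := by
  by_cases hx : ∀ k : ℤ, x ≠ k * (2 * d + 2) + a ∧ x ≠ k * (2 * d + 2) + b ∧
    x ≠ k * (2 * d + 2) - a ∧ x ≠ k * (2 * d + 2) - b
  · rw [hs.2 x hx]
  · have hadd : ∀ k y : ℤ, blockIdx r d c (k * (2 * d + 2) + y) =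
        blockIdx r d c y + k * (2 * r + 2) := fun k y => by rw [add_comm, blockIdx_add_mul]
    have hsub : ∀ k y : ℤ, blockIdx r d c (k * (2 * d + 2) - y) =
        -blockIdx r d c y + k * (2 * r + 2) := fun k y => by
      rw [sub_eq_add_neg, hadd, hc.blockIdx_neg]
    simp only [not_forall, not_and_or, not_not, ne_eq] at hx
    obtain ⟨k, rfl | rfl | rfl | rfl⟩ := hx
    · rw [(hs.1 k).1, hadd, hadd, hab]
    · rw [(hs.1 k).2.1, hadd, hadd, hab]
    · rw [(hs.1 k).2.2.1, hsub, hsub, hab]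
    · rw [(hs.1 k).2.2.2, hsub, hsub, hab]

theorem simpleRefl_blockIdx (hd : 2 ≤ d) (hc : IsComp r d c) {i : ℕ} (hi : i ≤ d)
    (h : blockIdx r d c (loIdx i) = blockIdx r d c (hiIdx d i)) (x : ℤ) :
    blockIdx r d c (simpleRefl hd hi x) = blockIdx r d c x := by
  have hs := isSimpleReflection_simpleRefl hd hi
  rw [IsSimpleReflection] at hs
  simp only [loIdx, hiIdx] at h
  split_ifs at hs h with h0 h1
  · exact hs.blockIdx_eq hc h.symm x
  · subst h1; exact hs.blockIdx_eq hc h x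
  · exact hs.blockIdx_eq hc h x

/-- Induction on the length. If `w` preserves blocks and has a descent at `s_i`, then monotonicity
of the block index forces the two swapped points into the same block. Hence `s_i` lies in the
parabolic subgroup and can be split off. -/
theorem mem_parabolic_of_len (hd : 2 ≤ d) (hc : IsComp r d c) (m : ℕ) : ∀ w ∈ weyl d,
    (∀ x, blockIdx r d c (w x) = blockIdx r d c x) → len d w ≤ m → w ∈ parabolic r d c := by
  induction m with
  | zero =>
    intro w hw hwb hm
    by_cases h1 : w = 1
    · rw [h1]; exact one_mem _
    · obtain ⟨i, hi, hdesc⟩ := exists_descent hd hw h1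
      have := len_mul_lt_of_descent hd hi hw hdesc
      omega
  | succ m ih =>
    intro w hw hwb hm
    by_cases h1 : w = 1
    · rw [h1]; exact one_mem _
    · obtain ⟨i, hi, hdesc⟩ := exists_descent hd hw h1
      have hlt := len_mul_lt_of_descent hd hi hw hdesc
      have hb : blockIdx r d c (loIdx i) = blockIdx r d c (hiIdx d i) := by
        apply le_antisymm (hc.blockIdx_mono (loIdx_lt_hiIdx d i).le)
        rw [← hwb (loIdx i), ← hwb (hiIdx d i)]
        exact hc.blockIdx_mono hdesc.le
      have hs : simpleRefl hd hi ∈ parabolic r d c :=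
        Subgroup.subset_closure ⟨i, hi, (hc.mem_generators_iff hd hi).2 hb,
          isSimpleReflection_simpleRefl hd hi⟩
      have := ih (w * simpleRefl hd hi) (mul_mem hw (simpleRefl_mem hd hi)) (fun x => by
        rw [Equiv.Perm.mul_apply, hwb, simpleRefl_blockIdx hd hc hi hb]) (by omega)
      have h2 := mul_mem this hs
      rwa [mul_assoc, simpleRefl_mul_self, mul_one] at h2

theorem mem_parabolic_iff (hd : 2 ≤ d) (hc : IsComp r d c) (w : Equiv.Perm ℤ) :
    w ∈ parabolic r d c ↔ w ∈ weyl d ∧ ∀ x, blockIdx r d c (w x) = blockIdx r d c x := by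
  refine ⟨fun h => ?_, fun h => mem_parabolic_of_len hd hc _ w h.1 h.2 le_rfl⟩
  induction h using Subgroup.closure_induction with
  | mem s hs =>
    obtain ⟨i, hi, hk, hs⟩ := hs
    rw [isSimpleReflection_iff hd hi] at hs
    subst hs
    exact ⟨simpleRefl_mem hd hi,
      simpleRefl_blockIdx hd hc hi ((hc.mem_generators_iff hd hi).1 hk)⟩
  | one => exact ⟨one_mem _, fun _ => rfl⟩
  | mul x y _ _ hx hy =>
    exact ⟨mul_mem hx.1 hy.1, fun z => by rw [Equiv.Perm.mul_apply, hx.2, hy.2]⟩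
  | inv x _ hx =>
    exact ⟨inv_mem hx.1, fun z => by rw [← hx.2, perm_apply_inv]⟩

/-- `g` is increasing on the fibres of `β`. -/
def BlockMono (β : ℤ → ℤ) (g : Equiv.Perm ℤ) : Prop := ∀ x y, β x = β y → x < y → g x < g y

/-- A descent at a generator of the parabolic subgroup would shorten `g`, so `g` increases at each
pair of neighbours in a common block. Blocks are intervals, hence neighbours suffice. -/
theorem blockMono_of_le (hd : 2 ≤ d) (hc : IsComp r d c) {g : Equiv.Perm ℤ} (hg : g ∈ weyl d)
    (hmin : ∀ y ∈ parabolic r d c, len d g ≤ len d (g * y)) : BlockMono (blockIdx r d c) g := by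
  have hm := hc.blockIdx_mono
  have hasc : ∀ i ≤ d, blockIdx r d c (loIdx i) = blockIdx r d c (hiIdx d i) →
      g (loIdx i) < g (hiIdx d i) := by
    intro i hi hb
    rcases lt_trichotomy (g (loIdx i)) (g (hiIdx d i)) with h | h | h
    · exact h
    · exact absurd (g.injective h) (loIdx_lt_hiIdx d i).ne
    · have h1 := len_mul_lt_of_descent hd hi hg h
      have h2 := hmin (simpleRefl hd hi) (Subgroup.subset_closure
        ⟨i, hi, (hc.mem_generators_iff hd hi).2 hb, isSimpleReflection_simpleRefl hd hi⟩)
      omega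
  have hlow : ∀ m : ℤ, 0 ≤ m → m ≤ d → blockIdx r d c m = blockIdx r d c (m + 1) →
      g m < g (m + 1) := by
    intro m h0 h1 hb
    obtain ⟨i, rfl⟩ := Int.eq_ofNat_of_zero_le h0
    have hi : i ≤ d := by omega
    have ha := hasc i hi
    simp only [loIdx, hiIdx] at ha
    split_ifs at ha with hi0 hid
    · subst hi0
      have e0 : blockIdx r d c 0 = 0 := by
        rw [blockIdx_of_le le_rfl (by omega), hc.wallCount_of_nonpos le_rfl]
      simp only [Nat.cast_zero, zero_add] at hb ⊢
      have := ha (by rw [hc.blockIdx_neg, ← hb, e0, neg_zero])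
      rw [weyl_neg hg] at this
      rw [weyl_zero hg]
      omega
    · subst hid
      have e1 : blockIdx r i c (i + 1) = r + 1 := by
        rw [blockIdx_of_le (by omega) le_rfl, hc.wallCount_of_gt (by omega)]
      have h2 := blockIdx_add r i c (-i)
      rw [hc.blockIdx_neg, show -(i : ℤ) + (2 * i + 2) = i + 2 by ring] at h2
      have := ha (by rw [h2, hb, e1]; ring)
      have h3 := weyl_add hg (-i)
      rw [weyl_neg hg, show -(i : ℤ) + (2 * i + 2) = i + 2 by ring] at h3
      have := weyl_mid hg
      omega
    · exact ha hb
  have hstep : ∀ x, blockIdx r d c x = blockIdx r d c (x + 1) → g x < g (x + 1) := by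
    intro x hb
    obtain ⟨k, m, rfl, h0, h1⟩ := exists_window (2 * d + 2) (by positivity) x
    rw [add_right_comm] at hb ⊢
    rw [blockIdx_add_mul, blockIdx_add_mul, add_left_inj] at hb
    rw [weyl_add_mul hg, weyl_add_mul hg, add_lt_add_iff_right]
    rcases le_or_gt m d with hmd | hmd
    · exact hlow m h0 hmd hb
    -- In the upper half of the window the neighbours `m, m + 1` are reflected to `2 * d + 1 - m, 2
    -- * d + 2 - m`, which start in `[0, d]`.
    · have b1 := blockIdx_add r d c (-m)
      have b2 := blockIdx_add r d c (-(m + 1))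
      rw [hc.blockIdx_neg] at b1 b2
      have g1 := weyl_add hg (-m)
      have g2 := weyl_add hg (-(m + 1))
      rw [weyl_neg hg] at g1 g2
      have e : -(m + 1) + (2 * (d : ℤ) + 2) + 1 = -m + (2 * d + 2) := by ring
      have := hlow (-(m + 1) + (2 * d + 2)) (by omega) (by omega) (by rw [e, b1, b2, hb])
      rw [e, g1, g2] at this
      omega
  have hall : ∀ k : ℕ, ∀ x, blockIdx r d c x = blockIdx r d c (x + k + 1) → g x < g (x + k + 1) := by
    intro k
    induction k with
    | zero => intro x hb; simpa using hstep x (by simpa using hb)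
    | succ k ih =>
      intro x hb
      push_cast at hb ⊢
      have h1 := hm (show x ≤ x + k + 1 by omega)
      have h2 := hm (show x + k + 1 ≤ x + (k + 1) + 1 by omega)
      have h3 := ih x (by omega)
      have h4 := hstep (x + k + 1) (by
        rw [show x + (k : ℤ) + 1 + 1 = x + (k + 1) + 1 by ring]; omega)
      rw [show x + (k : ℤ) + 1 + 1 = x + (k + 1) + 1 by ring] at h4
      omega
  intro x y hb hxy
  obtain ⟨k, hk⟩ := Int.eq_ofNat_of_zero_le (show 0 ≤ y - x - 1 by omega)
  have e : y = x + k + 1 := by have := hk; omega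
  rw [e] at hb ⊢
  exact hall k x hb

theorem blockMono_inv_of_le (hd : 2 ≤ d) (hc : IsComp r d c) {g : Equiv.Perm ℤ} (hg : g ∈ weyl d)
    (hmin : ∀ x ∈ parabolic r d c, len d g ≤ len d (x * g)) : BlockMono (blockIdx r d c) g⁻¹ := by
  refine blockMono_of_le hd hc (inv_mem hg) fun y hy => ?_
  have hy' := ((mem_parabolic_iff hd hc y).1 hy).1
  rw [len_inv hd hg, ← len_inv hd (mul_mem (inv_mem hg) hy'), mul_inv_rev, inv_inv]
  exact hmin _ (inv_mem hy)

/-- If `w⁻¹` increases on blocks, the two values of any inversion of `w` lie in different blocks. An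
element of the parabolic subgroup preserves blocks and so keeps the order of such values: every
inversion of `w` survives in `x * w`. -/
theorem le_len_mul_of_blockMono_inv (hd : 2 ≤ d) (hc : IsComp r d c) {w : Equiv.Perm ℤ}
    (hw : w ∈ weyl d) (hmono : BlockMono (blockIdx r d c) w⁻¹) :
    ∀ x ∈ parabolic r d c, len d w ≤ len d (x * w) := by
  intro x hx
  obtain ⟨hx1, hx2⟩ := (mem_parabolic_iff hd hc x).1 hx
  have hxw := mul_mem hx1 hw
  have h1 := four_mul_len hd hw
  have h2 := four_mul_len hd hxw
  have h3 : fourLen d w ≤ fourLen d (x * w) := by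
    refine fourLen_le_of_subset hxw ?_
    rintro ⟨u, v⟩ ⟨huv, hwuv⟩
    refine ⟨huv, ?_⟩
    simp only [Equiv.Perm.mul_apply] at hwuv ⊢
    rcases (hc.blockIdx_mono hwuv.le).eq_or_lt with h | h
    · have := hmono _ _ h hwuv
      rw [perm_inv_apply, perm_inv_apply] at this
      exact absurd huv (lt_asymm this)
    · rw [← hx2, ← hx2 (w u)] at h
      by_contra hcon
      exact h.not_ge (hc.blockIdx_mono (not_lt.1 hcon))
  omega

end

end AffineC

/-! ### Weyl group elements with a prescribed matrix -/

namespace AffineC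

/-! ### Cumulative sums -/

/-- The sum of the terms of `m` strictly before `j`. -/
noncomputable def cum (m : ℤ → ℤ) (j : ℤ) : ℤ := ∑ᶠ k ∈ Set.Iio j, m k

section cum

variable {m : ℤ → ℤ}

theorem cum_succ (hm : {j | m j ≠ 0}.Finite) (j : ℤ) : cum m (j + 1) = cum m j + m j := by
  have : Set.Iio (j + 1) = insert j (Set.Iio j) := by
    ext x; simp only [Set.mem_Iio, Set.mem_insert_iff]; omega
  rw [cum, this, finsum_mem_insert' _ (by simp) (hm.subset fun x hx => hx.2), cum, add_comm]

theorem cum_mono (hm : {j | m j ≠ 0}.Finite) (h0 : ∀ j, 0 ≤ m j) : Monotone (cum m) :=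
  monotone_int_of_le_succ fun j => by rw [cum_succ hm]; linarith [h0 j]

theorem cum_neg (hm : {j | m j ≠ 0}.Finite) (j : ℤ) :
    cum (fun k => m (-k)) (-j) = (∑ᶠ k, m k) - cum m (j + 1) := by
  have h1 : ∑ᶠ k, m k = ∑ᶠ k ∈ Set.Iio (j + 1) ∪ Set.Ici (j + 1), m k := by
    rw [Set.Iio_union_Ici]; simp
  have h2 : cum (fun k => m (-k)) (-j) = ∑ᶠ k ∈ Set.Ici (j + 1), m k := by
    refine finsum_mem_eq_of_bijOn (fun k => -k) ⟨?_, ?_, ?_⟩ fun _ _ => rfl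
    · intro k hk; simp only [Set.mem_Iio, Set.mem_Ici] at *; omega
    · exact fun _ _ _ _ h => neg_injective h
    · intro k hk; exact ⟨-k, by simp only [Set.mem_Iio, Set.mem_Ici] at *; omega, by simp⟩
  rw [h1, finsum_mem_union' (Set.Iio_disjoint_Ici le_rfl) (hm.subset fun x hx => hx.2)
    (hm.subset fun x hx => hx.2), h2, cum]
  ring

theorem cum_add (n j : ℤ) : cum (fun k => m (k - n)) (j + n) = cum m j := by
  refine finsum_mem_eq_of_bijOn (fun k => k - n) ⟨?_, ?_, ?_⟩ fun _ _ => rfl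
  · intro k hk; simp only [Set.mem_Iio] at *; omega
  · exact fun _ _ _ _ h => by simpa using h
  · intro k hk; exact ⟨k + n, by simp only [Set.mem_Iio] at *; omega, by simp⟩

theorem exists_bound_of_finite (hm : {j | m j ≠ 0}.Finite) : ∃ M : ℤ, ∀ j, m j ≠ 0 → |j| < M := by
  obtain ⟨M, hM⟩ := (hm.image fun j => |j|).bddAbove
  exact ⟨M + 1, fun j hj => Int.lt_add_one_iff.2 (hM ⟨j, hj, rfl⟩)⟩

theorem cum_eventually (hm : {j | m j ≠ 0}.Finite) :
    ∃ M : ℤ, (∀ j ≤ -M, cum m j = 0) ∧ ∀ j, M ≤ j → cum m j = ∑ᶠ k, m k := by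
  obtain ⟨M, hM⟩ := exists_bound_of_finite hm
  refine ⟨M, fun j hj => ?_, fun j hj => ?_⟩
  · refine finsum_mem_eq_zero_of_forall_eq_zero fun k hk => ?_
    by_contra h
    have := (abs_lt.1 (hM k h)).1
    simp only [Set.mem_Iio] at hk
    omega
  · rw [cum, finsum_mem_def]
    congr 1
    ext k
    by_cases hk : k < j
    · rw [Set.indicator_of_mem (Set.mem_Iio.2 hk)]
    · rw [Set.indicator_of_notMem (by simpa using hk)]
      by_contra h
      have := (abs_lt.1 (hM k (Ne.symm h))).2
      omega

theorem cum_nonneg (h0 : ∀ j, 0 ≤ m j) (j : ℤ) : 0 ≤ cum m j :=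
  finsum_nonneg fun k => finsum_nonneg fun _ => h0 k

theorem cum_le (hm : {j | m j ≠ 0}.Finite) (h0 : ∀ j, 0 ≤ m j) (j : ℤ) :
    cum m j ≤ ∑ᶠ k, m k := by
  obtain ⟨M, -, hM⟩ := cum_eventually hm
  rw [← hM (max M j) (le_max_left _ _)]
  exact cum_mono hm h0 (le_max_right _ _)

theorem exists_cum_le (hm : {j | m j ≠ 0}.Finite) {o : ℤ} (ho : 0 ≤ o)
    (ho' : o < ∑ᶠ k, m k) : ∃ j, cum m j ≤ o ∧ o < cum m (j + 1) := by
  obtain ⟨M, hM1, hM2⟩ := cum_eventually hm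
  obtain ⟨j, hj, hj'⟩ := Int.exists_greatest_of_bdd (P := fun j => cum m j ≤ o)
    ⟨M, fun z hz => by
      by_contra hcon
      rw [hM2 z (by omega)] at hz
      omega⟩ ⟨-M, by rw [hM1 _ le_rfl]; exact ho⟩
  refine ⟨j, hj, ?_⟩
  by_contra hcon
  have := hj' (j + 1) (not_lt.1 hcon)
  omega

end cum

/-! ### Elements of the Weyl group with a given matrix -/

/-- The hypotheses on a matrix `M` of cell sizes: rows are indexed with period `n'` and columns with
period `n`. -/
structure IsCellMatrix (n' n : ℤ) (M : ℤ → ℤ → ℤ) : Prop where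
  nonneg : ∀ i j, 0 ≤ M i j
  periodic : ∀ i j, M (i + n') (j + n) = M i j
  symm : ∀ i j, M (-i) (-j) = M i j
  finite_row : ∀ i, {j | M i j ≠ 0}.Finite
  finite_col : ∀ j, {i | M i j ≠ 0}.Finite

theorem IsCellMatrix.transpose {n' n : ℤ} {M : ℤ → ℤ → ℤ} (h : IsCellMatrix n' n M) :
    IsCellMatrix n n' fun i j => M j i :=
  ⟨fun i j => h.nonneg j i, fun i j => h.periodic j i, fun i j => h.symm j i, h.finite_col,
    h.finite_row⟩

/-- Cut each fibre of `β`, an interval with `∑ j, M i j` points, into consecutive cells of sizes `M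
i j` in the order of `j`. A point is then described by its block, its cell `J` and its offset `K` in
the cell. Periodicity of `M` makes these coordinates equivariant under translation; under negation
the order inside a cell is reversed, whence the offset `M - 1 - K`. -/
theorem exists_position {D n' n : ℤ} {β : ℤ → ℤ} (hadd : ∀ x, β (x + D) = β x + n')
    (hneg : ∀ x, β (-x) = -β x) {M : ℤ → ℤ → ℤ} (hM : IsCellMatrix n' n M)
    (hst : ∀ i, ∃ a, ∀ x, β x = i ↔ a ≤ x ∧ x < a + ∑ᶠ j, M i j) :
    ∃ (φ : ℤ → ℤ → ℤ → ℤ) (J K : ℤ → ℤ),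
      (∀ i j k, 0 ≤ k → k < M i j → β (φ i j k) = i ∧ J (φ i j k) = j ∧ K (φ i j k) = k) ∧
      (∀ x, 0 ≤ K x ∧ K x < M (β x) (J x) ∧ φ (β x) (J x) (K x) = x) ∧
      (∀ x, J (x + D) = J x + n ∧ K (x + D) = K x) ∧
      ∀ x, J (-x) = -J x ∧ K (-x) = M (β x) (J x) - 1 - K x := by
  choose st hst using hst
  have hcs := fun i => cum_succ (hM.finite_row i)
  have hcm := fun i => cum_mono (hM.finite_row i) (hM.nonneg i)
  have hc0 := fun i => cum_nonneg (hM.nonneg i)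
  have hcl := fun i => cum_le (hM.finite_row i) (hM.nonneg i)
  set φ : ℤ → ℤ → ℤ → ℤ := fun i j k => st i + cum (M i) j + k with hφ
  have hβ : ∀ i j k, 0 ≤ k → k < M i j → β (φ i j k) = i := by
    intro i j k h0 h1
    rw [hst]
    have := hc0 i j
    have := hcl i (j + 1)
    rw [hcs] at this
    simp only [hφ]
    omega
  have hinj : ∀ i j k j' k', 0 ≤ k → k < M i j → 0 ≤ k' → k' < M i j' →
      φ i j k = φ i j' k' → j = j' ∧ k = k' := by
    intro i j k j' k' h0 h1 h0' h1' h
    simp only [hφ] at h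
    have a1 := hcs i j
    have a2 := hcs i j'
    rcases lt_trichotomy j j' with hj | rfl | hj
    · have := hcm i (show j + 1 ≤ j' by omega)
      omega
    · exact ⟨rfl, by omega⟩
    · have := hcm i (show j' + 1 ≤ j by omega)
      omega
  have hsurj : ∀ x, ∃ j k, 0 ≤ k ∧ k < M (β x) j ∧ φ (β x) j k = x := by
    intro x
    have hx := (hst (β x) x).1 rfl
    obtain ⟨j, hj, hj'⟩ := exists_cum_le (hM.finite_row (β x)) (o := x - st (β x)) (by omega)
      (by omega)
    rw [hcs] at hj'
    exact ⟨j, x - st (β x) - cum (M (β x)) j, by omega, by omega, by simp only [hφ]; ring⟩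
  choose J K hK0 hK1 hJK using hsurj
  have huniq : ∀ x j k, 0 ≤ k → k < M (β x) j → φ (β x) j k = x → J x = j ∧ K x = k :=
    fun x j k h0 h1 h => hinj _ _ _ _ _ (hK0 x) (hK1 x) h0 h1 ((hJK x).trans h.symm)
  refine ⟨φ, J, K, fun i j k h0 h1 => ?_, fun x => ⟨hK0 x, hK1 x, hJK x⟩, fun x => ?_, fun x => ?_⟩
  · have hb := hβ i j k h0 h1
    refine ⟨hb, huniq _ _ _ h0 (by rwa [hb]) (by rw [hb])⟩
  · have hrow : M (β x + n') = fun k => M (β x) (k - n) := by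
      ext k
      rw [← hM.periodic (β x) (k - n), sub_add_cancel]
    have htot : ∑ᶠ k, M (β x + n') k = ∑ᶠ k, M (β x) k := by
      rw [hrow]
      exact finsum_comp_equiv (Equiv.subRight n) (f := M (β x))
    -- The starting point of a block is determined because the block contains `x`; for an empty
    -- block it would be arbitrary.
    have hst1 : st (β x + n') = st (β x) + D := by
      have hx := (hst (β x) x).1 rfl
      have h1 := (hst (β x) (st (β x))).2 ⟨le_rfl, by omega⟩
      have h2 := (hst (β x + n') (st (β x + n'))).2 ⟨le_rfl, by omega⟩
      have h3 := (hst (β x + n') (st (β x) + D)).1 (by rw [hadd, h1])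
      have h4 := (hst (β x) (st (β x + n') - D)).1 (by
        have := hadd (st (β x + n') - D)
        rw [sub_add_cancel] at this
        omega)
      omega
    refine huniq _ _ _ (hK0 x) (by rw [hadd, hM.periodic]; exact hK1 x) ?_
    have := hJK x
    simp only [hφ] at this ⊢
    rw [hadd, hst1, hrow, cum_add]
    omega
  · have hrow : M (-β x) = fun k => M (β x) (-k) := by
      ext k
      rw [← hM.symm (β x) (-k), neg_neg]
    have htot : ∑ᶠ k, M (-β x) k = ∑ᶠ k, M (β x) k := by
      rw [hrow]
      exact finsum_comp_equiv (Equiv.neg ℤ) (f := M (β x))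
    have hst1 : st (-β x) = -(st (β x) + ∑ᶠ k, M (β x) k) + 1 := by
      have hx := (hst (β x) x).1 rfl
      have h1 := (hst (β x) (st (β x) + (∑ᶠ k, M (β x) k) - 1)).2 ⟨by omega, by omega⟩
      have h2 := (hst (-β x) (st (-β x))).2 ⟨le_rfl, by omega⟩
      have h3 := (hst (-β x) (-(st (β x) + (∑ᶠ k, M (β x) k) - 1))).1 (by rw [hneg, h1])
      have h4 := (hst (β x) (-st (-β x))).1 (by rw [hneg, h2, neg_neg])
      omega
    refine huniq _ _ _ (by have := hK1 x; omega)
      (by rw [hneg, hM.symm]; have := hK0 x; omega) ?_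
    have := hJK x
    simp only [hφ] at this ⊢
    rw [hneg, hst1, hrow, cum_neg (hM.finite_row _), hcs]
    omega

/-- The number of `y` with `γ y = j` and `β (g y) = i`. -/
noncomputable def cell (β γ : ℤ → ℤ) (g : Equiv.Perm ℤ) (i j : ℤ) : ℤ :=
  ({y | β (g y) = i ∧ γ y = j}.ncard : ℤ)

/-- The blocks of `γ` are cut by the columns of `M` and those of `β` by its rows. Cell `(i, j)` has
`M i j` points on both sides, and `g` matches equal offsets. Equivariance of the two coordinate
systems puts `g` in the Weyl group. -/
theorem exists_perm_of_cellMatrix {d : ℕ} {n' n : ℤ} {β γ : ℤ → ℤ}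
    (hβ : ∀ x, β (x + (2 * d + 2)) = β x + n') (hβ' : ∀ x, β (-x) = -β x)
    (hγ : ∀ x, γ (x + (2 * d + 2)) = γ x + n) (hγ' : ∀ x, γ (-x) = -γ x)
    {M : ℤ → ℤ → ℤ} (hM : IsCellMatrix n' n M)
    (hst : ∀ i, ∃ a, ∀ x, β x = i ↔ a ≤ x ∧ x < a + ∑ᶠ j, M i j)
    (hst' : ∀ j, ∃ a, ∀ x, γ x = j ↔ a ≤ x ∧ x < a + ∑ᶠ i, M i j) :
    ∃ g ∈ weyl d, ∀ i j, cell β γ g i j = M i j := by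
  obtain ⟨φ, J, K, h1, h2, h3, h4⟩ := exists_position hβ hβ' hM hst
  obtain ⟨ψ, I, L, h1', h2', h3', h4'⟩ := exists_position hγ hγ' hM.transpose hst'
  have e1 : ∀ y, β (φ (I y) (γ y) (L y)) = I y ∧ J (φ (I y) (γ y) (L y)) = γ y ∧
      K (φ (I y) (γ y) (L y)) = L y := fun y => h1 _ _ _ (h2' y).1 (h2' y).2.1
  have e2 : ∀ x, γ (ψ (J x) (β x) (K x)) = J x ∧ I (ψ (J x) (β x) (K x)) = β x ∧
      L (ψ (J x) (β x) (K x)) = K x := fun x => h1' _ _ _ (h2 x).1 (h2 x).2.1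
  let g : Equiv.Perm ℤ :=
    { toFun := fun y => φ (I y) (γ y) (L y)
      invFun := fun x => ψ (J x) (β x) (K x)
      left_inv := fun y => by
        obtain ⟨a, b, c⟩ := e1 y
        simp only [a, b, c]
        exact (h2' y).2.2
      right_inv := fun x => by
        obtain ⟨a, b, c⟩ := e2 x
        simp only [a, b, c]
        exact (h2 x).2.2 }
  have hg : ∀ y, g y = φ (I y) (γ y) (L y) := fun _ => rfl
  have huniq : ∀ x x', β x = β x' → J x = J x' → K x = K x' → x = x' := fun x x' a b c => by
    rw [← (h2 x).2.2, ← (h2 x').2.2, a, b, c]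
  refine ⟨g, ⟨fun y => huniq _ _ ?_ ?_ ?_, fun y => huniq _ _ ?_ ?_ ?_⟩, fun i j => ?_⟩
  · rw [hβ, hg, hg, (e1 _).1, (e1 _).1, (h3' y).1]
  · rw [(h3 _).1, hg, hg, (e1 _).2.1, (e1 _).2.1, hγ]
  · rw [(h3 _).2, hg, hg, (e1 _).2.2, (e1 _).2.2, (h3' y).2]
  · rw [hβ', hg, hg, (e1 _).1, (e1 _).1, (h4' y).1]
  · rw [(h4 _).1, hg, hg, (e1 _).2.1, (e1 _).2.1, hγ']
  · rw [(h4 _).2, hg, hg, (e1 _).2.2, (e1 _).2.2, (h4' y).2, (e1 _).1, (e1 _).2.1]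
  · have : {y | β (g y) = i ∧ γ y = j}.ncard = (Set.Ico 0 (M i j)).ncard := by
      refine Set.ncard_congr (fun y _ => L y) ?_ ?_ ?_
      · rintro y ⟨hy1, hy2⟩
        rw [hg, (e1 y).1] at hy1
        have := h2' y
        rw [hy1, hy2] at this
        exact ⟨this.1, this.2.1⟩
      · rintro y y' ⟨hy1, hy2⟩ ⟨hy1', hy2'⟩ h
        rw [hg, (e1 _).1] at hy1 hy1'
        rw [← (h2' y).2.2, ← (h2' y').2.2, hy1, hy2, hy1', hy2', h]
      · rintro k ⟨hk0, hk1⟩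
        have := h1' j i k hk0 hk1
        refine ⟨ψ j i k, ⟨?_, this.1⟩, this.2.2⟩
        rw [hg, (e1 _).1, this.2.1]
    rw [cell, this, Set.ncard_eq_toFinset_card', Set.toFinset_Ico, Int.card_Ico, sub_zero]
    exact Int.toNat_of_nonneg (hM.nonneg i j)

/-! ### Sizes of blocks -/

section

variable {r d : ℕ} {c : ℕ → ℤ}

theorem exists_interval {S : Set ℤ} (hfin : S.Finite) (hS : S.OrdConnected) :
    ∃ a, ∀ x, x ∈ S ↔ a ≤ x ∧ x < a + (S.ncard : ℤ) := by
  rcases S.eq_empty_or_nonempty with rfl | hne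
  · exact ⟨0, fun x => by simp⟩
  · obtain ⟨a, ha, ha'⟩ := Set.exists_min_image S id hfin hne
    obtain ⟨b, hb, hb'⟩ := Set.exists_max_image S id hfin hne
    have e : S = Set.Icc a b := by
      ext x
      exact ⟨fun hx => ⟨ha' x hx, hb' x hx⟩, fun hx => hS.out ha hb hx⟩
    refine ⟨a, fun x => ?_⟩
    have hab : a ≤ b := ha' b hb
    rw [e, Set.ncard_eq_toFinset_card', Set.toFinset_Icc, Int.card_Icc, Set.mem_Icc,
      Int.toNat_of_nonneg (by omega)]
    omega

/-- The block index differs from its linear approximation `x / (2 * d + 2) * (2 * r + 2)` by at most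
one period, so bounding it bounds `x`. -/
theorem blockIdx_finite (r d : ℕ) (c : ℕ → ℤ) (a b : ℤ) :
    {x | a ≤ blockIdx r d c x ∧ blockIdx r d c x < b}.Finite := by
  have w := wallCount_le r c
  have w' := wallCount_nonneg r c
  have h : ∀ x, |blockIdx r d c x - x / (2 * d + 2) * (2 * r + 2)| ≤ 2 * r + 2 := by
    intro x
    rw [blockIdx, add_sub_cancel_left, abs_le]
    have := w (x % (2 * d + 2))
    have := w' (x % (2 * d + 2))
    have := w (2 * d + 2 - x % (2 * d + 2))
    have := w' (2 * d + 2 - x % (2 * d + 2))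
    split_ifs <;> omega
  refine (Set.finite_Icc ((-|a| - 2) * (2 * d + 2)) ((|b| + 3) * (2 * d + 2))).subset ?_
  rintro x ⟨h1, h2⟩
  have h3 := abs_le.1 (h x)
  have h4 := Int.emod_add_mul_ediv x (2 * d + 2)
  have h5 := Int.emod_nonneg x (show (2 * d + 2 : ℤ) ≠ 0 by positivity)
  have h6 := Int.emod_lt_of_pos x (show (0 : ℤ) < 2 * d + 2 by positivity)
  have h7 : -|a| - 2 ≤ x / (2 * d + 2) := by
    by_contra hcon
    have h8 : x / (2 * d + 2) + 1 ≤ -|a| - 2 := by omega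
    have h9 := mul_le_mul_of_nonneg_right h8 (show (0 : ℤ) ≤ 2 * r + 2 by positivity)
    have := neg_abs_le a
    have : 0 ≤ |a| := abs_nonneg a
    have : |a| * 1 ≤ |a| * (2 * r + 2) := by gcongr; omega
    nlinarith
  have h8 : x / (2 * d + 2) ≤ |b| + 2 := by
    by_contra hcon
    have h8 : |b| + 2 ≤ x / (2 * d + 2) - 1 := by omega
    have h9 := mul_le_mul_of_nonneg_right h8 (show (0 : ℤ) ≤ 2 * r + 2 by positivity)
    have := le_abs_self b
    have : 0 ≤ |b| := abs_nonneg b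
    have : |b| * 1 ≤ |b| * (2 * r + 2) := by gcongr; omega
    nlinarith
  have e1 := mul_le_mul_of_nonneg_left h7 (show (0 : ℤ) ≤ 2 * d + 2 by positivity)
  have e2 := mul_le_mul_of_nonneg_left h8 (show (0 : ℤ) ≤ 2 * d + 2 by positivity)
  rw [Set.mem_Icc]
  constructor <;> nlinarith

/-- The size of the block of index `i`. -/
noncomputable def blockSize (r d : ℕ) (c : ℕ → ℤ) (i : ℤ) : ℤ :=
  ({x | blockIdx r d c x = i}.ncard : ℤ)

theorem blockIdx_fibre_finite (r d : ℕ) (c : ℕ → ℤ) (i : ℤ) :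
    {x | blockIdx r d c x = i}.Finite :=
  (blockIdx_finite r d c i (i + 1)).subset fun x (hx : _ = _) => ⟨hx.ge, by omega⟩

theorem IsComp.exists_interval (hc : IsComp r d c) (i : ℤ) :
    ∃ a, ∀ x, blockIdx r d c x = i ↔ a ≤ x ∧ x < a + blockSize r d c i :=
  AffineC.exists_interval (blockIdx_fibre_finite r d c i) ⟨by
    intro x (hx : _ = _) y (hy : _ = _) z hz
    have h1 := hc.blockIdx_mono hz.1
    have h2 := hc.blockIdx_mono hz.2
    change _ = _
    omega⟩

theorem blockSize_add (r d : ℕ) (c : ℕ → ℤ) (i : ℤ) :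
    blockSize r d c (i + (2 * r + 2)) = blockSize r d c i := by
  rw [blockSize, blockSize, Nat.cast_inj]
  symm
  refine Set.ncard_congr (fun x _ => x + (2 * (d : ℤ) + 2)) ?_ ?_ ?_
  · intro x (hx : _ = _)
    change _ = _
    rw [blockIdx_add, hx]
  · intro x y _ _ h
    simpa using h
  · intro x (hx : _ = _)
    refine ⟨x - (2 * d + 2), ?_, by ring⟩
    have := blockIdx_add r d c (x - (2 * d + 2))
    rw [sub_add_cancel] at this
    change _ = _
    omega

theorem IsComp.blockSize_neg (hc : IsComp r d c) (i : ℤ) :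
    blockSize r d c (-i) = blockSize r d c i := by
  rw [blockSize, blockSize, Nat.cast_inj]
  refine Set.ncard_congr (fun x _ => -x) ?_ ?_ ?_
  · intro x (hx : _ = _)
    change _ = _
    rw [hc.blockIdx_neg, hx, neg_neg]
  · intro x y _ _ h
    simpa using h
  · intro x (hx : _ = _)
    refine ⟨-x, ?_, by ring⟩
    change _ = _
    rw [hc.blockIdx_neg, hx]

theorem IsComp.blockSize_base (hc : IsComp r d c) {k : ℕ} (hk : k ≤ r + 1) :
    blockSize r d c k = if k = 0 ∨ k = r + 1 then 2 * c k + 1 else c k := by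
  have hs : {x | blockIdx r d c x = k} = baseBlock r d c k := by
    ext x
    exact (hc.mem_baseBlock_iff hk x).symm
  have hn := hc.nonneg k hk
  rw [blockSize, hs, baseBlock]
  by_cases h0 : k = 0
  · subst h0
    rw [if_pos rfl, if_pos (Or.inl rfl), Set.ncard_eq_toFinset_card', Set.toFinset_Icc, Int.card_Icc,
      Int.toNat_of_nonneg (by omega)]
    ring
  by_cases h1 : k = r + 1
  · subst h1
    rw [if_neg h0, if_pos rfl, if_pos (Or.inr rfl), Set.ncard_eq_toFinset_card', Set.toFinset_Icc,
      Int.card_Icc, Int.toNat_of_nonneg (by omega)]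
    ring
  · rw [if_neg h0, if_neg h1, if_neg (by omega), Set.ncard_eq_toFinset_card', Set.toFinset_Ioc,
      Int.card_Ioc, Finset.sum_range_succ, Int.toNat_of_nonneg (by omega)]
    ring

/-- A periodic even function on `ℤ` is determined by its values on `0, …, r + 1`. -/
theorem eq_of_base {f h : ℤ → ℤ} (hf : ∀ i, f (i + (2 * r + 2)) = f i) (hf' : ∀ i, f (-i) = f i)
    (hh : ∀ i, h (i + (2 * r + 2)) = h i) (hh' : ∀ i, h (-i) = h i)
    (hb : ∀ k : ℕ, k ≤ r + 1 → f k = h k) (i : ℤ) : f i = h i := by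
  have hmul : ∀ u : ℤ → ℤ, (∀ i, u (i + (2 * r + 2)) = u i) → ∀ k i : ℤ,
      u (i + k * (2 * r + 2)) = u i := by
    intro u hu k
    induction k using Int.induction_on with
    | zero => simp
    | succ k ih =>
      intro i
      rw [show i + ((k : ℤ) + 1) * (2 * r + 2) = i + k * (2 * r + 2) + (2 * r + 2) by ring, hu, ih]
    | pred k ih =>
      intro i
      rw [← hu, show i + (-(k : ℤ) - 1) * (2 * r + 2) + (2 * r + 2) = i + -k * (2 * r + 2) by ring,
        ih]
  obtain ⟨k, m, rfl, h0, h1⟩ := exists_window (2 * r + 2) (by positivity) i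
  rw [hmul f hf, hmul h hh]
  rcases le_or_gt m (r + 1) with hm | hm
  · obtain ⟨j, rfl⟩ := Int.eq_ofNat_of_zero_le h0
    exact hb j (by omega)
  · obtain ⟨j, hj⟩ := Int.eq_ofNat_of_zero_le (show 0 ≤ 2 * (r : ℤ) + 2 - m by omega)
    have := hb j (by omega)
    change 2 * (r : ℤ) + 2 - m = j at hj
    rw [← hj] at this
    rw [← hf', ← hh', ← hf, ← hh (-m), show -m + (2 * (r : ℤ) + 2) = 2 * r + 2 - m by ring, this]

end

end AffineC

/-! ### Counting the inversions of minimal double coset representatives -/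

namespace AffineC

/-! ### Counting pairs by labels -/

theorem ncard_eq_finsum_mem {α : Type*} {Y : Set α} (hY : Y.Finite) :
    (Y.ncard : ℤ) = ∑ᶠ _y ∈ Y, (1 : ℤ) := by
  rw [finsum_mem_eq_finite_toFinset_sum _ hY, Set.ncard_eq_toFinset_card _ hY]
  simp

theorem finsum_mem_label {α κ : Type*} {Y : Set α} (hY : Y.Finite) (lab : α → κ) {P : Set κ}
    (hP : ∀ y ∈ Y, lab y ∈ P) (H : κ → ℤ) :
    ∑ᶠ y ∈ Y, H (lab y) = ∑ᶠ p ∈ P, ({y | y ∈ Y ∧ lab y = p}.ncard : ℤ) * H p := by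
  classical
  have hcard : ∀ p, {y | y ∈ Y ∧ lab y = p}.ncard = ({y ∈ hY.toFinset | lab y = p} : Finset α).card := by
    intro p
    rw [← Set.ncard_coe_finset]
    congr 1
    ext y
    simp
  rw [finsum_mem_eq_finite_toFinset_sum _ hY, Finset.sum_comp H lab]
  rw [finsum_mem_def, finsum_eq_sum_of_support_subset (s := hY.toFinset.image lab)]
  · refine Finset.sum_congr rfl fun p hp => ?_
    obtain ⟨y, hy, rfl⟩ := Finset.mem_image.1 hp
    rw [Set.indicator_of_mem (hP y (hY.mem_toFinset.1 hy)), hcard, nsmul_eq_mul]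
  · intro p hp
    rw [Function.mem_support, ne_eq, Set.indicator_apply_eq_zero, Classical.not_imp] at hp
    have h := hp.2
    rw [hcard] at h
    obtain ⟨y, hy⟩ : ({y ∈ hY.toFinset | lab y = p} : Finset α).Nonempty := by
      rw [Finset.nonempty_iff_ne_empty]
      rintro h0
      rw [h0] at h
      simp at h
    rw [Finset.mem_filter] at hy
    exact Finset.mem_coe.2 (Finset.mem_image.2 ⟨y, hy.1, hy.2⟩)

theorem ncard_label {α κ : Type*} {Y : Set α} (hY : Y.Finite) (lab : α → κ) {P : Set κ}
    (hP : ∀ y ∈ Y, lab y ∈ P) :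
    (Y.ncard : ℤ) = ∑ᶠ p ∈ P, ({y | y ∈ Y ∧ lab y = p}.ncard : ℤ) := by
  have := finsum_mem_label hY lab hP fun _ => 1
  simp only [mul_one] at this
  rw [ncard_eq_finsum_mem hY, this]

theorem ncard_pairs_label {α β κ κ' : Type*} {Y : Set β} {X : Set α} (lab : β → κ) (lab' : α → κ')
    {P : Set κ} {R : κ → κ' → Prop} (hP : ∀ y ∈ Y, lab y ∈ P) (hY : Y.Finite)
    (hX : ∀ y ∈ Y, {x | x ∈ X ∧ R (lab y) (lab' x)}.Finite) :
    ({p : α × β | p.2 ∈ Y ∧ p.1 ∈ X ∧ R (lab p.2) (lab' p.1)}.ncard : ℤ) =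
      ∑ᶠ p ∈ P, ({y | y ∈ Y ∧ lab y = p}.ncard : ℤ) *
        ∑ᶠ p' ∈ {p' | R p p'}, ({x | x ∈ X ∧ lab' x = p'}.ncard : ℤ) := by
  have hS : {p : α × β | p.2 ∈ Y ∧ p.1 ∈ X ∧ R (lab p.2) (lab' p.1)}.Finite := by
    refine (hY.biUnion fun y hy => (hX y hy).prod (Set.finite_singleton y)).subset ?_
    rintro ⟨x, y⟩ ⟨hy, hx, hR⟩
    simp only [Set.mem_iUnion]
    exact ⟨y, hy, ⟨hx, hR⟩, rfl⟩
  rw [ncard_label hS Prod.snd (P := Y) fun p hp => hp.1, ← finsum_mem_label hY lab hP]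
  refine finsum_mem_congr rfl fun y hy => ?_
  have e : {p | p ∈ {p : α × β | p.2 ∈ Y ∧ p.1 ∈ X ∧ R (lab p.2) (lab' p.1)} ∧ p.2 = y}.ncard =
      {x | x ∈ X ∧ R (lab y) (lab' x)}.ncard := by
    refine Set.ncard_congr (fun p _ => p.1) ?_ ?_ ?_
    · rintro ⟨x, y'⟩ ⟨⟨-, h⟩, rfl⟩
      exact h
    · rintro ⟨x, y'⟩ ⟨x', y''⟩ ⟨-, rfl⟩ ⟨-, h⟩ rfl
      simpa using h.symm
    · intro x hx
      exact ⟨(x, y), ⟨⟨hy, hx⟩, rfl⟩, rfl⟩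
  rw [e, ncard_label (hX y hy) lab' (P := {p' | R (lab y) p'}) fun x hx => hx.2]
  refine finsum_mem_congr rfl fun p' hp' => ?_
  congr 2
  ext x
  constructor
  · rintro ⟨⟨h1, -⟩, h2⟩
    exact ⟨h1, h2⟩
  · rintro ⟨h1, rfl⟩
    exact ⟨⟨h1, hp'⟩, rfl⟩

/-! ### Pairs with a central member -/

section

variable {d : ℕ}

theorem orbitCount_flip {Q : Set (ℤ × ℤ)} (hQ : ShiftInv (2 * d + 2) Q) :
    orbitCount (2 * d + 2) {p | (-p.2, -p.1) ∈ Q} = orbitCount (2 * d + 2) Q := by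
  -- The flip carries the window `0 ≤ x < 2 * d + 2` to `-(2 * d + 1) ≤ y ≤ 0`, hence the offset `2
  -- * d + 1`.
  rw [orbitCount_eq (by positivity) hQ (fun p => p.2 + (2 * d + 1)) (n := 2 * d + 2) (by positivity)
    (fun x y => by ring)]
  refine Set.ncard_congr (fun p _ => (-p.2, -p.1)) ?_ ?_ ?_
  · rintro ⟨x, y⟩ ⟨h1, h2, h3⟩
    exact ⟨h1, by simp only at *; omega, by simp only at *; omega⟩
  · rintro ⟨x, y⟩ ⟨x', y'⟩ _ _ h
    simp only [Prod.mk.injEq, neg_inj] at h ⊢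
    exact h.symm
  · rintro ⟨x, y⟩ ⟨h1, h2, h3⟩
    exact ⟨(-y, -x), ⟨by simpa using h1, by simp only at *; omega, by simp only at *; omega⟩,
      by simp⟩

/-- Twice the number of orbits of `Q`, corrected for pairs with a central member. -/
theorem orbitCount_add_noncentral {Q : Set (ℤ × ℤ)} (hQ : ShiftInv (2 * d + 2) Q)
    (hflip : ∀ x y, (x, y) ∈ Q → (-y, -x) ∈ Q)
    (hcent : ∀ x y, (x, y) ∈ Q → (d : ℤ) + 1 ∣ x → ¬ (d : ℤ) + 1 ∣ y)
    (hfin : {p | p ∈ Q ∧ 0 ≤ p.1 ∧ p.1 < 2 * (d : ℤ) + 2}.Finite) :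
    (orbitCount (2 * d + 2) Q + orbitCount (2 * d + 2) (Q ∩ noncentral d) : ℤ) =
      2 * orbitCount (2 * d + 2) Q -
        2 * ({y | (0, y) ∈ Q}.ncard + {y | ((d : ℤ) + 1, y) ∈ Q}.ncard) := by
  set Q1 : Set (ℤ × ℤ) := {p | p ∈ Q ∧ (d : ℤ) + 1 ∣ p.1} with hQ1
  set Q2 : Set (ℤ × ℤ) := {p | p ∈ Q ∧ (d : ℤ) + 1 ∣ p.2} with hQ2
  have hsub : ∀ Z : Set (ℤ × ℤ), Z ⊆ Q →
      {p | p ∈ Z ∧ 0 ≤ p.1 ∧ p.1 < 2 * (d : ℤ) + 2}.Finite := fun Z hZ =>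
    hfin.subset fun p hp => ⟨hZ hp.1, hp.2⟩
  have hunion : ∀ Z Z' : Set (ℤ × ℤ), Z ⊆ Q → Z' ⊆ Q → Disjoint Z Z' →
      orbitCount (2 * d + 2) (Z ∪ Z') = orbitCount (2 * d + 2) Z + orbitCount (2 * d + 2) Z' := by
    intro Z Z' hZ hZ' hdis
    rw [orbitCount, orbitCount, orbitCount, ← Set.ncard_union_eq ?_ (hsub Z hZ) (hsub Z' hZ')]
    · congr 1
      ext p
      simp only [Set.mem_union, Set.mem_ofPred_eq, or_and_right]
    · exact hdis.mono (fun _ h => h.1) (fun _ h => h.1)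
  -- No pair has two central members, so the pairs that are lost in `Q ∩ noncentral d` split into
  -- `Q1` and `Q2`. The flip exchanges these, which accounts for the factor `2`.
  have e1 : Q = (Q ∩ noncentral d) ∪ (Q1 ∪ Q2) := by
    ext p
    simp only [Set.mem_union, Set.mem_inter_iff, noncentral, Set.mem_ofPred_eq, hQ1, hQ2]
    tauto
  have h12 : Disjoint Q1 Q2 := Set.disjoint_left.2 fun p h h' => hcent p.1 p.2 h.1 h.2 h'.2
  have h3 : Disjoint (Q ∩ noncentral d) (Q1 ∪ Q2) := by
    rw [Set.disjoint_left]
    rintro p ⟨-, hp⟩ (h | h)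
    · exact hp.1 h.2
    · exact hp.2 h.2
  have c1 := hunion (Q ∩ noncentral d) (Q1 ∪ Q2) Set.inter_subset_left
    (Set.union_subset (fun _ h => h.1) fun _ h => h.1) h3
  rw [← e1, hunion Q1 Q2 (fun _ h => h.1) (fun _ h => h.1) h12] at c1
  have hQ1s : ShiftInv (2 * d + 2) Q1 := fun x y => by
    simp only [hQ1, Set.mem_ofPred_eq, central_add, hQ x y]
  have c2 : orbitCount (2 * d + 2) Q2 = orbitCount (2 * d + 2) Q1 := by
    rw [← orbitCount_flip hQ1s]
    congr 1
    ext ⟨x, y⟩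
    simp only [hQ1, hQ2, Set.mem_ofPred_eq, dvd_neg]
    refine and_congr_left fun _ => ⟨hflip x y, fun h => ?_⟩
    simpa using hflip _ _ h
  -- One window contains just two central points, `0` and `d + 1`.
  have c3 : orbitCount (2 * d + 2) Q1 =
      {y | (0, y) ∈ Q}.ncard + {y | ((d : ℤ) + 1, y) ∈ Q}.ncard := by
    have i0 : Function.Injective (Prod.mk (0 : ℤ) : ℤ → ℤ × ℤ) := fun _ _ h => by simpa using h
    have i1 : Function.Injective (Prod.mk ((d : ℤ) + 1) : ℤ → ℤ × ℤ) := fun _ _ h => by simpa using h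
    have e : {p | p ∈ Q1 ∧ 0 ≤ p.1 ∧ p.1 < 2 * (d : ℤ) + 2} =
        Prod.mk 0 '' {y | (0, y) ∈ Q} ∪ Prod.mk ((d : ℤ) + 1) '' {y | ((d : ℤ) + 1, y) ∈ Q} := by
      ext ⟨x, y⟩
      simp only [Set.mem_union, Set.mem_image, Set.mem_ofPred_eq, Prod.mk.injEq, hQ1]
      constructor
      · rintro ⟨⟨h, hx⟩, h0, h1⟩
        rcases mul_central_eq (by positivity) hx h0 (by omega) with rfl | rfl | hx'
        · exact Or.inl ⟨y, h, rfl, rfl⟩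
        · exact Or.inr ⟨y, h, rfl, rfl⟩
        · omega
      · rintro (⟨y', h, rfl, rfl⟩ | ⟨y', h, rfl, rfl⟩)
        · exact ⟨⟨h, dvd_zero _⟩, le_rfl, by positivity⟩
        · exact ⟨⟨h, dvd_refl _⟩, by positivity, by omega⟩
    have hf := hsub Q1 fun _ h => h.1
    rw [e] at hf
    rw [orbitCount, e, Set.ncard_union_eq ?_ (hf.subset Set.subset_union_left)
      (hf.subset Set.subset_union_right), Set.ncard_image_of_injective _ i0,
      Set.ncard_image_of_injective _ i1]
    rw [Set.disjoint_left]
    rintro _ ⟨y, -, rfl⟩ ⟨y', -, h⟩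
    simp only [Prod.mk.injEq] at h
    omega
  omega

end

/-! ### Length of minimal double coset representatives -/

/-- The sum of the entries of `M` strictly below and strictly to the left of `p`. -/
noncomputable def cornerSum (M : ℤ → ℤ → ℤ) (p : ℤ × ℤ) : ℤ :=
  ∑ᶠ p' ∈ {p' : ℤ × ℤ | p.1 < p'.1 ∧ p'.2 < p.2}, M p'.1 p'.2

/-- The number of inversions, up to translation, of a minimal double coset representative with
matrix `M`. -/
noncomputable def cornerCount (n' : ℤ) (M : ℤ → ℤ → ℤ) : ℤ :=
  ∑ᶠ p ∈ {p : ℤ × ℤ | 0 ≤ p.1 ∧ p.1 < n'}, M p.1 p.2 * cornerSum M p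

/-- The sum of the entries of `M` strictly above row `s` and strictly to the right of column `t`. -/
noncomputable def centSum (M : ℤ → ℤ → ℤ) (s t : ℤ) : ℤ :=
  ∑ᶠ p ∈ {p : ℤ × ℤ | p.1 < s ∧ t < p.2}, M p.1 p.2

section

variable {r' r d : ℕ} {a c : ℕ → ℤ} {g : Equiv.Perm ℤ}

theorem IsComp.blockIdx_zero (hc : IsComp r d c) : blockIdx r d c 0 = 0 := by
  rw [blockIdx_of_le le_rfl (by omega), hc.wallCount_of_nonpos le_rfl]

theorem IsComp.blockIdx_mid (hc : IsComp r d c) : blockIdx r d c (d + 1) = r + 1 := by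
  rw [blockIdx_of_le (by omega) le_rfl, hc.wallCount_of_gt (by omega)]

theorem IsComp.exists_lower (hc : IsComp r d c) (i : ℤ) :
    ∃ b, ∀ x, i < blockIdx r d c x → b < x := by
  refine ⟨-|i| * (2 * d + 2), fun x hx => ?_⟩
  by_contra hcon
  have h := hc.blockIdx_mono (not_lt.1 hcon)
  have h2 := blockIdx_add_mul r d c 0 (-|i|)
  rw [zero_add, hc.blockIdx_zero, zero_add] at h2
  have := neg_abs_le i
  have : 0 ≤ |i| := abs_nonneg i
  nlinarith

theorem IsComp.exists_upper (hc : IsComp r d c) (i : ℤ) :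
    ∃ b, ∀ x, blockIdx r d c x < i → x < b := by
  obtain ⟨b, hb⟩ := hc.exists_lower (-i)
  refine ⟨-b, fun x hx => ?_⟩
  have := hb (-x) (by rw [hc.blockIdx_neg]; omega)
  omega

theorem finite_corner (ha : IsComp r' d a) (hc : IsComp r d c) (hg : g ∈ weyl d) (i j : ℤ) :
    {x | i < blockIdx r' d a (g x) ∧ blockIdx r d c x < j}.Finite := by
  obtain ⟨b, hb⟩ := ha.exists_lower i
  obtain ⟨b', hb'⟩ := hc.exists_upper j
  obtain ⟨M, hM⟩ := weyl_bounded hg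
  refine (Set.finite_Icc (b - M) b').subset fun x hx => ?_
  have h1 := hb _ hx.1
  have h2 := hb' _ hx.2
  have := abs_le.1 (hM x)
  rw [Set.mem_Icc]
  omega

theorem finite_corner' (ha : IsComp r' d a) (hc : IsComp r d c) (hg : g ∈ weyl d) (i j : ℤ) :
    {x | blockIdx r' d a (g x) < i ∧ j < blockIdx r d c x}.Finite := by
  obtain ⟨b, hb⟩ := ha.exists_upper i
  obtain ⟨b', hb'⟩ := hc.exists_lower j
  obtain ⟨M, hM⟩ := weyl_bounded hg
  refine (Set.finite_Icc b' (b + M)).subset fun x hx => ?_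
  have h1 := hb _ hx.1
  have h2 := hb' _ hx.2
  have := abs_le.1 (hM x)
  rw [Set.mem_Icc]
  omega

theorem finite_rowWindow (r' d : ℕ) (a : ℕ → ℤ) (g : Equiv.Perm ℤ) (i j : ℤ) :
    {y | i ≤ blockIdx r' d a (g y) ∧ blockIdx r' d a (g y) < j}.Finite :=
  (blockIdx_finite r' d a i j).preimage g.injective.injOn

/-- Monotonicity of `g` on source blocks and of `g⁻¹` on target blocks excludes inversions inside a
block on either side. Between different blocks the order of points is the order of blocks. -/
theorem inversions_eq_of_blockMono (ha : IsComp r' d a) (hc : IsComp r d c)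
    (h1 : BlockMono (blockIdx r d c) g) (h2 : BlockMono (blockIdx r' d a) g⁻¹) :
    inversions g = {p | blockIdx r d c p.1 < blockIdx r d c p.2 ∧
      blockIdx r' d a (g p.2) < blockIdx r' d a (g p.1)} := by
  ext ⟨x, y⟩
  simp only [inversions, Set.mem_ofPred_eq]
  constructor
  · rintro ⟨hxy, hg⟩
    refine ⟨(hc.blockIdx_mono hxy.le).lt_of_ne fun h => ?_,
      (ha.blockIdx_mono hg.le).lt_of_ne fun h => ?_⟩
    · exact lt_asymm hg (h1 _ _ h hxy)
    · have := h2 _ _ h hg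
      rw [perm_inv_apply, perm_inv_apply] at this
      exact lt_asymm hxy this
  · rintro ⟨hxy, hg⟩
    constructor
    · by_contra hcon
      exact hxy.not_ge (hc.blockIdx_mono (not_lt.1 hcon))
    · by_contra hcon
      exact hg.not_ge (ha.blockIdx_mono (not_lt.1 hcon))

theorem inversions_flip (hg : g ∈ weyl d) (x y : ℤ) (h : (x, y) ∈ inversions g) :
    (-y, -x) ∈ inversions g := by
  simp only [inversions, Set.mem_ofPred_eq, weyl_neg hg] at h ⊢
  omega

theorem inversions_central (hg : g ∈ weyl d) (x y : ℤ) (h : (x, y) ∈ inversions g)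
    (hx : (d : ℤ) + 1 ∣ x) : ¬ (d : ℤ) + 1 ∣ y := fun hy => by
  simp only [inversions, Set.mem_ofPred_eq, weyl_central hg hx, weyl_central hg hy] at h
  omega

theorem fourLen_eq_orbitCount (hg : g ∈ weyl d) : (fourLen d g : ℤ) =
    2 * orbitCount (2 * d + 2) (inversions g) -
      2 * ({y | (0, y) ∈ inversions g}.ncard + {y | ((d : ℤ) + 1, y) ∈ inversions g}.ncard) := by
  rw [← orbitCount_add_noncentral (shiftInv_inversions hg) (inversions_flip hg)
    (inversions_central hg) (finite_window_inversions hg), fourLen, invCount, invCount,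
    Set.inter_univ]
  push_cast
  rfl

/-- Inversions now correspond to pairs of points in cells of which one lies strictly below and to
the left of the other, so their number depends only on the matrix; the window is taken along the row
of the second point. The corrections count inversions starting at `0` and `d + 1`. These points are
fixed and lie in blocks `0` and, on the two sides, `r' + 1` and `r + 1`. -/
theorem fourLen_of_blockMono (ha : IsComp r' d a) (hc : IsComp r d c) (hg : g ∈ weyl d)
    (h1 : BlockMono (blockIdx r d c) g) (h2 : BlockMono (blockIdx r' d a) g⁻¹) :
    (fourLen d g : ℤ) =
      2 * cornerCount (2 * r' + 2) (cell (blockIdx r' d a) (blockIdx r d c) g) -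
      2 * (centSum (cell (blockIdx r' d a) (blockIdx r d c) g) 0 0 +
        centSum (cell (blockIdx r' d a) (blockIdx r d c) g) (r' + 1) (r + 1)) := by
  set β := blockIdx r' d a with hβ
  set γ := blockIdx r d c with hγ
  have hinv : inversions g = {p | γ p.1 < γ p.2 ∧ β (g p.2) < β (g p.1)} :=
    inversions_eq_of_blockMono ha hc h1 h2
  have hcell : ∀ p : ℤ × ℤ, ({y | (β (g y), γ y) = p}.ncard : ℤ) = cell β γ g p.1 p.2 := by
    rintro ⟨i, j⟩
    simp only [Prod.mk.injEq, cell]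
  have hcent : ∀ s t : ℤ, ({y | β (g y) < s ∧ t < γ y}.ncard : ℤ) = centSum (cell β γ g) s t := by
    intro s t
    rw [ncard_label (finite_corner' ha hc hg s t) (fun y => (β (g y), γ y))
      (P := {p | p.1 < s ∧ t < p.2}) fun y hy => hy, centSum]
    refine finsum_mem_congr rfl fun p hp => ?_
    rw [← hcell]
    congr 2
    ext y
    constructor
    · exact fun h => h.2
    · rintro rfl
      exact ⟨hp, rfl⟩
  rw [fourLen_eq_orbitCount hg]
  congr 2
  · rw [orbitCount_eq (by positivity) (shiftInv_inversions hg) (fun p => β (g p.2))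
      (n := 2 * r' + 2) (by positivity) fun x y => by rw [weyl_add hg, hβ, blockIdx_add]]
    have e : {p | p ∈ inversions g ∧ 0 ≤ β (g p.2) ∧ β (g p.2) < 2 * r' + 2} =
        {p : ℤ × ℤ | p.2 ∈ {y | 0 ≤ β (g y) ∧ β (g y) < 2 * r' + 2} ∧ p.1 ∈ Set.univ ∧
          (fun q q' : ℤ × ℤ => q.1 < q'.1 ∧ q'.2 < q.2) (β (g p.2), γ p.2) (β (g p.1), γ p.1)} := by
      rw [hinv]
      ext p
      simp only [Set.mem_ofPred_eq, Set.mem_univ, true_and]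
      tauto
    have key := ncard_pairs_label (Y := {y | 0 ≤ β (g y) ∧ β (g y) < 2 * r' + 2})
      (X := Set.univ) (fun y => (β (g y), γ y)) (fun y => (β (g y), γ y))
      (R := fun q q' : ℤ × ℤ => q.1 < q'.1 ∧ q'.2 < q.2)
      (P := {p : ℤ × ℤ | 0 ≤ p.1 ∧ p.1 < 2 * r' + 2}) (fun y hy => hy)
      (finite_rowWindow r' d a g _ _)
      (fun y _ => (finite_corner ha hc hg _ _).subset fun x hx => hx.2)
    rw [e]
    refine key.trans ?_
    refine finsum_mem_congr rfl fun p hp => ?_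
    congr 1
    · rw [← hcell]
      congr 2
      ext y
      constructor
      · exact fun h => h.2
      · rintro rfl
        exact ⟨hp, rfl⟩
    · refine finsum_mem_congr rfl fun p' _ => ?_
      rw [← hcell]
      simp
  · have g0 := weyl_zero hg
    have gm := weyl_mid hg
    have a0 : β 0 = 0 := ha.blockIdx_zero
    have am : β (d + 1) = r' + 1 := ha.blockIdx_mid
    have c0 : γ 0 = 0 := hc.blockIdx_zero
    have cm : γ (d + 1) = r + 1 := hc.blockIdx_mid
    rw [← hcent, ← hcent, hinv]
    simp only [Set.mem_ofPred_eq, g0, gm, a0, am, c0, cm, and_comm]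

end

end AffineC

/-! ### Periodic matrices, their compositions and their representatives -/

namespace AffineC

/-! ### Finite sums over rows -/

theorem finsum_mem_row (G : ℤ × ℤ → ℤ) (i : ℤ) :
    ∑ᶠ p ∈ {p : ℤ × ℤ | p.1 = i}, G p = ∑ᶠ j, G (i, j) := by
  rw [← finsum_mem_univ (f := fun j => G (i, j))]
  symm
  refine finsum_mem_eq_of_bijOn (fun j => (i, j)) ⟨fun _ _ => rfl, fun _ _ _ _ h => by simpa using h,
    ?_⟩ fun _ _ => rfl
  rintro ⟨i', j⟩ (rfl : i' = i)
  exact ⟨j, Set.mem_univ _, rfl⟩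

theorem finsum_mem_rows {G : ℤ × ℤ → ℤ} (hG : ∀ i, {j | G (i, j) ≠ 0}.Finite) (I : Finset ℤ) :
    {p : ℤ × ℤ | p.1 ∈ I ∧ G p ≠ 0}.Finite ∧
      ∑ᶠ p ∈ {p : ℤ × ℤ | p.1 ∈ I}, G p = ∑ i ∈ I, ∑ᶠ j, G (i, j) := by
  classical
  have h1 : ∀ i, {p : ℤ × ℤ | p.1 = i ∧ G p ≠ 0}.Finite := fun i => by
    refine ((hG i).image fun j => (i, j)).subset ?_
    rintro ⟨i', j⟩ ⟨rfl, h⟩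
    exact ⟨j, h, rfl⟩
  induction I using Finset.induction with
  | empty => simp
  | insert i I hi ih =>
    have e : {p : ℤ × ℤ | p.1 ∈ insert i I} = {p | p.1 = i} ∪ {p | p.1 ∈ I} := by
      ext p
      simp [Finset.mem_insert]
    constructor
    · refine ((h1 i).union ih.1).subset ?_
      rintro p ⟨hp, hp'⟩
      rcases Finset.mem_insert.1 hp with h | h
      · exact Or.inl ⟨h, hp'⟩
      · exact Or.inr ⟨h, hp'⟩
    · have hdis : Disjoint {p : ℤ × ℤ | p.1 = i} {p | p.1 ∈ I} := by
        rw [Set.disjoint_left]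
        rintro p (rfl : p.1 = i) h
        exact hi h
      have hu := finsum_mem_union' (f := G) hdis (h1 i) ih.1
      rw [e]
      exact hu.trans (by rw [ih.2, finsum_mem_row, Finset.sum_insert hi])

theorem finsum_window_rows {G : ℤ × ℤ → ℤ} (hG : ∀ i, {j | G (i, j) ≠ 0}.Finite) (n : ℤ) :
    ∑ᶠ p ∈ {p : ℤ × ℤ | 0 ≤ p.1 ∧ p.1 < n}, G p = ∑ i ∈ Finset.Ico 0 n, ∑ᶠ j, G (i, j) := by
  rw [← (finsum_mem_rows hG _).2]
  simp only [Finset.mem_Ico]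

theorem sum_Ico_shift {n : ℤ} (hn : 0 < n) {f : ℤ → ℤ} (hf : ∀ i, f (i + n) = f i) (k : ℤ) :
    ∑ i ∈ Finset.Ico k (k + n), f i = ∑ i ∈ Finset.Ico 0 n, f i := by
  have h := finsum_window (Equiv.addRight n) f hf (fun i => i - k) (fun i => i) hn hn
    (fun i => by simp only [Equiv.coe_addRight]; ring) (fun i => rfl)
  rw [← finsum_mem_coe_finset, ← finsum_mem_coe_finset]
  have e1 : ((Finset.Ico k (k + n) : Finset ℤ) : Set ℤ) = {p | 0 ≤ p - k ∧ p - k < n} := by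
    ext i
    simp only [Finset.coe_Ico, Set.mem_Ico, Set.mem_ofPred_eq]
    omega
  have e2 : ((Finset.Ico 0 n : Finset ℤ) : Set ℤ) = {p | 0 ≤ p ∧ p < n} := by
    ext i
    simp only [Finset.coe_Ico, Set.mem_Ico, Set.mem_ofPred_eq]
  rw [e1, e2]
  exact h

theorem sum_Icc_period {n : ℤ} (hn : 0 < n) {f : ℤ → ℤ} (hf : ∀ i, f (i + n) = f i) :
    ∑ i ∈ Finset.Icc 1 n, f i = ∑ i ∈ Finset.Ico 0 n, f i := by
  rw [← sum_Ico_shift hn hf 1]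
  congr 1
  ext i
  simp only [Finset.mem_Icc, Finset.mem_Ico]
  omega

/-- Sums of even periodic functions over a period. -/
theorem sum_period_even (r : ℕ) {f : ℤ → ℤ} (hf : ∀ i, f (i + (2 * r + 2)) = f i)
    (hf' : ∀ i, f (-i) = f i) : ∑ i ∈ Finset.Ico 0 (2 * r + 2 : ℤ), f i =
      f 0 + f (r + 1) + 2 * ∑ i ∈ Finset.Icc (1 : ℤ) r, f i := by
  have e : Finset.Ico 0 (2 * r + 2 : ℤ) = insert 0 (insert ((r : ℤ) + 1)
      (Finset.Icc 1 (r : ℤ) ∪ Finset.Icc ((r : ℤ) + 2) (2 * r + 1))) := by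
    ext i
    simp only [Finset.mem_Ico, Finset.mem_insert, Finset.mem_union, Finset.mem_Icc]
    omega
  rw [e, Finset.sum_insert, Finset.sum_insert, Finset.sum_union]
  · have : ∑ i ∈ Finset.Icc ((r : ℤ) + 2) (2 * r + 1), f i = ∑ i ∈ Finset.Icc (1 : ℤ) r, f i := by
      refine Finset.sum_nbij' (fun i => 2 * r + 2 - i) (fun i => 2 * r + 2 - i) ?_ ?_ ?_ ?_ ?_
      · intro i hi; simp only [Finset.mem_Icc] at *; omega
      · intro i hi; simp only [Finset.mem_Icc] at *; omega
      · intro i _; ring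
      · intro i _; ring
      · intro i _
        rw [← hf', ← hf, show -i + (2 * (r : ℤ) + 2) = 2 * r + 2 - i by ring]
    rw [this]; ring
  · rw [Finset.disjoint_left]
    intro i h1 h2
    simp only [Finset.mem_Icc] at *
    omega
  · simp only [Finset.mem_union, Finset.mem_Icc]; omega
  · simp only [Finset.mem_insert, Finset.mem_union, Finset.mem_Icc]; omega

/-! ### Periodic matrices -/

section

variable {r d : ℕ} {A T : ℤ → ℤ → ℤ}

theorem periodic_mul {n : ℤ} {M : ℤ → ℤ → ℤ} (hM : ∀ i j, M (i + n) (j + n) = M i j) (k i j : ℤ) :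
    M (i + k * n) (j + k * n) = M i j := by
  induction k using Int.induction_on generalizing i j with
  | zero => simp
  | succ k ih =>
    rw [show i + ((k : ℤ) + 1) * n = i + k * n + n by ring,
      show j + ((k : ℤ) + 1) * n = j + k * n + n by ring, hM, ih]
  | pred k ih =>
    rw [← hM, show i + (-(k : ℤ) - 1) * n + n = i + -k * n by ring,
      show j + (-(k : ℤ) - 1) * n + n = j + -k * n by ring, ih]

/-- The finitely many nonzero entries in one period of rows bound the distance from the diagonal,
and periodicity transports the bound. In particular columns are finite too. -/
theorem exists_band {n : ℤ} (hn : 0 < n) {M : ℤ → ℤ → ℤ}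
    (hM : ∀ i j, M (i + n) (j + n) = M i j) (hfin : ∀ i, {j | M i j ≠ 0}.Finite) :
    ∃ m : ℤ, ∀ i j, M i j ≠ 0 → |i - j| ≤ m := by
  have h1 := (finsum_mem_rows (G := fun p => M p.1 p.2) hfin (Finset.Ico 0 n)).1
  obtain ⟨m, hm⟩ := (h1.image fun p => |p.1 - p.2|).bddAbove
  refine ⟨m, fun i j hij => ?_⟩
  obtain ⟨k, i, rfl, h0, h2⟩ := exists_window n hn i
  obtain ⟨j, rfl⟩ : ∃ j', j = j' + k * n := ⟨j - k * n, by ring⟩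
  rw [periodic_mul hM] at hij
  have := hm ⟨(i, j), ⟨Finset.mem_Ico.2 ⟨h0, h2⟩, hij⟩, rfl⟩
  rw [add_sub_add_right_eq_sub]
  exact this

theorem finite_of_band {M : ℤ → ℤ → ℤ} {m : ℤ} (hm : ∀ i j, M i j ≠ 0 → |i - j| ≤ m) :
    (∀ i, {j | M i j ≠ 0}.Finite) ∧ ∀ j, {i | M i j ≠ 0}.Finite := by
  constructor
  · intro i
    refine (Set.finite_Icc (i - m) (i + m)).subset fun j hj => ?_
    have := abs_le.1 (hm i j hj)
    rw [Set.mem_Icc]; omega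
  · intro j
    refine (Set.finite_Icc (j - m) (j + m)).subset fun i hi => ?_
    have := abs_le.1 (hm i j hi)
    rw [Set.mem_Icc]; omega

theorem IsTheta.band (hT : IsTheta r T) : ∃ m : ℤ, ∀ i j, T i j ≠ 0 → |i - j| ≤ m :=
  exists_band (by positivity) hT.periodic hT.finite_row

theorem IsTheta.finite_col (hT : IsTheta r T) (j : ℤ) : {i | T i j ≠ 0}.Finite :=
  (finite_of_band hT.band.choose_spec).2 j

theorem IsXi.isCellMatrix (hA : IsXi r d A) : IsCellMatrix (2 * r + 2) (2 * r + 2) A :=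
  ⟨hA.nonneg, hA.periodic, hA.symm, hA.finite_row, hA.toIsTheta.finite_col⟩

theorem rowSum_add {n' n : ℤ} (hT : ∀ i j, T (i + n') (j + n) = T i j) (i : ℤ) :
    rowSum T (i + n') = rowSum T i := by
  rw [rowSum, rowSum, ← finsum_comp_equiv (Equiv.addRight n)]
  exact finsum_congr fun j => hT i j

theorem rowSum_neg (hT : ∀ i j, T (-i) (-j) = T i j) (i : ℤ) : rowSum T (-i) = rowSum T i := by
  rw [rowSum, rowSum, ← finsum_comp_equiv (Equiv.neg ℤ)]
  exact finsum_congr fun j => hT i j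

/-- Both sides add one entry from each orbit under simultaneous translation, once with a window of
rows and once with a window of columns. -/
theorem sum_rowSum_eq_sum_colSum {n : ℤ} (hn : 0 < n) {M : ℤ → ℤ → ℤ}
    (hM : ∀ i j, M (i + n) (j + n) = M i j) (hfin : ∀ i, {j | M i j ≠ 0}.Finite) :
    ∑ i ∈ Finset.Ico 0 n, rowSum M i = ∑ j ∈ Finset.Ico 0 n, rowSum (fun j i => M i j) j := by
  obtain ⟨m, hm⟩ := exists_band hn hM hfin
  have h1 := finsum_window_rows (G := fun p => M p.1 p.2) hfin n
  have h2 := finsum_window_rows (G := fun p => M p.2 p.1) (finite_of_band hm).2 n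
  have h3 := finsum_window (shiftPair n) (fun p => M p.1 p.2) (fun p => hM p.1 p.2)
    (fun p => p.1) (fun p => p.2) hn hn (fun _ => rfl) (fun _ => rfl)
  simp only [rowSum]
  rw [← h1, ← h2, h3]
  refine finsum_mem_eq_of_bijOn Prod.swap ⟨fun p hp => hp, fun _ _ _ _ h => Prod.swap_injective h,
    fun p hp => ⟨p.swap, hp, by simp⟩⟩ fun _ _ => rfl

theorem IsXi.transpose (hA : IsXi r d A) : IsXi r d fun i j => A j i where
  nonneg i j := hA.nonneg j i
  periodic i j := hA.periodic j i
  finite_row i := hA.toIsTheta.finite_col i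
  symm i j := hA.symm j i
  odd_zero := hA.odd_zero
  odd_last := hA.odd_last
  total := by
    have hn : (0 : ℤ) < 2 * r + 2 := by positivity
    rw [sum_Icc_period hn (rowSum_add fun i j => hA.periodic j i),
      ← sum_rowSum_eq_sum_colSum hn hA.periodic hA.finite_row,
      ← sum_Icc_period hn (rowSum_add hA.periodic), hA.total]

theorem finsum_eq_center_add {m : ℤ → ℤ} (hm : {j | m j ≠ 0}.Finite) (e : ℤ)
    (hs : ∀ j, m (2 * e - j) = m j) :
    ∑ᶠ j, m j = m e + 2 * ∑ᶠ j ∈ Set.Ioi e, m j ∧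
      ∑ᶠ j ∈ Set.Iio e, m j = ∑ᶠ j ∈ Set.Ioi e, m j := by
  have h1 : ∑ᶠ j ∈ Set.Iio e, m j = ∑ᶠ j ∈ Set.Ioi e, m j := by
    refine finsum_mem_eq_of_bijOn (fun j => 2 * e - j) ⟨?_, ?_, ?_⟩ fun j _ => (hs j).symm
    · intro j hj; simp only [Set.mem_Iio, Set.mem_Ioi] at *; omega
    · intro j _ j' _ h; simpa using h
    · intro j hj; exact ⟨2 * e - j, by simp only [Set.mem_Iio, Set.mem_Ioi] at *; omega, by simp⟩
  refine ⟨?_, h1⟩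
  have hf : ∀ s : Set ℤ, (s ∩ Function.support m).Finite := fun s => hm.subset fun x hx => hx.2
  have h2 : ∑ᶠ j, m j = ∑ᶠ j ∈ insert e (Set.Iio e ∪ Set.Ioi e), m j := by
    have : insert e (Set.Iio e ∪ Set.Ioi e) = Set.univ := by
      ext j; simp only [Set.mem_insert_iff, Set.mem_union, Set.mem_Iio, Set.mem_Ioi, Set.mem_univ,
        iff_true]; omega
    rw [this]; simp
  rw [h2, finsum_mem_insert' _ (by simp) (hf _), finsum_mem_union' ?_ (hf _) (hf _), h1]
  · ring
  · rw [Set.disjoint_left]; intro j h h'; simp only [Set.mem_Iio, Set.mem_Ioi] at *; omega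

theorem IsXi.two_mul_entry_zero (hA : IsXi r d A) : 2 * entry r A 0 0 + 1 = A 0 0 := by
  have h : entry r A 0 0 = (A 0 0 - 1) / 2 := if_pos ⟨rfl, Or.inl (dvd_zero _)⟩
  obtain ⟨k, hk⟩ := hA.odd_zero
  omega

theorem IsXi.two_mul_entry_last (hA : IsXi r d A) :
    2 * entry r A (r + 1) (r + 1) + 1 = A (r + 1) (r + 1) := by
  have h : entry r A (r + 1) (r + 1) = (A (r + 1) (r + 1) - 1) / 2 :=
    if_pos ⟨rfl, Or.inr (by simp)⟩
  obtain ⟨k, hk⟩ := hA.odd_last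
  omega

theorem IsXi.symm_last (hA : ∀ i j, A (i + (2 * r + 2)) (j + (2 * r + 2)) = A i j)
    (hA' : ∀ i j, A (-i) (-j) = A i j) (j : ℤ) : A (r + 1) (2 * (r + 1) - j) = A (r + 1) j := by
  rw [← hA' (r + 1) j, ← hA (-(r + 1)) (-j)]
  congr 1 <;> ring

/-- Rows `0` and `r + 1` are symmetric about an odd diagonal entry, which makes the full row sum `2
λ + 1`: the size of a symmetric interval `R_0` or `R_{r+1}`. -/
theorem IsXi.rowSum_base (hA : IsXi r d A) {k : ℕ} (hk : k ≤ r + 1) :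
    rowSum A k = if k = 0 ∨ k = r + 1 then 2 * rowC r A k + 1 else rowC r A k := by
  rw [rowC]
  by_cases h0 : k = 0
  · subst h0
    have h := (finsum_eq_center_add (hA.finite_row 0) 0 fun j => by
      rw [← hA.symm]; simp).1
    have h2 := hA.two_mul_entry_zero
    have e : Set.Ici (1 : ℤ) = Set.Ioi 0 := rfl
    rw [if_pos (Or.inl rfl), if_pos rfl, e]
    simp only [rowSum, Nat.cast_zero]
    linarith
  by_cases h1 : k = r + 1
  · subst h1
    have h := finsum_eq_center_add (hA.finite_row (r + 1)) (r + 1)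
      (IsXi.symm_last hA.periodic hA.symm)
    have h2 := hA.two_mul_entry_last
    have e : Set.Iic (r : ℤ) = Set.Iio ((r : ℤ) + 1) := by ext; simp
    rw [if_pos (Or.inr rfl), if_neg h0, if_pos rfl, e, h.2]
    simp only [rowSum, Nat.cast_add, Nat.cast_one]
    linarith [h.1]
  · rw [if_neg (by tauto), if_neg h0, if_neg h1, if_pos (by omega)]

theorem rowSum_nonneg (hT : ∀ i j, 0 ≤ T i j) (i : ℤ) : 0 ≤ rowSum T i := finsum_nonneg fun j => hT i j

theorem sum_range_comp (r : ℕ) (f : ℤ → ℤ) :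
    ∑ k ∈ Finset.range (r + 2), f k = f 0 + f (r + 1) + ∑ i ∈ Finset.Icc (1 : ℤ) r, f i := by
  rw [Finset.sum_range_succ, Finset.sum_range_succ']
  have : ∑ i ∈ Finset.Icc (1 : ℤ) r, f i = ∑ k ∈ Finset.range r, f ((k + 1 : ℕ) : ℤ) := by
    symm
    refine Finset.sum_bij (fun k _ => ((k + 1 : ℕ) : ℤ)) ?_ ?_ ?_ ?_
    · intro k hk; simp only [Finset.mem_range, Finset.mem_Icc] at *; omega
    · intro k _ k' _ h; simpa using h
    · intro i hi
      rw [Finset.mem_Icc] at hi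
      exact ⟨(i - 1).toNat, by rw [Finset.mem_range]; omega, by omega⟩
    · intro _ _; rfl
  rw [this]
  push_cast
  ring

/-- A sequence is a composition as soon as it describes the row sums of a suitable matrix. -/
theorem isComp_of_even {f : ℤ → ℤ} {c : ℕ → ℤ} (hf : ∀ i, f (i + (2 * r + 2)) = f i)
    (hf' : ∀ i, f (-i) = f i)
    (hb : ∀ k ≤ r + 1, f k = if k = 0 ∨ k = r + 1 then 2 * c k + 1 else c k)
    (h0 : ∀ k ≤ r + 1, 0 ≤ c k) (htot : ∑ i ∈ Finset.Ico 0 (2 * r + 2 : ℤ), f i = 2 * d + 2) :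
    IsComp r d c := by
  refine ⟨h0, ?_⟩
  rw [sum_period_even r hf hf'] at htot
  have h1 := sum_range_comp r (fun i => c i.toNat)
  simp only [Int.toNat_natCast] at h1
  rw [h1]
  have h2 := hb 0 (by omega)
  have h3 := hb (r + 1) le_rfl
  have h4 : ∑ i ∈ Finset.Icc (1 : ℤ) r, f i = ∑ i ∈ Finset.Icc (1 : ℤ) r, c i.toNat := by
    refine Finset.sum_congr rfl fun i hi => ?_
    rw [Finset.mem_Icc] at hi
    obtain ⟨k, rfl⟩ := Int.eq_ofNat_of_zero_le (show 0 ≤ i by omega)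
    have := hb k (by omega)
    rw [if_neg (by omega)] at this
    exact this
  simp only [true_or, or_true, if_true, Nat.cast_zero, Nat.cast_add, Nat.cast_one] at h2 h3
  rw [h4] at htot
  have e : ((r : ℤ) + 1).toNat = r + 1 := by omega
  simp only [Int.toNat_zero, e]
  omega

theorem blockSize_eq_of_even {f : ℤ → ℤ} {c : ℕ → ℤ} (hc : IsComp r d c)
    (hf : ∀ i, f (i + (2 * r + 2)) = f i) (hf' : ∀ i, f (-i) = f i)
    (hb : ∀ k ≤ r + 1, f k = if k = 0 ∨ k = r + 1 then 2 * c k + 1 else c k) (i : ℤ) :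
    blockSize r d c i = f i :=
  eq_of_base (blockSize_add r d c) hc.blockSize_neg hf hf'
    (fun k hk => by rw [hc.blockSize_base hk, hb k hk]) i

theorem IsXi.rowC_nonneg (hA : IsXi r d A) (k : ℕ) (_ : k ≤ r + 1) : 0 ≤ rowC r A k := by
  have h2 := hA.two_mul_entry_zero
  have h3 := hA.two_mul_entry_last
  have h4 := hA.nonneg 0 0
  have h5 := hA.nonneg (r + 1) (r + 1)
  rw [rowC]
  split_ifs
  · have : 0 ≤ ∑ᶠ j ∈ Set.Ici (1 : ℤ), A 0 j := finsum_nonneg fun j => finsum_nonneg fun _ => hA.nonneg _ _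
    omega
  · have : 0 ≤ ∑ᶠ j ∈ Set.Iic (r : ℤ), A (r + 1) j := finsum_nonneg fun j => finsum_nonneg fun _ => hA.nonneg _ _
    omega
  · exact rowSum_nonneg hA.nonneg _
  · exact le_rfl

theorem IsXi.isComp (hA : IsXi r d A) : IsComp r d (rowC r A) := by
  refine isComp_of_even (rowSum_add hA.periodic) (rowSum_neg hA.symm) (fun _ hk => hA.rowSum_base hk)
    hA.rowC_nonneg ?_
  rw [← sum_Icc_period (by positivity) (rowSum_add hA.periodic), hA.total]

theorem IsXi.blockSize_rowC (hA : IsXi r d A) (i : ℤ) : blockSize r d (rowC r A) i = rowSum A i :=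
  blockSize_eq_of_even hA.isComp (rowSum_add hA.periodic) (rowSum_neg hA.symm)
    (fun _ hk => hA.rowSum_base hk) i

theorem IsXi.isComp_colC (hA : IsXi r d A) : IsComp r d (colC r A) := hA.transpose.isComp

theorem IsXi.blockSize_colC (hA : IsXi r d A) (j : ℤ) :
    blockSize r d (colC r A) j = ∑ᶠ i, A i j := hA.transpose.blockSize_rowC j

end

/-! ### Minimal double coset representatives -/

section

variable {r' r d : ℕ} {a c : ℕ → ℤ} {A : ℤ → ℤ → ℤ} {g : Equiv.Perm ℤ}

theorem cell_eq_ncard (ha : IsComp r' d a) (hc : IsComp r d c) (g : Equiv.Perm ℤ) (i j : ℤ) :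
    ((block r' d a i ∩ g '' block r d c j).ncard : ℤ) =
      cell (blockIdx r' d a) (blockIdx r d c) g i j := by
  rw [cell, Nat.cast_inj]
  have : block r' d a i ∩ g '' block r d c j =
      g '' {y | blockIdx r' d a (g y) = i ∧ blockIdx r d c y = j} := by
    ext x
    constructor
    · rintro ⟨hx, y, hy, rfl⟩
      exact ⟨y, ⟨(ha.mem_block_iff i _).1 hx, (hc.mem_block_iff j y).1 hy⟩, rfl⟩
    · rintro ⟨y, ⟨h1, h2⟩, rfl⟩
      exact ⟨(ha.mem_block_iff i _).2 h1, y, (hc.mem_block_iff j y).2 h2, rfl⟩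
  rw [this, Set.ncard_image_of_injective _ g.injective]

theorem cell_mul_mul {β γ : ℤ → ℤ} {x y : Equiv.Perm ℤ} (hx : ∀ z, β (x z) = β z)
    (hy : ∀ z, γ (y z) = γ z) (g : Equiv.Perm ℤ) (i j : ℤ) :
    cell β γ (x * g * y) i j = cell β γ g i j := by
  rw [cell, cell, Nat.cast_inj]
  refine Set.ncard_congr (fun z _ => y z) ?_ ?_ ?_
  · rintro z ⟨h1, h2⟩
    rw [Equiv.Perm.mul_apply, Equiv.Perm.mul_apply, hx] at h1
    exact ⟨h1, by rw [hy, h2]⟩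
  · intro z z' _ _ h
    exact y.injective h
  · rintro z ⟨h1, h2⟩
    refine ⟨y⁻¹ z, ⟨?_, ?_⟩, perm_apply_inv _ _⟩
    · rw [Equiv.Perm.mul_apply, Equiv.Perm.mul_apply, hx, perm_apply_inv, h1]
    · rw [← hy, perm_apply_inv, h2]

theorem exists_cell_eq (ha : IsComp r' d a) (hc : IsComp r d c) {M : ℤ → ℤ → ℤ}
    (hM : IsCellMatrix (2 * r' + 2) (2 * r + 2) M) (h1 : ∀ i, blockSize r' d a i = ∑ᶠ j, M i j)
    (h2 : ∀ j, blockSize r d c j = ∑ᶠ i, M i j) :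
    ∃ g ∈ weyl d, ∀ i j, cell (blockIdx r' d a) (blockIdx r d c) g i j = M i j :=
  exists_perm_of_cellMatrix (blockIdx_add r' d a) ha.blockIdx_neg (blockIdx_add r d c)
    hc.blockIdx_neg hM (fun i => by rw [← h1]; exact ha.exists_interval i)
    (fun j => by rw [← h2]; exact hc.exists_interval j)

/-- In each double coset there is an element that is minimal and hence increasing on blocks. -/
theorem exists_minimal (hd : 2 ≤ d) (ha : IsComp r' d a) (hc : IsComp r d c) {g₀ : Equiv.Perm ℤ}
    (hg₀ : g₀ ∈ weyl d) : ∃ g ∈ weyl d,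
      (∀ x ∈ parabolic r' d a, ∀ y ∈ parabolic r d c, len d g ≤ len d (x * g * y)) ∧
      (∀ i j, cell (blockIdx r' d a) (blockIdx r d c) g i j =
        cell (blockIdx r' d a) (blockIdx r d c) g₀ i j) ∧ len d g ≤ len d g₀ := by
  classical
  have hex : ∃ m, ∃ x ∈ parabolic r' d a, ∃ y ∈ parabolic r d c, len d (x * g₀ * y) = m :=
    ⟨_, 1, one_mem _, 1, one_mem _, rfl⟩
  obtain ⟨x, hx, y, hy, hm⟩ := Nat.find_spec hex
  have hx' := (mem_parabolic_iff hd ha x).1 hx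
  have hy' := (mem_parabolic_iff hd hc y).1 hy
  refine ⟨x * g₀ * y, mul_mem (mul_mem hx'.1 hg₀) hy'.1, fun x' hx1 y' hy1 => ?_,
    cell_mul_mul hx'.2 hy'.2 g₀, ?_⟩
  · rw [hm]
    exact Nat.find_min' hex ⟨x' * x, mul_mem hx1 hx, y * y', mul_mem hy hy1, by
      simp only [mul_assoc]⟩
  · rw [hm]
    exact Nat.find_min' hex ⟨1, one_mem _, 1, one_mem _, by simp⟩

theorem blockMono_of_minimal (hd : 2 ≤ d) (ha : IsComp r' d a) (hc : IsComp r d c)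
    (hg : g ∈ weyl d)
    (hmin : ∀ x ∈ parabolic r' d a, ∀ y ∈ parabolic r d c, len d g ≤ len d (x * g * y)) :
    BlockMono (blockIdx r d c) g ∧ BlockMono (blockIdx r' d a) g⁻¹ :=
  ⟨blockMono_of_le hd hc hg fun y hy => by simpa using hmin 1 (one_mem _) y hy,
    blockMono_inv_of_le hd ha hg fun x hx => by simpa using hmin x hx 1 (one_mem _)⟩

theorem IsRep.cell_eq (hA : IsXi r d A) (hg : IsRep r d A g) :
    cell (blockIdx r d (rowC r A)) (blockIdx r d (colC r A)) g = A := by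
  ext i j
  rw [hg.2.2 i j, cell_eq_ncard hA.isComp hA.isComp_colC]

theorem IsRep.blockMono (hd : 2 ≤ d) (hA : IsXi r d A) (hg : IsRep r d A g) :
    BlockMono (blockIdx r d (colC r A)) g ∧ BlockMono (blockIdx r d (rowC r A)) g⁻¹ :=
  blockMono_of_minimal hd hA.isComp hA.isComp_colC hg.1 hg.2.1

theorem exists_isRep (hd : 2 ≤ d) (hA : IsXi r d A) : ∃ g, IsRep r d A g := by
  obtain ⟨g₀, hg₀, h⟩ := exists_cell_eq hA.isComp hA.isComp_colC hA.isCellMatrix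
    (fun i => hA.blockSize_rowC i) (fun j => hA.blockSize_colC j)
  obtain ⟨g, hg, hmin, hcell, -⟩ := exists_minimal hd hA.isComp hA.isComp_colC hg₀
  exact ⟨g, hg, hmin, fun i j => by rw [cell_eq_ncard hA.isComp hA.isComp_colC, hcell, h]⟩

theorem four_mul_len_of_isRep (hd : 2 ≤ d) (hA : IsXi r d A) (hg : IsRep r d A g) :
    (4 * len d g : ℤ) = 2 * cornerCount (2 * r + 2) A -
      2 * (centSum A 0 0 + centSum A (r + 1) (r + 1)) := by
  have h := hg.blockMono hd hA
  have h1 := fourLen_of_blockMono hA.isComp hA.isComp_colC hg.1 h.1 h.2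
  rw [hg.cell_eq hA, ← four_mul_len hd hg.1] at h1
  exact_mod_cast h1

/-- The formula for a representative involves only `A`, so all representatives have the same length
and the infimum in `lenMat` is this common value. -/
theorem four_mul_lenMat (hd : 2 ≤ d) (hA : IsXi r d A) :
    (4 * lenMat r d A : ℤ) = 2 * cornerCount (2 * r + 2) A -
      2 * (centSum A 0 0 + centSum A (r + 1) (r + 1)) := by
  obtain ⟨g, hg⟩ := exists_isRep hd hA
  obtain ⟨g', hg', h⟩ := Nat.sInf_mem (s := {m | ∃ g, IsRep r d A g ∧ len d g = m}) ⟨_, g, hg, rfl⟩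
  rw [lenMat, ← h, four_mul_len_of_isRep hd hA hg']

end

end AffineC

/-! ### Factorisation along a parabolic subgroup and the refined composition -/

namespace AffineC

/-! ### Lengths of products and equality of monotone functions -/

theorem orbitCount_union {D : ℤ} {Q Q' : Set (ℤ × ℤ)} (hdis : Disjoint Q Q')
    (h : {p | p ∈ Q ∧ 0 ≤ p.1 ∧ p.1 < D}.Finite) (h' : {p | p ∈ Q' ∧ 0 ≤ p.1 ∧ p.1 < D}.Finite) :
    orbitCount D (Q ∪ Q') = orbitCount D Q + orbitCount D Q' := by
  rw [orbitCount, orbitCount, orbitCount, ← Set.ncard_union_eq ?_ h h']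
  · congr 1
    ext p
    simp only [Set.mem_union, Set.mem_ofPred_eq, or_and_right]
  · exact hdis.mono (fun _ h => h.1) (fun _ h => h.1)

section

variable {r d : ℕ} {c : ℕ → ℤ} {g w : Equiv.Perm ℤ}

/-- The factor `w` reverses pairs only inside blocks, whereas `g`, whose inverse increases on
blocks, has no inversion with both values in one block. The inversions of the two factors therefore
add up. -/
theorem invCount_mul_of_parabolic (hc : IsComp r d c) (hg : g ∈ weyl d) (hw : w ∈ weyl d)
    (hwb : ∀ x, blockIdx r d c (w x) = blockIdx r d c x) (hmono : BlockMono (blockIdx r d c) g⁻¹)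
    {Z : Set (ℤ × ℤ)} (hZ : WeylInv d Z) (hZ' : ShiftInv (2 * d + 2) Z) :
    invCount d Z (w * g) = invCount d Z w + invCount d Z g := by
  have hm := hc.blockIdx_mono
  have hw' : ∀ x y, blockIdx r d c x < blockIdx r d c y → w x < w y := fun x y h => by
    by_contra hcon
    have := hm (not_lt.1 hcon)
    rw [hwb, hwb] at this
    omega
  have hlt : ∀ x y, blockIdx r d c x < blockIdx r d c y → x < y := fun x y h => by
    by_contra hcon
    exact h.not_ge (hm (not_lt.1 hcon))
  have hg' : ∀ x y, blockIdx r d c (g x) = blockIdx r d c (g y) → g x < g y → x < y :=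
    fun x y h h' => by
      have := hmono _ _ h h'
      rwa [perm_inv_apply, perm_inv_apply] at this
  have e : inversions (w * g) ∩ Z = {p | (g p.1, g p.2) ∈ inversions w ∩ Z} ∪ (inversions g ∩ Z) := by
    ext ⟨x, y⟩
    simp only [inversions, Set.mem_union, Set.mem_inter_iff, Set.mem_ofPred_eq,
      Equiv.Perm.mul_apply, hZ g hg x y, ← or_and_right]
    refine and_congr_left fun _ => ?_
    rcases lt_trichotomy (blockIdx r d c (g x)) (blockIdx r d c (g y)) with h | h | h
    · have := hw' _ _ h
      have := hlt _ _ h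
      omega
    · have h1 := hg' x y h
      have h2 := hg' y x h.symm
      have h3 : g x = g y → x = y := fun h => g.injective h
      have h4 : g x = g y → w (g x) = w (g y) := fun h => by rw [h]
      omega
    · have := hw' _ _ h
      have := hlt _ _ h
      omega
  have hdis : Disjoint {p : ℤ × ℤ | (g p.1, g p.2) ∈ inversions w ∩ Z} (inversions g ∩ Z) := by
    rw [Set.disjoint_left]
    rintro ⟨x, y⟩ ⟨⟨h1, -⟩, -⟩ ⟨⟨-, h2⟩, -⟩
    simp only at h1 h2
    omega
  have hfin := finite_window_inter (mul_mem hw hg) Z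
  rw [e] at hfin
  rw [invCount, e, orbitCount_union hdis (hfin.subset fun p hp => ⟨Or.inl hp.1, hp.2⟩)
    (hfin.subset fun p hp => ⟨Or.inr hp.1, hp.2⟩),
    orbitCount_comap hg ((shiftInv_inversions hw).inter hZ')]
  rfl

theorem len_mul_of_parabolic (hd : 2 ≤ d) (hc : IsComp r d c) (hg : g ∈ weyl d) (hw : w ∈ weyl d)
    (hwb : ∀ x, blockIdx r d c (w x) = blockIdx r d c x) (hmono : BlockMono (blockIdx r d c) g⁻¹) :
    len d (w * g) = len d w + len d g := by
  have h1 := four_mul_len hd hg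
  have h2 := four_mul_len hd hw
  have h3 := four_mul_len hd (mul_mem hw hg)
  rw [fourLen, invCount_mul_of_parabolic hc hg hw hwb hmono (weylInv_univ d) (shiftInv_univ _),
    invCount_mul_of_parabolic hc hg hw hwb hmono (weylInv_noncentral d) (shiftInv_noncentral d)] at h3
  rw [fourLen] at h1 h2
  omega

end

/-- Monotone functions on a finite set are determined by the sizes of their fibres. -/
theorem eqOn_of_fibres {Y : Set ℤ} (hY : Y.Finite) {f f' : ℤ → ℤ} (hf : MonotoneOn f Y)
    (hf' : MonotoneOn f' Y)
    (h : ∀ i, {y | y ∈ Y ∧ f y = i}.ncard = {y | y ∈ Y ∧ f' y = i}.ncard) : Set.EqOn f f' Y := by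
  have hlow : ∀ u : ℤ → ℤ, ∀ i : ℤ, ({y | y ∈ Y ∧ u y < i}.ncard : ℤ) =
      ∑ᶠ k ∈ Set.Iio i, ({y | y ∈ Y ∧ u y = k}.ncard : ℤ) := by
    intro u i
    rw [ncard_label (hY.subset fun y hy => hy.1) u (P := Set.Iio i) fun y hy => hy.2]
    refine finsum_mem_congr rfl fun k hk => ?_
    congr 2
    ext y
    constructor
    · exact fun h => ⟨h.1.1, h.2⟩
    · rintro ⟨h1, rfl⟩
      exact ⟨⟨h1, hk⟩, rfl⟩
  have hcard : ∀ i, {y | y ∈ Y ∧ f y < i}.ncard = {y | y ∈ Y ∧ f' y < i}.ncard := by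
    intro i
    have : ({y | y ∈ Y ∧ f y < i}.ncard : ℤ) = ({y | y ∈ Y ∧ f' y < i}.ncard : ℤ) := by
      rw [hlow, hlow]
      exact finsum_mem_congr rfl fun k _ => by rw [h]
    exact_mod_cast this
  have hmain : ∀ u u' : ℤ → ℤ, MonotoneOn u Y → MonotoneOn u' Y →
      (∀ i, {y | y ∈ Y ∧ u y < i}.ncard = {y | y ∈ Y ∧ u' y < i}.ncard) → ∀ y ∈ Y, u' y ≤ u y := by
    intro u u' hu hu' hcard y hy
    by_contra hcon
    push Not at hcon
    -- If `u y < u' y`, a point with `u' ≤ u y` must lie before `y`, where `u ≤ u y`. The point `y`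
    -- itself makes the inclusion strict, against equal cardinalities.
    have hss : {z | z ∈ Y ∧ u' z < u y + 1} ⊂ {z | z ∈ Y ∧ u z < u y + 1} := by
      refine ⟨fun z hz => ⟨hz.1, ?_⟩, fun h => ?_⟩
      · rcases le_total z y with hzy | hzy
        · have := hu hz.1 hy hzy
          omega
        · have := hu' hy hz.1 hzy
          have := hz.2
          omega
      · have := (h (show y ∈ {z | z ∈ Y ∧ u z < u y + 1} from ⟨hy, by omega⟩)).2
        omega
    have := Set.ncard_lt_ncard hss (hY.subset fun z hz => hz.1)
    rw [hcard] at this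
    exact this.false
  exact fun y hy => le_antisymm (hmain f' f hf' hf (fun i => (hcard i).symm) y hy)
    (hmain f f' hf hf' hcard y hy)

/-! ### Triples of interleaved matrices -/

/-- The matrix whose rows `3 i`, `3 i + 1`, `3 i + 2` are the `i`-th rows of three given matrices. -/
def interleave (U V W : ℤ → ℤ → ℤ) (p j : ℤ) : ℤ :=
  if p % 3 = 0 then U (p / 3) j else if p % 3 = 1 then V (p / 3) j else W (p / 3) j

section

variable (U V W : ℤ → ℤ → ℤ) (i j : ℤ)

theorem interleave_zero : interleave U V W (3 * i) j = U i j := by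
  rw [interleave, if_pos (by omega)]; congr 1; omega

theorem interleave_one : interleave U V W (3 * i + 1) j = V i j := by
  rw [interleave, if_neg (by omega), if_pos (by omega)]; congr 1; omega

theorem interleave_two : interleave U V W (3 * i + 2) j = W i j := by
  rw [interleave, if_neg (by omega), if_neg (by omega)]; congr 1; omega

theorem exists_mod_three (p : ℤ) : ∃ i, p = 3 * i ∨ p = 3 * i + 1 ∨ p = 3 * i + 2 :=
  ⟨p / 3, by omega⟩

theorem interleave_rotate :
    interleave U V W (i + 1) j = interleave V W (fun i => U (i + 1)) i j := by
  obtain ⟨k, rfl | rfl | rfl⟩ := exists_mod_three i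
  · rw [interleave_one, interleave_zero]
  · rw [show 3 * k + 1 + 1 = 3 * k + 2 by ring, interleave_two, interleave_one]
  · rw [show 3 * k + 2 + 1 = 3 * (k + 1) by ring, interleave_zero, interleave_two]

end

/-- The refinement of a matrix with rows `Tᵢ`, `Mᵢ`, `(T₋ᵢ,₋ⱼ)ⱼ` at `3 i - 1`, `3 i`, `3 i + 1`. -/
def refinement (M T : ℤ → ℤ → ℤ) (p j : ℤ) : ℤ :=
  interleave T M (fun i j => T (-i) (-j)) (p + 1) j

section

variable {r d : ℕ} {A B M T : ℤ → ℤ → ℤ}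

theorem refinement_pred (M T : ℤ → ℤ → ℤ) (i : ℤ) : refinement M T (3 * i - 1) = T i := by
  ext j; rw [refinement, sub_add_cancel, interleave_zero]

theorem refinement_self (M T : ℤ → ℤ → ℤ) (i : ℤ) : refinement M T (3 * i) = M i := by
  ext j; rw [refinement, interleave_one]

theorem refinement_succ (M T : ℤ → ℤ → ℤ) (i : ℤ) :
    refinement M T (3 * i + 1) = fun j => T (-i) (-j) := by
  ext j; rw [refinement, add_assoc, one_add_one_eq_two, interleave_two]

theorem exists_pred_self_succ (p : ℤ) : ∃ i, p = 3 * i - 1 ∨ p = 3 * i ∨ p = 3 * i + 1 :=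
  ⟨(p + 1) / 3, by omega⟩

theorem finite_neg {m : ℤ → ℤ} (h : {j | m j ≠ 0}.Finite) : {j | m (-j) ≠ 0}.Finite :=
  h.preimage (f := fun j : ℤ => -j) neg_injective.injOn

theorem refinement_isCellMatrix (hT : IsTheta r T) (hM : IsTheta r M)
    (hM' : ∀ i j, M (-i) (-j) = M i j) :
    IsCellMatrix (2 * ((3 * r + 2 : ℕ) : ℤ) + 2) (2 * r + 2) (refinement M T) where
  nonneg p j := by
    obtain ⟨i, rfl | rfl | rfl⟩ := exists_pred_self_succ p
    · rw [refinement_pred]; exact hT.nonneg _ _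
    · rw [refinement_self]; exact hM.nonneg _ _
    · rw [refinement_succ]; exact hT.nonneg _ _
  periodic p j := by
    have e : ∀ q : ℤ, q + (2 * ((3 * r + 2 : ℕ) : ℤ) + 2) = q + 3 * (2 * r + 2) := fun q => by
      push_cast; ring
    rw [e]
    obtain ⟨i, rfl | rfl | rfl⟩ := exists_pred_self_succ p
    · rw [show 3 * i - 1 + 3 * (2 * (r : ℤ) + 2) = 3 * (i + (2 * r + 2)) - 1 by ring,
        refinement_pred, refinement_pred, hT.periodic]
    · rw [show 3 * i + 3 * (2 * (r : ℤ) + 2) = 3 * (i + (2 * r + 2)) by ring,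
        refinement_self, refinement_self, hM.periodic]
    · rw [show 3 * i + 1 + 3 * (2 * (r : ℤ) + 2) = 3 * (i + (2 * r + 2)) + 1 by ring,
        refinement_succ, refinement_succ]
      simp only
      rw [← hT.periodic]
      congr 1 <;> ring
  symm p j := by
    obtain ⟨i, rfl | rfl | rfl⟩ := exists_pred_self_succ p
    · rw [show -(3 * i - 1) = 3 * (-i) + 1 by ring, refinement_pred, refinement_succ]
      simp only [neg_neg]
    · rw [show -(3 * i) = 3 * (-i) by ring, refinement_self, refinement_self, hM']
    · rw [show -(3 * i + 1) = 3 * (-i) - 1 by ring, refinement_pred, refinement_succ]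
  finite_row p := by
    obtain ⟨i, rfl | rfl | rfl⟩ := exists_pred_self_succ p
    · rw [refinement_pred]; exact hT.finite_row i
    · rw [refinement_self]; exact hM.finite_row i
    · rw [refinement_succ]; exact finite_neg (hT.finite_row _)
  finite_col j := by
    have h1 := (hT.finite_col j).image fun i => 3 * i - 1
    have h2 := (hM.finite_col j).image fun i => 3 * i
    have h3 := (finite_neg (hT.finite_col (-j))).image fun i => 3 * i + 1
    refine ((h1.union h2).union h3).subset fun p hp => ?_
    obtain ⟨i, rfl | rfl | rfl⟩ := exists_pred_self_succ p
    · rw [Set.mem_ofPred_eq, refinement_pred] at hp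
      exact Or.inl (Or.inl ⟨i, hp, rfl⟩)
    · rw [Set.mem_ofPred_eq, refinement_self] at hp
      exact Or.inl (Or.inr ⟨i, hp, rfl⟩)
    · rw [Set.mem_ofPred_eq, refinement_succ] at hp
      exact Or.inr ⟨i, hp, rfl⟩

/-! ### The composition attached to a tridiagonal matrix -/

theorem IsTridiagonal.eq_zero (htri : IsTridiagonal B) {i j : ℤ} (h : i + 1 < j ∨ j + 1 < i) :
    B i j = 0 := htri i j (by rw [lt_abs]; omega)

theorem IsTridiagonal.finsum_col (htri : IsTridiagonal B) (i : ℤ) :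
    ∑ᶠ k, B k i = B (i - 1) i + B i i + B (i + 1) i := by
  rw [finsum_eq_sum_of_support_subset (s := {i - 1, i, i + 1}) _ ?_]
  · rw [Finset.sum_insert, Finset.sum_insert, Finset.sum_singleton, add_assoc]
    · simp
    · simp only [Finset.mem_insert, Finset.mem_singleton]; omega
  · intro k hk
    by_contra hcon
    simp only [Finset.coe_insert, Finset.coe_singleton, Set.mem_insert_iff, Set.mem_singleton_iff,
      not_or] at hcon
    exact hk (htri.eq_zero (by omega))

/-- The sizes of the blocks attached to a tridiagonal matrix. -/
def deltaSize (B : ℤ → ℤ → ℤ) (p : ℤ) : ℤ :=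
  interleave (fun i _ => B (i - 1) i) (fun i _ => B i i) (fun i _ => B (i + 1) i) (p + 1) 0

theorem deltaSize_pred (B : ℤ → ℤ → ℤ) (i : ℤ) : deltaSize B (3 * i - 1) = B (i - 1) i := by
  rw [deltaSize, sub_add_cancel, interleave_zero]

theorem deltaSize_self (B : ℤ → ℤ → ℤ) (i : ℤ) : deltaSize B (3 * i) = B i i := by
  rw [deltaSize, interleave_one]

theorem deltaSize_succ (B : ℤ → ℤ → ℤ) (i : ℤ) : deltaSize B (3 * i + 1) = B (i + 1) i := by
  rw [deltaSize, add_assoc, one_add_one_eq_two, interleave_two]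

theorem IsXi.deltaSize_add (hB : IsXi r d B) (p : ℤ) :
    deltaSize B (p + (2 * ((3 * r + 2 : ℕ) : ℤ) + 2)) = deltaSize B p := by
  rw [show p + (2 * ((3 * r + 2 : ℕ) : ℤ) + 2) = p + 3 * (2 * r + 2) by push_cast; ring]
  obtain ⟨i, rfl | rfl | rfl⟩ := exists_pred_self_succ p
  · rw [show 3 * i - 1 + 3 * (2 * (r : ℤ) + 2) = 3 * (i + (2 * r + 2)) - 1 by ring,
      deltaSize_pred, deltaSize_pred, ← hB.periodic (i - 1)]
    congr 1; ring
  · rw [show 3 * i + 3 * (2 * (r : ℤ) + 2) = 3 * (i + (2 * r + 2)) by ring,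
      deltaSize_self, deltaSize_self, hB.periodic]
  · rw [show 3 * i + 1 + 3 * (2 * (r : ℤ) + 2) = 3 * (i + (2 * r + 2)) + 1 by ring,
      deltaSize_succ, deltaSize_succ, ← hB.periodic (i + 1)]
    congr 1; ring

theorem IsXi.deltaSize_neg (hB : IsXi r d B) (p : ℤ) : deltaSize B (-p) = deltaSize B p := by
  obtain ⟨i, rfl | rfl | rfl⟩ := exists_pred_self_succ p
  · rw [show -(3 * i - 1) = 3 * (-i) + 1 by ring, deltaSize_pred, deltaSize_succ, ← hB.symm (i - 1)]
    congr 1; ring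
  · rw [show -(3 * i) = 3 * (-i) by ring, deltaSize_self, deltaSize_self, hB.symm]
  · rw [show -(3 * i + 1) = 3 * (-i) - 1 by ring, deltaSize_pred, deltaSize_succ, ← hB.symm (i + 1)]
    congr 1; ring

theorem entry_of_ne {i : ℤ} (h0 : 0 < i) (h1 : i < r + 1) (B : ℤ → ℤ → ℤ) (j : ℤ) :
    entry r B i j = B i j := by
  refine if_neg ?_
  rintro ⟨-, h | h⟩
  · have := Int.le_of_dvd h0 h
    omega
  · have := Int.le_of_dvd (by omega) ((dvd_sub_comm).1 h)
    omega

theorem delta_zero (B : ℤ → ℤ → ℤ) (m : ℕ) : delta r B (3 * m) = entry r B m m := by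
  rw [delta, if_pos (show 3 * m % 3 = 0 by omega), show 3 * m / 3 = m by omega]

theorem delta_one (B : ℤ → ℤ → ℤ) (m : ℕ) : delta r B (3 * m + 1) = B (m + 1) m := by
  rw [delta, if_neg (show ¬ (3 * m + 1) % 3 = 0 by omega),
    if_pos (show (3 * m + 1) % 3 = 1 by omega), show (3 * m + 1) / 3 = m by omega]

theorem delta_two (B : ℤ → ℤ → ℤ) (m : ℕ) : delta r B (3 * m + 2) = B m (m + 1) := by
  rw [delta, if_neg (show ¬ (3 * m + 2) % 3 = 0 by omega),
    if_neg (show ¬ (3 * m + 2) % 3 = 1 by omega), show (3 * m + 2) / 3 = m by omega]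

theorem IsXi.deltaSize_base (hB : IsXi r d B) (k : ℕ) (hk : k ≤ 3 * r + 2 + 1) :
    deltaSize B k = if k = 0 ∨ k = 3 * r + 2 + 1 then 2 * delta r B k + 1 else delta r B k := by
  have h2 := hB.two_mul_entry_zero
  have h3 := hB.two_mul_entry_last
  obtain ⟨m, rfl | rfl | rfl⟩ : ∃ m, k = 3 * m ∨ k = 3 * m + 1 ∨ k = 3 * m + 2 := ⟨k / 3, by omega⟩
  · rw [delta_zero]
    push_cast
    rw [deltaSize_self]
    by_cases h0 : m = 0
    · subst h0
      rw [if_pos (by omega)]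
      simpa using h2.symm
    by_cases h1 : m = r + 1
    · subst h1
      rw [if_pos (by omega)]
      push_cast
      exact h3.symm
    · rw [if_neg (by omega), entry_of_ne (by omega) (by omega)]
  · rw [delta_one, if_neg (by omega)]
    push_cast
    rw [deltaSize_succ]
  · rw [delta_two, if_neg (by omega)]
    push_cast
    rw [show 3 * (m : ℤ) + 2 = 3 * (m + 1) - 1 by ring, deltaSize_pred, add_sub_cancel_right]

theorem delta_nonneg (hB : IsXi r d B) (k : ℕ) (hk : k ≤ 3 * r + 2 + 1) : 0 ≤ delta r B k := by
  have h := hB.deltaSize_base k hk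
  have : 0 ≤ deltaSize B k := by
    rw [deltaSize, interleave]
    split_ifs <;> exact hB.nonneg _ _
  split_ifs at h <;> omega

theorem sum_Ico_three {f : ℤ → ℤ} {n : ℤ} (hn : 0 < n) (hf : ∀ p, f (p + 3 * n) = f p) :
    ∑ p ∈ Finset.Ico 0 (3 * n), f p =
      ∑ i ∈ Finset.Ico 0 n, (f (3 * i - 1) + f (3 * i) + f (3 * i + 1)) := by
  rw [← sum_Ico_shift (by omega) hf (-1)]
  have e : Finset.Ico (-1) (-1 + 3 * n) =
      ((Finset.Ico 0 n).image fun i => 3 * i - 1) ∪ (((Finset.Ico 0 n).image fun i => 3 * i) ∪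
        (Finset.Ico 0 n).image fun i => 3 * i + 1) := by
    ext p
    simp only [Finset.mem_Ico, Finset.mem_union, Finset.mem_image]
    constructor
    · intro h
      obtain ⟨i, rfl | rfl | rfl⟩ := exists_pred_self_succ p
      · exact Or.inl ⟨i, by omega, rfl⟩
      · exact Or.inr (Or.inl ⟨i, by omega, rfl⟩)
      · exact Or.inr (Or.inr ⟨i, by omega, rfl⟩)
    · rintro (⟨i, h, rfl⟩ | ⟨i, h, rfl⟩ | ⟨i, h, rfl⟩) <;> omega
  rw [e, Finset.sum_union, Finset.sum_union, Finset.sum_image, Finset.sum_image, Finset.sum_image,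
    Finset.sum_add_distrib, Finset.sum_add_distrib, add_assoc]
  · intro a _ b _ h; simp only at h; omega
  · intro a _ b _ h; simp only at h; omega
  · intro a _ b _ h; simp only at h; omega
  · rw [Finset.disjoint_left]
    intro p h1 h2
    simp only [Finset.mem_image] at h1 h2
    obtain ⟨i, -, rfl⟩ := h1
    obtain ⟨i', -, h⟩ := h2
    omega
  · rw [Finset.disjoint_left]
    intro p h1 h2
    simp only [Finset.mem_image, Finset.mem_union] at h1 h2
    obtain ⟨i, -, rfl⟩ := h1
    rcases h2 with ⟨i', -, h⟩ | ⟨i', -, h⟩ <;> omega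

/-- The sizes at `3 i - 1`, `3 i`, `3 i + 1` are the entries of column `i` of `B`, so they total the
column sums over a period. -/
theorem IsXi.isComp_delta (hB : IsXi r d B) (htri : IsTridiagonal B) :
    IsComp (3 * r + 2) d (delta r B) := by
  refine isComp_of_even hB.deltaSize_add hB.deltaSize_neg
    (fun k hk => hB.deltaSize_base k hk) (delta_nonneg hB) ?_
  rw [show (2 * ((3 * r + 2 : ℕ) : ℤ) + 2) = 3 * (2 * r + 2) by push_cast; ring,
    sum_Ico_three (by positivity) fun p => by rw [← hB.deltaSize_add p]; congr 1; push_cast; ring]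
  have h := hB.transpose.total
  rw [sum_Icc_period (by positivity) (rowSum_add hB.transpose.periodic)] at h
  rw [← h]
  refine Finset.sum_congr rfl fun i _ => ?_
  rw [deltaSize_pred, deltaSize_self, deltaSize_succ, rowSum, htri.finsum_col]

theorem IsXi.blockSize_delta (hB : IsXi r d B) (htri : IsTridiagonal B) (p : ℤ) :
    blockSize (3 * r + 2) d (delta r B) p = deltaSize B p :=
  blockSize_eq_of_even (hB.isComp_delta htri) hB.deltaSize_add hB.deltaSize_neg
    (fun k hk => hB.deltaSize_base k hk) p

/-- The composition `δ(B)` lists the entries of the columns of `B` one after the other, so each wall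
of `col_c(B)` is a wall of `δ(B)`, after three entries per column and only two for column `0`, which
begins at its diagonal. -/
theorem psum_colC (htri : IsTridiagonal B) (k : ℕ) (hk : k ≤ r) :
    psum (colC r B) (k + 1) = psum (delta r B) (3 * k + 2) := by
  induction k with
  | zero =>
    have : ∑ᶠ j ∈ Set.Ici (1 : ℤ), B j 0 = B 1 0 := by
      rw [finsum_eq_single _ 1 fun j hj1 => ?_]
      · simp
      · by_cases hj : 1 ≤ j
        · simp [htri.eq_zero (show j + 1 < 0 ∨ 0 + 1 < j by omega)]
        · simp [hj]
    simp only [psum, Finset.sum_range_succ, Finset.sum_range_zero, colC, rowC, delta, if_true, this]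
    simp [entry]
  | succ k ih =>
    rw [psum, Finset.sum_range_succ]
    have ih' := ih (by omega)
    rw [psum] at ih'
    rw [ih', show 3 * (k + 1) + 2 = 3 * k + 2 + 1 + 1 + 1 by ring, psum, psum,
      Finset.sum_range_succ _ (3 * k + 2 + 1 + 1), Finset.sum_range_succ _ (3 * k + 2 + 1),
      Finset.sum_range_succ _ (3 * k + 2)]
    have h1 : colC r B (k + 1) =
        B k (k + 1 : ℕ) + B (k + 1 : ℕ) (k + 1 : ℕ) + B ((k + 1 : ℕ) + 1) (k + 1 : ℕ) := by
      rw [colC, rowC, if_neg (by omega), if_neg (by omega), if_pos (by omega), rowSum,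
        htri.finsum_col]
      push_cast
      rw [add_sub_cancel_right]
    have h2 : delta r B (3 * k + 2) = B k (k + 1 : ℕ) := by
      rw [delta_two]; push_cast; rfl
    have h3 : delta r B (3 * k + 2 + 1) = B (k + 1 : ℕ) (k + 1 : ℕ) := by
      rw [show 3 * k + 2 + 1 = 3 * (k + 1) by ring, delta_zero,
        entry_of_ne (by omega) (by omega)]
    have h4 : delta r B (3 * k + 2 + 1 + 1) = B ((k + 1 : ℕ) + 1) (k + 1 : ℕ) := by
      rw [show 3 * k + 2 + 1 + 1 = 3 * (k + 1) + 1 by ring, delta_one]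
    rw [h1, h2, h3, h4]
    ring

theorem wallCount_colC (hB : IsXi r d B) (htri : IsTridiagonal B) (x : ℤ) :
    wallCount r (colC r B) x = (wallCount (3 * r + 2) (delta r B) x + 1) / 3 := by
  have hδ := hB.isComp_delta htri
  have w := wallCount_le (3 * r + 2) (delta r B) x
  have w' := wallCount_nonneg (3 * r + 2) (delta r B) x
  obtain ⟨K, hK⟩ := Int.eq_ofNat_of_zero_le w'
  have hK' : K ≤ 3 * r + 2 + 1 := by push_cast at w; omega
  obtain ⟨h1, h2⟩ := (hδ.wallCount_eq_iff hK').1 hK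
  rw [hK, hB.isComp_colC.wallCount_eq_of (k := (K + 1) / 3) (by omega)]
  · omega
  · by_cases h0 : (K + 1) / 3 = 0
    · exact Or.inl h0
    · refine Or.inr ?_
      obtain ⟨m, hm⟩ : ∃ m, (K + 1) / 3 = m + 1 := ⟨(K + 1) / 3 - 1, by omega⟩
      rw [hm, psum_colC htri m (by omega)]
      refine lt_of_le_of_lt (hδ.psum_mono (show 3 * m + 2 ≤ K by omega) (by omega)) ?_
      exact h1.resolve_left (by omega)
  · by_cases h0 : (K + 1) / 3 = r + 1
    · exact Or.inl h0
    · refine Or.inr ?_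
      rw [psum_colC htri _ (by omega)]
      exact (h2.resolve_left (by omega)).trans (hδ.psum_mono (by omega) (by omega))

/-- Hence the `δ`-blocks `3 i - 1`, `3 i`, `3 i + 1` together form block `i` of `col_c(B)`. This
links the lengths for the two compositions. -/
theorem blockIdx_colC (hB : IsXi r d B) (htri : IsTridiagonal B) (x : ℤ) :
    blockIdx r d (colC r B) x = (blockIdx (3 * r + 2) d (delta r B) x + 1) / 3 := by
  have e : ∀ q : ℤ, q * (2 * ((3 * r + 2 : ℕ) : ℤ) + 2) = 3 * (q * (2 * r + 2)) := fun q => by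
    push_cast; ring
  rw [blockIdx, blockIdx, wallCount_colC hB htri, wallCount_colC hB htri, e]
  push_cast
  split_ifs <;> omega

end

end AffineC

/-! ### The length of the fibre representative -/

namespace AffineC

/-! ### The length of the fibre representative -/

theorem finsum_three {f : ℤ → ℤ} (hf : {p | f p ≠ 0}.Finite) :
    ∑ᶠ p, f p = (∑ᶠ i, f (3 * i - 1)) + (∑ᶠ i, f (3 * i)) + ∑ᶠ i, f (3 * i + 1) := by
  have i0 : Function.Injective fun i : ℤ => 3 * i - 1 := fun a b h => by simp only at h; omega
  have i1 : Function.Injective fun i : ℤ => 3 * i := fun a b h => by simp only at h; omega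
  have i2 : Function.Injective fun i : ℤ => 3 * i + 1 := fun a b h => by simp only at h; omega
  have hs : ∀ s : Set ℤ, (s ∩ Function.support f).Finite := fun s => hf.subset fun x hx => hx.2
  rw [← finsum_mem_range i0, ← finsum_mem_range i1, ← finsum_mem_range i2,
    ← finsum_mem_union' ?_ (hs _) (hs _), ← finsum_mem_union' ?_ (hs _) (hs _),
    ← finsum_mem_univ]
  · have : (Set.range (fun i : ℤ => 3 * i - 1) ∪ Set.range fun i : ℤ => 3 * i) ∪
        Set.range (fun i : ℤ => 3 * i + 1) = Set.univ := by
      refine Set.eq_univ_of_forall fun p => ?_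
      obtain ⟨i, rfl | rfl | rfl⟩ := exists_pred_self_succ p
      · exact Or.inl (Or.inl ⟨i, rfl⟩)
      · exact Or.inl (Or.inr ⟨i, rfl⟩)
      · exact Or.inr ⟨i, rfl⟩
    rw [this]
  · rw [Set.disjoint_left]
    rintro p (⟨i, rfl⟩ | ⟨i, rfl⟩) ⟨i', h⟩ <;> simp only at h <;> omega
  · rw [Set.disjoint_left]
    rintro p ⟨i, rfl⟩ ⟨i', h⟩
    simp only at h
    omega

theorem finsum_neg_index (m : ℤ → ℤ) : ∑ᶠ j, m (-j) = ∑ᶠ j, m j :=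
  finsum_comp_equiv (Equiv.neg ℤ)

section

variable {r d : ℕ} {A B T : ℤ → ℤ → ℤ} {β γ : ℤ → ℤ} {g : Equiv.Perm ℤ}

theorem cell_neg (hβ : ∀ x, β (-x) = -β x) (hγ : ∀ x, γ (-x) = -γ x) (hg : g ∈ weyl d) (i j : ℤ) :
    cell β γ g (-i) (-j) = cell β γ g i j := by
  rw [cell, cell, Nat.cast_inj]
  refine Set.ncard_congr (fun z _ => -z) ?_ ?_ ?_
  · rintro z ⟨h1, h2⟩
    refine ⟨?_, ?_⟩
    · rw [weyl_neg hg, hβ, h1, neg_neg]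
    · rw [hγ, h2, neg_neg]
  · intro z z' _ _ h
    exact neg_injective h
  · rintro z ⟨h1, h2⟩
    refine ⟨-z, ⟨?_, ?_⟩, neg_neg z⟩
    · rw [weyl_neg hg, hβ, h1]
    · rw [hγ, h2]

theorem cell_three {η : ℤ → ℤ} (hη : ∀ x, η x = (β x + 1) / 3)
    (hγ : ∀ j, {x | γ x = j}.Finite) (g : Equiv.Perm ℤ) (i j : ℤ) : cell η γ g i j =
      cell β γ g (3 * i - 1) j + cell β γ g (3 * i) j + cell β γ g (3 * i + 1) j := by
  have hfin : ∀ p, {y | β (g y) = p ∧ γ y = j}.Finite := fun p => (hγ j).subset fun y hy => hy.2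
  simp only [cell]
  rw [← Nat.cast_add, ← Nat.cast_add, Nat.cast_inj, ← Set.ncard_union_eq ?_ (hfin _) (hfin _),
    ← Set.ncard_union_eq ?_ ((hfin _).union (hfin _)) (hfin _)]
  · congr 1
    ext y
    simp only [Set.mem_union, Set.mem_ofPred_eq, ← or_and_right, hη]
    refine and_congr_left fun _ => ?_
    constructor <;> intro h <;> omega
  · rw [Set.disjoint_left]
    rintro y (⟨h, -⟩ | ⟨h, -⟩) ⟨h', -⟩ <;> omega
  · rw [Set.disjoint_left]
    rintro y ⟨h, -⟩ ⟨h', -⟩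
    omega

/-- The hypothesis prescribes the rows `3 i - 1`, oddness of `g` gives the rows `3 i + 1`, and the
rows `3 i` are what is left of `A`. So the condition on `T` alone determines the whole refined
matrix. -/
theorem cell_eq_refinement {η : ℤ → ℤ} (hη : ∀ x, η x = (β x + 1) / 3)
    (hγ : ∀ j, {x | γ x = j}.Finite) (hβ' : ∀ x, β (-x) = -β x) (hγ' : ∀ x, γ (-x) = -γ x)
    (hg : g ∈ weyl d) (hA : cell η γ g = A) (hT : ∀ i j, cell β γ g (3 * i - 1) j = T i j) :
    cell β γ g = refinement (A - theta T) T := by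
  have h1 : ∀ i j, cell β γ g (3 * i + 1) j = T (-i) (-j) := fun i j => by
    rw [← hT, ← cell_neg hβ' hγ' hg]
    congr 1
    ring
  ext p j
  obtain ⟨i, rfl | rfl | rfl⟩ := exists_pred_self_succ p
  · rw [refinement_pred, hT]
  · rw [refinement_self, Pi.sub_apply, Pi.sub_apply, theta, ← hA, cell_three hη hγ, h1, hT]
    ring
  · rw [refinement_succ, h1]

theorem cell_refinement_sum (T : ℤ → ℤ → ℤ) (M : ℤ → ℤ → ℤ) (i j : ℤ) :
    refinement M T (3 * i - 1) j + refinement M T (3 * i) j + refinement M T (3 * i + 1) j =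
      M i j + theta T i j := by
  rw [refinement_pred, refinement_self, refinement_succ, theta]
  ring

theorem IsTheta.theta (hT : IsTheta r T) : IsTheta r (theta T) where
  nonneg i j := add_nonneg (hT.nonneg _ _) (hT.nonneg _ _)
  periodic i j := by
    rw [AffineC.theta, AffineC.theta, hT.periodic, ← hT.periodic (-(i + _))]
    congr 2 <;> ring
  finite_row i := ((hT.finite_row i).union (finite_neg (hT.finite_row (-i)))).subset fun j hj => by
    by_contra hcon
    simp only [Set.mem_union, Set.mem_ofPred_eq, not_or, not_not] at hcon
    exact hj (by rw [AffineC.theta, hcon.1, hcon.2, add_zero])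

theorem theta_neg (T : ℤ → ℤ → ℤ) (i j : ℤ) : theta T (-i) (-j) = theta T i j := by
  rw [theta, theta, neg_neg, neg_neg, add_comm]

theorem IsTheta.sub {S : ℤ → ℤ → ℤ} (hT : IsTheta r T) (hS : IsTheta r S) (h : ∀ i j, S i j ≤ T i j) :
    IsTheta r (T - S) where
  nonneg i j := sub_nonneg.2 (h i j)
  periodic i j := by simp only [Pi.sub_apply, hT.periodic, hS.periodic]
  finite_row i := ((hT.finite_row i).union (hS.finite_row i)).subset fun j hj => by
    by_contra hcon
    simp only [Set.mem_union, Set.mem_ofPred_eq, not_or, not_not] at hcon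
    exact hj (by simp only [Pi.sub_apply, hcon.1, hcon.2, sub_zero])

theorem IsTheta.add {S : ℤ → ℤ → ℤ} (hT : IsTheta r T) (hS : IsTheta r S) :
    IsTheta r (T + S) where
  nonneg i j := add_nonneg (hT.nonneg i j) (hS.nonneg i j)
  periodic i j := by simp only [Pi.add_apply, hT.periodic, hS.periodic]
  finite_row i := ((hT.finite_row i).union (hS.finite_row i)).subset fun j hj => by
    by_contra hcon
    simp only [Set.mem_union, Set.mem_ofPred_eq, not_or, not_not] at hcon
    exact hj (by simp only [Pi.add_apply, hcon.1, hcon.2, add_zero])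

theorem rowSum_sub {S : ℤ → ℤ → ℤ} (hT : IsTheta r T) (hS : IsTheta r S) (i : ℤ) :
    rowSum (T - S) i = rowSum T i - rowSum S i :=
  finsum_sub_distrib (hT.finite_row i) (hS.finite_row i)

theorem rowSum_plus {S : ℤ → ℤ → ℤ} (hT : IsTheta r T) (hS : IsTheta r S) (i : ℤ) :
    rowSum (T + S) i = rowSum T i + rowSum S i :=
  finsum_add_distrib (hT.finite_row i) (hS.finite_row i)

theorem rowSum_theta (hT : IsTheta r T) (i : ℤ) :
    rowSum (theta T) i = rowSum T i + rowSum T (-i) := by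
  rw [rowSum, rowSum, rowSum, ← finsum_neg_index (T (-i)),
    ← finsum_add_distrib (hT.finite_row i) (finite_neg (hT.finite_row (-i)))]
  rfl

theorem rowSum_eq_of_rowC (hA : IsXi r d A) (hB : IsXi r d B) (htri : IsTridiagonal B)
    (hAB : rowC r A = colC r B) (i : ℤ) : rowSum A i = B (i - 1) i + B i i + B (i + 1) i := by
  rw [← hA.blockSize_rowC, hAB, hB.blockSize_colC, htri.finsum_col]

/-- The condition on the row sums of `T` is just what makes the refined matrix compatible with the
blocks of `δ(B)`. -/
theorem rowSum_refinement (hA : IsXi r d A) (hB : IsXi r d B) (htri : IsTridiagonal B)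
    (hAB : rowC r A = colC r B) (hT : T ∈ ThetaSet r B A) (p : ℤ) :
    ∑ᶠ j, refinement (A - theta T) T p j = deltaSize B p := by
  obtain ⟨h1, h2, h3⟩ := hT
  have hsymm : ∀ i, B (-i - 1) (-i) = B (i + 1) i := fun i => by
    rw [← hB.symm (i + 1)]; congr 1; ring
  obtain ⟨i, rfl | rfl | rfl⟩ := exists_pred_self_succ p
  · rw [refinement_pred, deltaSize_pred, ← h3]; rfl
  · rw [refinement_self, deltaSize_self]
    have := rowSum_sub hA.toIsTheta h1.theta i
    rw [rowSum_theta h1, rowSum_eq_of_rowC hA hB htri hAB, h3, h3, hsymm] at this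
    rw [rowSum] at this
    rw [this]
    ring
  · rw [refinement_succ, deltaSize_succ, finsum_neg_index, ← hsymm, ← h3]; rfl

theorem colSum_refinement (hA : IsXi r d A) (hT : IsTheta r T) (hTA : ∀ i j, theta T i j ≤ A i j)
    (j : ℤ) : ∑ᶠ p, refinement (A - theta T) T p j = ∑ᶠ i, A i j := by
  have hM := hA.toIsTheta.sub hT.theta hTA
  have hF := refinement_isCellMatrix hT hM fun i j => by
    simp only [Pi.sub_apply, hA.symm, theta_neg]
  have hs : ∀ u : ℤ → ℤ, Function.Injective u → {i | refinement (A - theta T) T (u i) j ≠ 0}.Finite :=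
    fun u hu => (hF.finite_col j).preimage (f := u) hu.injOn
  have f0 := hs (fun i => 3 * i - 1) fun a b h => by simp only at h; omega
  have f1 := hs (fun i => 3 * i) fun a b h => by simp only at h; omega
  have f2 := hs (fun i => 3 * i + 1) fun a b h => by simp only at h; omega
  rw [finsum_three (hF.finite_col j), ← finsum_add_distrib f0 f1, ← finsum_add_distrib ?_ f2]
  · refine finsum_congr fun i => ?_
    rw [cell_refinement_sum]
    simp
  · exact (f0.union f1).subset (Function.support_add _ _)

/-- The length of `w_{A,T}`, up to the length of `A`. -/
theorem lenMat_add_lenFibre (hd : 2 ≤ d) (hA : IsXi r d A) (hB : IsXi r d B)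
    (htri : IsTridiagonal B) (hAB : rowC r A = colC r B) (hT : T ∈ ThetaSet r B A) :
    (4 * (lenMat r d A + lenFibre r d B A T) : ℤ) =
      2 * cornerCount (3 * (2 * r + 2)) (refinement (A - theta T) T) -
        2 * (centSum (refinement (A - theta T) T) 0 0 +
          centSum (refinement (A - theta T) T) (3 * (r + 1)) (r + 1)) := by
  have hδ := hB.isComp_delta htri
  have hν := hA.isComp_colC
  have hμ := hA.isComp
  have hη : ∀ x, blockIdx r d (rowC r A) x = (blockIdx (3 * r + 2) d (delta r B) x + 1) / 3 :=
    fun x => by rw [hAB, blockIdx_colC hB htri]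
  have hγ : ∀ j, {x | blockIdx r d (colC r A) x = j}.Finite := blockIdx_fibre_finite r d _
  have hM := hA.toIsTheta.sub hT.1.theta hT.2.1
  have hF := refinement_isCellMatrix hT.1 hM fun i j => by
    simp only [Pi.sub_apply, hA.symm, theta_neg]
  set F := refinement (A - theta T) T with hFdef
  -- minimal elements with the refined matrix
  have hval : ∀ g ∈ weyl d,
      (∀ x ∈ parabolic (3 * r + 2) d (delta r B), ∀ y ∈ parabolic r d (colC r A),
        len d g ≤ len d (x * g * y)) →
      cell (blockIdx (3 * r + 2) d (delta r B)) (blockIdx r d (colC r A)) g = F →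
      (4 * len d g : ℤ) = 2 * cornerCount (3 * (2 * r + 2)) F -
        2 * (centSum F 0 0 + centSum F (3 * (r + 1)) (r + 1)) := by
    intro g hg hmin hcell
    obtain ⟨m1, m2⟩ := blockMono_of_minimal hd hδ hν hg hmin
    have h := fourLen_of_blockMono hδ hν hg m1 m2
    rw [hcell, ← four_mul_len hd hg] at h
    push_cast at h
    rw [h]
    congr 3
    ring_nf
  -- Every `w` in a fibre gives a product `w * g₂` with the refined matrix, and lengths add because
  -- `w` preserves the blocks of `row_c(A)`.
  have hfib : ∀ g₂ w, IsRep r d A g₂ → InFibre r d B A T g₂ w →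
      w * g₂ ∈ weyl d ∧ len d (w * g₂) = len d w + lenMat r d A ∧
      cell (blockIdx (3 * r + 2) d (delta r B)) (blockIdx r d (colC r A)) (w * g₂) = F := by
    intro g₂ w hg₂ hw
    obtain ⟨w1, w2⟩ := (mem_parabolic_iff hd hμ w).1 hw.1
    have hl := len_mul_of_parabolic hd hμ hg₂.1 w1 w2 (hg₂.blockMono hd hA).2
    refine ⟨mul_mem w1 hg₂.1, ?_, ?_⟩
    · have h1 := four_mul_lenMat hd hA
      have h2 := four_mul_len_of_isRep hd hA hg₂
      rw [← h1] at h2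
      omega
    · refine cell_eq_refinement hη hγ hδ.blockIdx_neg hν.blockIdx_neg (mul_mem w1 hg₂.1) ?_ ?_
      · refine Eq.trans ?_ (hg₂.cell_eq hA)
        ext i j
        simp only [cell, Equiv.Perm.mul_apply, w2]
      · intro i j
        rw [hw.2.2 i j, cell_eq_ncard hδ hν]
  obtain ⟨g₀, hg₀, hcell₀⟩ := exists_cell_eq hδ hν hF
    (fun p => by rw [hB.blockSize_delta htri, rowSum_refinement hA hB htri hAB hT])
    (fun j => by rw [hA.blockSize_colC, colSum_refinement hA hT.1 hT.2.1])
  -- Conversely, start from a minimal `g` with the refined matrix; the candidate for `w_{A,T}` is `g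
  -- * g₂⁻¹`.
  obtain ⟨g, hg, hmin, hcell, -⟩ := exists_minimal hd hδ hν hg₀
  have hcell' : cell (blockIdx (3 * r + 2) d (delta r B)) (blockIdx r d (colC r A)) g = F := by
    ext i j; rw [hcell, hcell₀]
  obtain ⟨g₂, hg₂⟩ := exists_isRep hd hA
  obtain ⟨m1, m2⟩ := blockMono_of_minimal hd hδ hν hg hmin
  have hηm : Monotone (blockIdx r d (rowC r A)) := hμ.blockIdx_mono
  -- On each column block both `g` and `g₂` have monotone coarse block index with fibres of the same
  -- sizes, since the refined matrix coarsens to `A`. They therefore agree pointwise, and `g * g₂⁻¹`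
  -- preserves the blocks of `row_c(A)`.
  have heq : ∀ y, blockIdx r d (rowC r A) (g y) = blockIdx r d (rowC r A) (g₂ y) := by
    intro y
    have hmon : ∀ u : Equiv.Perm ℤ, BlockMono (blockIdx r d (colC r A)) u →
        MonotoneOn (fun z => blockIdx r d (rowC r A) (u z))
          {z | blockIdx r d (colC r A) z = blockIdx r d (colC r A) y} := by
      intro u hu z hz z' hz' hzz
      rcases hzz.eq_or_lt with rfl | hlt
      · exact le_rfl
      · exact hηm (hu z z' (hz.trans hz'.symm) hlt).le
    refine eqOn_of_fibres (hγ _) (hmon g m1) (hmon g₂ (hg₂.blockMono hd hA).1) (fun i => ?_)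
      (show y ∈ {z | blockIdx r d (colC r A) z = blockIdx r d (colC r A) y} from rfl)
    have h1 : cell (blockIdx r d (rowC r A)) (blockIdx r d (colC r A)) g i
          (blockIdx r d (colC r A) y) =
        cell (blockIdx r d (rowC r A)) (blockIdx r d (colC r A)) g₂ i
          (blockIdx r d (colC r A) y) := by
      rw [cell_three hη hγ, hcell', cell_refinement_sum, hg₂.cell_eq hA]
      simp
    simp only [cell, Nat.cast_inj] at h1
    simpa only [Set.mem_ofPred_eq, and_comm] using h1
  have hw : g * g₂⁻¹ ∈ parabolic r d (rowC r A) :=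
    (mem_parabolic_iff hd hμ _).2 ⟨mul_mem hg (inv_mem hg₂.1), fun x => by
      rw [Equiv.Perm.mul_apply, heq, perm_apply_inv]⟩
  obtain ⟨w1, w2⟩ := (mem_parabolic_iff hd hμ _).1 hw
  have hin : InFibre r d B A T g₂ (g * g₂⁻¹) := by
    refine ⟨hw, le_len_mul_of_blockMono_inv hd hδ w1 ?_, fun i j => ?_⟩
    · intro x y hxy hlt
      have h1 := m2 x y hxy hlt
      rw [mul_inv_rev, inv_inv, Equiv.Perm.mul_apply, Equiv.Perm.mul_apply]
      -- the images lie in the same block of the composition of `A`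
      by_contra hcon
      have h2 : blockIdx r d (rowC r A) (g₂ (g⁻¹ x)) = blockIdx r d (rowC r A) (g₂ (g⁻¹ y)) := by
        rw [← heq, ← heq, perm_apply_inv, perm_apply_inv, hη, hη, hxy]
      have h3 : g₂ (g⁻¹ y) < g₂ (g⁻¹ x) := (not_lt.1 hcon).lt_of_ne fun h =>
        h1.ne' (g₂.injective h)
      have h4 := (hg₂.blockMono hd hA).2 _ _ h2.symm h3
      rw [perm_inv_apply, perm_inv_apply] at h4
      exact lt_asymm h1 h4
    · rw [inv_mul_cancel_right, cell_eq_ncard hδ hν, hcell', hFdef, refinement_pred]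
  have hl := (hfib g₂ _ hg₂ hin).2.1
  rw [inv_mul_cancel_right] at hl
  have hle : lenFibre r d B A T ≤ len d (g * g₂⁻¹) := Nat.sInf_le ⟨g₂, _, hg₂, hin, rfl⟩
  -- For the lower bound take an element of the fibre with minimal length. A minimal element of the
  -- double coset of `w' * g₂'` has the refined matrix too, hence the same length as `g`.
  obtain ⟨g₂', w', h1, h2, h3⟩ := Nat.sInf_mem
    (s := {m | ∃ g₂ w, IsRep r d A g₂ ∧ InFibre r d B A T g₂ w ∧ len d w = m})
    ⟨_, g₂, _, hg₂, hin, rfl⟩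
  obtain ⟨k1, k2, k3⟩ := hfib g₂' w' h1 h2
  obtain ⟨g', hg', hmin', hcell'', hlen'⟩ := exists_minimal hd hδ hν k1
  have v1 := hval g hg hmin hcell'
  have v2 := hval g' hg' hmin' (by ext i j; rw [hcell'', k3])
  rw [← v1] at v2 ⊢
  change len d w' = lenFibre r d B A T at h3
  omega

end

end AffineC

/-! ### Bilinear forms of sequences and the exponent of a row -/

namespace AffineC

/-! ### Bilinear expressions in sequences -/

/-- The sum of `u j * w l` over `l < j`. -/
noncomputable def inv (u w : ℤ → ℤ) : ℤ := ∑ᶠ j, u j * cum w j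

/-- The sum of `u j * w j`. -/
noncomputable def dot (u w : ℤ → ℤ) : ℤ := ∑ᶠ j, u j * w j

/-- The sum of a sequence. -/
noncomputable def total (u : ℤ → ℤ) : ℤ := ∑ᶠ j, u j

section

variable {u u' w w' : ℤ → ℤ}

theorem finite_mul_left (hu : u.support.Finite) (f : ℤ → ℤ) :
    (Function.support fun j => u j * f j).Finite :=
  hu.subset fun j hj h => hj (by simp only [h, zero_mul])

theorem finite_add (hu : u.support.Finite) (hw : w.support.Finite) : (u + w).support.Finite :=
  (hu.union hw).subset (Function.support_add _ _)

theorem finite_sub (hu : u.support.Finite) (hw : w.support.Finite) : (u - w).support.Finite :=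
  (hu.union hw).subset (Function.support_sub _ _)

theorem cum_plus (hw : w.support.Finite) (hw' : w'.support.Finite) (j : ℤ) :
    cum (w + w') j = cum w j + cum w' j :=
  finsum_mem_add_distrib' (hw.subset fun _ h => h.2) (hw'.subset fun _ h => h.2)

theorem cum_sub (hw : w.support.Finite) (hw' : w'.support.Finite) (j : ℤ) :
    cum (w - w') j = cum w j - cum w' j := by
  have := cum_plus (finite_sub hw hw') hw' j
  rw [sub_add_cancel] at this
  linarith

theorem inv_add_left (hu : u.support.Finite) (hu' : u'.support.Finite) (w : ℤ → ℤ) :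
    inv (u + u') w = inv u w + inv u' w := by
  rw [inv, inv, inv, ← finsum_add_distrib (finite_mul_left hu _) (finite_mul_left hu' _)]
  exact finsum_congr fun j => add_mul _ _ _

theorem inv_sub_left (hu : u.support.Finite) (hu' : u'.support.Finite) (w : ℤ → ℤ) :
    inv (u - u') w = inv u w - inv u' w := by
  have := inv_add_left (finite_sub hu hu') hu' w
  rw [sub_add_cancel] at this
  linarith

theorem inv_add_right (hu : u.support.Finite) (hw : w.support.Finite) (hw' : w'.support.Finite) :
    inv u (w + w') = inv u w + inv u w' := by
  rw [inv, inv, inv, ← finsum_add_distrib (finite_mul_left hu _) (finite_mul_left hu _)]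
  exact finsum_congr fun j => by rw [cum_plus hw hw', mul_add]

theorem inv_sub_right (hu : u.support.Finite) (hw : w.support.Finite) (hw' : w'.support.Finite) :
    inv u (w - w') = inv u w - inv u w' := by
  have := inv_add_right hu (finite_sub hw hw') hw'
  rw [sub_add_cancel] at this
  linarith

theorem dot_add_left (hu : u.support.Finite) (hu' : u'.support.Finite) (w : ℤ → ℤ) :
    dot (u + u') w = dot u w + dot u' w := by
  rw [dot, dot, dot, ← finsum_add_distrib (finite_mul_left hu _) (finite_mul_left hu' _)]
  exact finsum_congr fun j => add_mul _ _ _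

theorem dot_sub_left (hu : u.support.Finite) (hu' : u'.support.Finite) (w : ℤ → ℤ) :
    dot (u - u') w = dot u w - dot u' w := by
  have := dot_add_left (finite_sub hu hu') hu' w
  rw [sub_add_cancel] at this
  linarith

theorem dot_comm (u w : ℤ → ℤ) : dot u w = dot w u := finsum_congr fun _ => mul_comm _ _

theorem dot_add_right (u : ℤ → ℤ) (hw : w.support.Finite) (hw' : w'.support.Finite) :
    dot u (w + w') = dot u w + dot u w' := by
  rw [dot_comm, dot_add_left hw hw', dot_comm w, dot_comm w']

theorem dot_sub_right (u : ℤ → ℤ) (hw : w.support.Finite) (hw' : w'.support.Finite) :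
    dot u (w - w') = dot u w - dot u w' := by
  rw [dot_comm, dot_sub_left hw hw', dot_comm w, dot_comm w']

theorem total_add (hu : u.support.Finite) (hu' : u'.support.Finite) :
    total (u + u') = total u + total u' := finsum_add_distrib hu hu'

theorem total_sub (hu : u.support.Finite) (hu' : u'.support.Finite) :
    total (u - u') = total u - total u' := finsum_sub_distrib hu hu'

theorem sum_Ico_int_sub (f : ℤ → ℤ) (a : ℤ) (n : ℕ) :
    ∑ j ∈ Finset.Ico a (a + n), (f (j + 1) - f j) = f (a + n) - f a := by
  induction n with
  | zero => simp
  | succ n ih =>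
    have : Finset.Ico a (a + (n + 1 : ℕ)) = insert (a + n) (Finset.Ico a (a + n)) := by
      ext j; simp only [Finset.mem_Ico, Finset.mem_insert]; push_cast; omega
    rw [this, Finset.sum_insert (by simp), ih]
    push_cast
    rw [add_assoc]
    ring

/-- Summation by parts: the difference of `cum u * cum w` at consecutive places is the sum of the
three summands on the left. -/
theorem inv_add_inv (hu : u.support.Finite) (hw : w.support.Finite) :
    inv u w + inv w u + dot u w = total u * total w := by
  obtain ⟨M, h1, h2⟩ := cum_eventually hu
  obtain ⟨M', h1', h2'⟩ := cum_eventually hw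
  obtain ⟨m, hm⟩ := exists_bound_of_finite hu
  obtain ⟨m', hm'⟩ := exists_bound_of_finite hw
  obtain ⟨N, hN⟩ : ∃ N : ℕ, M ≤ N ∧ M' ≤ N ∧ m ≤ N ∧ m' ≤ N :=
    ⟨(max (max M M') (max m m')).toNat, by omega⟩
  have hsub : ∀ f : ℤ → ℤ, (∀ j, f j ≠ 0 → u j ≠ 0 ∨ w j ≠ 0) →
      ∑ᶠ j, f j = ∑ j ∈ Finset.Ico (-(N : ℤ)) (-N + (2 * N : ℕ)), f j := by
    intro f hf
    refine finsum_eq_sum_of_support_subset _ fun j hj => ?_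
    rw [Finset.coe_Ico, Set.mem_Ico]
    rcases hf j hj with h | h
    · have := abs_lt.1 (hm j h)
      push_cast; omega
    · have := abs_lt.1 (hm' j h)
      push_cast; omega
  rw [inv, inv, dot, hsub _ fun j h => Or.inl (left_ne_zero_of_mul h),
    hsub _ fun j h => Or.inr (left_ne_zero_of_mul h),
    hsub _ fun j h => Or.inl (left_ne_zero_of_mul h), ← Finset.sum_add_distrib,
    ← Finset.sum_add_distrib]
  have := sum_Ico_int_sub (fun j => cum u j * cum w j) (-N) (2 * N)
  rw [h1 (-N) (by omega), h2 (-N + (2 * N : ℕ)) (by push_cast; omega),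
    h2' (-N + (2 * N : ℕ)) (by push_cast; omega), zero_mul, sub_zero] at this
  rw [total, total, ← this]
  refine Finset.sum_congr rfl fun j _ => ?_
  rw [cum_succ hu, cum_succ hw]
  ring

/-- Reflection reverses the order of the places and so exchanges the two arguments. -/
theorem inv_neg (hu : u.support.Finite) (hw : w.support.Finite) :
    inv (fun j => u (-j)) (fun j => w (-j)) = inv w u := by
  have h : inv (fun j => u (-j)) (fun j => w (-j)) =
      ∑ᶠ j, (u j * total w - u j * cum w j - u j * w j) := by
    rw [inv, ← finsum_neg_index]
    refine finsum_congr fun j => ?_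
    rw [cum_neg hw, cum_succ hw, neg_neg, total]
    ring
  have h3 := finite_mul_left hu (fun _ => total w)
  have h4 := finite_mul_left hu (cum w)
  have h5 := finite_mul_left hu w
  have h34 : (Function.support fun j => u j * total w - u j * cum w j).Finite := finite_sub h3 h4
  rw [finsum_sub_distrib h34 h5, finsum_sub_distrib h3 h4, ← finsum_mul] at h
  have := inv_add_inv hu hw
  rw [h]
  change total u * total w - inv u w - dot u w = _
  linarith

theorem finsum_Iic (hu : u.support.Finite) (j : ℤ) : ∑ᶠ k ∈ Set.Iic j, u k = cum u j + u j := by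
  have : Set.Iic j = Set.Iio (j + 1) := by ext; simp only [Set.mem_Iic, Set.mem_Iio]; omega
  rw [← cum_succ hu, cum, this]

theorem finsum_Ici (hu : u.support.Finite) (j : ℤ) : ∑ᶠ k ∈ Set.Ici j, u k = total u - cum u j := by
  have h : ∑ᶠ k, u k = ∑ᶠ k ∈ Set.Iio j ∪ Set.Ici j, u k := by
    rw [Set.Iio_union_Ici]; simp
  rw [finsum_mem_union' ?_ (hu.subset fun _ h => h.2) (hu.subset fun _ h => h.2)] at h
  · rw [total, h, cum]; ring
  · rw [Set.disjoint_left]; intro k h1 h2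
    simp only [Set.mem_Iio, Set.mem_Ici] at *
    omega

/-- The exponent attached to a row. -/
noncomputable def rowExp (a c s s' : ℤ → ℤ) : ℤ :=
  inv c a + dot (c - s') a + (inv (c - s') s - inv (c - s') s' - dot (c - s') s') +
    ∑ᶠ j, s' j * (s' j - 1) / 2

theorem two_mul_finsum_choose (hu : u.support.Finite) :
    2 * ∑ᶠ j, u j * (u j - 1) / 2 = dot u u - total u := by
  have h : (Function.support fun j => u j * (u j - 1) / 2).Finite :=
    hu.subset fun j hj h => hj (by simp only [h]; norm_num)
  rw [mul_finsum, dot, total, ← finsum_sub_distrib (finite_mul_left hu _) hu]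
  refine finsum_congr fun j => ?_
  have := Int.even_mul_pred_self (u j)
  rw [Int.mul_ediv_cancel' this.two_dvd]
  ring

theorem two_mul_finsum_choose' (hu : u.support.Finite) :
    2 * ∑ᶠ j, u j * (u j + 1) / 2 = dot u u + total u := by
  have h : (Function.support fun j => u j * (u j + 1) / 2).Finite :=
    hu.subset fun j hj h => hj (by simp only [h]; norm_num)
  rw [mul_finsum, dot, total, ← finsum_add_distrib (finite_mul_left hu _) hu]
  refine finsum_congr fun j => ?_
  have := Int.even_mul_succ_self (u j)
  rw [Int.mul_ediv_cancel' this.two_dvd]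
  ring

/-- The row-wise discrepancy of the two exponents. Here `t`, `c` are rows of `T` and of its
reflection, `s`, `s'` are rows of `S` and `S^†`, and `total t * total c` is the share of `ℓ(B)`;
`total s` and the bracket are the shares of `n(S)` and `h(S,T)`. Everything expands into `inv`,
`dot` and `total`, and the identity then follows linearly from `inv_add_inv`, symmetry of `dot` and
`total s = total s'`. -/
theorem row_exponent {t c s s' : ℤ → ℤ} (ht : t.support.Finite) (hc : c.support.Finite)
    (hs : s.support.Finite) (hs' : s'.support.Finite) (htot : total s = total s') :
    inv c t - inv (t - s + s') (c - s' + s) + total t * total c =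
      rowExp (t - s + s') c s s' + total s +
        ((∑ᶠ j, (s j * (∑ᶠ k ∈ Set.Iic j, t k) - s j * (s j + 1) / 2)) +
        ∑ᶠ j, (c j - s' j) * ((∑ᶠ k ∈ Set.Iic (j - 1), t k) + (∑ᶠ k ∈ Set.Ici j, s k) -
          ∑ᶠ k ∈ Set.Ici (j + 1), s' k)) := by
  have e1 : ∑ᶠ j, (s j * (∑ᶠ k ∈ Set.Iic j, t k) - s j * (s j + 1) / 2) =
      inv s t + dot s t - ∑ᶠ j, s j * (s j + 1) / 2 := by
    have h : (Function.support fun j => s j * (s j + 1) / 2).Finite :=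
      hs.subset fun j hj h => hj (by simp only [h]; norm_num)
    rw [finsum_sub_distrib (finite_mul_left hs _) h, inv, dot,
      ← finsum_add_distrib (finite_mul_left hs _) (finite_mul_left hs _)]
    congr 1
    refine finsum_congr fun j => ?_
    rw [finsum_Iic ht]
    ring
  have hcs := finite_sub hc hs'
  have e2 : ∑ᶠ j, (c j - s' j) * ((∑ᶠ k ∈ Set.Iic (j - 1), t k) + (∑ᶠ k ∈ Set.Ici j, s k) -
          ∑ᶠ k ∈ Set.Ici (j + 1), s' k) =
      inv (c - s') t - inv (c - s') s + inv (c - s') s' + dot (c - s') s' := by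
    have k1 := finite_mul_left hcs (cum t)
    have k2 := finite_mul_left hcs (cum s)
    have k3 := finite_mul_left hcs (cum s')
    have k4 : (Function.support fun j => (c - s') j * cum t j - (c - s') j * cum s j).Finite :=
      finite_sub k1 k2
    have k5 : (Function.support fun j => (c - s') j * cum t j - (c - s') j * cum s j +
      (c - s') j * cum s' j).Finite := finite_add k4 k3
    rw [inv, inv, inv, dot, ← finsum_sub_distrib k1 k2, ← finsum_add_distrib k4 k3,
      ← finsum_add_distrib k5 (finite_mul_left hcs _)]
    refine finsum_congr fun j => ?_
    have : Set.Iic (j - 1) = Set.Iio j := by ext; simp only [Set.mem_Iic, Set.mem_Iio]; omega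
    rw [this, finsum_Ici hs, finsum_Ici hs', cum_succ hs', htot, Pi.sub_apply]
    change (c j - s' j) * (cum t j + _ - _) = _
    ring
  have e3 := two_mul_finsum_choose hs'
  have e4 := two_mul_finsum_choose' hs
  rw [e1, e2, rowExp]
  have hts := finite_sub ht hs
  have r1 := inv_add_inv ht hc
  have r2 := inv_add_inv hs hc
  have r3 := inv_add_inv hs' hc
  have r4 := inv_add_inv hs ht
  have r5 := inv_add_inv hs' ht
  have r6 := inv_add_inv hs hs'
  have r7 := inv_add_inv hs hs
  have r8 := inv_add_inv hs' hs'
  have d1 := dot_comm s s'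
  have d2 := dot_comm s t
  have d3 := dot_comm s' t
  have d4 := dot_comm s c
  have d5 := dot_comm s' c
  have d6 := dot_comm t c
  simp only [inv_add_left hts hs', inv_sub_left ht hs, inv_sub_left hc hs', inv_add_right, inv_sub_right,
    dot_sub_left hc hs', dot_add_right _ hts hs', dot_sub_right _ ht hs, ht, hc, hs, hs', hts, hcs] at *
  rw [htot] at *
  linarith

end

end AffineC

/-! ### Corner sums and central sums of interleaved matrices -/

namespace AffineC

/-! ### Corner sums -/

/-- Every corner of `M` has finitely many nonzero entries. -/
def CornerFinite (M : ℤ → ℤ → ℤ) : Prop :=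
  ∀ i j, {p : ℤ × ℤ | (i < p.1 ∧ p.2 < j) ∧ M p.1 p.2 ≠ 0}.Finite

/-- The contribution of a row to `cornerCount`. -/
noncomputable def rowCorner (M : ℤ → ℤ → ℤ) (i : ℤ) : ℤ := ∑ᶠ j, M i j * cornerSum M (i, j)

section

variable {r d : ℕ} {M N U V W T : ℤ → ℤ → ℤ}

theorem IsTheta.cornerFinite (hT : IsTheta r T) : CornerFinite T := by
  intro i j
  obtain ⟨m, hm⟩ := hT.band
  refine ((Set.finite_Icc i (j + m)).prod (Set.finite_Icc (i - m) j)).subset ?_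
  rintro ⟨a, b⟩ ⟨⟨h1, h2⟩, h3⟩
  have := abs_le.1 (hm a b h3)
  simp only at h1 h2
  refine Set.mem_prod.2 ⟨Set.mem_Icc.2 ?_, Set.mem_Icc.2 ?_⟩ <;> simp only <;> omega

theorem CornerFinite.add (hM : CornerFinite M) (hN : CornerFinite N) : CornerFinite (M + N) := by
  intro i j
  refine ((hM i j).union (hN i j)).subset ?_
  rintro p ⟨h1, h2⟩
  by_cases h : M p.1 p.2 = 0
  · exact Or.inr ⟨h1, fun h' => h2 (by simp only [Pi.add_apply, h, h', add_zero])⟩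
  · exact Or.inl ⟨h1, h⟩

theorem CornerFinite.interleave (hU : CornerFinite U) (hV : CornerFinite V) (hW : CornerFinite W) :
    CornerFinite (interleave U V W) := by
  intro i j
  have h1 := (hU ((i - 2) / 3 - 1) j).image fun p => (3 * p.1, p.2)
  have h2 := (hV ((i - 2) / 3 - 1) j).image fun p => (3 * p.1 + 1, p.2)
  have h3 := (hW ((i - 2) / 3 - 1) j).image fun p => (3 * p.1 + 2, p.2)
  refine ((h1.union h2).union h3).subset ?_
  rintro ⟨p, q⟩ ⟨⟨k1, k2⟩, k3⟩
  simp only at k1 k2 k3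
  obtain ⟨k, rfl | rfl | rfl⟩ := exists_mod_three p
  · rw [interleave_zero] at k3
    exact Or.inl (Or.inl ⟨(k, q), ⟨⟨by simp only; omega, k2⟩, k3⟩, rfl⟩)
  · rw [interleave_one] at k3
    exact Or.inl (Or.inr ⟨(k, q), ⟨⟨by simp only; omega, k2⟩, k3⟩, rfl⟩)
  · rw [interleave_two] at k3
    exact Or.inr ⟨(k, q), ⟨⟨by simp only; omega, k2⟩, k3⟩, rfl⟩

theorem cornerSum_pred (hM : CornerFinite M) (i j : ℤ) :
    cornerSum M (i - 1, j) = cum (M i) j + cornerSum M (i, j) := by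
  have e : {p : ℤ × ℤ | i - 1 < p.1 ∧ p.2 < j} =
      (Prod.mk i '' Set.Iio j) ∪ {p | i < p.1 ∧ p.2 < j} := by
    ext ⟨a, b⟩
    simp only [Set.mem_ofPred_eq, Set.mem_union, Set.mem_image, Set.mem_Iio, Prod.mk.injEq]
    constructor
    · intro h
      by_cases ha : a = i
      · exact Or.inl ⟨b, h.2, ha.symm, rfl⟩
      · exact Or.inr ⟨by omega, h.2⟩
    · rintro (⟨b, h, rfl, rfl⟩ | h)
      · exact ⟨by omega, h⟩
      · exact ⟨by omega, h.2⟩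
  have hsub : (Prod.mk i '' Set.Iio j) ⊆ {p : ℤ × ℤ | i - 1 < p.1 ∧ p.2 < j} :=
    e ▸ Set.subset_union_left
  have hdis : Disjoint (Prod.mk i '' Set.Iio j) {p : ℤ × ℤ | i < p.1 ∧ p.2 < j} := by
    rw [Set.disjoint_left]
    rintro _ ⟨b, -, rfl⟩ ⟨h, -⟩
    exact lt_irrefl _ h
  have hu := finsum_mem_union' (f := fun p : ℤ × ℤ => M p.1 p.2) hdis
    ((hM (i - 1) j).subset fun p hp => ⟨hsub hp.1, hp.2⟩) (hM i j)
  rw [cornerSum]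
  refine (finsum_mem_congr e fun _ _ => rfl).trans (hu.trans ?_)
  rw [finsum_mem_image fun a _ b _ h => by simpa using h]
  rfl

theorem cornerSum_eventually (hM : CornerFinite M) (i₀ j : ℤ) :
    ∃ m, i₀ ≤ m ∧ ∀ i, m ≤ i → cornerSum M (i, j) = 0 := by
  obtain ⟨m, hm⟩ := ((hM i₀ j).image Prod.fst).bddAbove
  refine ⟨max m i₀, le_max_right _ _, fun i hi => finsum_mem_eq_zero_of_forall_eq_zero fun p hp => ?_⟩
  by_contra hcon
  have h1 : i < p.1 := hp.1
  have := hm ⟨p, ⟨⟨by omega, hp.2⟩, hcon⟩, rfl⟩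
  omega

/-- Three rows of the interleaved matrix add to a corner what one row of `U + V + W` adds. Both
corners vanish far down, so they agree at the end of each triple; inside a triple the rows still
below contribute their partial sums. -/
theorem cornerSum_interleave (hU : CornerFinite U) (hV : CornerFinite V) (hW : CornerFinite W)
    (fU : ∀ i, (U i).support.Finite) (fV : ∀ i, (V i).support.Finite)
    (fW : ∀ i, (W i).support.Finite) (i j : ℤ) :
    cornerSum (interleave U V W) (3 * i + 2, j) = cornerSum (U + V + W) (i, j) ∧
    cornerSum (interleave U V W) (3 * i + 1, j) = cum (W i) j + cornerSum (U + V + W) (i, j) ∧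
    cornerSum (interleave U V W) (3 * i, j) =
      cum (V i) j + cum (W i) j + cornerSum (U + V + W) (i, j) := by
  have hF := hU.interleave hV hW
  have hN := (hU.add hV).add hW
  have r0 : ∀ k, interleave U V W (3 * k) = U k := fun k => by ext; rw [interleave_zero]
  have r1 : ∀ k, interleave U V W (3 * k + 1) = V k := fun k => by ext; rw [interleave_one]
  have r2 : ∀ k, interleave U V W (3 * k + 2) = W k := fun k => by ext; rw [interleave_two]
  have s2 : ∀ k, cornerSum (interleave U V W) (3 * k + 1, j) =
      cum (W k) j + cornerSum (interleave U V W) (3 * k + 2, j) := fun k => by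
    have := cornerSum_pred hF (3 * k + 2) j
    rwa [show 3 * k + 2 - 1 = 3 * k + 1 by ring, r2] at this
  have s1 : ∀ k, cornerSum (interleave U V W) (3 * k, j) =
      cum (V k) j + cornerSum (interleave U V W) (3 * k + 1, j) := fun k => by
    have := cornerSum_pred hF (3 * k + 1) j
    rwa [show 3 * k + 1 - 1 = 3 * k by ring, r1] at this
  have s0 : ∀ k, cornerSum (interleave U V W) (3 * (k - 1) + 2, j) =
      cum (U k) j + cornerSum (interleave U V W) (3 * k, j) := fun k => by
    have := cornerSum_pred hF (3 * k) j
    rwa [show 3 * k - 1 = 3 * (k - 1) + 2 by ring, r0] at this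
  have hmain : cornerSum (interleave U V W) (3 * i + 2, j) = cornerSum (U + V + W) (i, j) := by
    obtain ⟨m, hm0, hm⟩ := cornerSum_eventually hF 0 j
    obtain ⟨m', hm0', hm'⟩ := cornerSum_eventually hN 0 j
    -- The bounds `m`, `m'` were taken nonnegative so that `3 * m + 2 ≥ m` is again in the range
    -- where the corner vanishes.
    have hdown : ∀ k : ℕ, cornerSum (interleave U V W) (3 * (max (max m m') i - k) + 2, j) =
        cornerSum (U + V + W) (max (max m m') i - k, j) := by
      intro k
      induction k with
      | zero => rw [hm _ (by push_cast; omega), hm' _ (by push_cast; omega)]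
      | succ k ih =>
        have e : max (max m m') i - ((k + 1 : ℕ) : ℤ) = max (max m m') i - k - 1 := by
          push_cast; ring
        rw [e, s0, s1, s2, ih, cornerSum_pred hN]
        change _ = cum (U _ + V _ + W _) j + _
        rw [cum_plus (finite_add (fU _) (fV _)) (fW _), cum_plus (fU _) (fV _)]
        ring
    have := hdown (max (max m m') i - i).toNat
    rwa [show max (max m m') i - ((max (max m m') i - i).toNat : ℤ) = i by omega] at this
  refine ⟨hmain, ?_, ?_⟩
  · rw [s2, hmain]
  · rw [s1, s2, hmain]
    ring

/-- Corner pairs with rows in different triples are the corner pairs of the sum; those inside one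
triple give the three inversion forms. -/
theorem rowCorner_interleave (hU : CornerFinite U) (hV : CornerFinite V) (hW : CornerFinite W)
    (fU : ∀ i, (U i).support.Finite) (fV : ∀ i, (V i).support.Finite)
    (fW : ∀ i, (W i).support.Finite) (i : ℤ) :
    rowCorner (interleave U V W) (3 * i) + rowCorner (interleave U V W) (3 * i + 1) +
        rowCorner (interleave U V W) (3 * i + 2) =
      rowCorner (U + V + W) i + inv (U i) (V i + W i) + inv (V i) (W i) := by
  have hc := fun j => cornerSum_interleave hU hV hW fU fV fW i j
  have a1 : rowCorner (interleave U V W) (3 * i) =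
      inv (U i) (V i + W i) + ∑ᶠ j, U i j * cornerSum (U + V + W) (i, j) := by
    rw [rowCorner, inv, ← finsum_add_distrib (finite_mul_left (fU i) _) (finite_mul_left (fU i) _)]
    refine finsum_congr fun j => ?_
    rw [(hc j).2.2, interleave_zero, cum_plus (fV i) (fW i)]
    ring
  have a2 : rowCorner (interleave U V W) (3 * i + 1) =
      inv (V i) (W i) + ∑ᶠ j, V i j * cornerSum (U + V + W) (i, j) := by
    rw [rowCorner, inv, ← finsum_add_distrib (finite_mul_left (fV i) _) (finite_mul_left (fV i) _)]
    refine finsum_congr fun j => ?_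
    rw [(hc j).2.1, interleave_one]
    ring
  have a3 : rowCorner (interleave U V W) (3 * i + 2) =
      ∑ᶠ j, W i j * cornerSum (U + V + W) (i, j) :=
    finsum_congr fun j => by rw [(hc j).1, interleave_two]
  have a4 : rowCorner (U + V + W) i = (∑ᶠ j, U i j * cornerSum (U + V + W) (i, j)) +
      (∑ᶠ j, V i j * cornerSum (U + V + W) (i, j)) +
      ∑ᶠ j, W i j * cornerSum (U + V + W) (i, j) := by
    have k : (Function.support fun j => U i j * cornerSum (U + V + W) (i, j) +
        V i j * cornerSum (U + V + W) (i, j)).Finite :=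
      finite_add (finite_mul_left (fU i) _) (finite_mul_left (fV i) _)
    rw [← finsum_add_distrib (finite_mul_left (fU i) _) (finite_mul_left (fV i) _),
      ← finsum_add_distrib k (finite_mul_left (fW i) _), rowCorner]
    refine finsum_congr fun j => ?_
    simp only [Pi.add_apply]
    ring
  rw [a1, a2, a3, a4]
  ring

theorem cornerCount_eq_sum (hM : ∀ i, (M i).support.Finite) (n : ℤ) :
    cornerCount n M = ∑ i ∈ Finset.Ico 0 n, rowCorner M i :=
  finsum_window_rows (G := fun p => M p.1 p.2 * cornerSum M p)
    (fun i => finite_mul_left (hM i) fun j => cornerSum M (i, j)) n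

theorem cornerSum_shift (M : ℤ → ℤ → ℤ) (a b i j : ℤ) :
    cornerSum (fun p q => M (p + a) (q + b)) (i, j) = cornerSum M (i + a, j + b) := by
  refine finsum_mem_eq_of_bijOn (fun p : ℤ × ℤ => (p.1 + a, p.2 + b)) ⟨?_, ?_, ?_⟩ fun _ _ => rfl
  · rintro p ⟨h1, h2⟩
    exact ⟨add_lt_add_left h1 a, add_lt_add_left h2 b⟩
  · rintro ⟨p, q⟩ _ ⟨p', q'⟩ _ h
    simpa using h
  · rintro ⟨p, q⟩ ⟨h1, h2⟩
    refine ⟨(p - a, q - b), ⟨?_, ?_⟩, by simp⟩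
    · simp only at *; omega
    · simp only at *; omega

theorem rowCorner_shift (M : ℤ → ℤ → ℤ) (a b i : ℤ) :
    rowCorner (fun p q => M (p + a) (q + b)) i = rowCorner M (i + a) := by
  rw [rowCorner, rowCorner]
  refine (finsum_congr fun j => ?_).trans
    (finsum_comp_equiv (Equiv.addRight b) (f := fun j => M (i + a) j * cornerSum M (i + a, j)))
  rw [cornerSum_shift]
  rfl

theorem rowCorner_add {a b : ℤ} (hM : ∀ i j, M (i + a) (j + b) = M i j) (i : ℤ) :
    rowCorner M (i + a) = rowCorner M i := by
  rw [← rowCorner_shift M a b]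
  simp only [hM]

theorem sum_Ico_three' (f : ℤ → ℤ) (n : ℤ) : ∑ p ∈ Finset.Ico 0 (3 * n), f p =
    ∑ i ∈ Finset.Ico 0 n, (f (3 * i) + f (3 * i + 1) + f (3 * i + 2)) := by
  have e : Finset.Ico 0 (3 * n) =
      ((Finset.Ico 0 n).image fun i => 3 * i) ∪ (((Finset.Ico 0 n).image fun i => 3 * i + 1) ∪
        (Finset.Ico 0 n).image fun i => 3 * i + 2) := by
    ext p
    simp only [Finset.mem_Ico, Finset.mem_union, Finset.mem_image]
    constructor
    · intro h
      obtain ⟨i, rfl | rfl | rfl⟩ := exists_mod_three p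
      · exact Or.inl ⟨i, by omega, rfl⟩
      · exact Or.inr (Or.inl ⟨i, by omega, rfl⟩)
      · exact Or.inr (Or.inr ⟨i, by omega, rfl⟩)
    · rintro (⟨i, h, rfl⟩ | ⟨i, h, rfl⟩ | ⟨i, h, rfl⟩) <;> omega
  rw [e, Finset.sum_union, Finset.sum_union, Finset.sum_image, Finset.sum_image, Finset.sum_image,
    Finset.sum_add_distrib, Finset.sum_add_distrib, add_assoc]
  · intro a _ b _ h; simp only at h; omega
  · intro a _ b _ h; simp only at h; omega
  · intro a _ b _ h; simp only at h; omega
  · rw [Finset.disjoint_left]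
    intro p h1 h2
    simp only [Finset.mem_image] at h1 h2
    obtain ⟨i, -, rfl⟩ := h1
    obtain ⟨i', -, h⟩ := h2
    omega
  · rw [Finset.disjoint_left]
    intro p h1 h2
    simp only [Finset.mem_image, Finset.mem_union] at h1 h2
    obtain ⟨i, -, rfl⟩ := h1
    rcases h2 with ⟨i', -, h⟩ | ⟨i', -, h⟩ <;> omega

/-! ### Central sums -/

/-- A point reflection turns upper right corners into lower left ones. Reflecting rows by `-1 - p`
rather than `-p` maps the triples `3 k, 3 k + 1, 3 k + 2` to such triples again, so that
`cornerSum_interleave` applies. -/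
theorem centSum_eq_cornerSum (M : ℤ → ℤ → ℤ) (s t : ℤ) :
    centSum M s t = cornerSum (fun p q => M (-1 - p) (-q)) (-1 - s, -t) := by
  refine finsum_mem_eq_of_bijOn (fun p : ℤ × ℤ => (-1 - p.1, -p.2)) ⟨?_, ?_, ?_⟩ fun p _ => by simp
  · rintro p ⟨h1, h2⟩
    constructor <;> simp only <;> omega
  · rintro ⟨p, q⟩ _ ⟨p', q'⟩ _ h
    simpa using h
  · rintro ⟨p, q⟩ ⟨h1, h2⟩
    refine ⟨(-1 - p, -q), ⟨?_, ?_⟩, by simp⟩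
    · simp only at *; omega
    · simp only at *; omega

/-- The matrix `(t_{-i,-j})`. -/
def negMat (T : ℤ → ℤ → ℤ) (i j : ℤ) : ℤ := T (-i) (-j)

theorem negMat_negMat (T : ℤ → ℤ → ℤ) : negMat (negMat T) = T := by
  ext i j; simp [negMat]

theorem IsTheta.shift (hT : IsTheta r T) (a : ℤ) : IsTheta r fun i j => T (i + a) j where
  nonneg i j := hT.nonneg _ _
  periodic i j := by rw [add_right_comm, hT.periodic]
  finite_row i := hT.finite_row _

theorem IsTheta.negMat (hT : IsTheta r T) : IsTheta r (negMat T) where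
  nonneg i j := hT.nonneg _ _
  periodic i j := by
    rw [AffineC.negMat, ← hT.periodic, AffineC.negMat]
    congr 1 <;> ring
  finite_row i := finite_neg (hT.finite_row _)

theorem centSum_interleave (hU : IsTheta r U) (hV : IsTheta r V) (hW : IsTheta r W) (s t : ℤ) :
    centSum (interleave U V W) (3 * s) t = centSum (U + V + W) s t := by
  have hf : ∀ {M : ℤ → ℤ → ℤ}, IsTheta r M → IsTheta r fun p q => M (-1 - p) (-q) := fun {M} h => by
    have := (h.shift (-1)).negMat
    have e : (fun p q => M (-1 - p) (-q)) = negMat fun i j => M (i + -1) j := by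
      ext p q; rw [negMat]; congr 1; ring
    rwa [e]
  have := (cornerSum_interleave (hf hW).cornerFinite (hf hV).cornerFinite (hf hU).cornerFinite
    (hf hW).finite_row (hf hV).finite_row (hf hU).finite_row (-1 - s) (-t)).1
  rw [centSum_eq_cornerSum, centSum_eq_cornerSum]
  have e1 : (fun p q => interleave U V W (-1 - p) (-q)) = interleave (fun p q => W (-1 - p) (-q))
      (fun p q => V (-1 - p) (-q)) fun p q => U (-1 - p) (-q) := by
    ext p q
    obtain ⟨k, rfl | rfl | rfl⟩ := exists_mod_three p
    · rw [interleave_zero, show -1 - 3 * k = 3 * (-1 - k) + 2 by ring, interleave_two]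
    · rw [interleave_one, show -1 - (3 * k + 1) = 3 * (-1 - k) + 1 by ring, interleave_one]
    · rw [interleave_two, show -1 - (3 * k + 2) = 3 * (-1 - k) by ring, interleave_zero]
  have e2 : (fun p q => (U + V + W) (-1 - p) (-q)) = (fun p q => W (-1 - p) (-q)) +
      (fun p q => V (-1 - p) (-q)) + fun p q => U (-1 - p) (-q) := by
    ext p q
    simp only [Pi.add_apply]
    ring
  rw [e1, e2, ← this]
  congr 2
  ring

theorem centSum_add (hU : IsTheta r U) (hV : IsTheta r V) (s t : ℤ) :
    centSum (U + V) s t = centSum U s t + centSum V s t := by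
  have hf : ∀ {M : ℤ → ℤ → ℤ}, IsTheta r M →
      ({p : ℤ × ℤ | p.1 < s ∧ t < p.2} ∩ Function.support fun p => M p.1 p.2).Finite :=
    fun {M} h => by
      refine (h.negMat.cornerFinite (-s) (-t)).preimage (f := fun p : ℤ × ℤ => (-p.1, -p.2))
        (fun a _ b _ h => by simpa [Prod.ext_iff] using h) |>.subset ?_
      rintro p ⟨⟨h1, h2⟩, h3⟩
      refine ⟨⟨neg_lt_neg h1, neg_lt_neg h2⟩, ?_⟩
      simpa [AffineC.negMat] using h3
  exact finsum_mem_add_distrib' (hf hU) (hf hV)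

theorem centSum_shift (hU : IsTheta r U) (s t : ℤ) :
    centSum (fun i j => U (i + 1) j) s t = centSum U s t + ∑ᶠ j ∈ Set.Ioi t, U s j := by
  have hf : IsTheta r fun p q => U (-1 - p) (-q) := by
    have := (hU.shift (-1)).negMat
    have e : (fun p q => U (-1 - p) (-q)) = negMat fun i j => U (i + -1) j := by
      ext p q; rw [negMat]; congr 1; ring
    rwa [e]
  have h := cornerSum_pred hf.cornerFinite (-1 - s) (-t)
  rw [centSum_eq_cornerSum, centSum_eq_cornerSum]
  have e : cornerSum (fun p q => U (-1 - p + 1) (-q)) (-1 - s, -t) =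
      cornerSum (fun p q => U (-1 - p) (-q)) (-1 - s - 1, -t) := by
    have := cornerSum_shift (fun p q => U (-1 - p) (-q)) (-1) 0 (-1 - s) (-t)
    rw [add_zero] at this
    rw [sub_eq_add_neg _ (1 : ℤ), ← this]
    congr 1
    ext p q
    rw [add_zero]
    congr 1
    ring
  rw [e, h, add_comm]
  congr 1
  refine finsum_mem_eq_of_bijOn (fun j => -j) ⟨?_, ?_, ?_⟩ fun j _ => by simp
  · intro k hk; simp only [Set.mem_Iio, Set.mem_Ioi] at *; omega
  · intro _ _ _ _ h; simpa using h
  · intro k hk; exact ⟨-k, by simp only [Set.mem_Iio, Set.mem_Ioi] at *; omega, by simp⟩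

/-! ### Refinements with the same sums -/

/-- The second way to read the refined matrix, with triples starting at row `3 i`. It mixes row `i`
of the coarse matrix with row `i + 1` of `T`, and produces the intermediate matrix `V` through which
lengths are compared. -/
theorem refinement_eq (M T : ℤ → ℤ → ℤ) :
    refinement M T = interleave M (negMat T) fun i j => T (i + 1) j := by
  ext p j
  rw [refinement, interleave_rotate]
  rfl

theorem cornerCount_refinement (hM : IsTheta r M) (hT : IsTheta r T) (n : ℤ) :
    cornerCount (3 * n) (refinement M T) = ∑ i ∈ Finset.Ico 0 n,
      (rowCorner (M + negMat T + fun i j => T (i + 1) j) i +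
        inv (M i) (negMat T i + T (i + 1)) + inv (negMat T i) (T (i + 1))) := by
  have h1 := hT.shift 1
  have hF : ∀ p, (refinement M T p).support.Finite := fun p => by
    obtain ⟨i, rfl | rfl | rfl⟩ := exists_pred_self_succ p
    · rw [refinement_pred]; exact hT.finite_row i
    · rw [refinement_self]; exact hM.finite_row i
    · rw [refinement_succ]; exact finite_neg (hT.finite_row _)
  rw [cornerCount_eq_sum hF, sum_Ico_three', refinement_eq]
  exact Finset.sum_congr rfl fun i _ => rowCorner_interleave hM.cornerFinite
    hT.negMat.cornerFinite h1.cornerFinite hM.finite_row hT.negMat.finite_row h1.finite_row i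

/-- The reading with triples starting at `3 i - 1`. Since the count is over a whole period, moving
the window by one row does not change it. -/
theorem cornerCount_refinement' (hM : IsTheta r M) (hM' : ∀ i j, M (-i) (-j) = M i j)
    (hT : IsTheta r T) :
    cornerCount (3 * (2 * r + 2)) (refinement M T) = ∑ i ∈ Finset.Ico 0 (2 * r + 2 : ℤ),
      (rowCorner (T + M + negMat T) i + inv (T i) (M i + negMat T i) + inv (M i) (negMat T i)) := by
  have hF := refinement_isCellMatrix hT hM hM'
  rw [cornerCount_eq_sum hF.finite_row, sum_Ico_three (by positivity)]
  · refine Finset.sum_congr rfl fun i _ => ?_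
    rw [← rowCorner_interleave hT.cornerFinite hM.cornerFinite hT.negMat.cornerFinite hT.finite_row
      hM.finite_row hT.negMat.finite_row]
    have e : ∀ p, rowCorner (refinement M T) p =
        rowCorner (interleave T M (negMat T)) (p + 1) := fun p => by
      have := rowCorner_shift (interleave T M (negMat T)) 1 0 p
      simp only [add_zero] at this
      exact this
    rw [e, e, e, sub_add_cancel, add_assoc (3 * i), one_add_one_eq_two]
  · intro p
    refine rowCorner_add (b := 2 * r + 2) (fun i j => ?_) p
    have := hF.periodic i j
    push_cast at this
    rwa [show 2 * (3 * (r : ℤ) + 2) + 2 = 3 * (2 * r + 2) by ring] at this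

theorem centSum_refinement (hM : IsTheta r M) (hT : IsTheta r T) (s t : ℤ) :
    centSum (refinement M T) (3 * s) t =
      centSum (M + negMat T + fun i j => T (i + 1) j) s t := by
  rw [refinement_eq, centSum_interleave hM hT.negMat (hT.shift 1)]

/-- The cut at row `3 s` divides the triple `3 s - 1, 3 s, 3 s + 1` of the first reading, and the
part of row `3 s - 1`, that is of `T s`, beyond `t` appears as a correction. -/
theorem centSum_refinement' (hM : IsTheta r M) (hT : IsTheta r T) (s t : ℤ) :
    centSum (refinement M T) (3 * s) t =
      centSum (T + M + negMat T) s t + ∑ᶠ j ∈ Set.Ioi t, T s j := by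
  rw [centSum_refinement hM hT, centSum_add (hM.add hT.negMat) (hT.shift 1), centSum_shift hT,
    centSum_add (hT.add hM) hT.negMat, centSum_add hT hM, centSum_add hM hT.negMat]
  ring

end

end AffineC

/-! ### Comparison of the exponents -/

namespace AffineC

/-! ### Sums over half periods -/

theorem sum_Ico_reflect {n : ℤ} (hn : 0 < n) {f : ℤ → ℤ} (hf : ∀ i, f (i + n) = f i) (k : ℤ) :
    ∑ i ∈ Finset.Ico 0 n, f (k - i) = ∑ i ∈ Finset.Ico 0 n, f i := by
  rw [← sum_Ico_shift hn hf (k - n + 1)]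
  refine Finset.sum_nbij' (fun i => k - i) (fun i => k - i) ?_ ?_ ?_ ?_ ?_
  · intro i hi; simp only [Finset.mem_Ico] at *; omega
  · intro i hi; simp only [Finset.mem_Ico] at *; omega
  · intro i _; ring
  · intro i _; ring
  · intro i _; rfl

theorem sum_Ico_translate {n : ℤ} (hn : 0 < n) {f : ℤ → ℤ} (hf : ∀ i, f (i + n) = f i) (k : ℤ) :
    ∑ i ∈ Finset.Ico 0 n, f (i + k) = ∑ i ∈ Finset.Ico 0 n, f i := by
  rw [← sum_Ico_shift hn hf k]
  refine Finset.sum_nbij' (fun i => i + k) (fun i => i - k) ?_ ?_ ?_ ?_ ?_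
  · intro i hi; simp only [Finset.mem_Ico] at *; omega
  · intro i hi; simp only [Finset.mem_Ico] at *; omega
  · intro i _; ring
  · intro i _; ring
  · intro i _; rfl

theorem sum_period_reflect (r : ℕ) {f : ℤ → ℤ} (hf : ∀ i, f (i + (2 * r + 2)) = f i)
    (hf' : ∀ i, f (1 - i) = f i) :
    ∑ i ∈ Finset.Ico 0 (2 * r + 2 : ℤ), f i = 2 * ∑ i ∈ Finset.Icc (1 : ℤ) (r + 1), f i := by
  rw [← sum_Ico_shift (by positivity) hf (-r)]
  have e : Finset.Ico (-r : ℤ) (-r + (2 * r + 2)) =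
      Finset.Icc (-r : ℤ) 0 ∪ Finset.Icc 1 ((r : ℤ) + 1) := by
    ext i; simp only [Finset.mem_Ico, Finset.mem_union, Finset.mem_Icc]; omega
  rw [e, Finset.sum_union, two_mul]
  · congr 1
    refine Finset.sum_nbij' (fun i => 1 - i) (fun i => 1 - i) ?_ ?_ ?_ ?_ ?_
    · intro i hi; simp only [Finset.mem_Icc] at *; omega
    · intro i hi; simp only [Finset.mem_Icc] at *; omega
    · intro i _; ring
    · intro i _; ring
    · intro i _; exact (hf' i).symm
  · rw [Finset.disjoint_left]; intro i h1 h2; simp only [Finset.mem_Icc] at *; omega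

theorem inv_shift (u w : ℤ → ℤ) (n : ℤ) :
    inv (fun j => u (j - n)) (fun j => w (j - n)) = inv u w := by
  rw [inv, inv, ← finsum_comp_equiv (Equiv.addRight n)]
  refine finsum_congr fun j => ?_
  simp only [Equiv.coe_addRight, add_sub_cancel_right]
  rw [cum_add]

theorem finsum_mem_lt {u w : ℤ → ℤ} (hu : u.support.Finite) (hw : w.support.Finite) :
    ∑ᶠ p ∈ {p : ℤ × ℤ | p.2 < p.1}, u p.1 * w p.2 = inv u w := by
  rw [finsum_mem_def, finsum_curry, inv]
  · refine finsum_congr fun a => ?_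
    have : ∀ b, Set.indicator {p : ℤ × ℤ | p.2 < p.1} (fun p => u p.1 * w p.2) (a, b) =
        Set.indicator (Set.Iio a) (fun b => u a * w b) b := fun b => by
      simp only [Set.indicator_apply, Set.mem_ofPred_eq, Set.mem_Iio]
    simp only [this]
    rw [← finsum_mem_def, cum, mul_finsum_mem]
  · refine (hu.prod hw).subset fun p hp => ?_
    have : u p.1 * w p.2 ≠ 0 := fun h => hp (by simp only [Set.indicator_apply, h, ite_self])
    exact ⟨left_ne_zero_of_mul this, right_ne_zero_of_mul this⟩

/-- Pairs are reflected at an anti-diagonal. -/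
theorem finsum_mem_lt_reflect {x : ℤ → ℤ} (hx : x.support.Finite) (e : ℤ) :
    ∑ᶠ p ∈ {p : ℤ × ℤ | p.2 < p.1}, x (2 * e - p.1) * x p.2 =
      2 * (∑ᶠ p ∈ {p : ℤ × ℤ | p.2 < p.1 ∧ p.1 < 2 * e - p.2}, x (2 * e - p.1) * x p.2) +
        ∑ᶠ j ∈ Set.Iio e, x j * x j := by
  set g : ℤ × ℤ → ℤ := fun p => x (2 * e - p.1) * x p.2 with hg
  have hfin : g.support.Finite := by
    refine ((hx.preimage (f := fun j : ℤ => 2 * e - j) fun a _ b _ h => by simpa using h).prod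
      hx).subset fun p hp => ⟨left_ne_zero_of_mul hp, right_ne_zero_of_mul hp⟩
  have hs : ∀ s : Set (ℤ × ℤ), (s ∩ g.support).Finite := fun s => hfin.subset fun _ h => h.2
  -- The two sides of the antidiagonal are exchanged by the reflection about `e`, and the
  -- antidiagonal itself contributes the squares.
  have e1 : {p : ℤ × ℤ | p.2 < p.1} = ({p | p.2 < p.1 ∧ p.1 < 2 * e - p.2} ∪
      {p | p.2 < p.1 ∧ 2 * e - p.2 < p.1}) ∪ (fun j => (2 * e - j, j)) '' Set.Iio e := by
    ext ⟨a, b⟩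
    simp only [Set.mem_ofPred_eq, Set.mem_union, Set.mem_image, Set.mem_Iio, Prod.mk.injEq]
    constructor
    · intro h
      rcases lt_trichotomy a (2 * e - b) with h' | h' | h'
      · exact Or.inl (Or.inl ⟨h, h'⟩)
      · exact Or.inr ⟨b, by omega, h'.symm, rfl⟩
      · exact Or.inl (Or.inr ⟨h, h'⟩)
    · rintro ((h | h) | ⟨j, h, h1, h2⟩) <;> omega
  rw [e1, finsum_mem_union' ?_ (hs _) (hs _), finsum_mem_union' ?_ (hs _) (hs _),
    finsum_mem_image fun a _ b _ h => by simpa using h]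
  · have e2 : ∑ᶠ p ∈ {p : ℤ × ℤ | p.2 < p.1 ∧ 2 * e - p.2 < p.1}, g p =
        ∑ᶠ p ∈ {p : ℤ × ℤ | p.2 < p.1 ∧ p.1 < 2 * e - p.2}, g p := by
      refine finsum_mem_eq_of_bijOn (fun p : ℤ × ℤ => (2 * e - p.2, 2 * e - p.1)) ⟨?_, ?_, ?_⟩ ?_
      · rintro p ⟨h1, h2⟩
        constructor <;> simp only <;> omega
      · rintro ⟨a, b⟩ _ ⟨a', b'⟩ _ h
        simp only [Prod.mk.injEq] at h ⊢
        omega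
      · rintro ⟨a, b⟩ ⟨h1, h2⟩
        refine ⟨(2 * e - b, 2 * e - a), ⟨?_, ?_⟩, by simp⟩
        · simp only at *; omega
        · simp only at *; omega
      · rintro ⟨a, b⟩ -
        simp only [hg, sub_sub_cancel]
        ring
    have e3 : ∑ᶠ j ∈ Set.Iio e, g (2 * e - j, j) = ∑ᶠ j ∈ Set.Iio e, x j * x j := by
      simp only [hg, sub_sub_cancel]
    rw [e2, e3]
    ring
  · rw [Set.disjoint_left]
    rintro p ⟨-, h⟩ ⟨-, h'⟩
    omega
  · rw [Set.disjoint_left]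
    rintro _ (⟨-, h⟩ | ⟨-, h⟩) ⟨j, -, rfl⟩ <;> simp only at h <;> omega

section

variable {r d : ℕ} {A B C M S T X : ℤ → ℤ → ℤ}

theorem inv_periodic {U W : ℤ → ℤ → ℤ} (hU : IsTheta r U) (hW : IsTheta r W) (i : ℤ) :
    inv (U (i + (2 * r + 2))) (W (i + (2 * r + 2))) = inv (U i) (W i) := by
  rw [← inv_shift (U i) (W i) (2 * r + 2)]
  congr 1
  · ext j; rw [← hU.periodic i, sub_add_cancel]
  · ext j; rw [← hW.periodic i, sub_add_cancel]

theorem two_mul_finsum_mem_choose {x : ℤ → ℤ} (hx : x.support.Finite) (s : Set ℤ) :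
    2 * ∑ᶠ j ∈ s, x j * (x j + 1) / 2 = (∑ᶠ j ∈ s, x j * x j) + ∑ᶠ j ∈ s, x j := by
  have h1 : (s ∩ Function.support fun j => x j * x j).Finite :=
    (finite_mul_left hx x).subset fun _ h => h.2
  rw [mul_finsum_mem, ← finsum_mem_add_distrib' h1 (hx.subset fun _ h => h.2)]
  refine finsum_mem_congr rfl fun j _ => ?_
  rw [Int.mul_ediv_cancel' (Int.even_mul_succ_self (x j)).two_dvd]
  ring

theorem IsTheta.reflect (hX : IsTheta r X) {i : ℤ} (hi : i ∈ ({-(r : ℤ) - 1, 0} : Finset ℤ))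
    (j : ℤ) : X (-i) (-j) = X i (2 * i - j) := by
  rcases Finset.mem_insert.1 hi with rfl | h
  · rw [← hX.periodic (-(r : ℤ) - 1)]
    congr 1 <;> ring
  · rw [Finset.mem_singleton] at h
    subst h
    simp

/-- With `C = negMat X + M + X`, the first sum of `xi` is a sum over a period of `inv M X` and `f =
inv (negMat X) X`. The subtracted terms remove half of all the `f`: rows `-r, …, -1` represent the
noncentral rows because `f` is even, and rows `0` and `-r - 1` are halved by reflection at the
antidiagonal. The squares left over cancel against `x (x + 1) / 2`, leaving only linear terms, which
match the central corrections of the length. -/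
theorem four_mul_xi (hX : IsTheta r X) (hM : IsTheta r M) (hM' : ∀ i j, M (-i) (-j) = M i j) :
    4 * xi r (negMat X + M + X) X =
      2 * ∑ i ∈ Finset.Ico 0 (2 * r + 2 : ℤ),
        (inv (negMat X i) (M i + X i) + inv (M i) (X i)) -
      2 * ((∑ᶠ j ∈ Set.Ioi 0, negMat X 0 j) + ∑ᶠ j ∈ Set.Ioi ((r : ℤ) + 1), negMat X (r + 1) j) := by
  have hX' := hX.negMat
  have hn : (0 : ℤ) < 2 * r + 2 := by positivity
  set f : ℤ → ℤ := fun i => inv (negMat X i) (X i) with hf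
  set m : ℤ → ℤ := fun i => inv (M i) (X i) with hm
  have fper : ∀ i, f (i + (2 * r + 2)) = f i := fun i => inv_periodic hX' hX i
  have mper : ∀ i, m (i + (2 * r + 2)) = m i := fun i => inv_periodic hM hX i
  have feven : ∀ i, f (-i) = f i := fun i => by
    simp only [hf]
    rw [← inv_neg (hX.finite_row i) (hX'.finite_row i)]
    congr 1
    · ext j; simp [negMat]
    · ext j; simp [negMat]
  have hm1 : ∀ i, inv (negMat X i) (M i) = m (0 - i) := fun i => by
    simp only [hm, zero_sub]
    rw [← inv_neg (hX.finite_row _) (hM.finite_row _)]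
    congr 1
    ext j
    rw [hM']
  have hsum : ∑ i ∈ Finset.Ico 0 (2 * r + 2 : ℤ), (inv (negMat X i) (M i + X i) + inv (M i) (X i)) =
      2 * ∑ i ∈ Finset.Ico 0 (2 * r + 2 : ℤ), m i + ∑ i ∈ Finset.Ico 0 (2 * r + 2 : ℤ), f i := by
    have := sum_Ico_reflect hn mper 0
    rw [two_mul (∑ i ∈ _, m i)]
    nth_rw 1 [← this]
    rw [← Finset.sum_add_distrib, ← Finset.sum_add_distrib]
    refine Finset.sum_congr rfl fun i _ => ?_
    rw [inv_add_right (hX'.finite_row i) (hM.finite_row i) (hX.finite_row i), hm1]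
    ring
  have x1 : ∑ i ∈ Finset.Icc (-r - 1 : ℤ) r, ∑ᶠ p ∈ {p : ℤ × ℤ | p.2 < p.1},
      ((negMat X + M + X) i p.1 - X i p.1) * X i p.2 =
      (∑ i ∈ Finset.Ico 0 (2 * r + 2 : ℤ), m i) + ∑ i ∈ Finset.Ico 0 (2 * r + 2 : ℤ), f i := by
    rw [← Finset.sum_add_distrib, ← sum_Ico_shift hn (fun i => by rw [fper, mper]) (-r - 1)]
    have e : Finset.Icc (-r - 1 : ℤ) r = Finset.Ico (-r - 1 : ℤ) (-r - 1 + (2 * r + 2)) := by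
      ext i; simp only [Finset.mem_Icc, Finset.mem_Ico]; omega
    rw [e]
    refine Finset.sum_congr rfl fun i _ => ?_
    rw [hm, hf]
    simp only
    rw [← inv_add_left (hM.finite_row i) (hX'.finite_row i), ← finsum_mem_lt
      (finite_add (hM.finite_row i) (hX'.finite_row i)) (hX.finite_row i)]
    refine finsum_mem_congr rfl fun p _ => ?_
    simp only [Pi.add_apply]
    ring
  have x2 : ∑ i ∈ Finset.Icc (-r : ℤ) (-1), ∑ᶠ p ∈ {p : ℤ × ℤ | p.2 < p.1},
      X (-i) (-p.1) * X i p.2 = ∑ i ∈ Finset.Icc (1 : ℤ) r, f i := by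
    refine Finset.sum_nbij' (fun i => -i) (fun i => -i) ?_ ?_ ?_ ?_ ?_
    · intro i hi; simp only [Finset.mem_Icc] at *; omega
    · intro i hi; simp only [Finset.mem_Icc] at *; omega
    · intro i _; ring
    · intro i _; ring
    · intro i _
      rw [feven, hf]
      simp only
      rw [← finsum_mem_lt (hX'.finite_row i) (hX.finite_row i)]
      rfl
  have x3 : ∀ i ∈ ({-(r : ℤ) - 1, 0} : Finset ℤ),
      f i = 2 * (∑ᶠ p ∈ {p : ℤ × ℤ | p.2 < p.1 ∧ p.1 < 2 * i - p.2}, X (-i) (-p.1) * X i p.2) +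
        ∑ᶠ j ∈ Set.Iio i, X i j * X i j := fun i hi => by
    simp only [hX.reflect hi]
    rw [← finsum_mem_lt_reflect (hX.finite_row i), hf]
    simp only
    rw [← finsum_mem_lt (hX'.finite_row i) (hX.finite_row i)]
    simp only [negMat, hX.reflect hi]
  have hne : -(r : ℤ) - 1 ≠ 0 := by omega
  have p0 : ∑ᶠ j ∈ Set.Ioi 0, negMat X 0 j = ∑ᶠ j ∈ Set.Iio 0, X 0 j := by
    refine finsum_mem_eq_of_bijOn (fun j => -j) ⟨?_, ?_, ?_⟩ fun j _ => by simp [negMat]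
    · intro k hk; simp only [Set.mem_Iio, Set.mem_Ioi] at *; omega
    · intro _ _ _ _ h; simpa using h
    · intro k hk; exact ⟨-k, by simp only [Set.mem_Iio, Set.mem_Ioi] at *; omega, by simp⟩
  have p1 : ∑ᶠ j ∈ Set.Ioi ((r : ℤ) + 1), negMat X (r + 1) j =
      ∑ᶠ j ∈ Set.Iio (-(r : ℤ) - 1), X (-r - 1) j := by
    refine finsum_mem_eq_of_bijOn (fun j => -j) ⟨?_, ?_, ?_⟩ fun j _ => ?_
    · intro k hk; simp only [Set.mem_Iio, Set.mem_Ioi] at *; omega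
    · intro _ _ _ _ h; simpa using h
    · intro k hk; exact ⟨-k, by simp only [Set.mem_Iio, Set.mem_Ioi] at *; omega, by simp⟩
    · rw [negMat]; congr 1; ring
  have y0 := x3 0 (by simp)
  have y1 := x3 (-(r : ℤ) - 1) (by simp)
  have z0 := two_mul_finsum_mem_choose (hX.finite_row 0) (Set.Iio 0)
  have z1 := two_mul_finsum_mem_choose (hX.finite_row (-(r : ℤ) - 1)) (Set.Iio (-r - 1))
  have hev := sum_period_even r fper feven
  have hlast : f (r + 1) = f (-r - 1) := by rw [← feven]; congr 1; ring
  rw [hsum, p0, p1, xi, x1, x2, Finset.sum_pair hne, Finset.sum_pair hne]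
  linarith

/-- The length of a tridiagonal matrix. -/
theorem lenMat_of_tridiagonal (hd : 2 ≤ d) (hB : IsXi r d B) (htri : IsTridiagonal B) :
    (lenMat r d B : ℤ) = ∑ i ∈ Finset.Icc (1 : ℤ) (r + 1), B (i - 1) i * B (-i) (1 - i) := by
  have hn : (0 : ℤ) < 2 * r + 2 := by positivity
  have h := four_mul_lenMat hd hB
  have hcent : ∀ s, centSum B s s = 0 := fun s =>
    finsum_mem_eq_zero_of_forall_eq_zero fun p ⟨h1, h2⟩ => htri.eq_zero (by omega)
  -- For a tridiagonal matrix the corner strictly below and to the left of `(i, i + 1)` contains the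
  -- single relevant place `(i + 1, i)`.
  have hcorner : ∀ i, cornerSum B (i, i + 1) = B (i + 1) i := fun i => by
    have e : {p : ℤ × ℤ | i < p.1 ∧ p.2 < i + 1} ∩ (Function.support fun p => B p.1 p.2) =
        {(i + 1, i)} ∩ Function.support fun p => B p.1 p.2 := by
      ext ⟨a, b⟩
      simp only [Set.mem_inter_iff, Set.mem_ofPred_eq, Set.mem_singleton_iff, Prod.mk.injEq]
      refine and_congr_left fun h => ⟨fun h1 => ?_, fun h1 => by omega⟩
      by_contra hcon
      exact h (htri.eq_zero (by omega))
    exact (finsum_mem_inter_support_eq _ _ _ e).trans finsum_mem_singleton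
  have hrow : ∀ i, rowCorner B i = B i (i + 1) * B (i + 1) i := fun i => by
    rw [rowCorner, finsum_eq_single _ (i + 1), hcorner]
    intro j hj
    by_cases h1 : B i j = 0
    · rw [h1, zero_mul]
    · have : cornerSum B (i, j) = 0 := finsum_mem_eq_zero_of_forall_eq_zero fun p ⟨h2, h3⟩ => by
        refine htri.eq_zero ?_
        by_contra hcon
        refine h1 (htri.eq_zero ?_)
        simp only at h2 h3
        omega
      rw [this, mul_zero]
  rw [hcent, hcent, cornerCount_eq_sum hB.finite_row] at h
  have e : ∑ i ∈ Finset.Ico 0 (2 * r + 2 : ℤ), rowCorner B i =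
      2 * ∑ i ∈ Finset.Icc (1 : ℤ) (r + 1), B (i - 1) i * B (-i) (1 - i) := by
    have hper : ∀ i, rowCorner B (i + (2 * r + 2)) = rowCorner B i := rowCorner_add hB.periodic
    have hs : ∀ i, rowCorner B (i + -1) = B (i - 1) i * B (-i) (1 - i) := fun i => by
      rw [hrow, ← hB.symm (-i)]
      congr 1
      · congr 1; ring
      · congr 1 <;> ring
    rw [← sum_Ico_translate hn hper (-1), sum_period_reflect]
    · simp only [hs]
    · intro i
      rw [add_right_comm, hper]
    · intro i
      rw [hs, hs, mul_comm]
      congr 2 <;> ring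
  rw [e] at h
  linarith

/-! ### The correspondence between the index sets -/

/-- The matrix `X` attached to `(T, S)`. -/
def moveX (T S : ℤ → ℤ → ℤ) (i j : ℤ) : ℤ := T (i + 1) j - S (i + 1) j + S (-i) (-j)

theorem IsTheta.moveX (hT : IsTheta r T) (hS : IsTheta r S) (h : ∀ i j, S i j ≤ T i j) :
    IsTheta r (moveX T S) := ((hT.sub hS h).shift 1).add hS.negMat

/-- Exhibits `A^{(T-S)}` as the coarsening of the refinement of `A - T_θ` by the reflected `X`, in
the same way as `A` is the coarsening of its refinement by `T`. -/
theorem moveTS_eq (A T S : ℤ → ℤ → ℤ) :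
    moveTS A T S = negMat (moveX T S) + (A - theta T) + moveX T S := by
  ext i j
  simp only [moveTS, theta, hat, negMat, moveX, Pi.add_apply, Pi.sub_apply, neg_neg]
  ring

theorem moveTS_eq_moveXY (A T S : ℤ → ℤ → ℤ) :
    moveTS A T S = moveXY A (moveX T S) (negMat T) := by
  ext i j
  simp only [moveTS, moveXY, theta, hat, check, negMat, moveX, Pi.sub_apply, neg_sub]
  ring_nf

theorem isXi_moveTS (hA : IsXi r d A) (hT : T ∈ ThetaSet r B A) (hS : S ∈ GammaSet r T) :
    IsXi r d (moveTS A T S) := by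
  have hX := hT.1.moveX hS.1 hS.2.1
  have hM := hA.toIsTheta.sub hT.1.theta hT.2.1
  have hC : IsTheta r (moveTS A T S) := by
    rw [moveTS_eq]; exact (hX.negMat.add hM).add hX
  -- At a central diagonal place the two entries added by `θ` coincide up to translation, so parity
  -- is unchanged.
  have hodd : ∀ e : ℤ, (∃ k : ℤ, -e = e + k * (2 * r + 2)) → Odd (A e e) →
      Odd (moveTS A T S e e) := by
    rintro e ⟨k, hk⟩ ho
    have e1 : ∀ U : ℤ → ℤ → ℤ, IsTheta r U → theta U e e = 2 * U e e := fun U hU => by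
      rw [theta, hk, periodic_mul hU.periodic]; ring
    rw [moveTS_eq]
    have h1 := e1 _ hT.1
    have h2 : negMat (moveX T S) e e = moveX T S e e := by
      rw [negMat, hk, periodic_mul hX.periodic]
    simp only [Pi.add_apply, Pi.sub_apply]
    rw [h1, h2]
    obtain ⟨m, hm⟩ := ho
    exact ⟨m - T e e + moveX T S e e, by rw [hm]; ring⟩
  refine { hC with symm := ?_, odd_zero := hodd 0 ⟨0, by ring⟩ hA.odd_zero,
                   odd_last := hodd _ ⟨-1, by ring⟩ hA.odd_last, total := ?_ }
  · intro i j
    rw [moveTS_eq]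
    simp only [Pi.add_apply, Pi.sub_apply, negMat, hA.symm, theta_neg, neg_neg]
    ring
  · have hn : (0 : ℤ) < 2 * r + 2 := by positivity
    rw [← hA.total, sum_Icc_period hn (rowSum_add hC.periodic),
      sum_Icc_period hn (rowSum_add hA.periodic)]
    have hper := fun {U : ℤ → ℤ → ℤ} (hU : IsTheta r U) => rowSum_add hU.periodic
    have hr : ∀ i, rowSum (moveTS A T S) i = rowSum A i - rowSum T i - rowSum T (0 - i) +
        rowSum T (i + 1) + rowSum T (1 - i) := by
      intro i
      have g1 : ∀ i, rowSum (moveX T S) i = rowSum T (i + 1) := fun i => by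
        have k1 := rowSum_plus ((hT.1.sub hS.1 hS.2.1).shift 1) hS.1.negMat i
        have k2 := rowSum_sub hT.1 hS.1 (i + 1)
        have k3 := hS.2.2 (i + 1)
        have k4 : rowSum (negMat S) i = rowSum S (-i) := finsum_neg_index _
        have k5 : rowSum (dagger S) (i + 1) = rowSum S (-i) := by
          rw [rowSum, rowSum, ← finsum_neg_index]
          refine finsum_congr fun j => ?_
          rw [dagger, neg_neg]
          congr 1
          ring
        change rowSum (moveX T S) i = rowSum (T - S) (i + 1) + _ at k1
        rw [k1, k2, k4, k3, k5]
        ring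
      have g2 : rowSum (negMat (moveX T S)) i = rowSum T (1 - i) := by
        rw [show 1 - i = -i + 1 by ring, ← g1]; exact finsum_neg_index _
      rw [moveTS_eq, rowSum_plus (hX.negMat.add hM) hX, rowSum_plus hX.negMat hM, g1, g2,
        rowSum_sub hA.toIsTheta hT.1.theta, rowSum_theta hT.1, zero_sub]
      ring
    simp only [hr, Finset.sum_add_distrib, Finset.sum_sub_distrib]
    rw [sum_Ico_reflect hn (hper hT.1), sum_Ico_reflect hn (hper hT.1),
      sum_Ico_translate hn (hper hT.1)]
    ring

/-- The involution `i ↦ 1 - i` preserves the summand of the right-hand side, since reflection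
exchanges the arguments of `inv`; a period consists of two copies of `1, …, r + 1`. -/
theorem sum_inv_negMat {U : ℤ → ℤ → ℤ} (hU : IsTheta r U) :
    ∑ i ∈ Finset.Ico 0 (2 * r + 2 : ℤ), inv (negMat U i) (U (i + 1)) =
      2 * ∑ i ∈ Finset.Icc (1 : ℤ) (r + 1), inv (negMat U (i - 1)) (U i) := by
  have hper : ∀ i, inv (negMat U (i + (2 * r + 2) - 1)) (U (i + (2 * r + 2))) =
      inv (negMat U (i - 1)) (U i) := fun i => by
    have := inv_periodic (hU.negMat.shift (-1)) hU i
    simp only [← sub_eq_add_neg] at this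
    exact this
  rw [← sum_period_reflect r (f := fun i => inv (negMat U (i - 1)) (U i)) hper,
    ← sum_Ico_translate (f := fun i => inv (negMat U (i - 1)) (U i)) (by positivity) hper 1]
  · simp only [add_sub_cancel_right]
  · intro i
    rw [← inv_neg (hU.finite_row i) (hU.negMat.finite_row (i - 1))]
    congr 1
    · ext j; rw [negMat]; congr 1; ring
    · ext j; rw [negMat, neg_neg]; congr 1; ring

/-- Comparison of the exponents of the two formulas. -/
theorem lenABST_sub (hd : 2 ≤ d) (hA : IsXi r d A) (hB : IsXi r d B)
    (htri : IsTridiagonal B) (hAB : rowC r A = colC r B) (hT : T ∈ ThetaSet r B A)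
    (hS : S ∈ GammaSet r T) :
    lenABST r d A B S T - nS r S - hST r S T = xi r (moveTS A T S) (moveX T S) +
      ∑ i ∈ Finset.Icc (1 : ℤ) (r + 1),
        rowExp (moveX T S (i - 1)) (negMat T (i - 1)) (S i) (dagger S i) := by
  have hX := hT.1.moveX hS.1 hS.2.1
  have hM := hA.toIsTheta.sub hT.1.theta hT.2.1
  have hM' : ∀ i j, (A - theta T) (-i) (-j) = (A - theta T) i j := fun i j => by
    simp only [Pi.sub_apply, hA.symm, theta_neg]
  have hC := isXi_moveTS hA hT hS
  have hn : (0 : ℤ) < 2 * r + 2 := by positivity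
  have h1 := lenMat_add_lenFibre hd hA hB htri hAB hT
  have h2 := four_mul_lenMat hd hC
  have h3 := lenMat_of_tridiagonal hd hB htri
  have h4 := four_mul_xi hX hM hM'
  -- `c1` coarsens the refinement by `T` to `V`; `c2` and `c3` coarsen the refinement by the
  -- reflected `X`, once to `V` and once to `A^{(T-S)}`.
  have c1 := cornerCount_refinement hM hT.1 (2 * r + 2)
  have c2 := cornerCount_refinement hM hX.negMat (2 * r + 2)
  have c3 := cornerCount_refinement' hM hM' hX.negMat
  have c4 := cornerCount_eq_sum hC.finite_row (2 * r + 2)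
  have s1 := centSum_refinement hM hT.1
  have s2 := centSum_refinement hM hX.negMat
  have s3 := centSum_refinement' hM hX.negMat
  rw [negMat_negMat] at c2 c3 s2 s3
  -- Both refinements have the same second coarsening `V`, because in `T (i + 1) j + T (-i) (-j)`
  -- the contributions of `S` cancel. This joins the two lengths.
  have hV : (A - theta T + moveX T S + fun i j => negMat (moveX T S) (i + 1) j) =
      A - theta T + negMat T + fun i j => T (i + 1) j := by
    ext i j
    simp only [Pi.add_apply, negMat, moveX]
    ring_nf
  have hV' : ∀ i, moveX T S i + negMat (moveX T S) (i + 1) = negMat T i + T (i + 1) := by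
    intro i
    ext j
    simp only [Pi.add_apply, negMat, moveX]
    ring_nf
  have s4 : ∀ s t, centSum (refinement (A - theta T) T) (3 * s) t =
      centSum (moveTS A T S) s t + ∑ᶠ j ∈ Set.Ioi t, negMat (moveX T S) s j := by
    intro s t
    rw [s1, ← hV, ← s2, s3, ← moveTS_eq]
  have s40 := s4 0 0
  rw [mul_zero] at s40
  rw [c1, s4, s40] at h1
  rw [c4] at h2
  have c5 := c2.symm.trans c3
  simp only [hV, hV', ← moveTS_eq] at c5
  rw [← moveTS_eq] at h4
  simp only [Finset.sum_add_distrib] at h1 c5 h4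
  have p1 := sum_inv_negMat hT.1
  have p2 := sum_inv_negMat hX.negMat
  rw [negMat_negMat] at p2
  have hdag : ∀ i, (dagger S i).support.Finite := fun i => finite_neg (hS.1.finite_row (1 - i))
  -- What remains of the length difference are inversion forms in the rows `i = 1, …, r + 1`,
  -- evaluated with `t = T_i`, `c = negMat T (i - 1)`, `s = S_i`, `s' = S^†_i`.
  have hrows : ∀ i ∈ Finset.Icc (1 : ℤ) (r + 1), _ := fun i _ =>
    row_exponent (hT.1.finite_row i) (hT.1.negMat.finite_row (i - 1)) (hS.1.finite_row i) (hdag i)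
      (hS.2.2 i)
  have q := Finset.sum_congr rfl hrows
  have e1 : ∀ i, T i - S i + dagger S i = moveX T S (i - 1) := fun i => by
    ext j
    simp only [Pi.add_apply, Pi.sub_apply, dagger, moveX]
    ring_nf
  have e2 : ∀ i, negMat T (i - 1) - dagger S i + S i = negMat (moveX T S) i := fun i => by
    ext j
    simp only [Pi.add_apply, Pi.sub_apply, dagger, moveX, negMat]
    ring_nf
  have e3 : ∀ i, total (T i) = B (i - 1) i := fun i => hT.2.2 i
  have e4 : ∀ i, total (negMat T (i - 1)) = B (-i) (1 - i) := fun i => by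
    have : total (negMat T (i - 1)) = rowSum T (1 - i) := by
      rw [show 1 - i = -(i - 1) by ring]; exact finsum_neg_index _
    rw [this, hT.2.2]
    congr 1
    ring
  have e5 : ∀ i j, negMat T (i - 1) j = T (1 - i) (-j) := fun i j => by
    rw [negMat, neg_sub]
  simp only [e1, e2, e3, e4, Finset.sum_add_distrib, Finset.sum_sub_distrib] at q
  rw [← h3] at q
  simp only [e5] at q
  simp only [dagger] at q ⊢
  rw [lenABST, nS]
  have q3 : ∑ i ∈ Finset.Icc (1 : ℤ) (r + 1), total (S i) =
    ∑ i ∈ Finset.Icc (1 : ℤ) (r + 1), rowSum S i := rfl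
  rw [q3] at q
  rw [hST]
  linarith

end

end AffineC

/-! ### Quantum integers and the `q`-Vandermonde identity -/

namespace AffineC

/-! ### Quantum integers -/

theorem v_ne_zero : v ≠ 0 := RatFunc.X_ne_zero

theorem v_pow_ne_one {n : ℕ} (hn : n ≠ 0) : v ^ n ≠ 1 := by
  intro h
  have h1 : algebraMap (Polynomial ℚ) (RatFunc ℚ) (Polynomial.X ^ n) =
      algebraMap (Polynomial ℚ) (RatFunc ℚ) 1 := by
    rw [map_pow, RatFunc.algebraMap_X, map_one]
    exact h
  have h2 := congrArg Polynomial.natDegree (RatFunc.algebraMap_injective ℚ h1)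
  rw [Polynomial.natDegree_X_pow, Polynomial.natDegree_one] at h2
  exact hn h2

theorem v_zpow_ne_one {k : ℤ} (hk : k ≠ 0) : v ^ k ≠ 1 := by
  intro h
  obtain ⟨n, rfl | rfl⟩ := Int.eq_nat_or_neg k
  · exact v_pow_ne_one (n := n) (by omega) (by rw [← zpow_natCast]; exact h)
  · rw [zpow_neg, inv_eq_one, zpow_natCast] at h
    exact v_pow_ne_one (n := n) (by omega) h

theorem v_sq_sub_one_ne_zero : v ^ 2 - 1 ≠ 0 := sub_ne_zero.2 (v_pow_ne_one two_ne_zero)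

theorem qint_eq (m : ℤ) : qint m = (v ^ (2 * m) - 1) / (v ^ 2 - 1) := by
  have h : ∀ k : ℤ, q ^ k = v ^ (-k) := fun k => by rw [q, inv_zpow', zpow_neg]
  rw [qint, h, h, show -(-2 * m) = 2 * m by ring, neg_neg]
  rfl

theorem qint_mul (m : ℤ) : qint m * (v ^ 2 - 1) = v ^ (2 * m) - 1 := by
  rw [qint_eq, div_mul_cancel₀ _ v_sq_sub_one_ne_zero]

theorem qint_zero : qint 0 = 0 := by rw [qint_eq]; simp

theorem qint_ne_zero {m : ℤ} (hm : m ≠ 0) : qint m ≠ 0 := by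
  rw [qint_eq]
  exact div_ne_zero (sub_ne_zero.2 (v_zpow_ne_one (by omega))) v_sq_sub_one_ne_zero

theorem qint_add (a b : ℤ) : qint (a + b) = qint a + v ^ (2 * a) * qint b := by
  rw [qint_eq, qint_eq, qint_eq, mul_add, zpow_add₀ v_ne_zero]
  field_simp
  ring

theorem qfact_zero : qfact 0 = 1 := by simp [qfact]

theorem qfact_succ (n : ℕ) : qfact ((n : ℤ) + 1) = qfact n * qint (n + 1) := by
  rw [qfact, qfact, show ((n : ℤ) + 1).toNat = n + 1 by omega, Int.toNat_natCast,
    Finset.prod_range_succ]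

theorem qfact_ne_zero (m : ℤ) : qfact m ≠ 0 :=
  Finset.prod_ne_zero_iff.2 fun k _ => qint_ne_zero (by omega)

theorem qbinom_zero (m : ℤ) : qbinom m 0 = 1 := by simp [qbinom, qfact_zero]

theorem qbinom_succ (m : ℤ) (k : ℕ) :
    qbinom m ((k : ℤ) + 1) * qint (k + 1) = qbinom m k * qint (m - k) := by
  have h1 := qfact_ne_zero k
  have h2 := qint_ne_zero (show (k : ℤ) + 1 ≠ 0 by omega)
  rw [qbinom, qbinom, qfact_succ, show ((k : ℤ) + 1).toNat = k + 1 by omega, Int.toNat_natCast,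
    Finset.prod_range_succ]
  field_simp

theorem qbinom_eq_zero {m k : ℤ} (h0 : 0 ≤ m) (h : m < k) : qbinom m k = 0 := by
  rw [qbinom, Finset.prod_eq_zero (i := m.toNat), zero_div]
  · rw [Finset.mem_range]; omega
  · rw [Int.toNat_of_nonneg h0, sub_self, qint_zero]

theorem qbinom_mul_qfact {m k : ℤ} (h0 : 0 ≤ k) (h : k ≤ m) :
    qbinom m k * qfact k * qfact (m - k) = qfact m := by
  obtain ⟨n, rfl⟩ := Int.eq_ofNat_of_zero_le h0
  obtain ⟨p, hp⟩ := Int.eq_ofNat_of_zero_le (sub_nonneg.2 h)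
  obtain rfl : m = n + p := by omega
  clear h h0
  rw [add_sub_cancel_left] at *
  induction n generalizing p with
  | zero => simp [qbinom_zero, qfact_zero]
  | succ n ih =>
    have h1 := qbinom_succ (((n + 1 : ℕ) : ℤ) + p) n
    have h2 := ih (p + 1) (by push_cast; ring)
    rw [show ((n + 1 : ℕ) : ℤ) + p - n = p + 1 by push_cast; ring] at h1
    rw [show (n : ℤ) + (p + 1 : ℕ) = ((n + 1 : ℕ) : ℤ) + p by push_cast; ring] at h2
    rw [← h2]
    push_cast at *
    rw [qfact_succ, qfact_succ]
    linear_combination (qfact n * qfact p) * h1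

theorem qbinom_pascal (m : ℤ) (k : ℕ) : qbinom (m + 1) ((k : ℤ) + 1) =
    qbinom m ((k : ℤ) + 1) + v ^ (2 * (m - k)) * qbinom m k := by
  have h1 := qfact_ne_zero k
  have h2 := qint_ne_zero (show (k : ℤ) + 1 ≠ 0 by omega)
  have h3 : qint (m + 1) = qint (m - k) + v ^ (2 * (m - k)) * qint (k + 1) := by
    rw [← qint_add]; congr 1; ring
  have h4 : ∏ l ∈ Finset.range (k + 1), qint (m + 1 - l) =
      qint (m + 1) * ∏ l ∈ Finset.range k, qint (m - l) := by
    rw [Finset.prod_range_succ', mul_comm]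
    congr 1
    · simp
    · refine Finset.prod_congr rfl fun l _ => ?_
      congr 1
      push_cast
      ring
  rw [qbinom, qbinom, qbinom, qfact_succ, show ((k : ℤ) + 1).toNat = k + 1 by omega,
    Int.toNat_natCast, h4, Finset.prod_range_succ, h3]
  field_simp

/-- Induction on `n`: Pascal's rule for `qbinom n x` splits the sum into those for `m + 1` and `m`,
and Pascal's rule on the right recombines them. The upper index `u` is an arbitrary integer. -/
theorem q_vandermonde (u : ℤ) (n m : ℕ) : ∑ x ∈ Finset.range (m + 1),
    v ^ (2 * (x * (u - (m - x)))) * qbinom n x * qbinom u (m - x) = qbinom (u + n) m := by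
  induction n generalizing m with
  | zero =>
    rw [Finset.sum_eq_single 0]
    · simp [qbinom_zero]
    · intro x _ hx
      rw [qbinom_eq_zero (by simp) (by push_cast; omega)]
      ring
    · simp
  | succ n ih =>
    cases m with
    | zero => simp [qbinom_zero]
    | succ m =>
      have h1 := ih (m + 1)
      have h2 := ih m
      rw [show u + ((n + 1 : ℕ) : ℤ) = u + n + 1 by push_cast; ring]
      have h3 := qbinom_pascal (u + n) m
      push_cast at *
      rw [h3, ← h1, ← h2, Finset.sum_range_succ' _ (m + 1), Finset.sum_range_succ' _ (m + 1),
        Finset.mul_sum, add_right_comm, ← Finset.sum_add_distrib]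
      congr 1
      · refine Finset.sum_congr rfl fun x _ => ?_
        push_cast
        rw [qbinom_pascal]
        have e : v ^ (2 * (((x : ℤ) + 1) * (u - (m + 1 - (x + 1))))) * v ^ (2 * ((n : ℤ) - x)) =
            v ^ (2 * (u + n - m)) * v ^ (2 * ((x : ℤ) * (u - (m - x)))) := by
          rw [← zpow_add₀ v_ne_zero, ← zpow_add₀ v_ne_zero]
          congr 1
          ring
        rw [show (m : ℤ) + 1 - (x + 1) = m - x by ring] at e ⊢
        linear_combination (qbinom n x * qbinom u (m - x)) * e

end AffineC

/-! ### Weighted sums over strictly upper triangular matrices -/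

namespace AffineC

/-! ### Sums over finitely supported matrices -/

theorem finsum_mem_fiberwise {α β M : Type*} [AddCommMonoid M] {U : Set α} {I : Set β}
    (hU : U.Finite) (hI : I.Finite) {φ : α → β} (hφ : ∀ x ∈ U, φ x ∈ I) (f : α → M) :
    ∑ᶠ x ∈ U, f x = ∑ᶠ y ∈ I, ∑ᶠ x ∈ {x | x ∈ U ∧ φ x = y}, f x := by
  have h : U = ⋃ y ∈ I, {x | x ∈ U ∧ φ x = y} := by
    ext x
    simp only [Set.mem_iUnion, Set.mem_ofPred_eq, exists_prop]
    exact ⟨fun hx => ⟨φ x, hφ x hx, hx, rfl⟩, fun ⟨_, _, hx, _⟩ => hx⟩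
  conv_lhs => rw [h]
  refine finsum_mem_biUnion ?_ hI fun y _ => hU.subset fun x hx => hx.1
  intro y _ y' _ hyy'
  exact Set.disjoint_left.2 fun x hx hx' => hyy' (hx.2.symm.trans hx'.2)

open Classical in
/-- The sum of the entries of `σ` at the places satisfying `P`. -/
noncomputable def part (P : ℤ × ℤ → Prop) (σ : ℤ × ℤ →₀ ℕ) : ℤ :=
  σ.sum fun t x => if P t then (x : ℤ) else 0

open Classical in
theorem part_eq_sum (P : ℤ × ℤ → Prop) (σ : ℤ × ℤ →₀ ℕ) :
    part P σ = ∑ t ∈ σ.support, if P t then (σ t : ℤ) else 0 := rfl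

section

variable {P P' P'' : ℤ × ℤ → Prop} {σ τ : ℤ × ℤ →₀ ℕ}

theorem part_add (P : ℤ × ℤ → Prop) (σ τ : ℤ × ℤ →₀ ℕ) :
    part P (σ + τ) = part P σ + part P τ := by
  refine Finsupp.sum_add_index' (fun _ => by simp) fun t x y => ?_
  split_ifs <;> simp

open Classical in
theorem part_single (P : ℤ × ℤ → Prop) (t : ℤ × ℤ) (x : ℕ) :
    part P (Finsupp.single t x) = if P t then (x : ℤ) else 0 :=
  Finsupp.sum_single_index (by simp)

theorem part_or (h : ∀ t, σ t ≠ 0 → (P t ↔ P' t ∨ P'' t)) (h' : ∀ t, P' t → ¬ P'' t) :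
    part P σ = part P' σ + part P'' σ := by
  rw [part, part, part, Finsupp.sum, Finsupp.sum, Finsupp.sum, ← Finset.sum_add_distrib]
  refine Finset.sum_congr rfl fun t ht => ?_
  have h1 := h t (Finsupp.mem_support_iff.1 ht)
  have h2 := h' t
  by_cases hP' : P' t <;> by_cases hP'' : P'' t <;> simp_all

theorem part_eq_zero (h : ∀ t, σ t ≠ 0 → ¬ P t) : part P σ = 0 :=
  Finset.sum_eq_zero fun t ht => if_neg (h t (Finsupp.mem_support_iff.1 ht))

theorem part_nonneg (P : ℤ × ℤ → Prop) (σ : ℤ × ℤ →₀ ℕ) : 0 ≤ part P σ :=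
  Finset.sum_nonneg fun t _ => by dsimp only; split_ifs <;> simp

open Classical in
theorem le_part {t : ℤ × ℤ} (h : P t) : (σ t : ℤ) ≤ part P σ := by
  by_cases ht : σ t = 0
  · rw [ht]; exact part_nonneg P σ
  · refine le_trans (le_of_eq ?_) (Finset.single_le_sum (f := fun t => if P t then (σ t : ℤ) else 0)
      (fun t _ => by split_ifs <;> simp) (Finsupp.mem_support_iff.2 ht))
    simp [h]

theorem finsum_part (φ : ℤ × ℤ → ℤ) (σ : ℤ × ℤ →₀ ℕ) (f : ℤ → ℤ) :
    ∑ᶠ p, part (fun t => φ t = p) σ * f p = ∑ t ∈ σ.support, (σ t : ℤ) * f (φ t) := by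
  simp only [part, Finsupp.sum, Finset.sum_mul]
  rw [finsum_sum_comm]
  · refine Finset.sum_congr rfl fun t _ => ?_
    rw [finsum_eq_single _ (φ t) fun p hp => by rw [if_neg hp.symm, zero_mul], if_pos rfl]
  · intro t _
    refine (Set.finite_singleton (φ t)).subset fun p hp => ?_
    by_contra h
    exact hp (by dsimp only; rw [if_neg fun h' => h h'.symm, zero_mul])

theorem finsum_mem_part (φ : ℤ × ℤ → ℤ) (σ : ℤ × ℤ →₀ ℕ) (R : Set ℤ) :
    ∑ᶠ p ∈ R, part (fun t => φ t = p) σ = part (fun t => φ t ∈ R) σ := by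
  classical
  have h := finsum_part φ σ fun p => if p ∈ R then 1 else 0
  rw [finsum_mem_def]
  convert h using 2
  · ext p
    by_cases hp : p ∈ R <;> simp [hp]
  · rw [part, Finsupp.sum]
    exact Finset.sum_congr rfl fun t _ => by simp

theorem finsum_entry {φ : ℤ → ℤ × ℤ} (hφ : Function.Injective φ) (hP : ∀ t, P t ↔ t ∈ Set.range φ) :
    ∑ᶠ l, (σ (φ l) : ℤ) = part P σ := by
  classical
  have h : ∀ l, (σ (φ l) : ℤ) = ∑ t ∈ σ.support, if t = φ l then (σ t : ℤ) else 0 := by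
    intro l
    rw [Finset.sum_ite_eq']
    split_ifs with h
    · rfl
    · simpa using h
  simp only [h, part_eq_sum]
  rw [finsum_sum_comm]
  · refine Finset.sum_congr rfl fun t _ => ?_
    by_cases ht : P t
    · obtain ⟨l, rfl⟩ := (hP t).1 ht
      rw [finsum_eq_single _ l fun l' hl' => if_neg fun h' => hl' (hφ h').symm, if_pos rfl,
        if_pos ht]
    · rw [if_neg ht]
      refine finsum_eq_zero_of_forall_eq_zero fun l => if_neg ?_
      rintro rfl
      exact ht ((hP _).2 ⟨l, rfl⟩)
  · intro t _
    refine Set.Finite.subset (Set.Finite.preimage hφ.injOn (Set.finite_singleton t)) fun l hl => ?_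
    by_contra h'
    exact hl (if_neg fun h'' => h' h''.symm)

theorem finsum_row (σ : ℤ × ℤ →₀ ℕ) (k : ℤ) : ∑ᶠ l, (σ (k, l) : ℤ) = part (fun t => t.1 = k) σ :=
  finsum_entry (φ := fun l => (k, l)) (fun _ _ h => (Prod.ext_iff.1 h).2)
    fun t => ⟨fun h => ⟨t.2, by rw [← h]⟩, by rintro ⟨l, rfl⟩; rfl⟩

theorem finsum_column (σ : ℤ × ℤ →₀ ℕ) (l : ℤ) :
    ∑ᶠ k, (σ (k, l) : ℤ) = part (fun t => t.2 = l) σ :=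
  finsum_entry (φ := fun k => (k, l)) (fun _ _ h => (Prod.ext_iff.1 h).1)
    fun t => ⟨fun h => ⟨t.1, by rw [← h]⟩, by rintro ⟨l, rfl⟩; rfl⟩

/-- Matrices with given finitely supported row and column sums form a finite set. -/
theorem finite_of_sums {s c : ℤ → ℤ} (hs : s.support.Finite) (hc : c.support.Finite)
    {U : Set (ℤ × ℤ →₀ ℕ)} (hU : ∀ σ ∈ U, (∀ k, part (fun t => t.1 = k) σ = s k) ∧
      ∀ l, part (fun t => t.2 = l) σ = c l) : U.Finite := by
  classical
  let F : Finset (ℤ × ℤ) := hs.toFinset ×ˢ hc.toFinset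
  refine ((F.finsupp fun t => Finset.range ((s t.1).toNat + 1)).finite_toSet).subset ?_
  intro σ hσ
  obtain ⟨h1, h2⟩ := hU σ hσ
  have h3 : ∀ t, (σ t : ℤ) ≤ s t.1 := fun t => (le_part (P := fun u => u.1 = t.1) rfl).trans (h1 _).le
  have h4 : ∀ t, (σ t : ℤ) ≤ c t.2 := fun t => (le_part (P := fun u => u.2 = t.2) rfl).trans (h2 _).le
  rw [Finset.mem_coe, Finset.mem_finsupp_iff]
  refine ⟨?_, fun t _ => ?_⟩
  rotate_left
  · rw [Finset.mem_range]
    have := h3 t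
    omega
  · intro t ht
    have h := Finsupp.mem_support_iff.1 ht
    have := h3 t
    have := h4 t
    simp only [F, Finset.mem_product, Set.Finite.mem_toFinset, Function.mem_support]
    omega

open Classical in
/-- The bilinear inversion form of matrices. -/
noncomputable def cross (σ τ : ℤ × ℤ →₀ ℕ) : ℤ :=
  σ.sum fun s x => x * part (fun t => t.1 < s.1 ∧ s.2 < t.2) τ

theorem cross_add_left (σ σ' τ : ℤ × ℤ →₀ ℕ) : cross (σ + σ') τ = cross σ τ + cross σ' τ :=
  Finsupp.sum_add_index' (fun _ => by simp) fun t x y => by push_cast; ring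

theorem cross_add_right (σ τ τ' : ℤ × ℤ →₀ ℕ) : cross σ (τ + τ') = cross σ τ + cross σ τ' := by
  simp only [cross, part_add, mul_add, Finsupp.sum_add]

theorem cross_eq_zero (h : ∀ s, σ s ≠ 0 → ∀ t, τ t ≠ 0 → ¬ (t.1 < s.1 ∧ s.2 < t.2)) :
    cross σ τ = 0 :=
  Finset.sum_eq_zero fun s hs => by
    dsimp only
    rw [part_eq_zero (h s (Finsupp.mem_support_iff.1 hs)), mul_zero]

theorem cross_single_left (s : ℤ × ℤ) (x : ℕ) (τ : ℤ × ℤ →₀ ℕ) :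
    cross (Finsupp.single s x) τ = x * part (fun t => t.1 < s.1 ∧ s.2 < t.2) τ :=
  Finsupp.sum_single_index (by simp)

theorem sum_sum_eq_cross (σ : ℤ × ℤ →₀ ℕ) :
    ∑ s ∈ σ.support, ∑ t ∈ σ.support with t.1 < s.1 ∧ s.2 < t.2, (σ s : ℤ) * σ t =
      cross σ σ := by
  refine Finset.sum_congr rfl fun s _ => ?_
  rw [← Finset.mul_sum, Finset.sum_filter]
  dsimp only
  rw [part_eq_sum]
  congr 1
  exact Finset.sum_congr rfl fun t _ => by congr

/-- The weight of a matrix. -/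
noncomputable def weight (σ : ℤ × ℤ →₀ ℕ) : K :=
  v ^ (2 * cross σ σ) * (σ.prod fun _ x => qfact x)⁻¹

theorem finprod_ratio {f g : ℤ → K} (hg : ∀ j, g j ≠ 0) (hf : (Function.mulSupport f).Finite)
    (hg' : (Function.mulSupport g).Finite) (k : ℤ) (h : ∀ j, j ≠ k → f j = g j) :
    (∏ᶠ j, f j) * g k = (∏ᶠ j, g j) * f k := by
  have h1 : ∏ᶠ j, f j / g j = f k / g k :=
    finprod_eq_single _ k fun j hj => by rw [h j hj, div_self (hg j)]
  have h2 : ∏ᶠ j, g j ≠ 0 := by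
    rw [finprod_eq_prod _ hg']
    exact Finset.prod_ne_zero_iff.2 fun j _ => hg j
  rw [finprod_div_distrib hf hg'] at h1
  have := hg k
  field_simp at h1
  rw [h1]

theorem finite_qfact {s : ℤ → ℤ} (hs : s.support.Finite) :
    (Function.mulSupport fun j => qfact (s j)).Finite :=
  hs.subset fun j hj h => hj (by simp only [h, qfact_zero])

theorem finprod_qfact_ne_zero {s : ℤ → ℤ} (hs : s.support.Finite) : ∏ᶠ j, qfact (s j) ≠ 0 := by
  rw [finprod_eq_prod _ (finite_qfact hs)]
  exact Finset.prod_ne_zero_iff.2 fun j _ => qfact_ne_zero _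

end

/-! ### Strictly upper triangular matrices with given row and column sums -/

/-- The matrices whose entries in the columns before `l` vanish, which are strictly upper triangular
in the columns after `l`, and supported in the rows before `k` in column `l`; with row sums `s` and
column sums `c`. -/
def strictSet (l k : ℤ) (s c : ℤ → ℤ) : Set (ℤ × ℤ →₀ ℕ) :=
  {σ | (∀ t, σ t ≠ 0 → (t.2 = l ∧ t.1 < k) ∨ (l < t.2 ∧ t.1 < t.2)) ∧
    (∀ p, part (fun t => t.1 = p) σ = s p) ∧ ∀ m, part (fun t => t.2 = m) σ = c m}

section

variable {s c : ℤ → ℤ} {l k : ℤ} {σ τ : ℤ × ℤ →₀ ℕ}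

theorem finite_strictSet (hs : s.support.Finite) (hc : c.support.Finite) (l k : ℤ) :
    (strictSet l k s c).Finite :=
  finite_of_sums hs hc fun _ hσ => hσ.2

theorem part_row_lt (hσ : ∀ p, part (fun t => t.1 = p) σ = s p) (k : ℤ) :
    part (fun t => t.1 < k) σ = cum s k := by
  have h := finsum_mem_part (fun t => t.1) σ (Set.Iio k)
  simp only [hσ] at h
  exact h.symm

theorem part_col_lt (hσ : ∀ m, part (fun t => t.2 = m) σ = c m) (k : ℤ) :
    part (fun t => t.2 < k) σ = cum c k := by
  have h := finsum_mem_part (fun t => t.2) σ (Set.Iio k)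
  simp only [hσ] at h
  exact h.symm

/-- The sequence with entry `x` at `k` and zero elsewhere. -/
def spike (k x j : ℤ) : ℤ := if j = k then x else 0

@[simp] theorem spike_same (k x : ℤ) : spike k x k = x := if_pos rfl

@[simp] theorem spike_of_ne {k j : ℤ} (h : j ≠ k) (x : ℤ) : spike k x j = 0 := if_neg h

theorem finite_spike (k x : ℤ) : (spike k x).support.Finite :=
  (Set.finite_singleton k).subset fun j hj => by
    by_contra h
    exact hj (by simp [show j ≠ k from h])

theorem cum_spike (k x j : ℤ) : cum (spike k x) j = if k < j then x else 0 := by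
  rw [cum, finsum_mem_def, finsum_eq_single _ k]
  · simp [Set.indicator_apply]
  · intro i hi
    simp [Set.indicator_apply, hi]

/-- Adding the entry `x` at the place `(k, l)`. -/
theorem weight_single_add (hτ : τ ∈ strictSet l k s c) (x : ℕ) :
    weight (Finsupp.single (k, l) x + τ) =
      v ^ (2 * (x * (cum s k - c l))) * (qfact x)⁻¹ * weight τ := by
  obtain ⟨h1, h2, h3⟩ := hτ
  -- The entries strictly above and to the right of `(k, l)` are those in rows before `k`, except
  -- those in column `l`; by the support condition all of column `l` lies in rows before `k`.
  have e1 : part (fun t => t.1 < k ∧ l < t.2) τ = cum s k - c l := by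
    have := part_or (σ := τ) (P := fun t => t.1 < k) (P' := fun t => t.1 < k ∧ l < t.2)
      (P'' := fun t => t.2 = l) (fun t ht => by have := h1 t ht; omega) (fun t => by omega)
    rw [part_row_lt h2, h3] at this
    omega
  have e2 : cross τ (Finsupp.single (k, l) x) = 0 := by
    refine cross_eq_zero fun t ht u hu => ?_
    have h4 : u = (k, l) := by
      by_contra h
      exact hu (Finsupp.single_eq_of_ne h)
    have := h1 t ht
    rw [h4]
    dsimp only
    omega
  have e3 : cross (Finsupp.single (k, l) x) (Finsupp.single (k, l) x) = 0 := by
    rw [cross_single_left, part_single, if_neg (by dsimp only; omega), mul_zero]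
  have e4 : cross (Finsupp.single (k, l) x + τ) (Finsupp.single (k, l) x + τ) =
      x * (cum s k - c l) + cross τ τ := by
    rw [cross_add_left, cross_add_right, cross_add_right, e2, e3, cross_single_left, e1]
    ring
  have e5 : (Finsupp.single (k, l) x + τ).prod (fun _ y => qfact y) =
      qfact x * τ.prod fun _ y => qfact y := by
    rw [Finsupp.prod_add_index_of_disjoint, Finsupp.prod_single_index (by simp [qfact_zero])]
    rw [Finset.disjoint_left]
    intro t ht ht'
    have h4 : t = (k, l) := by
      by_contra h
      exact Finsupp.mem_support_iff.1 ht (Finsupp.single_eq_of_ne h)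
    have := h1 t (Finsupp.mem_support_iff.1 ht')
    rw [h4] at this
    dsimp only at this
    omega
  rw [weight, weight, e4, e5, mul_add, zpow_add₀ v_ne_zero, mul_inv]
  ring

theorem part_single_row (x : ℕ) (p : ℤ) :
    part (fun t => t.1 = p) (Finsupp.single (k, l) x) = spike k (x : ℤ) p := by
  rw [part_single]
  by_cases h : p = k
  · simp [h]
  · simp [h, Ne.symm h]

theorem part_single_col (x : ℕ) (p : ℤ) :
    part (fun t => t.2 = p) (Finsupp.single (k, l) x) = spike l (x : ℤ) p := by
  rw [part_single]
  by_cases h : p = l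
  · simp [h]
  · simp [h, Ne.symm h]

/-- Allowing row `k` in column `l` opens exactly one new place. Fixing its entry `x` and erasing it
leads back to the previous support with the sums of row `k` and column `l` lowered by `x`. -/
theorem bijOn_single_add (hkl : k < l) (x : ℕ) :
    Set.BijOn (fun τ => Finsupp.single (k, l) x + τ)
      (strictSet l k (s - spike k (x : ℤ)) (c - spike l (x : ℤ)))
      {σ | σ ∈ strictSet l (k + 1) s c ∧ σ (k, l) = x} := by
  refine ⟨fun τ hτ => ⟨⟨fun t ht => ?_, fun p => ?_, fun p => ?_⟩, ?_⟩, fun _ _ _ _ h => ?_,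
    fun σ hσ => ?_⟩
  · by_cases h : t = (k, l)
    · left
      rw [h]
      exact ⟨rfl, by dsimp only; omega⟩
    · rw [Finsupp.add_apply, Finsupp.single_eq_of_ne h, zero_add] at ht
      have := hτ.1 t ht
      omega
  · rw [part_add, hτ.2.1, part_single_row, Pi.sub_apply]
    ring
  · rw [part_add, hτ.2.2, part_single_col, Pi.sub_apply]
    ring
  · have h : τ (k, l) = 0 := by
      by_contra h
      have := hτ.1 _ h
      dsimp only at this
      omega
    simp [h]
  · exact add_left_cancel h
  · obtain ⟨⟨h1, h2, h3⟩, h4⟩ := hσ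
    have h5 : Finsupp.single (k, l) x + σ.erase (k, l) = σ := by
      rw [← h4]; exact Finsupp.single_add_erase (k, l) σ
    refine ⟨σ.erase (k, l), ⟨fun t ht => ?_, fun p => ?_, fun p => ?_⟩, h5⟩
    · have h : t ≠ (k, l) := fun h => ht (by rw [h, Finsupp.erase_same])
      rw [Finsupp.erase_ne h] at ht
      have := h1 t ht
      have h6 : ¬ (t.1 = k ∧ t.2 = l) := fun h' => h (Prod.ext h'.1 h'.2)
      omega
    · rw [Pi.sub_apply, ← h2, ← h5, part_add, part_single_row, h5]
      ring
    · rw [Pi.sub_apply, ← h3, ← h5, part_add, part_single_col, h5]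
      ring

theorem sum_single_add (hs : s.support.Finite) (hkl : k < l) (x : ℕ) :
    ∑ᶠ σ ∈ {σ | σ ∈ strictSet l (k + 1) s c ∧ σ (k, l) = x}, weight σ =
      v ^ (2 * (x * (cum s k - (c l - x)))) * (qfact x)⁻¹ *
        ∑ᶠ τ ∈ strictSet l k (s - spike k (x : ℤ)) (c - spike l (x : ℤ)), weight τ := by
  rw [mul_finsum_mem]
  refine (finsum_mem_eq_of_bijOn _ (bijOn_single_add hkl x) fun τ hτ => ?_).symm
  rw [weight_single_add hτ, cum_sub hs (finite_spike _ _), cum_spike, if_neg (lt_irrefl k)]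
  simp

theorem strictSet_eq_empty_of_neg {p : ℤ} (h : s p < 0) : strictSet l k s c = ∅ := by
  refine Set.eq_empty_of_forall_notMem fun σ hσ => ?_
  have := part_nonneg (fun t => t.1 = p) σ
  rw [hσ.2.1] at this
  omega

/-- An empty column imposes nothing, so the recursion passes to the next column with all strictly
upper places open. -/
theorem strictSet_succ (hl : ∀ m ≤ l, c m = 0) :
    strictSet l k s c = strictSet (l + 1) (l + 1) s c := by
  ext σ
  refine and_congr_left fun ⟨_, h3⟩ => forall₂_congr fun t ht => ?_
  have h5 := le_part (σ := σ) (P := fun u => u.2 = t.2) (t := t) rfl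
  rw [h3] at h5
  have h6 := hl t.2
  omega

theorem strictSet_eq_empty_of_low (hk : ∀ p < k, s p = 0) (hl : c l ≠ 0) :
    strictSet l k s c = ∅ := by
  refine Set.eq_empty_of_forall_notMem fun σ hσ => hl ?_
  rw [← hσ.2.2]
  refine part_eq_zero fun t ht h => ?_
  have h5 := le_part (σ := σ) (P := fun u => u.1 = t.1) (t := t) rfl
  rw [hσ.2.1] at h5
  have h6 := hk t.1
  have := hσ.1 t ht
  omega

theorem strictSet_zero : strictSet l k (0 : ℤ → ℤ) (0 : ℤ → ℤ) = {0} := by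
  ext σ
  refine ⟨fun h => ?_, ?_⟩
  · ext t
    have h5 := le_part (σ := σ) (P := fun u => u.1 = t.1) (t := t) rfl
    rw [h.2.1] at h5
    simpa using h5
  · rintro rfl
    exact ⟨by simp, fun p => part_eq_zero (by simp), fun p => part_eq_zero (by simp)⟩

theorem weight_zero : weight 0 = 1 := by
  rw [weight, cross_eq_zero (by simp)]
  simp

theorem cum_eq_zero (h : ∀ m < l, c m = 0) : cum c l = 0 := by
  rw [cum]
  exact finsum_mem_eq_zero_of_forall_eq_zero fun m hm => h m hm

theorem eq_zero_of_total (hs : s.support.Finite) (h0 : ∀ p, 0 ≤ s p) (h : total s = 0) : s = 0 := by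
  funext p
  have h1 : total s = ∑ j ∈ hs.toFinset, s j := finsum_eq_sum _ hs
  rw [h1, Finset.sum_eq_zero_iff_of_nonneg fun j _ => h0 j] at h
  by_contra hp
  exact hp (h p (hs.mem_toFinset.2 hp))

theorem total_spike (k x : ℤ) : total (spike k x) = x := by
  rw [total, finsum_eq_single _ k fun j hj => by simp [hj]]
  simp

/-- The sum of the weights of the strictly upper triangular matrices with given row and column
sums, the columns before `l` being zero. -/
theorem sum_strictSet_aux (M : ℤ) (n : ℕ) : ∀ s c : ℤ → ℤ, s.support.Finite → c.support.Finite →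
    (∀ p, 0 ≤ s p) → (∀ p, 0 ≤ c p) → (∀ m < M - n, c m = 0) → (∀ m, M ≤ m → c m = 0) →
    total s = total c →
    ∑ᶠ σ ∈ strictSet (M - n) (M - n) s c, weight σ =
      (∏ j ∈ Finset.Ico (M - n) M, qbinom (cum s j - cum c j) (c j)) * (∏ᶠ p, qfact (s p))⁻¹ := by
  induction n with
  | zero =>
    intro s c hs hc hs0 hc0 h1 h2 h3
    obtain rfl : c = 0 := funext fun m => by
      rcases lt_or_ge m M with h | h
      · exact h1 m (by simpa using h)
      · exact h2 m h
    obtain rfl := eq_zero_of_total hs hs0 (h3.trans (by simp [total]))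
    rw [strictSet_zero, finsum_mem_singleton, weight_zero]
    simp [qfact_zero]
  | succ n ih =>
    obtain ⟨l, hl⟩ : ∃ l, l = M - ((n + 1 : ℕ) : ℤ) := ⟨_, rfl⟩
    rw [show M - (n : ℤ) = l + 1 by push_cast at hl; omega] at ih
    rw [← hl]
    -- Column `l` is filled row by row. With the rows before `k` open, its factor is `[cum s k; c
    -- l]`; opening row `k` raises the upper index by `s k`, which is the `q`-Vandermonde identity.
    have key : ∀ k₀ k : ℤ, k₀ ≤ k → k ≤ l → ∀ s c : ℤ → ℤ, s.support.Finite → c.support.Finite →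
        (∀ p, 0 ≤ s p) → (∀ p, 0 ≤ c p) → (∀ m < l, c m = 0) → (∀ m, M ≤ m → c m = 0) →
        total s = total c → (∀ p < k₀, s p = 0) →
        ∑ᶠ σ ∈ strictSet l k s c, weight σ = qbinom (cum s k) (c l) *
          (∏ j ∈ Finset.Ico (l + 1) M, qbinom (cum s j - cum c j) (c j)) *
            (∏ᶠ p, qfact (s p))⁻¹ := by
      intro k₀ k hk
      induction k, hk using Int.leInduction with
      | base =>
        intro hk s c hs hc hs0 hc0 h1 h2 h3 h4
        by_cases h5 : c l = 0
        · have h6 : ∀ m < l + 1, c m = 0 := fun m hm => by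
            rcases (show m < l ∨ m = l by omega) with h | h
            · exact h1 m h
            · rw [h, h5]
          rw [strictSet_succ fun m hm => h6 m (by omega), ih s c hs hc hs0 hc0 h6 h2 h3, h5,
            qbinom_zero, one_mul]
        · rw [strictSet_eq_empty_of_low h4 h5, finsum_mem_empty, cum_eq_zero h4,
            qbinom_eq_zero le_rfl (lt_of_le_of_ne (hc0 l) (Ne.symm h5))]
          ring
      | succ k hk ihk =>
        intro hkl s c hs hc hs0 hc0 h1 h2 h3 h4
        obtain ⟨m, hm⟩ := Int.eq_ofNat_of_zero_le (hc0 l)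
        obtain ⟨n', hn'⟩ := Int.eq_ofNat_of_zero_le (hs0 k)
        have h5 : ∀ σ ∈ strictSet l (k + 1) s c, σ (k, l) ∈ (Finset.range (m + 1) : Set ℕ) := by
          intro σ hσ
          have h6 := le_part (σ := σ) (P := fun u => u.2 = l) (t := (k, l)) rfl
          rw [hσ.2.2] at h6
          rw [Finset.coe_range, Set.mem_Iio]
          omega
        -- Split by the entry `x` at `(k, l)`. The missing binomial `[s k; x]` comes from replacing
        -- the row sum `s k` by `s k - x` in the product of row factorials.
        rw [finsum_mem_fiberwise (finite_strictSet hs hc _ _) (Finset.finite_toSet _) h5,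
          finsum_mem_coe_finset, cum_succ hs, hm, hn', ← q_vandermonde, Finset.sum_mul,
          Finset.sum_mul]
        refine Finset.sum_congr rfl fun x hx => ?_
        rw [Finset.mem_range] at hx
        rw [sum_single_add hs (by omega)]
        rcases le_or_gt x n' with hxn | hxn
        · have e1 : ∀ j, l + 1 ≤ j → (c - spike l (x : ℤ)) j = c j := fun j hj => by
            simp [show j ≠ l by omega]
          have h7 : ∏ᶠ p, qfact ((s - spike k (x : ℤ)) p) ≠ 0 :=
            finprod_qfact_ne_zero (finite_sub hs (finite_spike k x))
          have h8 : ∏ᶠ p, qfact (s p) ≠ 0 := finprod_qfact_ne_zero hs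
          have h9 := finprod_ratio (f := fun p => qfact (s p))
            (g := fun p => qfact ((s - spike k (x : ℤ)) p)) (fun _ => qfact_ne_zero _)
            (finite_qfact hs) (finite_qfact (finite_sub hs (finite_spike k x))) k
            fun j hj => by simp [hj]
          have h10 : (s - spike k (x : ℤ)) k = n' - x := by simp [hn']
          simp only [h10, hn'] at h9
          have h11 := qbinom_mul_qfact (m := (n' : ℤ)) (k := (x : ℤ)) (by omega) (by omega)
          have h12 := qfact_ne_zero x
          have h13 := qfact_ne_zero (n' - x)
          rw [ihk (by omega) _ _ (finite_sub hs (finite_spike _ _))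
            (finite_sub hc (finite_spike _ _)) ?_ ?_ ?_ ?_ ?_ ?_, cum_sub hs (finite_spike _ _),
            cum_spike, if_neg (lt_irrefl k), sub_zero]
          · have e2 : ∏ j ∈ Finset.Ico (l + 1) M,
                qbinom (cum (s - spike k (x : ℤ)) j - cum (c - spike l (x : ℤ)) j)
                  ((c - spike l (x : ℤ)) j) =
                ∏ j ∈ Finset.Ico (l + 1) M, qbinom (cum s j - cum c j) (c j) := by
              refine Finset.prod_congr rfl fun j hj => ?_
              rw [Finset.mem_Ico] at hj
              rw [e1 j hj.1, cum_sub hs (finite_spike _ _), cum_sub hc (finite_spike _ _),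
                cum_spike, cum_spike, if_pos (by omega), if_pos (by omega)]
              congr 1
              ring
            have h14 : (∏ᶠ p, qfact ((s - spike k (x : ℤ)) p))⁻¹ =
                qbinom n' x * qfact x * (∏ᶠ p, qfact (s p))⁻¹ := by
              rw [← h11] at h9
              field_simp
              refine mul_right_cancel₀ h13 ?_
              linear_combination h9
            rw [e2, h14, hm, show (c - spike l (x : ℤ)) l = m - x by simp [hm]]
            field_simp
          · intro p
            by_cases hp : p = k
            · subst hp; rw [h10]; omega
            · simpa [hp] using hs0 p
          · intro p
            by_cases hp : p = l
            · subst hp; simp [hm]; omega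
            · simpa [hp] using hc0 p
          · intro p hp
            simpa [show p ≠ l by omega] using h1 p hp
          · intro p hp
            rw [e1 p (by push_cast at hl; omega)]
            exact h2 p hp
          · rw [total_sub hs (finite_spike _ _), total_sub hc (finite_spike _ _), total_spike,
              total_spike, h3]
          · intro p hp
            simpa [show p ≠ k by omega] using h4 p hp
        -- An entry larger than its row sum: no matrices remain, and the binomial `[s k; x]` is
        -- zero.
        · rw [strictSet_eq_empty_of_neg (p := k) (by simp; omega), finsum_mem_empty,
            qbinom_eq_zero (m := (n' : ℤ)) (by omega) (by omega)]
          ring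
    intro s c hs hc hs0 hc0 h1 h2 h3
    obtain ⟨m, hm⟩ := exists_bound_of_finite hs
    rw [key (min l (-m)) l (min_le_left _ _) le_rfl s c hs hc hs0 hc0 h1 h2 h3]
    · rw [← Finset.insert_Ico_add_one_left_eq_Ico (by push_cast at hl; omega : l < M),
        Finset.prod_insert (by simp), cum_eq_zero h1, sub_zero]
    · intro p hp
      by_contra h
      have := abs_lt.1 (hm p h)
      have := min_le_right l (-m)
      omega

end

end AffineC

/-! ### The row identity for `n(a,c,b)` -/

namespace AffineC

/-! ### The row identity -/

section

variable {a b c s s' : ℤ → ℤ} {σ τ : ℤ × ℤ →₀ ℕ}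

theorem finite_le {α : Type*} {c : α → ℤ} (hc : c.support.Finite) :
    {f : α → ℤ | ∀ j, 0 ≤ f j ∧ f j ≤ c j}.Finite := by
  have h : (Set.pi Set.univ fun i : hc.toFinset => Set.Icc 0 (c i)).Finite :=
    Set.Finite.pi fun i => Set.finite_Icc _ _
  refine Set.Finite.of_injOn (f := fun (f : α → ℤ) (i : hc.toFinset) => f i.1)
    ?_ ?_ h
  · exact fun f hf i _ => hf i.1
  intro f hf g hg hfg
  funext j
  by_cases hj : c j = 0
  · have h1 := hf j
    have h2 := hg j
    omega
  · exact congrFun hfg ⟨j, hc.mem_toFinset.2 hj⟩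

theorem zpow_sum_of_ne_zero {α : Type*} {x : K} (hx : x ≠ 0) (F : Finset α) (f : α → ℤ) :
    x ^ (∑ i ∈ F, f i) = ∏ i ∈ F, x ^ f i := by
  classical
  induction F using Finset.induction_on with
  | empty => simp
  | insert i F hi ih => rw [Finset.sum_insert hi, Finset.prod_insert hi, zpow_add₀ hx, ih]

/-- The strictly upper triangular matrices with row sums `s` and column sums `c`. -/
def strictUpper (s c : ℤ → ℤ) : Set (ℤ × ℤ →₀ ℕ) :=
  {σ | (∀ t, σ t ≠ 0 → t.1 < t.2) ∧
    (∀ p, part (fun t => t.1 = p) σ = s p) ∧ ∀ m, part (fun t => t.2 = m) σ = c m}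

theorem finsum_Iic_sub (hs : s.support.Finite) (hc : c.support.Finite) (j : ℤ) :
    ∑ᶠ k ∈ Set.Iic j, (s k - c k) = cum s (j + 1) - cum c (j + 1) := by
  have h : Set.Iic j = Set.Iio (j + 1) := by
    ext; simp only [Set.mem_Iic, Set.mem_Iio]; omega
  rw [h, ← cum_sub hs hc]
  rfl

/-- All nonzero column sums lie strictly between `-M` and `M`, so the strictly upper triangular
matrices are those of `strictSet` beginning at column `-M`. The index shift by one turns `cum` at
`j` into the sum over `k ≤ j - 1`, as in `⟦S⟧`. -/
theorem sum_strictUpper (hs : s.support.Finite) (hc : c.support.Finite) (hs0 : ∀ p, 0 ≤ s p)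
    (hc0 : ∀ p, 0 ≤ c p) (h : total s = total c) :
    ∑ᶠ σ ∈ strictUpper s c, weight σ =
      (∏ᶠ j, qbinom (∑ᶠ k ∈ Set.Iic j, (s k - c k)) (c (j + 1))) * (∏ᶠ p, qfact (s p))⁻¹ := by
  obtain ⟨M₀, hM₀⟩ := exists_bound_of_finite hc
  obtain ⟨M, hM1, hM⟩ : ∃ M, 0 < M ∧ ∀ j, c j ≠ 0 → -M < j ∧ j < M := by
    refine ⟨max M₀ 1, by omega, fun j hj => ?_⟩
    have := abs_lt.1 (hM₀ j hj)
    omega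
  have h1 : strictUpper s c = strictSet (M - ((2 * M).toNat : ℤ)) (M - ((2 * M).toNat : ℤ)) s c := by
    ext σ
    refine and_congr_left fun ⟨_, h3⟩ => forall₂_congr fun t ht => ?_
    have h5 := le_part (σ := σ) (P := fun u => u.2 = t.2) (t := t) rfl
    rw [h3] at h5
    have := hM t.2
    omega
  rw [h1, sum_strictSet_aux M _ s c hs hc hs0 hc0 (fun m hm => ?_) (fun m hm => ?_) h]
  · congr 1
    rw [← finprod_comp_equiv (Equiv.subRight (1 : ℤ))]
    rw [finprod_eq_prod_of_mulSupport_subset (s := Finset.Ico (M - ((2 * M).toNat : ℤ)) M)]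
    · refine Finset.prod_congr rfl fun j _ => ?_
      rw [Equiv.subRight_apply, finsum_Iic_sub hs hc, sub_add_cancel]
    · intro j hj
      rw [Finset.coe_Ico, Set.mem_Ico]
      have : c j ≠ 0 := by
        rintro h0
        refine hj ?_
        dsimp only
        rw [Equiv.subRight_apply, sub_add_cancel, h0, qbinom_zero]
      have := hM j this
      omega
  · by_contra h0
    have := hM m h0
    omega
  · by_contra h0
    have := hM m h0
    omega

theorem diag_injective : Function.Injective fun k : ℤ => (k, k) :=
  fun _ _ h => (Prod.ext_iff.1 h).1

/-- The diagonal matrix with the given entries. -/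
noncomputable def diagMat (ρ : ℤ →₀ ℕ) : ℤ × ℤ →₀ ℕ := ρ.embDomain ⟨_, diag_injective⟩

theorem diagMat_apply (ρ : ℤ →₀ ℕ) (k : ℤ) : diagMat ρ (k, k) = ρ k :=
  Finsupp.embDomain_apply_self ⟨_, diag_injective⟩ ρ k

theorem diagMat_apply_of_ne (ρ : ℤ →₀ ℕ) {t : ℤ × ℤ} (h : t.1 ≠ t.2) : diagMat ρ t = 0 := by
  refine Finsupp.embDomain_of_notMem_range _ _ _ ?_
  rintro ⟨k, rfl⟩
  exact h rfl

open Classical in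
theorem part_diagMat (P : ℤ × ℤ → Prop) (ρ : ℤ →₀ ℕ) :
    part P (diagMat ρ) = ρ.sum fun k x => if P (k, k) then (x : ℤ) else 0 :=
  Finsupp.sum_embDomain

theorem part_diagMat_of_iff {P : ℤ × ℤ → Prop} {p : ℤ} (hP : ∀ k, P (k, k) ↔ k = p) (ρ : ℤ →₀ ℕ) :
    part P (diagMat ρ) = ρ p := by
  rw [part_diagMat]
  simp only [hP]
  rw [Finsupp.sum, Finset.sum_ite_eq']
  split_ifs with h
  · rfl
  · rw [Finsupp.notMem_support_iff.1 h]; rfl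

theorem cross_diagMat (ρ : ℤ →₀ ℕ) (τ : ℤ × ℤ →₀ ℕ) :
    cross (diagMat ρ) τ = ρ.sum fun k x => x * part (fun t => t.1 < k ∧ k < t.2) τ :=
  Finsupp.sum_embDomain

/-- Only pairs of a diagonal place `(k, k)` with a place `t` of `τ` such that `t.1 < k < t.2` are
new. Since `τ` is strictly upper triangular, their weight is the rows before `k` minus the columns
up to `k`, that is `cum s k - cum s' (k + 1)`. -/
theorem cross_diag_add (ρ : ℤ →₀ ℕ) (hτ : τ ∈ strictUpper s s')
    (hs' : s'.support.Finite) (hρ : ∀ k, (ρ k : ℤ) = c k - s' k) :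
    cross (diagMat ρ + τ) (diagMat ρ + τ) =
      (inv (c - s') s - inv (c - s') s' - dot (c - s') s') + cross τ τ := by
  obtain ⟨h1, h2, h3⟩ := hτ
  have hD : ∀ t, diagMat ρ t ≠ 0 → t.1 = t.2 := fun t ht => by
    by_contra h
    exact ht (diagMat_apply_of_ne ρ h)
  have e1 : cross (diagMat ρ) (diagMat ρ) = 0 := by
    refine cross_eq_zero fun t ht u hu => ?_
    have := hD t ht
    have := hD u hu
    omega
  have e2 : cross τ (diagMat ρ) = 0 := by
    refine cross_eq_zero fun t ht u hu => ?_
    have := h1 t ht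
    have := hD u hu
    omega
  have hfin : (c - s').support.Finite := by
    refine ρ.hasFiniteSupport.subset fun k hk h => hk ?_
    have := hρ k
    rw [h] at this
    simpa using this.symm
  have e3 : cross (diagMat ρ) τ = inv (c - s') s - inv (c - s') s' - dot (c - s') s' := by
    have k1 := finite_mul_left hfin (cum s)
    have k2 := finite_mul_left hfin (cum s')
    have k3 : (Function.support fun j => (c - s') j * cum s j - (c - s') j * cum s' j).Finite :=
      finite_sub k1 k2
    rw [inv, inv, dot, ← finsum_sub_distrib k1 k2, ← finsum_sub_distrib k3 (finite_mul_left hfin _),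
      cross_diagMat, Finsupp.sum, finsum_eq_sum_of_support_subset (s := ρ.support)]
    · refine Finset.sum_congr rfl fun k _ => ?_
      have h4 := part_or (σ := τ) (P := fun t => t.1 < k) (P' := fun t => t.1 < k ∧ k < t.2)
        (P'' := fun t => t.2 < k + 1) (fun t ht => by have := h1 t ht; omega) (fun t => by omega)
      rw [part_row_lt h2, part_col_lt h3, cum_succ hs'] at h4
      rw [hρ, Pi.sub_apply]
      linear_combination (-(c k - s' k)) * h4
    · intro k hk
      rw [Finset.mem_coe, Finsupp.mem_support_iff]
      intro h
      refine hk ?_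
      have := hρ k
      simp only [Pi.sub_apply, ← this, h]
      simp
  rw [cross_add_left, cross_add_right, cross_add_right, e1, e2, e3]
  ring

theorem prod_diag_add (ρ : ℤ →₀ ℕ) (hτ : τ ∈ strictUpper s s')
    (hρ : ∀ k, (ρ k : ℤ) = c k - s' k) :
    ((diagMat ρ + τ).prod fun _ y => qfact y) =
      (∏ᶠ k, qfact (c k - s' k)) * τ.prod fun _ y => qfact y := by
  rw [Finsupp.prod_add_index_of_disjoint]
  · congr 1
    rw [diagMat, Finsupp.prod_embDomain, Finsupp.prod,
      finprod_eq_prod_of_mulSupport_subset (s := ρ.support)]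
    · exact Finset.prod_congr rfl fun k _ => by rw [hρ]
    · intro k hk
      rw [Finset.mem_coe, Finsupp.mem_support_iff]
      intro h
      refine hk ?_
      simp only [← hρ, h]
      simp [qfact_zero]
  · rw [Finset.disjoint_left]
    intro t ht ht'
    have := hτ.1 t (Finsupp.mem_support_iff.1 ht')
    exact Finsupp.mem_support_iff.1 ht (diagMat_apply_of_ne ρ (by omega))

theorem sigmaExp_diag_add (ρ : ℤ →₀ ℕ) (hτ : τ ∈ strictUpper s s')
    (hs' : s'.support.Finite) (hρ : ∀ k, (ρ k : ℤ) = c k - s' k) (a : ℤ → ℤ) :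
    sigmaExp a (diagMat ρ + τ) =
      inv c a + dot (c - s') a + (inv (c - s') s - inv (c - s') s' - dot (c - s') s') +
        cross τ τ := by
  rw [sigmaExp, sum_sum_eq_cross, cross_diag_add ρ hτ hs' hρ]
  have e1 := finsum_part (fun t => t.2) (diagMat ρ + τ) (cum a)
  have e2 : ∀ p, part (fun t => t.2 = p) (diagMat ρ + τ) = c p := fun p => by
    rw [part_add, part_diagMat_of_iff fun k => Iff.rfl, hτ.2.2, hρ]
    ring
  simp only [e2] at e1
  have e3 : ∀ k, (((diagMat ρ + τ) (k, k) : ℕ) : ℤ) = (c - s') k := fun k => by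
    rw [Finsupp.add_apply, diagMat_apply, Pi.sub_apply, ← hρ]
    have : τ (k, k) = 0 := by
      by_contra h
      exact lt_irrefl _ (hτ.1 _ h)
    rw [this, add_zero]
  simp only [e3]
  have e4 : inv c a = ∑ t ∈ (diagMat ρ + τ).support, ((diagMat ρ + τ) t : ℤ) *
      ∑ᶠ p ∈ Set.Iio t.2, a p := e1
  have e5 : dot (c - s') a = ∑ᶠ k, (c - s') k * a k := rfl
  rw [e4, e5]
  ring

theorem bijOn_diag_add (ρ : ℤ →₀ ℕ) (hρ : ∀ k, (ρ k : ℤ) = c k - s' k) (hsb : ∀ k, s k = s' k + b k - c k)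
    (ha : ∀ k, s' k ≤ a k) :
    Set.BijOn (fun τ => diagMat ρ + τ) (strictUpper s s')
      {σ | (σ ∈ UpperSet b c ∧ ∀ k, c k - σ (k, k) ≤ a k) ∧ (fun k => c k - (σ (k, k) : ℤ)) = s'} := by
  have hD : ∀ t : ℤ × ℤ, t.1 ≠ t.2 → diagMat ρ t = 0 := fun t h => diagMat_apply_of_ne ρ h
  refine ⟨fun τ hτ => ?_, fun _ _ _ _ h => add_left_cancel h, fun σ hσ => ?_⟩
  · have e3 : ∀ k, τ (k, k) = 0 := fun k => by
      by_contra h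
      exact lt_irrefl _ (hτ.1 _ h)
    have e4 : ∀ k, c k - ((diagMat ρ + τ) (k, k) : ℕ) = s' k := fun k => by
      rw [Finsupp.add_apply, diagMat_apply, e3, add_zero, hρ]
      ring
    refine ⟨⟨⟨fun k l hkl => ?_, fun k => ?_, fun l => ?_⟩, fun k => (e4 k).le.trans (ha k)⟩, funext e4⟩
    · rw [Finsupp.add_apply, hD _ (by dsimp only; omega), zero_add]
      by_contra h
      have := hτ.1 _ h
      dsimp only at this
      omega
    · rw [finsum_row, part_add, part_diagMat_of_iff fun k => Iff.rfl, hτ.2.1, hρ, hsb]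
      ring
    · rw [finsum_column, part_add, part_diagMat_of_iff fun k => Iff.rfl, hτ.2.2, hρ]
      ring
  · obtain ⟨⟨⟨h1, h2, h3⟩, -⟩, h4⟩ := hσ
    have h5 : diagMat ρ ≤ σ := by
      rintro ⟨k, l⟩
      by_cases h : k = l
      · subst h
        rw [diagMat_apply]
        have h7 : c k - (σ (k, k) : ℤ) = s' k := congrFun h4 k
        have := hρ k
        omega
      · rw [hD _ h]
        exact Nat.zero_le _
    have h6 : diagMat ρ + (σ - diagMat ρ) = σ := add_tsub_cancel_of_le h5
    refine ⟨σ - diagMat ρ, ⟨?_, fun p => ?_, fun p => ?_⟩, h6⟩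
    · rintro ⟨k, l⟩ ht
      rw [Finsupp.tsub_apply] at ht
      rcases lt_trichotomy k l with h | h | h
      · exact h
      · subst h
        have h7 : c k - (σ (k, k) : ℤ) = s' k := congrFun h4 k
        have := hρ k
        rw [diagMat_apply] at ht
        omega
      · rw [h1 k l h] at ht
        simp at ht
    · have := h2 p
      rw [finsum_row, ← h6, part_add, part_diagMat_of_iff fun k => Iff.rfl, hρ] at this
      rw [hsb, ← this]
      ring
    · have := h3 p
      rw [finsum_column, ← h6, part_add, part_diagMat_of_iff fun k => Iff.rfl, hρ] at this
      linarith

/-- Each factor is `v ^ (2 k) (v ^ 2 - 1) [m - k]`; the powers of `v` add up to a triangular number,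
and the quantum integers form a quotient of factorials. -/
theorem prod_range_sub (m : ℤ) (n : ℕ) (h : (n : ℤ) ≤ m) :
    ∏ k ∈ Finset.range n, (v ^ (2 * m) - v ^ (2 * k)) =
      v ^ (2 * ((n : ℤ) * (n - 1) / 2)) * (v ^ 2 - 1) ^ (n : ℤ) * (qfact m * (qfact (m - n))⁻¹) := by
  induction n with
  | zero =>
    have := qfact_ne_zero m
    simp [this]
  | succ n ih =>
    have h1 := qint_mul (m - n)
    obtain ⟨p, hp⟩ := Int.eq_ofNat_of_zero_le (sub_nonneg.2 h)
    have h2 := qfact_succ p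
    rw [← hp, show m - ((n + 1 : ℕ) : ℤ) + 1 = m - n by push_cast; ring] at h2
    have h3 := qfact_ne_zero (m - ((n + 1 : ℕ) : ℤ))
    have h4 : qint (m - n) ≠ 0 := qint_ne_zero (by push_cast at h; omega)
    have h5 : (((n + 1 : ℕ) : ℤ) * (((n + 1 : ℕ) : ℤ) - 1)) / 2 = (n : ℤ) * (n - 1) / 2 + n := by
      rw [show (((n + 1 : ℕ) : ℤ) * (((n + 1 : ℕ) : ℤ) - 1)) = (n : ℤ) * (n - 1) + n * 2 by
        push_cast; ring, Int.add_mul_ediv_right _ _ two_ne_zero]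
    have h6 : v ^ (2 * m) - v ^ (2 * n) = v ^ (2 * (n : ℤ)) * (qint (m - n) * (v ^ 2 - 1)) := by
      rw [h1, mul_sub, ← zpow_add₀ v_ne_zero, mul_one, ← zpow_natCast]
      push_cast
      congr 2
      ring
    rw [Finset.prod_range_succ, ih (by push_cast at h; omega), h5, h6, h2, mul_add,
      zpow_add₀ v_ne_zero, Nat.cast_succ, zpow_add_one₀ v_sq_sub_one_ne_zero]
    push_cast at h3
    field_simp

/-- The constant factor of a fibre of the map taking the diagonal of a matrix. -/
theorem finprod_range_sub (ha : a.support.Finite) (h0 : ∀ k, 0 ≤ s' k)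
    (h : ∀ k, s' k ≤ a k) :
    ∏ᶠ l, ∏ m ∈ Finset.range (s' l).toNat, (v ^ (2 * a l) - v ^ (2 * m)) =
      v ^ (2 * ∑ᶠ j, s' j * (s' j - 1) / 2) * (v ^ 2 - 1) ^ total s' *
        ((∏ᶠ k, qfact (a k)) * (∏ᶠ k, qfact (a k - s' k))⁻¹) := by
  have e0 : ∀ j, a j = 0 → s' j = 0 := fun j hj => le_antisymm (hj ▸ h j) (h0 j)
  rw [finprod_eq_prod_of_mulSupport_subset (s := ha.toFinset),
    finsum_eq_sum_of_support_subset (s := ha.toFinset), total,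
    finsum_eq_sum_of_support_subset (s := ha.toFinset),
    finprod_eq_prod_of_mulSupport_subset (s := ha.toFinset),
    finprod_eq_prod_of_mulSupport_subset (s := ha.toFinset), Finset.mul_sum, zpow_sum_of_ne_zero v_ne_zero,
    zpow_sum_of_ne_zero v_sq_sub_one_ne_zero, ← Finset.prod_inv_distrib, ← Finset.prod_mul_distrib,
    ← Finset.prod_mul_distrib, ← Finset.prod_mul_distrib]
  · refine Finset.prod_congr rfl fun j _ => ?_
    have := prod_range_sub (a j) (s' j).toNat (by rw [Int.toNat_of_nonneg (h0 j)]; exact h j)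
    rw [this, Int.toNat_of_nonneg (h0 j)]
  all_goals
    intro j hj
    rw [Set.Finite.coe_toFinset]
    intro hj'
    refine hj ?_
    simp [e0 j hj', hj', qfact_zero]

/-- The sequences over which a row of the first formula is summed. -/
def rowIndex (a b c : ℤ → ℤ) : Set (ℤ → ℤ) :=
  {s' | ∀ j, 0 ≤ s' j ∧ s' j ≤ a j ∧ s' j ≤ c j ∧ c j ≤ s' j + b j}

theorem finite_rowIndex (ha : a.support.Finite) (b c : ℤ → ℤ) : (rowIndex a b c).Finite :=
  (finite_le ha).subset fun _ h j => ⟨(h j).1, (h j).2.1⟩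

/-- The contribution of a row to the first formula. -/
noncomputable def rowTerm (a b c s' : ℤ → ℤ) : K :=
  v ^ (2 * rowExp a c (s' + b - c) s') * (v ^ 2 - 1) ^ total s' *
    ((∏ᶠ k, qfact (a k)) * ∏ᶠ k, qfact (b k)) *
    (∏ᶠ j, qbinom (∑ᶠ k ∈ Set.Iic j, ((s' + b - c) k - s' k)) (s' (j + 1)) * qfact (s' (j + 1))) /
    ((∏ᶠ k, qfact ((a - s') k)) * (∏ᶠ k, qfact ((c - s') k)) *
      (∏ᶠ k, qfact ((s' + b - c) k)) * ∏ᶠ k, qfact (s' k))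

theorem finprod_qbinom_mul_qfact (f : ℤ → ℤ) (hs' : s'.support.Finite) :
    ∏ᶠ j, qbinom (f j) (s' (j + 1)) * qfact (s' (j + 1)) =
      (∏ᶠ j, qbinom (f j) (s' (j + 1))) * ∏ᶠ k, qfact (s' k) := by
  have h : (Function.support fun j => s' (j + 1)).Finite :=
    Set.Finite.preimage (f := fun j : ℤ => j + 1) (add_left_injective 1).injOn hs'
  rw [finprod_mul_distrib]
  · congr 1
    exact finprod_comp_equiv (Equiv.addRight (1 : ℤ)) (f := fun k => qfact (s' k))
  · refine h.subset fun j hj h0 => hj ?_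
    dsimp only at h0 ⊢
    rw [h0, qbinom_zero]
  · exact finite_qfact h

/-- Group the matrices `σ` by `s'_k = c_k - σ_{kk}`, the column sums of the part off the diagonal;
the row sums of that part are then `s' + b - c`. For fixed `s'` the diagonal is fixed, every factor
except the weight of the strict part is constant, and `sum_strictUpper` evaluates the sum of these
weights. -/
theorem nSeq_eq (ha : a.support.Finite) (hb : b.support.Finite) (hc : c.support.Finite)
    (ha0 : ∀ k, 0 ≤ a k) (htot : total b = total c) :
    nSeq a c b = ∑ᶠ s' ∈ rowIndex a b c, rowTerm a b c s' := by
  set f : (ℤ × ℤ →₀ ℕ) → K := fun σ =>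
    v ^ (2 * sigmaExp a σ) * ((∏ᶠ k, qfact (b k)) / ∏ s ∈ σ.support, qfact (σ s)) *
      ∏ᶠ l : ℤ, ∏ m ∈ Finset.range (c l - σ (l, l)).toNat, (v ^ (2 * a l) - v ^ (2 * m)) with hf
  have hU : (UpperSet b c).Finite := finite_of_sums hb hc fun σ hσ =>
    ⟨fun k => by rw [← finsum_row]; exact hσ.2.1 k, fun l => by rw [← finsum_column]; exact hσ.2.2 l⟩
  have hle : ∀ σ ∈ UpperSet b c, ∀ k, (σ (k, k) : ℤ) ≤ b k ∧ (σ (k, k) : ℤ) ≤ c k := fun σ hσ k => by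
    rw [← hσ.2.1, ← hσ.2.2, finsum_row, finsum_column]
    exact ⟨le_part rfl, le_part rfl⟩
  -- If `s'_k > a_k` for some `k`, the factor `v ^ (2 a_k) - v ^ (2 m)` with `m = a_k` is zero, so
  -- such matrices may be dropped.
  have h1 : nSeq a c b = ∑ᶠ σ ∈ {σ | σ ∈ UpperSet b c ∧ ∀ k, c k - σ (k, k) ≤ a k}, f σ := by
    refine finsum_mem_inter_support_eq f _ _ ?_
    ext σ
    refine ⟨fun ⟨h2, h3⟩ => ⟨⟨h2, fun k => ?_⟩, h3⟩, fun ⟨h2, h3⟩ => ⟨h2.1, h3⟩⟩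
    by_contra! h4
    refine h3 ?_
    have h5 : ∏ m ∈ Finset.range (c k - σ (k, k)).toNat, (v ^ (2 * a k) - v ^ (2 * m)) = 0 := by
      refine Finset.prod_eq_zero (i := (a k).toNat) (by rw [Finset.mem_range]; have := ha0 k; omega) ?_
      rw [← zpow_natCast, sub_eq_zero]
      congr 1
      have := ha0 k
      push_cast
      omega
    have h6 : (Function.mulSupport fun l : ℤ =>
        ∏ m ∈ Finset.range (c l - σ (l, l)).toNat, (v ^ (2 * a l) - v ^ (2 * m))).Finite := by
      refine hc.subset fun l hl h0 => hl ?_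
      dsimp only
      rw [h0, Int.toNat_of_nonpos (by omega)]
      rfl
    rw [hf]
    dsimp only
    rw [finprod_eq_prod _ h6, Finset.prod_eq_zero (i := k) (h6.mem_toFinset.2 ?_) h5, mul_zero]
    rw [Function.mem_mulSupport, h5]
    exact zero_ne_one
  rw [h1, finsum_mem_fiberwise (hU.subset fun σ hσ => hσ.1) (finite_rowIndex ha b c)
    (φ := fun σ k => c k - (σ (k, k) : ℤ))]
  · refine finsum_mem_congr rfl fun s' hs' => ?_
    have fs' : s'.support.Finite := hc.subset fun j hj h => hj (by have := hs' j; omega)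
    have fs : (s' + b - c).support.Finite := finite_sub (finite_add fs' hb) hc
    have fd : (c - s').support.Finite := finite_sub hc fs'
    have hsb : ∀ k, (s' + b - c) k = s' k + b k - c k := fun k => rfl
    let ρ : ℤ →₀ ℕ := Finsupp.ofSupportFinite (fun k => (c k - s' k).toNat)
      (fd.subset fun k hk h => hk (by
        rw [Pi.sub_apply] at h
        simp [h]))
    have hρ : ∀ k, (ρ k : ℤ) = c k - s' k := fun k =>
      Int.toNat_of_nonneg (by have := hs' k; omega)
    refine (finsum_mem_eq_of_bijOn _ (bijOn_diag_add (a := a) ρ hρ hsb fun k => (hs' k).2.1)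
      (f := fun τ => (v ^ (2 * rowExp a c (s' + b - c) s') * (v ^ 2 - 1) ^ total s' *
        ((∏ᶠ k, qfact (a k)) * (∏ᶠ k, qfact (b k)) * (∏ᶠ k, qfact (a k - s' k))⁻¹ *
          (∏ᶠ k, qfact (c k - s' k))⁻¹)) * weight τ) ?_).symm.trans ?_
    rotate_left
    · rw [← mul_finsum_mem, sum_strictUpper fs fs' (fun p => by rw [hsb]; have := hs' p; omega)
        (fun p => (hs' p).1), rowTerm, finprod_qbinom_mul_qfact _ fs']
      · have := finprod_qfact_ne_zero fs'
        simp only [Pi.sub_apply a s', Pi.sub_apply c s']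
        field_simp
      · rw [total_sub (finite_add fs' hb) hc, total_add fs' hb, htot]
        ring
    · intro τ hτ
      have e3 : ∀ k, (c k - ((diagMat ρ + τ) (k, k) : ℕ) : ℤ) = s' k := fun k => by
        have : τ (k, k) = 0 := by
          by_contra h
          exact lt_irrefl _ (hτ.1 _ h)
        rw [Finsupp.add_apply, diagMat_apply, this, add_zero, hρ]
        ring
      have e4 := prod_diag_add ρ hτ hρ
      rw [Finsupp.prod] at e4
      rw [hf]
      dsimp only
      simp only [e3]
      rw [e4, sigmaExp_diag_add ρ hτ fs' hρ, finprod_range_sub ha (fun k => (hs' k).1)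
        (fun k => (hs' k).2.1), rowExp, weight]
      simp only [mul_add, zpow_add₀ v_ne_zero]
      rw [div_eq_mul_inv, mul_inv]
      ring
  · intro σ hσ k
    have := hle σ hσ.1 k
    have := hσ.2 k
    dsimp only
    omega

end

end AffineC

/-! ### The symbol `[A_{X,Y}; X]` as a quotient of factorials -/

namespace AffineC

/-! ### The symbol indexed by `X` in terms of factorials -/

section

variable {r d : ℕ} {C X : ℤ → ℤ → ℤ}

/-- At these parameters the correction factor is `1 + v ^ (2 k)`, so the even quantum integers of
both types become `[2k]`. -/
theorem qevenOne_eq (k : ℤ) : qevenOne k = qint (2 * k) := by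
  have h : q₀ * q₁⁻¹ * q ^ (-2 * (k - 1)) = v ^ (2 * k) := by
    rw [q₀, q₁, q, one_mul, inv_pow, inv_inv, inv_zpow', ← zpow_natCast, ← zpow_add₀ v_ne_zero]
    congr 1
    push_cast
    ring
  rw [qevenOne, h, two_mul k, qint_add, ← two_mul]
  ring

theorem qevenZero_eq (k : ℤ) : qevenZero k = qint (2 * k) := by
  rw [← qevenOne_eq, qevenZero, qevenOne, q₀, inv_one]

/-- For a diagonal entry `2 e + 1` the numerators `[2 (e - k)]` are the top `x` factors of `[2][4] ⋯
[2e]`. This is the replacement for the Gaussian binomials at the central places. -/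
theorem prod_even (e : ℤ) (x : ℕ) (h : (x : ℤ) ≤ e) :
    (∏ k ∈ Finset.range x, qint (2 * e + 1 - 2 * k - 1) / qint (k + 1)) *
      (qfact x * ∏ k ∈ Finset.range (e - x).toNat, qint (2 * (k + 1))) =
    ∏ k ∈ Finset.range e.toNat, qint (2 * (k + 1)) := by
  induction x with
  | zero => simp [qfact_zero]
  | succ x ih =>
    rw [← ih (by push_cast at h; omega), Finset.prod_range_succ, Nat.cast_succ, qfact_succ,
      show (e - x).toNat = (e - (x + 1)).toNat + 1 by omega, Finset.prod_range_succ]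
    have h1 : qint ((x : ℤ) + 1) ≠ 0 := qint_ne_zero (by omega)
    have h2 : 2 * (((e - (x + 1)).toNat : ℤ) + 1) = 2 * e + 1 - 2 * x - 1 := by omega
    rw [h2]
    field_simp

theorem IsTheta.finite_window (hX : IsTheta r X) (I : Finset ℤ) :
    {p : ℤ × ℤ | p.1 ∈ I ∧ X p.1 p.2 ≠ 0}.Finite := by
  refine (I.finite_toSet.biUnion fun i _ => (hX.finite_row i).image fun j => (i, j)).subset ?_
  rintro ⟨i, j⟩ ⟨hi, hj⟩
  exact Set.mem_biUnion hi ⟨j, hj, rfl⟩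

theorem finprod_mem_window {g : ℤ × ℤ → K} (I : Finset ℤ)
    (hg : {p : ℤ × ℤ | p.1 ∈ I ∧ g p ≠ 1}.Finite) :
    ∏ᶠ p ∈ {p : ℤ × ℤ | p.1 ∈ I}, g p = ∏ i ∈ I, ∏ᶠ j, g (i, j) := by
  classical
  rw [finprod_mem_def, finprod_curry]
  · rw [finprod_eq_prod_of_mulSupport_subset (s := I)]
    · refine Finset.prod_congr rfl fun i hi => finprod_congr fun j => ?_
      rw [Set.mulIndicator_of_mem (by exact hi)]
    · intro i hi
      by_contra h
      refine hi (finprod_eq_one_of_forall_eq_one fun j => ?_)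
      rw [Set.mulIndicator_of_notMem (by exact h)]
  · refine hg.subset fun p hp => ?_
    by_cases h : p.1 ∈ I
    · refine ⟨h, fun h' => hp ?_⟩
      rw [Set.mulIndicator_of_mem (by exact h), h']
    · exact absurd (Set.mulIndicator_of_notMem (by exact h) _) hp

/-- The rows of a period. -/
noncomputable def period (r : ℕ) : Finset ℤ := Finset.Icc (-(r : ℤ) - 1) r

/-- The reflection of `IMinus` modulo the period. -/
def flip (r : ℕ) (p : ℤ × ℤ) : ℤ × ℤ :=
  if p.1 = -r - 1 then (-r - 1, -p.2 - (2 * r + 2)) else (-p.1, -p.2)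

theorem flip_flip {p : ℤ × ℤ} : flip r (flip r p) = p ∨ p.1 = r + 1 := by
  obtain ⟨i, j⟩ := p
  unfold flip
  by_cases h : i = -r - 1
  · left
    simp [h]
  · by_cases h' : i = r + 1
    · exact Or.inr h'
    · left
      simp only [h, if_false]
      rw [if_neg (by omega)]
      simp

theorem flip_apply (hX : ∀ i j, X (i + (2 * r + 2)) (j + (2 * r + 2)) = X i j) (p : ℤ × ℤ) :
    X (flip r p).1 (flip r p).2 = X (-p.1) (-p.2) := by
  unfold flip
  split_ifs with h
  · rw [← hX, h]
    congr 1 <;> dsimp only <;> ring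
  · rfl

theorem injOn_flip : Set.InjOn (flip r) (IMinus r) := by
  intro p hp p' hp' h
  have h1 := congrArg (flip r) h
  have h2 : p.1 ≠ r + 1 := fun h => by
    simp only [IMinus, Set.mem_ofPred_eq] at hp; omega
  have h3 : p'.1 ≠ r + 1 := fun h => by
    simp only [IMinus, Set.mem_ofPred_eq] at hp'; omega
  rwa [flip_flip.resolve_right h2, flip_flip.resolve_right h3] at h1

/-- Up to translation, negation pairs the places of a period, with only the two central diagonal
places fixed. `IMinus` contains one place from each remaining pair; in row `-r - 1` the reflection
must be followed by a translation to return to the same row. -/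
theorem period_eq (r : ℕ) : {p : ℤ × ℤ | p.1 ∈ period r} =
    ((IMinus r ∪ flip r '' IMinus r) ∪ {((0 : ℤ), (0 : ℤ))}) ∪ {(-(r : ℤ) - 1, -(r : ℤ) - 1)} := by
  ext ⟨i, j⟩
  constructor
  · intro h
    simp only [period, Finset.mem_Icc, Set.mem_ofPred_eq] at h
    by_cases h0 : (i, j) ∈ IMinus r
    · exact Or.inl (Or.inl (Or.inl h0))
    by_cases h1 : i = 0 ∧ j = 0
    · exact Or.inl (Or.inr (by rw [h1.1, h1.2]; rfl))
    by_cases h2 : i = -r - 1 ∧ j = -r - 1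
    · exact Or.inr (by rw [h2.1, h2.2]; rfl)
    refine Or.inl (Or.inl (Or.inr ⟨flip r (i, j), ?_, flip_flip.resolve_right (by dsimp only; omega)⟩))
    unfold flip
    simp only [IMinus, Set.mem_ofPred_eq] at h0 ⊢
    split_ifs <;> dsimp only <;> omega
  · rintro (((h | ⟨p, h, h'⟩) | h) | h)
    · simp only [IMinus, Set.mem_ofPred_eq, period, Finset.mem_Icc] at h ⊢
      omega
    · rw [← h']
      unfold flip
      simp only [IMinus, Set.mem_ofPred_eq, period, Finset.mem_Icc] at h ⊢
      split_ifs <;> dsimp only <;> omega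
    · obtain ⟨rfl, rfl⟩ := Prod.ext_iff.1 (Set.mem_singleton_iff.1 h)
      simp only [period, Set.mem_ofPred_eq, Finset.mem_Icc]
      omega
    · obtain ⟨rfl, rfl⟩ := Prod.ext_iff.1 (Set.mem_singleton_iff.1 h)
      simp only [period, Set.mem_ofPred_eq, Finset.mem_Icc]
      omega

theorem finprod_period (hX : IsTheta r X) :
    ∏ i ∈ period r, ∏ᶠ j, qfact (X i j) =
      (∏ᶠ p ∈ IMinus r, qfact (X p.1 p.2) * qfact (X (-p.1) (-p.2))) *
        qfact (X 0 0) * qfact (X (-r - 1) (-r - 1)) := by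
  have hfin := hX.finite_window (period r)
  have hg : {p : ℤ × ℤ | p.1 ∈ period r ∧ qfact (X p.1 p.2) ≠ 1}.Finite :=
    hfin.subset fun p hp => ⟨hp.1, fun h => hp.2 (by rw [h, qfact_zero])⟩
  have hsub : ∀ s : Set (ℤ × ℤ), s ⊆ {p | p.1 ∈ period r} →
      (s ∩ Function.mulSupport fun p : ℤ × ℤ => qfact (X p.1 p.2)).Finite :=
    fun s hs => hg.subset fun p hp => ⟨hs hp.1, hp.2⟩
  have hfl : ∏ᶠ p ∈ flip r '' IMinus r, qfact (X p.1 p.2) =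
      ∏ᶠ p ∈ IMinus r, qfact (X (-p.1) (-p.2)) := by
    rw [finprod_mem_image injOn_flip]
    refine finprod_mem_congr rfl fun p _ => ?_
    rw [flip_apply hX.periodic]
  have hsubset := period_eq r
  have h1 : IMinus r ⊆ {p : ℤ × ℤ | p.1 ∈ period r} := fun p hp => by
    rw [hsubset]; exact Or.inl (Or.inl (Or.inl hp))
  have h2 : flip r '' IMinus r ⊆ {p : ℤ × ℤ | p.1 ∈ period r} := fun p hp => by
    rw [hsubset]; exact Or.inl (Or.inl (Or.inr hp))
  have hd1 : Disjoint (IMinus r) (flip r '' IMinus r) := by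
    rw [Set.disjoint_left]
    rintro _ hp ⟨p, hp', rfl⟩
    unfold flip at hp
    simp only [IMinus, Set.mem_ofPred_eq] at hp hp'
    split_ifs at hp <;> dsimp only at hp <;> omega
  have hd2 : Disjoint (IMinus r ∪ flip r '' IMinus r) {((0 : ℤ), (0 : ℤ))} := by
    rw [Set.disjoint_singleton_right]
    rintro (hp | ⟨p, hp, h⟩)
    · simp only [IMinus, Set.mem_ofPred_eq] at hp
      omega
    · unfold flip at h
      simp only [IMinus, Set.mem_ofPred_eq] at hp
      split_ifs at h <;> simp only [Prod.mk.injEq] at h <;> omega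
  have hd3 : Disjoint ((IMinus r ∪ flip r '' IMinus r) ∪ {((0 : ℤ), (0 : ℤ))})
      {(-(r : ℤ) - 1, -(r : ℤ) - 1)} := by
    rw [Set.disjoint_singleton_right]
    rintro ((hp | ⟨p, hp, h⟩) | h)
    · simp only [IMinus, Set.mem_ofPred_eq] at hp
      omega
    · unfold flip at h
      simp only [IMinus, Set.mem_ofPred_eq] at hp
      split_ifs at h <;> simp only [Prod.mk.injEq] at h <;> omega
    · have := (Prod.ext_iff.1 (Set.mem_singleton_iff.1 h)).1
      dsimp only at this
      omega
  rw [← finprod_mem_window (g := fun p => qfact (X p.1 p.2)) _ hg, hsubset,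
    finprod_mem_union' hd3 (hsub _ (by rw [hsubset]; exact Set.subset_union_left))
      (hsub _ (by rw [hsubset]; exact Set.subset_union_right)),
    finprod_mem_union' hd2 (hsub _ (Set.union_subset h1 h2))
      (hsub _ (by rw [hsubset]; exact fun p hp => Or.inl (Or.inr hp))),
    finprod_mem_union' hd1 (hsub _ h1) (hsub _ h2), finprod_mem_singleton, finprod_mem_singleton,
    hfl, finprod_mem_mul_distrib' (hsub _ h1)]
  exact (hX.negMat.finite_window (period r)).subset fun p hp => ⟨h1 hp.1, fun h => hp.2 (by
    rw [AffineC.negMat] at h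
    dsimp only
    rw [h, qfact_zero])⟩

theorem IMinus_subset (r : ℕ) : IMinus r ⊆ {p : ℤ × ℤ | p.1 ∈ period r} := fun p hp => by
  rw [period_eq]; exact Or.inl (Or.inl (Or.inl hp))

theorem finprod_IPlus (hC : ∀ i j, C (-i) (-j) = C i j) :
    ∏ᶠ p ∈ IPlus r, qfact (C p.1 p.2) = ∏ᶠ p ∈ IMinus r, qfact (C p.1 p.2) := by
  refine finprod_mem_eq_of_bijOn (fun p => (-p.1, -p.2)) ⟨fun p hp => ?_, fun p _ q _ h => ?_,
    fun p hp => ⟨(-p.1, -p.2), ?_, by simp⟩⟩ fun p _ => by dsimp only; rw [hC]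
  · simp only [IPlus, IMinus, Set.mem_ofPred_eq] at *
    omega
  · simpa [Prod.ext_iff] using h
  · simp only [IPlus, IMinus, Set.mem_ofPred_eq] at *
    omega

theorem exists_period_shift (r : ℕ) (i : ℤ) : ∃ k : ℤ, i + k * (2 * r + 2) ∈ period r := by
  have hn : (0 : ℤ) < 2 * r + 2 := by omega
  refine ⟨-((i + r + 1) / (2 * r + 2)), ?_⟩
  have h2 := Int.emod_add_mul_ediv (i + r + 1) (2 * r + 2)
  have h3 := Int.emod_nonneg (i + r + 1) hn.ne'
  have h4 := Int.emod_lt_of_pos (i + r + 1) hn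
  have h5 : i + -((i + r + 1) / (2 * r + 2)) * (2 * r + 2) =
    (i + r + 1) % (2 * r + 2) - r - 1 := by linear_combination -h2
  rw [h5, period, Finset.mem_Icc]
  omega

/-- Both sides of the inequality are invariant under translation and negation, so it needs checking
only on `IMinus` and at the two central places. -/
theorem theta_le_of_IMinus (hX : IsTheta r X) (hC : IsXi r d C)
    (h : ∀ p ∈ IMinus r, theta X p.1 p.2 ≤ C p.1 p.2) (h0 : theta X 0 0 ≤ C 0 0)
    (h1 : theta X (-r - 1) (-r - 1) ≤ C (-r - 1) (-r - 1)) (i j : ℤ) : theta X i j ≤ C i j := by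
  have hθ := hX.theta
  obtain ⟨k, hk⟩ : ∃ k, (i + k * (2 * r + 2), j + k * (2 * r + 2)) ∈ {p : ℤ × ℤ | p.1 ∈ period r} :=
    exists_period_shift r i
  rw [← periodic_mul hθ.periodic k, ← periodic_mul hC.periodic k]
  rw [period_eq] at hk
  rcases hk with ((hk | ⟨p, hp, hk⟩) | hk) | hk
  · exact h _ hk
  · have h2 := h p hp
    have h3 := flip_apply hθ.periodic p
    have h4 := flip_apply hC.periodic p
    rw [hk] at h3 h4
    rw [h3, h4, hC.symm, theta_neg]
    exact h2
  · obtain ⟨h2, h3⟩ := Prod.ext_iff.1 (Set.mem_singleton_iff.1 hk)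
    dsimp only at h2 h3
    rw [h2, h3]
    exact h0
  · obtain ⟨h2, h3⟩ := Prod.ext_iff.1 (Set.mem_singleton_iff.1 hk)
    dsimp only at h2 h3
    rw [h2, h3]
    exact h1

theorem IsTheta.finite_qbinom (hX : IsTheta r X) (C : ℤ → ℤ → ℤ) :
    (IMinus r ∩ Function.mulSupport fun p : ℤ × ℤ => qbinom (C p.1 p.2) (X p.1 p.2) *
      qbinom (C p.1 p.2 - X p.1 p.2) (X (-p.1) (-p.2))).Finite := by
  refine ((hX.finite_window (period r)).union (hX.negMat.finite_window (period r))).subset ?_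
  intro p hp
  have h1 := IMinus_subset r hp.1
  by_contra h
  refine hp.2 ?_
  have h2 : X p.1 p.2 = 0 := by
    by_contra h'
    exact h (Or.inl ⟨h1, h'⟩)
  have h3 : X (-p.1) (-p.2) = 0 := by
    by_contra h'
    exact h (Or.inr ⟨h1, h'⟩)
  dsimp only
  rw [h2, h3, qbinom_zero, qbinom_zero, one_mul]

/-- If `x_{ij} + x_{-i,-j}` exceeds the entry at a place of `IMinus`, one of the two Gaussian
binomials vanishes. At a central place the entry `c` is odd, and `2 x > c` makes `[c - 2k - 1]` with
`k = (c - 1) / 2` occur in the product. -/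
theorem brackXY_eq_zero (hX : IsTheta r X) (hC : IsXi r d C) (h : ¬ ∀ i j, theta X i j ≤ C i j) :
    brackXY r C X = 0 := by
  have key : ∀ i, Odd (C i i) → C i i < 2 * X i i → 0 ≤ C i i →
      ∏ k ∈ Finset.range (X i i).toNat, qint (C i i - 2 * k - 1) / qint (k + 1) = 0 := by
    rintro i ⟨e, he⟩ hi h0
    refine Finset.prod_eq_zero (i := e.toNat) (Finset.mem_range.2 (by omega)) ?_
    rw [show C i i - 2 * (e.toNat : ℤ) - 1 = 0 by omega, qint_zero, zero_div]
  have h0 := hC.nonneg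
  by_contra hne
  rw [brackXY, mul_eq_zero, not_or, ← ne_eq, ← ne_eq, Finset.prod_ne_zero_iff] at hne
  have hodd : Odd (C (-r - 1) (-r - 1)) := by
    rw [← hC.symm]
    convert hC.odd_last using 1
    congr 1 <;> ring
  have hX' : ∀ i ∈ ({0, -(r : ℤ) - 1} : Finset ℤ), X (-i) (-i) = X i i := fun i hi => by
    simp only [Finset.mem_insert, Finset.mem_singleton] at hi
    rcases hi with rfl | rfl
    · simp
    · rw [← hX.periodic (-r - 1)]
      congr 1 <;> ring
  refine h (theta_le_of_IMinus hX hC (fun p hp => ?_) ?_ ?_)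
  · by_contra! hlt
    refine hne.1 ?_
    have hz : qbinom (C p.1 p.2) (X p.1 p.2) *
        qbinom (C p.1 p.2 - X p.1 p.2) (X (-p.1) (-p.2)) = 0 := by
      rw [theta] at hlt
      rcases lt_or_ge (C p.1 p.2) (X p.1 p.2) with h1 | h1
      · rw [qbinom_eq_zero (h0 _ _) h1, zero_mul]
      · rw [qbinom_eq_zero (m := C p.1 p.2 - X p.1 p.2) (by omega) (by omega), mul_zero]
    rw [finprod_mem_eq_prod _ (hX.finite_qbinom C)]
    refine Finset.prod_eq_zero (i := p) ?_ hz
    rw [Set.Finite.mem_toFinset]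
    refine ⟨hp, ?_⟩
    rw [Function.mem_mulSupport, hz]
    exact zero_ne_one
  · by_contra! hlt
    rw [theta, hX' 0 (by simp)] at hlt
    exact hne.2 0 (by simp) (key 0 hC.odd_zero (by omega) (h0 _ _))
  · by_contra! hlt
    rw [theta, hX' (-r - 1) (by simp)] at hlt
    exact hne.2 (-r - 1) (by simp) (key _ hodd (by omega) (h0 _ _))

theorem matFactC_ne_zero (r : ℕ) (C : ℤ → ℤ → ℤ) : matFactC r C ≠ 0 := by
  have h : ∀ k : ℕ, qint (2 * ((k : ℤ) + 1)) ≠ 0 := fun k => qint_ne_zero (by omega)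
  rw [matFactC]
  simp only [qevenZero_eq, qevenOne_eq]
  refine mul_ne_zero (mul_ne_zero (Finset.prod_ne_zero_iff.2 fun k _ => h k)
    (Finset.prod_ne_zero_iff.2 fun k _ => h k)) ?_
  by_cases hf : (IPlus r ∩ Function.mulSupport fun p : ℤ × ℤ => qfact (C p.1 p.2)).Finite
  · rw [finprod_mem_eq_prod _ hf]
    exact Finset.prod_ne_zero_iff.2 fun _ _ => qfact_ne_zero _
  · rw [finprod_mem_eq_one_of_infinite hf]
    exact one_ne_zero

/-- At each place of `IMinus` the two binomials form a multinomial of `c` into `x_{ij}`, `x_{-i,-j}`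
and the rest, and the central places are treated by `prod_even`. The factorials of `X` at `IMinus`,
at its reflection and at the central places make up one period. -/
theorem brackXY_mul (hX : IsTheta r X) (hC : IsXi r d C) (h : ∀ i j, theta X i j ≤ C i j) :
    brackXY r C X * (matFactC r (C - theta X) * ∏ i ∈ period r, ∏ᶠ j, qfact (X i j)) =
      matFactC r C := by
  have hX0 := hX.nonneg
  have hC0 := hC.nonneg
  have hM : IsTheta r (C - theta X) := hC.toIsTheta.sub hX.theta h
  have hM' : ∀ i j, (C - theta X) (-i) (-j) = (C - theta X) i j := fun i j => by
    rw [Pi.sub_apply, Pi.sub_apply, Pi.sub_apply, Pi.sub_apply, theta_neg, hC.symm]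
  have hper := hX.periodic (-r - 1) (-r - 1)
  have hper' := hC.periodic (-r - 1) (-r - 1)
  rw [show (-r - 1 : ℤ) + (2 * r + 2) = r + 1 by ring] at hper hper'
  have e0 := hC.two_mul_entry_zero
  have e1 := hC.two_mul_entry_last
  have hθ0 : theta X 0 0 = 2 * X 0 0 := by rw [theta, neg_zero]; ring
  have hθ1 : theta X (r + 1) (r + 1) = 2 * X (r + 1) (r + 1) := by
    rw [theta, show -((r : ℤ) + 1) = -r - 1 by ring, ← hper]; ring
  have f0 : entry r (C - theta X) 0 0 = entry r C 0 0 - X 0 0 := by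
    rw [entry, if_pos (by simp), Pi.sub_apply, Pi.sub_apply, ← e0, hθ0]
    omega
  have f1 : entry r (C - theta X) (r + 1) (r + 1) = entry r C (r + 1) (r + 1) - X (r + 1) (r + 1) := by
    rw [entry, if_pos (by simp), Pi.sub_apply, Pi.sub_apply, ← e1, hθ1]
    omega
  have g0 := prod_even (entry r C 0 0) (X 0 0).toNat
    (by rw [Int.toNat_of_nonneg (hX0 _ _)]; have := h 0 0; omega)
  have g1 := prod_even (entry r C (r + 1) (r + 1)) (X (r + 1) (r + 1)).toNat
    (by rw [Int.toNat_of_nonneg (hX0 _ _)]; have := h (r + 1) (r + 1); omega)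
  rw [Int.toNat_of_nonneg (hX0 _ _), e0] at g0
  rw [Int.toNat_of_nonneg (hX0 _ _), e1] at g1
  have hfin : ∀ {M : ℤ → ℤ → ℤ}, IsTheta r M →
      (IMinus r ∩ Function.mulSupport fun p : ℤ × ℤ => qfact (M p.1 p.2)).Finite := fun hM =>
    (hM.finite_window (period r)).subset fun p hp =>
      ⟨IMinus_subset r hp.1, fun h' => hp.2 (by dsimp only; rw [h', qfact_zero])⟩
  have g2 : (∏ᶠ p ∈ IMinus r, qbinom (C p.1 p.2) (X p.1 p.2) *
      qbinom (C p.1 p.2 - X p.1 p.2) (X (-p.1) (-p.2))) *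
      ((∏ᶠ p ∈ IMinus r, qfact ((C - theta X) p.1 p.2)) *
        ∏ᶠ p ∈ IMinus r, qfact (X p.1 p.2) * qfact (X (-p.1) (-p.2))) =
      ∏ᶠ p ∈ IMinus r, qfact (C p.1 p.2) := by
    have hx := finprod_mem_mul_distrib' (hfin hX) (hfin hX.negMat)
    have hf3 : (IMinus r ∩ Function.mulSupport fun p : ℤ × ℤ =>
        qfact (X p.1 p.2) * qfact (X (-p.1) (-p.2))).Finite :=
      ((hfin hX).union (hfin hX.negMat)).subset fun p hp => by
        rcases Function.mulSupport_mul _ _ hp.2 with h | h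
        · exact Or.inl ⟨hp.1, h⟩
        · exact Or.inr ⟨hp.1, h⟩
    have hf4 : (IMinus r ∩ Function.mulSupport fun p : ℤ × ℤ => qfact ((C - theta X) p.1 p.2) *
        (qfact (X p.1 p.2) * qfact (X (-p.1) (-p.2)))).Finite :=
      ((hfin hM).union hf3).subset fun p hp => by
        rcases Function.mulSupport_mul _ _ hp.2 with h | h
        · exact Or.inl ⟨hp.1, h⟩
        · exact Or.inr ⟨hp.1, h⟩
    rw [← finprod_mem_mul_distrib' (hfin hM) hf3,
      ← finprod_mem_mul_distrib' (hX.finite_qbinom C) hf4]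
    refine finprod_mem_congr rfl fun p _ => ?_
    have h1 := h p.1 p.2
    have h2 := hX0 p.1 p.2
    have h3 := hX0 (-p.1) (-p.2)
    rw [theta] at h1
    rw [← qbinom_mul_qfact h2 (show X p.1 p.2 ≤ C p.1 p.2 by omega),
      ← qbinom_mul_qfact h3 (show X (-p.1) (-p.2) ≤ C p.1 p.2 - X p.1 p.2 by omega), Pi.sub_apply,
      Pi.sub_apply, theta, sub_sub]
    ring
  rw [finprod_period hX, brackXY, matFactC, matFactC, finprod_IPlus hM', finprod_IPlus hC.symm, ← g2,
    Finset.prod_pair (by omega), f0, f1]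
  simp only [qevenZero_eq, qevenOne_eq]
  rw [← g0, ← g1, ← hper, ← hper']
  ring

end

end AffineC

/-! ### Finiteness of the index sets and the off-diagonal sequence -/

namespace AffineC

/-! ### Finiteness of the index sets -/

section

variable {r d : ℕ} {A B X Y : ℤ → ℤ → ℤ} {α : ℤ → ℕ}

/-- A periodic matrix is determined by the rows of one period, where only finitely many entries can
be nonzero and each of them is bounded. -/
theorem finite_theta_le {c : ℤ × ℤ → ℤ} (hc : {p : ℤ × ℤ | p.1 ∈ period r ∧ c p ≠ 0}.Finite) :
    {T : ℤ → ℤ → ℤ | IsTheta r T ∧ ∀ i j, T i j ≤ c (i, j)}.Finite := by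
  classical
  let c' : ℤ × ℤ → ℤ := fun p => if p.1 ∈ period r then c p else 0
  have hc' : c'.support.Finite := hc.subset fun p hp => by
    by_cases h : p.1 ∈ period r
    · exact ⟨h, fun h' => hp (by simp only [c', h', ite_self])⟩
    · exact absurd (if_neg h) hp
  refine Set.Finite.of_injOn
    (f := fun (T : ℤ → ℤ → ℤ) (p : ℤ × ℤ) => if p.1 ∈ period r then T p.1 p.2 else 0) ?_ ?_
    (finite_le hc')
  · intro T hT p
    have := hT.1.nonneg p.1 p.2
    have := hT.2 p.1 p.2
    dsimp only [c']
    split_ifs <;> simp_all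
  · intro T hT T' hT' h
    funext i j
    obtain ⟨k, hk⟩ := exists_period_shift r i
    have h1 := congrFun h (i + k * (2 * r + 2), j + k * (2 * r + 2))
    dsimp only at h1
    rw [if_pos hk, if_pos hk, periodic_mul hT.1.periodic, periodic_mul hT'.1.periodic] at h1
    exact h1

theorem finite_indexTS (hA : IsXi r d A) : (indexTS r B A).Finite := by
  have h := finite_theta_le (r := r) (c := fun p => A p.1 p.2) (hA.finite_window (period r))
  refine (h.prod h).subset ?_
  rintro ⟨T, S⟩ ⟨⟨hT, hTA, -⟩, hS, hST, -⟩
  have h1 : ∀ i j, T i j ≤ A i j := fun i j => by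
    have := hTA i j
    have := hT.nonneg (-i) (-j)
    rw [theta] at *
    dsimp only at *
    omega
  exact ⟨⟨hT, h1⟩, hS, fun i j => (hST i j).trans (h1 i j)⟩

theorem le_rowSum (hX : IsTheta r X) (i j : ℤ) : X i j ≤ rowSum X i := by
  rw [rowSum, finsum_eq_sum _ (hX.finite_row i)]
  by_cases h : X i j = 0
  · rw [h]; exact Finset.sum_nonneg fun _ _ => hX.nonneg _ _
  · exact Finset.single_le_sum (f := X i) (fun _ _ => hX.nonneg _ _)
      ((hX.finite_row i).mem_toFinset.2 h)

/-- A column is part of a window of columns, and over a period the column sums have the same total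
as the row sums. -/
theorem column_le (hY : IsTheta r Y) (j : ℤ) (F : Finset ℤ) :
    ∑ k ∈ F, Y k j ≤ ∑ i ∈ Finset.Ico (0 : ℤ) (2 * r + 2), rowSum Y i := by
  rw [sum_rowSum_eq_sum_colSum (by omega) hY.periodic hY.finite_row]
  have hnn : ∀ j, 0 ≤ rowSum (fun j i => Y i j) j := fun j =>
    rowSum_nonneg (T := fun j i => Y i j) (fun j i => hY.nonneg i j) j
  refine le_trans ?_ (le_trans (b := rowSum (fun j i => Y i j) j) le_rfl ?_)
  · rw [rowSum, finsum_eq_sum_of_support_subset (s := F ∪ (hY.finite_col j).toFinset)]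
    · exact Finset.sum_le_sum_of_subset_of_nonneg Finset.subset_union_left
        fun i _ _ => hY.nonneg i j
    · intro i hi
      rw [Finset.coe_union, Set.Finite.coe_toFinset]
      exact Or.inr hi
  · obtain ⟨k, j, rfl, h0, h1⟩ := exists_window (2 * r + 2) (by omega) j
    have h2 : rowSum (fun j i => Y i j) (j + k * (2 * r + 2)) = rowSum (fun j i => Y i j) j :=
      rowSum_add (fun j i => periodic_mul hY.periodic k i j) j
    rw [h2]
    exact Finset.single_le_sum (f := rowSum fun j i => Y i j) (fun j _ => hnn j)
      (Finset.mem_Ico.2 ⟨h0, h1⟩)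

/-- A uniform band for the second index of the second formula. -/
theorem band_of_decreasing {m : ℤ} (hA : ∀ i j, A i j ≠ 0 → |i - j| ≤ m) (hY : IsTheta r Y)
    (h : ∀ i j, Y i j ≤ A i j + Y (i - 1) j) {i j : ℤ} (hij : Y i j ≠ 0) :
    |i - j| ≤ |m| + ∑ i ∈ Finset.Ico (0 : ℤ) (2 * r + 2), rowSum Y i := by
  have hA' : ∀ i j, m < |i - j| → A i j = 0 := fun i j h => by
    by_contra h'
    have := hA i j h'
    omega
  have hN : 0 ≤ ∑ i ∈ Finset.Ico (0 : ℤ) (2 * r + 2), rowSum Y i :=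
    Finset.sum_nonneg fun i _ => rowSum_nonneg hY.nonneg i
  have hm := le_abs_self m
  have hm' := abs_nonneg m
  rw [abs_le]
  constructor
  -- To the right of the band of `A`, a nonzero entry of `Y` forces nonzero entries in all rows
  -- above it, and these stay outside the band: the column would be infinite.
  · by_contra! hlt
    have h1 : ∀ n : ℕ, Y (i - n) j ≠ 0 := by
      intro n
      induction n with
      | zero => simpa using hij
      | succ n ih =>
        have h2 := h (i - n) j
        rw [hA' (i - n) j (by rw [lt_abs]; omega)] at h2
        have h3 := hY.nonneg (i - n) j
        rw [show i - ((n + 1 : ℕ) : ℤ) = i - n - 1 by push_cast; ring]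
        omega
    refine Set.infinite_of_injective_forall_mem (f := fun n : ℕ => i - n) (fun a b hab => ?_) h1
      (hY.finite_col j)
    simpa using hab
  -- To the left of the band, nonzero entries are forced only up to the band, but this already makes
  -- the column sum exceed the total of the row sums.
  · by_contra! hlt
    have h1 : ∀ n : ℕ, (n : ℤ) ≤ i - j - |m| → Y (i - n) j ≠ 0 := by
      intro n hn
      induction n with
      | zero => simpa using hij
      | succ n ih =>
        have h2 := h (i - n) j
        rw [hA' (i - n) j (by rw [lt_abs]; push_cast at hn; omega)] at h2
        have h3 := hY.nonneg (i - n) j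
        have h4 := ih (by push_cast at hn; omega)
        rw [show i - ((n + 1 : ℕ) : ℤ) = i - n - 1 by push_cast; ring]
        omega
    have h2 := column_le hY j (Finset.Icc (j + |m|) i)
    have h3 : ∑ k ∈ Finset.Icc (j + |m|) i, (1 : ℤ) ≤ ∑ k ∈ Finset.Icc (j + |m|) i, Y k j := by
      refine Finset.sum_le_sum fun k hk => ?_
      rw [Finset.mem_Icc] at hk
      have h4 := h1 (i - k).toNat (by omega)
      have h5 := hY.nonneg k j
      rw [show i - ((i - k).toNat : ℤ) = k by omega] at h4
      omega
    rw [Finset.sum_const, Int.card_Icc, nsmul_eq_mul, mul_one] at h3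
    omega

/-- Nonnegativity of `A - Y + Y̌` confines `Y` to a band that depends only on `A` and `α`; the
relation between `X` and `Y` confines `X` to a band wider by one. Entries are bounded by the row
sums, which `α` prescribes. -/
theorem finite_indexXY (hA : IsXi r d A) (α : ℤ → ℕ) :
    (indexXY r d A α).Finite := by
  obtain ⟨m, hm⟩ := hA.band
  obtain ⟨N, hN⟩ : ∃ N, N = |m| + ∑ i ∈ Finset.Ico (0 : ℤ) (2 * r + 2), (α (-i - 1) : ℤ) := ⟨_, rfl⟩
  have hfin : ∀ (M : ℤ) (f : ℤ → ℤ), {p : ℤ × ℤ | p.1 ∈ period r ∧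
      (if |p.1 - p.2| ≤ M then f p.1 else 0) ≠ 0}.Finite := by
    intro M f
    refine ((period r).finite_toSet.biUnion fun i _ =>
      (Set.finite_Icc (i - M) (i + M)).image fun j => (i, j)).subset ?_
    rintro ⟨i, j⟩ ⟨hi, hj⟩
    refine Set.mem_biUnion hi ⟨j, ?_, rfl⟩
    have h : |i - j| ≤ M := by
      by_contra h
      exact hj (if_neg h)
    rw [abs_le] at h
    rw [Set.mem_Icc]
    omega
  refine ((finite_theta_le (hfin (N + 1) fun i => α i)).prod
    (finite_theta_le (hfin N fun i => α (-i - 1)))).subset ?_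
  rintro ⟨X, Y⟩ ⟨hX, hY, hXY, hXα, hYα, hAY, -⟩
  dsimp only at *
  have hb : ∀ i j, Y i j ≠ 0 → |i - j| ≤ N := fun i j hij => by
    have := band_of_decreasing hm hY (fun i j => by
      have := hAY.nonneg i j
      simp only [Pi.add_apply, Pi.sub_apply, check] at this
      omega) hij
    simp only [hYα] at this
    rw [hN]
    exact this
  have hbX : ∀ i j, X i j ≠ 0 → |i - j| ≤ N + 1 := fun i j hij => by
    have h1 := hX.nonneg i j
    have h2 := hX.nonneg (-i - 1) (-j)
    have h3 := hXY i j
    rcases (show Y i j ≠ 0 ∨ Y (-i - 1) (-j) ≠ 0 by omega) with h | h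
    · have := hb _ _ h
      omega
    · have := abs_le.1 (hb _ _ h)
      rw [abs_le]
      omega
  refine ⟨⟨hX, fun i j => ?_⟩, hY, fun i j => ?_⟩
  · dsimp only
    split_ifs with h
    · rw [← hXα]; exact le_rowSum hX i j
    · by_contra h'
      exact h (hbX i j (by omega))
  · dsimp only
    split_ifs with h
    · rw [← hYα]; exact le_rowSum hY i j
    · by_contra h'
      exact h (hb i j (by omega))

/-! ### The off-diagonal entries of a tridiagonal matrix -/

/-- Each place next to the diagonal is met by exactly one residue class: that of its row above the
diagonal, and that of the negated row below it. -/
theorem sum_mul_ETheta (hα : ∀ i, α (i + (2 * r + 2)) = α i) (a b : ℤ) :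
    ∑ i ∈ Finset.Icc (1 : ℤ) (2 * r + 2), (α i : ℤ) * ETheta r i a b =
      if b = a + 1 then (α a : ℤ) else if b = a - 1 then (α (-a) : ℤ) else 0 := by
  have hn : (0 : ℤ) < 2 * r + 2 := by omega
  have hαk : ∀ k i : ℤ, α (i + k * (2 * r + 2)) = α i := fun k i => by
    have := periodic_mul (n := 2 * r + 2) (M := fun i _ => (α i : ℤ))
      (fun i _ => by rw [hα]) k i 0
    exact_mod_cast this
  have key : ∀ x : ℤ, ∃ k : ℤ, x + k * (2 * r + 2) ∈ Finset.Icc (1 : ℤ) (2 * r + 2) := fun x => by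
    refine ⟨-((x - 1) / (2 * r + 2)), ?_⟩
    have h2 := Int.emod_add_mul_ediv (x - 1) (2 * r + 2)
    have h3 := Int.emod_nonneg (x - 1) hn.ne'
    have h4 := Int.emod_lt_of_pos (x - 1) hn
    have h5 : x + -((x - 1) / (2 * r + 2)) * (2 * r + 2) = (x - 1) % (2 * r + 2) + 1 := by
      linear_combination -h2
    rw [h5, Finset.mem_Icc]
    omega
  have uniq : ∀ i j k : ℤ, i ∈ Finset.Icc (1 : ℤ) (2 * r + 2) → j ∈ Finset.Icc (1 : ℤ) (2 * r + 2) →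
      i = j + k * (2 * r + 2) → i = j := fun i j k hi hj h => by
    rw [Finset.mem_Icc] at hi hj
    have : k = 0 := by
      rcases lt_trichotomy k 0 with h' | h' | h'
      · nlinarith
      · exact h'
      · nlinarith
    rw [h, this]
    ring
  split_ifs with h1 h2
  · obtain ⟨k, hk⟩ := key a
    rw [Finset.sum_eq_single_of_mem _ hk]
    · rw [hαk, ETheta, if_pos ⟨-k, Or.inl ⟨by ring, by rw [h1]; ring⟩⟩, mul_one]
    · intro i hi hne
      rw [ETheta, if_neg, mul_zero]
      rintro ⟨l, ⟨h3, h4⟩ | ⟨h3, h4⟩⟩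
      · exact hne (uniq _ _ (-l - k) hi hk (by rw [h3]; ring))
      · omega
  · obtain ⟨k, hk⟩ := key (-a)
    rw [Finset.sum_eq_single_of_mem _ hk]
    · rw [hαk, ETheta, if_pos ⟨k, Or.inr ⟨by ring, by rw [h2]; ring⟩⟩, mul_one]
    · intro i hi hne
      rw [ETheta, if_neg, mul_zero]
      rintro ⟨l, ⟨h3, h4⟩ | ⟨h3, h4⟩⟩
      · omega
      · exact hne (uniq _ _ (l - k) hi hk (by rw [h3]; ring))
  · refine Finset.sum_eq_zero fun i _ => ?_
    rw [ETheta, if_neg, mul_zero]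
    rintro ⟨l, ⟨h3, h4⟩ | ⟨h3, h4⟩⟩
    · exact h1 (by rw [h3, h4]; ring)
    · exact h2 (by rw [h3, h4]; ring)

theorem exists_isOffDiag (hB : IsXi r d B) (htri : IsTridiagonal B) : ∃ α, IsOffDiag r B α := by
  have hper : ∀ i : ℤ, (B (i + (2 * r + 2)) (i + (2 * r + 2) + 1)).toNat = (B i (i + 1)).toNat :=
    fun i => by rw [← hB.periodic i (i + 1)]; congr 2; ring
  refine ⟨fun i => (B i (i + 1)).toNat, hper, fun a b hab => ?_⟩
  rw [sum_mul_ETheta (α := fun i => (B i (i + 1)).toNat) hper, sub_eq_zero]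
  split_ifs with h1 h2
  · rw [Int.toNat_of_nonneg (hB.nonneg _ _), h1]
  · rw [Int.toNat_of_nonneg (hB.nonneg _ _), h2, ← hB.symm]
    congr 1
    ring
  · exact htri a b (by rw [lt_abs]; omega)

/-- So `α` is forced to be the superdiagonal of `B`, and the second sum does not depend on a choice.
-/
theorem IsOffDiag.eq (h : IsOffDiag r B α) (i : ℤ) : (α i : ℤ) = B i (i + 1) := by
  have := h.2 i (i + 1) (by omega)
  rw [sum_mul_ETheta h.1, if_pos rfl] at this
  omega

end

end AffineC

/-! ### Comparison of the coefficients -/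

namespace AffineC

/-! ### Comparison of the coefficients -/

section

variable {r d : ℕ} {A B X Y T S : ℤ → ℤ → ℤ} {α : ℤ → ℕ}

theorem prod_Icc_succ (r : ℕ) (f : ℤ → K) :
    ∏ i ∈ Finset.Icc (1 : ℤ) (r + 1), f i = ∏ k ∈ Finset.Icc (0 : ℤ) r, f (k + 1) := by
  refine Finset.prod_nbij' (fun i => i - 1) (fun k => k + 1) (fun i hi => ?_) (fun i hi => ?_)
    (fun i _ => by ring) (fun i _ => by ring) fun i _ => by ring_nf
  · rw [Finset.mem_Icc] at *; omega
  · rw [Finset.mem_Icc] at *; omega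

theorem sum_Icc_succ (r : ℕ) (f : ℤ → ℤ) :
    ∑ i ∈ Finset.Icc (1 : ℤ) (r + 1), f i = ∑ k ∈ Finset.Icc (0 : ℤ) r, f (k + 1) := by
  refine Finset.sum_nbij' (fun i => i - 1) (fun k => k + 1) (fun i hi => ?_) (fun i hi => ?_)
    (fun i _ => by ring) (fun i _ => by ring) fun i _ => by ring_nf
  · rw [Finset.mem_Icc] at *; omega
  · rw [Finset.mem_Icc] at *; omega

theorem prod_period_eq (r : ℕ) (f : ℤ → K) :
    ∏ i ∈ period r, f i = ∏ k ∈ Finset.Icc (0 : ℤ) r, f k * f (-k - 1) := by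
  have h : period r = Finset.Icc (0 : ℤ) r ∪ (Finset.Icc (0 : ℤ) r).image fun k => -k - 1 := by
    ext i
    simp only [period, Finset.mem_union, Finset.mem_image, Finset.mem_Icc]
    refine ⟨fun h => ?_, ?_⟩
    · rcases le_or_gt 0 i with h' | h'
      · exact Or.inl ⟨h', h.2⟩
      · exact Or.inr ⟨-i - 1, by omega, by ring⟩
    · rintro (h | ⟨k, h, rfl⟩) <;> omega
  rw [h, Finset.prod_union, Finset.prod_image, ← Finset.prod_mul_distrib]
  · intro a _ b _ hab
    dsimp only at hab
    omega
  · rw [Finset.disjoint_left]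
    intro a ha ha'
    simp only [Finset.mem_image, Finset.mem_Icc] at ha ha'
    obtain ⟨k, hk, rfl⟩ := ha'
    omega

theorem prod_period_eq' (r : ℕ) {f : ℤ → K} (hf : ∀ i, f (i + (2 * r + 2)) = f i) :
    ∏ i ∈ Finset.Icc (1 : ℤ) (2 * r + 2), f i =
      ∏ k ∈ Finset.Icc (0 : ℤ) r, f (k + 1) * f (-k) := by
  have h : Finset.Icc (1 : ℤ) (2 * r + 2) = (Finset.Icc (0 : ℤ) r).image (fun k => k + 1) ∪
      (Finset.Icc (0 : ℤ) r).image fun k => -k + (2 * (r : ℤ) + 2) := by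
    ext i
    simp only [Finset.mem_union, Finset.mem_image, Finset.mem_Icc]
    refine ⟨fun h => ?_, ?_⟩
    · rcases le_or_gt i (r + 1) with h' | h'
      · exact Or.inl ⟨i - 1, by omega, by ring⟩
      · exact Or.inr ⟨-i + (2 * r + 2), by omega, by ring⟩
    · rintro (⟨k, h, rfl⟩ | ⟨k, h, rfl⟩) <;> omega
  rw [h, Finset.prod_union, Finset.prod_image, Finset.prod_image, ← Finset.prod_mul_distrib]
  · exact Finset.prod_congr rfl fun k _ => by rw [hf]
  · intro a _ b _ hab
    dsimp only at hab
    omega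
  · intro a _ b _ hab
    dsimp only at hab
    omega
  · rw [Finset.disjoint_left]
    intro a ha ha'
    simp only [Finset.mem_image, Finset.mem_Icc] at ha ha'
    obtain ⟨k, hk, rfl⟩ := ha
    obtain ⟨l, hl, h⟩ := ha'
    omega

theorem matFact_eq (hT : IsTheta r T) : matFact r T =
    ∏ k ∈ Finset.Icc (0 : ℤ) r, (∏ᶠ j, qfact (T (k + 1) j)) * ∏ᶠ j, qfact (T (-k) (-j)) := by
  rw [matFact, prod_period_eq' r (f := fun i => ∏ᶠ j, qfact (T i j)) fun i => ?_]
  · refine Finset.prod_congr rfl fun k _ => ?_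
    congr 1
    exact (finprod_comp_equiv (Equiv.neg ℤ) (f := fun j => qfact (T (-k) j))).symm
  · rw [← finprod_comp_equiv (Equiv.addRight (2 * (r : ℤ) + 2))]
    exact finprod_congr fun j => by rw [Equiv.coe_addRight, hT.periodic]

theorem finprod_period_eq (X : ℤ → ℤ → ℤ) : ∏ i ∈ period r, ∏ᶠ j, qfact (X i j) =
    ∏ k ∈ Finset.Icc (0 : ℤ) r, (∏ᶠ j, qfact (X k j)) * ∏ᶠ j, qfact (X (-k - 1) (-j)) := by
  rw [prod_period_eq r (f := fun i => ∏ᶠ j, qfact (X i j))]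
  refine Finset.prod_congr rfl fun k _ => ?_
  congr 1
  exact (finprod_comp_equiv (Equiv.neg ℤ) (f := fun j => qfact (X (-k - 1) j))).symm

theorem finprod_qfact_ne_zero' (f : ℤ → ℤ) : ∏ᶠ j, qfact (f j) ≠ 0 := by
  by_cases hf : (Function.mulSupport fun j => qfact (f j)).Finite
  · rw [finprod_eq_prod _ hf]
    exact Finset.prod_ne_zero_iff.2 fun j _ => qfact_ne_zero _
  · rw [finprod_of_infinite_mulSupport hf]
    exact one_ne_zero

theorem prod_quotient {ι : Type*} (I : Finset ι) (f₁ f₂ f₃ f₄ g₁ g₂ : ι → K) :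
    ∏ k ∈ I, f₁ k * f₂ k * f₃ k * f₄ k / (g₁ k * g₂ k) =
      (∏ k ∈ I, f₁ k) * (∏ k ∈ I, f₂ k) * (∏ k ∈ I, f₃ k) * (∏ k ∈ I, f₄ k) /
        ((∏ k ∈ I, g₁ k) * ∏ k ∈ I, g₂ k) := by
  simp only [Finset.prod_mul_distrib, Finset.prod_div_distrib]

/-- The powers of `v` are compared by `lenABST_sub`. Since `A^{(T-S)} - X_θ = A - T_θ`,
`brackXY_mul` turns the quotient of `[·]_c^!` factors into the symbol times the factorials of `X`.
The remaining factorials of `X`, `S`, `T - S` and the factors of `⟦S⟧` regroup row by row into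
`rowTerm`. -/
theorem coef_eq (hd : 2 ≤ d) (hA : IsXi r d A) (hB : IsXi r d B)
    (htri : IsTridiagonal B) (hAB : rowC r A = colC r B) (hT : T ∈ ThetaSet r B A)
    (hS : S ∈ GammaSet r T) :
    (v ^ 2 - 1) ^ nS r S * v ^ (2 * (lenABST r d A B S T - nS r S - hST r S T)) * brackAST r A S T =
      v ^ (2 * xi r (moveTS A T S) (moveX T S)) * brackXY r (moveTS A T S) (moveX T S) *
        ∏ k ∈ Finset.Icc (0 : ℤ) r, rowTerm (moveX T S k) (fun j => moveX T S (-k - 1) (-j))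
          (negMat T k) fun j => S (-k) (-j) := by
  have hXθ : IsTheta r (moveX T S) := hT.1.moveX hS.1 hS.2.1
  have hsub : IsTheta r (T - S) := hT.1.sub hS.1 hS.2.1
  have hC : IsXi r d (moveTS A T S) := isXi_moveTS hA hT hS
  have hCX : moveTS A T S - theta (moveX T S) = A - theta T := by
    rw [moveTS_eq]
    funext i j
    simp only [Pi.sub_apply, Pi.add_apply, theta, negMat]
    ring
  have hle : ∀ i j, theta (moveX T S) i j ≤ moveTS A T S i j := fun i j => by
    have h1 := congrFun (congrFun hCX i) j
    have h2 := hT.2.1 i j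
    simp only [Pi.sub_apply] at h1
    omega
  have hbr := brackXY_mul hXθ hC hle
  rw [hCX, finprod_period_eq] at hbr
  have hrow : ∀ k, rowTerm (moveX T S k) (fun j => moveX T S (-k - 1) (-j))
      (negMat T k) (fun j => S (-k) (-j)) =
      v ^ (2 * rowExp (moveX T S k) (negMat T k) (S (k + 1)) (dagger S (k + 1))) *
        (v ^ 2 - 1) ^ rowSum S (k + 1) *
        ((∏ᶠ j, qfact (moveX T S k j)) * ∏ᶠ j, qfact (moveX T S (-k - 1) (-j))) *
        (∏ᶠ j, qbinom (∑ᶠ l ∈ Set.Iic j, (S (k + 1) l - dagger S (k + 1) l))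
          (dagger S (k + 1) (j + 1)) * qfact (dagger S (k + 1) (j + 1))) /
        (((∏ᶠ j, qfact ((T - S) (k + 1) j)) * ∏ᶠ j, qfact ((T - S) (-k) (-j))) *
        ((∏ᶠ j, qfact (S (k + 1) j)) * ∏ᶠ j, qfact (S (-k) (-j)))) := by
    intro k
    have e1 : (fun j => S (-k) (-j)) = dagger S (k + 1) := by
      funext j
      rw [dagger]
      congr 1
      ring
    have e2 : dagger S (k + 1) + (fun j => moveX T S (-k - 1) (-j)) - negMat T k = S (k + 1) := by
      rw [← e1]
      funext j
      simp only [Pi.sub_apply, Pi.add_apply, moveX, negMat]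
      ring_nf
    have e3 : total (dagger S (k + 1)) = rowSum S (k + 1) := (hS.2.2 (k + 1)).symm
    have e4 : moveX T S k - dagger S (k + 1) = (T - S) (k + 1) := by
      rw [← e1]
      funext j
      simp only [Pi.sub_apply, moveX]
      ring
    have e5 : negMat T k - dagger S (k + 1) = fun j => (T - S) (-k) (-j) := by
      rw [← e1]
      rfl
    rw [rowTerm, e1, e2, e3, e4, e5, ← e1]
    simp only [mul_assoc]
  rw [lenABST_sub hd hA hB htri hAB hT hS, brackAST, matFact_eq hsub, matFact_eq hS.1,
    Finset.prod_congr rfl fun k _ => hrow k, prod_quotient, ← hbr, dbrack,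
    prod_Icc_succ, nS, sum_Icc_succ, sum_Icc_succ, zpow_sum_of_ne_zero v_sq_sub_one_ne_zero, mul_add,
    zpow_add₀ v_ne_zero, Finset.mul_sum, zpow_sum_of_ne_zero v_ne_zero]
  simp only [add_sub_cancel_right]
  have n1 := matFactC_ne_zero r (A - theta T)
  have n2 : ∏ k ∈ Finset.Icc (0 : ℤ) r, (∏ᶠ j, qfact ((T - S) (k + 1) j)) *
      ∏ᶠ j, qfact ((T - S) (-k) (-j)) ≠ 0 := Finset.prod_ne_zero_iff.2 fun k _ =>
    mul_ne_zero (finprod_qfact_ne_zero' _) (finprod_qfact_ne_zero' _)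
  have n3 : ∏ k ∈ Finset.Icc (0 : ℤ) r, (∏ᶠ j, qfact (S (k + 1) j)) *
      ∏ᶠ j, qfact (S (-k) (-j)) ≠ 0 := Finset.prod_ne_zero_iff.2 fun k _ =>
    mul_ne_zero (finprod_qfact_ne_zero' _) (finprod_qfact_ne_zero' _)
  rw [mul_div_assoc', mul_div_assoc', div_eq_div_iff (mul_ne_zero (mul_ne_zero n1 n3) n2)
    (mul_ne_zero n2 n3)]
  ring

end

end AffineC

/-! ### Fibres of the correspondence and the end of the proof -/

namespace AffineC

/-! ### Matrices glued from sequences -/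

section

variable {r d : ℕ} {A B X Y T S p : ℤ → ℤ → ℤ} {α : ℤ → ℕ}

/-- The periodic matrix `S` with rows `S_{-k} = p_k` (reversed), `0 ≤ k ≤ r`, such that
`moveX (negMat Y) S = X`. -/
def glue (r : ℕ) (X Y p : ℤ → ℤ → ℤ) (i j : ℤ) : ℤ :=
  if i - (i + r) / (2 * r + 2) * (2 * r + 2) ≤ 0 then
    p (-(i - (i + r) / (2 * r + 2) * (2 * r + 2))) (-(j - (i + r) / (2 * r + 2) * (2 * r + 2)))
  else
    p (i - (i + r) / (2 * r + 2) * (2 * r + 2) - 1) (j - (i + r) / (2 * r + 2) * (2 * r + 2)) +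
      X (-(i - (i + r) / (2 * r + 2) * (2 * r + 2))) (-(j - (i + r) / (2 * r + 2) * (2 * r + 2))) -
      Y (i - (i + r) / (2 * r + 2) * (2 * r + 2) - 1) (j - (i + r) / (2 * r + 2) * (2 * r + 2))

theorem glue_periodic (i j : ℤ) :
    glue r X Y p (i + (2 * r + 2)) (j + (2 * r + 2)) = glue r X Y p i j := by
  have h : (i + (2 * r + 2) + r) / (2 * r + 2 : ℤ) = (i + r) / (2 * r + 2) + 1 := by
    rw [show i + (2 * r + 2) + (r : ℤ) = i + r + 1 * (2 * r + 2) by ring,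
      Int.add_mul_ediv_right _ _ (by omega)]
  have h1 : ∀ x : ℤ, x + (2 * r + 2) - ((i + r) / (2 * r + 2) + 1) * (2 * r + 2) =
      x - (i + r) / (2 * r + 2) * (2 * r + 2) := fun x => by ring
  unfold glue
  rw [h, h1, h1]

theorem glue_low {k : ℤ} (hk : k ∈ Finset.Icc (0 : ℤ) r) (j : ℤ) :
    glue r X Y p (-k) (-j) = p k j := by
  rw [Finset.mem_Icc] at hk
  have h : (-k + r) / (2 * r + 2 : ℤ) = 0 := Int.ediv_eq_zero_of_lt (by omega) (by omega)
  rw [glue, h, zero_mul, sub_zero, if_pos (by omega)]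
  simp

theorem glue_high {k : ℤ} (hk : k ∈ Finset.Icc (0 : ℤ) r) (j : ℤ) :
    glue r X Y p (k + 1) j = p k j + X (-k - 1) (-j) - Y k j := by
  rw [Finset.mem_Icc] at hk
  have h : (k + 1 + r) / (2 * r + 2 : ℤ) = 0 := Int.ediv_eq_zero_of_lt (by omega) (by omega)
  rw [glue, h, zero_mul, sub_zero, if_neg (by omega), neg_add', add_sub_cancel_right, sub_zero]

theorem exists_row (r : ℕ) (i : ℤ) : ∃ m : ℤ, ∃ k ∈ Finset.Icc (0 : ℤ) r,
    i + m * (2 * r + 2) = -k ∨ i + m * (2 * r + 2) = k + 1 := by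
  obtain ⟨m, hm⟩ := exists_period_shift r (i - 1)
  rw [period, Finset.mem_Icc] at hm
  rcases le_or_gt (i + m * (2 * r + 2)) 0 with h | h
  · exact ⟨m, -(i + m * (2 * r + 2)), Finset.mem_Icc.2 (by omega), Or.inl (by ring)⟩
  · exact ⟨m, i + m * (2 * r + 2) - 1, Finset.mem_Icc.2 (by omega), Or.inr (by ring)⟩

/-- Up to translation each row is `-k` or `k + 1` with `0 ≤ k ≤ r`. For `-k` the bounds are those
imposed directly on `p k`; for `k + 1` they are the other two conditions of `rowIndex`, rewritten by
the relation between `X` and `Y`. -/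
theorem glue_bounds (hY : IsTheta r Y)
    (hXY : ∀ i j, X i j + X (-i - 1) (-j) = Y i j + Y (-i - 1) (-j))
    (hp : ∀ k ∈ Finset.Icc (0 : ℤ) r, p k ∈ rowIndex (X k) (fun j => X (-k - 1) (-j)) (Y k))
    (i j : ℤ) : 0 ≤ glue r X Y p i j ∧ glue r X Y p i j ≤ negMat Y i j := by
  obtain ⟨m, k, hk, h⟩ := exists_row r i
  rw [← periodic_mul (M := glue r X Y p) glue_periodic m i j,
    ← periodic_mul hY.negMat.periodic m i j]
  generalize j + m * (2 * r + 2) = j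
  rcases h with h | h <;> rw [h]
  · obtain ⟨j, rfl⟩ : ∃ j', j = -j' := ⟨-j, by ring⟩
    rw [glue_low hk, negMat, neg_neg, neg_neg]
    have := hp k hk j
    exact ⟨this.1, this.2.2.1⟩
  · rw [glue_high hk, negMat, neg_add']
    have h1 := hp k hk j
    have h2 := hXY k j
    dsimp only at h1
    omega

theorem moveX_glue (hX : IsTheta r X) (hY : IsTheta r Y)
    (hXY : ∀ i j, X i j + X (-i - 1) (-j) = Y i j + Y (-i - 1) (-j)) :
    moveX (negMat Y) (glue r X Y p) = X := by
  have hper : ∀ i j, moveX (negMat Y) (glue r X Y p) (i + (2 * r + 2)) (j + (2 * r + 2)) =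
      moveX (negMat Y) (glue r X Y p) i j := fun i j => by
    have h1 := hY.negMat.periodic (i + 1) j
    have h2 := glue_periodic (r := r) (X := X) (Y := Y) (p := p) (i + 1) j
    have h3 := glue_periodic (r := r) (X := X) (Y := Y) (p := p) (-(i + (2 * r + 2)))
      (-(j + (2 * r + 2)))
    rw [add_right_comm] at h1 h2
    rw [show -(i + (2 * (r : ℤ) + 2)) + (2 * r + 2) = -i by ring,
      show -(j + (2 * (r : ℤ) + 2)) + (2 * r + 2) = -j by ring] at h3
    rw [moveX, moveX, h1, h2, h3]
  funext i j
  obtain ⟨m, hm⟩ := exists_period_shift r i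
  rw [← periodic_mul hper m, ← periodic_mul hX.periodic m]
  revert hm
  generalize i + m * (2 * r + 2) = i
  generalize j + m * (2 * r + 2) = j
  intro hm
  rw [period, Finset.mem_Icc] at hm
  rcases le_or_gt 0 i with h | h
  · have hk : i ∈ Finset.Icc (0 : ℤ) r := Finset.mem_Icc.2 ⟨h, hm.2⟩
    rw [moveX, glue_high hk, glue_low hk, negMat, neg_add']
    linarith [hXY i j]
  · obtain ⟨k, rfl⟩ : ∃ k, i = -k - 1 := ⟨-i - 1, by ring⟩
    obtain ⟨j, rfl⟩ : ∃ j', j = -j' := ⟨-j, by ring⟩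
    have hk : k ∈ Finset.Icc (0 : ℤ) r := Finset.mem_Icc.2 (by omega)
    rw [moveX, sub_add_cancel, glue_low hk, show -(-k - 1) = k + 1 by ring, glue_high hk, negMat,
      neg_neg, neg_neg]
    ring

theorem rowSum_dagger (S : ℤ → ℤ → ℤ) (i : ℤ) : rowSum (dagger S) (i + 1) = rowSum S (-i) := by
  rw [rowSum, rowSum, ← finsum_neg_index]
  refine finsum_congr fun j => ?_
  rw [dagger, neg_neg]
  congr 1
  ring

theorem rowSum_moveX (hT : IsTheta r T) (hS : IsTheta r S) (i : ℤ) :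
    rowSum (moveX T S) i = rowSum T (i + 1) - rowSum S (i + 1) + rowSum (dagger S) (i + 1) := by
  have h1 : (Function.support fun j => T (i + 1) j).Finite := hT.finite_row _
  have h2 : (Function.support fun j => S (i + 1) j).Finite := hS.finite_row _
  have h3 : (Function.support fun j => S (-i) (-j)).Finite := hS.negMat.finite_row i
  have h4 : (Function.support fun j => T (i + 1) j - S (i + 1) j).Finite := finite_sub h1 h2
  rw [rowSum_dagger, rowSum, rowSum, rowSum, rowSum, ← finsum_sub_distrib h1 h2,
    ← finsum_neg_index (S (-i)), ← finsum_add_distrib h4 h3]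
  rfl

theorem mem_indexXY (hA : IsXi r d A) (hα : ∀ i, (α i : ℤ) = B i (i + 1))
    (hT : T ∈ ThetaSet r B A) (hS : S ∈ GammaSet r T) :
    (moveX T S, negMat T) ∈ indexXY r d A α := by
  have hY := hT.1.negMat
  have hle : ∀ i j, negMat T i j ≤ A i j := fun i j => by
    have h1 := hT.2.1 i j
    have h2 := hT.1.nonneg i j
    rw [theta] at h1
    rw [negMat]
    omega
  have hcheck : check (negMat T) = fun i j => negMat T (i + -1) j := rfl
  refine ⟨hT.1.moveX hS.1 hS.2.1, hY, fun i j => ?_, fun i => ?_, fun i => ?_, ?_, ?_⟩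
  · simp only [moveX, negMat]
    ring_nf
  · rw [rowSum_moveX hT.1 hS.1, ← hS.2.2, hT.2.2, hα]
    ring_nf
  · rw [rowSum, hα, ← finsum_neg_index]
    have := hT.2.2 (-i)
    rw [rowSum] at this
    simp only [negMat, neg_neg]
    rw [this]
    congr 1
    ring
  · rw [hcheck]
    exact (hA.toIsTheta.sub hY hle).add (hY.shift (-1))
  · rw [← moveTS_eq_moveXY]
    exact isXi_moveTS hA hT hS

/-- The fibres of the correspondence between the index sets are products over the rows. -/
theorem bijOn_fibre (hα : ∀ i, (α i : ℤ) = B i (i + 1)) (hXY : (X, Y) ∈ indexXY r d A α)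
    (hθ : ∀ i j, theta (negMat Y) i j ≤ A i j)
    (t : Finset.Icc (0 : ℤ) r → Finset (ℤ → ℤ))
    (ht : ∀ k f, f ∈ t k ↔ f ∈ rowIndex (X k) (fun j => X (-k - 1) (-j)) (Y k)) :
    Set.BijOn (fun (q : (ℤ → ℤ → ℤ) × (ℤ → ℤ → ℤ)) (k : Finset.Icc (0 : ℤ) r) (j : ℤ) =>
        q.2 (-k) (-j))
      {q | q ∈ indexTS r B A ∧ (moveX q.1 q.2, negMat q.1) = (X, Y)}
      (Fintype.piFinset t : Set (Finset.Icc (0 : ℤ) r → ℤ → ℤ)) := by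
  obtain ⟨hX, hY, hrel, hXα, hYα, -, -⟩ := hXY
  dsimp only at hX hY hrel hXα hYα
  refine ⟨?_, ?_, ?_⟩
  -- For `s'_j = S (-k) (-j)` the conditions of `rowIndex` say in turn: `S ≥ 0` in row `-k`, `S ≤ T`
  -- in row `k + 1`, `S ≤ T` in row `-k`, and `S ≥ 0` in row `k + 1`.
  · rintro ⟨T, S⟩ ⟨⟨hT, hS⟩, h⟩
    obtain ⟨rfl, rfl⟩ := Prod.ext_iff.1 h
    rw [Finset.mem_coe, Fintype.mem_piFinset]
    intro k
    rw [ht]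
    intro j
    have h1 := hS.2.1 (k + 1) j
    have h2 := hS.2.1 (-k) (-j)
    have h3 := hS.1.nonneg (k + 1) j
    have h4 := hS.1.nonneg (-k) (-j)
    dsimp only at *
    have e1 : moveX T S (-k - 1) (-j) = T (-k) (-j) - S (-k) (-j) + S (k + 1) j := by
      rw [moveX]
      ring_nf
    have e2 : moveX T S k j = T (k + 1) j - S (k + 1) j + S (-k) (-j) := rfl
    have e3 : negMat T k j = T (-k) (-j) := rfl
    omega
  -- `Y` determines `T`. The rows `-k` of `S` are given, and `X` then determines the rows `k + 1`;
  -- periodicity gives the others.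
  · rintro ⟨T, S⟩ ⟨⟨hT, hS⟩, h⟩ ⟨T', S'⟩ ⟨⟨hT', hS'⟩, h'⟩ heq
    obtain ⟨h1, h2⟩ := Prod.ext_iff.1 h
    obtain ⟨h1', h2'⟩ := Prod.ext_iff.1 h'
    dsimp only at *
    obtain rfl : T = T' := by rw [← negMat_negMat T, ← negMat_negMat T', h2, h2']
    have hlow : ∀ k ∈ Finset.Icc (0 : ℤ) r, ∀ j, S (-k) (-j) = S' (-k) (-j) := fun k hk j =>
      congrFun (congrFun heq ⟨k, hk⟩) j
    have : S = S' := by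
      funext i j
      obtain ⟨m, k, hk, h⟩ := exists_row r i
      rw [← periodic_mul hS.1.periodic m, ← periodic_mul hS'.1.periodic m]
      generalize j + m * (2 * r + 2) = j
      rcases h with h | h <;> rw [h]
      · have := hlow k hk (-j)
        rwa [neg_neg] at this
      · have h3 := congrFun (congrFun (h1.trans h1'.symm) k) j
        have h4 := hlow k hk j
        rw [moveX, moveX] at h3
        omega
    rw [this]
  · intro p hp
    rw [Finset.mem_coe, Fintype.mem_piFinset] at hp
    obtain ⟨P, hP⟩ : ∃ P : ℤ → ℤ → ℤ, ∀ k : Finset.Icc (0 : ℤ) r, P k = p k :=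
      ⟨fun k => if hk : k ∈ Finset.Icc (0 : ℤ) r then p ⟨k, hk⟩ else 0, fun k => dif_pos k.2⟩
    have hP' : ∀ k ∈ Finset.Icc (0 : ℤ) r, P k ∈ rowIndex (X k) (fun j => X (-k - 1) (-j)) (Y k) :=
      fun k hk => by
        rw [hP ⟨k, hk⟩]
        exact (ht ⟨k, hk⟩ _).1 (hp ⟨k, hk⟩)
    have hb := glue_bounds hY hrel hP'
    have hTθ := hY.negMat
    have hSθ : IsTheta r (glue r X Y P) :=
      ⟨fun i j => (hb i j).1, glue_periodic, fun i => (hTθ.finite_row i).subset fun j hj h =>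
        hj (le_antisymm ((hb i j).2.trans h.le) (hb i j).1)⟩
    have hmove := moveX_glue (p := P) hX hY hrel
    have hrowT : ∀ i, rowSum (negMat Y) i = α (i - 1) := fun i => by
      have h1 : rowSum (negMat Y) i = rowSum Y (-i) := finsum_neg_index (Y (-i))
      rw [h1, hYα]
      congr 2
      ring
    refine ⟨(negMat Y, glue r X Y P), ⟨⟨⟨hTθ, hθ, fun i => ?_⟩, hSθ, fun i j => (hb i j).2,
      fun i => ?_⟩, ?_⟩, ?_⟩
    · rw [hrowT, hα]
      congr 1
      ring
    -- The rows of `X` and `T` involved both have sum `α (i - 1)`, which forces the rows of `S` and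
    -- `S^†` to have equal sums.
    · have h1 := rowSum_moveX hTθ hSθ (i - 1)
      rw [hmove, hXα, sub_add_cancel, hrowT] at h1
      dsimp only
      omega
    · dsimp only
      rw [hmove, negMat_negMat]
    · funext k j
      dsimp only
      rw [glue_low k.2, hP]

/-- Consequently `X_θ ≤ A_{X,Y}` holds if and only if `T_θ ≤ A` does, for `T` the reflection of `Y`.
-/
theorem sub_theta_moveXY (hrel : ∀ i j, X i j + X (-i - 1) (-j) = Y i j + Y (-i - 1) (-j)) :
    moveXY A X Y - theta X = A - theta (negMat Y) := by
  funext i j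
  have h := hrel (i - 1) j
  rw [show -(i - 1) - 1 = -i by ring] at h
  simp only [Pi.sub_apply, moveXY, theta, negMat, check, neg_neg]
  linarith

/-- Distributing the product over rows of the sums in `nSeq_eq` gives a sum over families of
sequences, the shape of a fibre. -/
theorem nXY_eq (hX : IsTheta r X) (hY : IsTheta r Y)
    (hrow : ∀ i, rowSum X (-i - 1) = rowSum Y i)
    (t : Finset.Icc (0 : ℤ) r → Finset (ℤ → ℤ))
    (ht : ∀ k f, f ∈ t k ↔ f ∈ rowIndex (X k) (fun j => X (-k - 1) (-j)) (Y k)) :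
    nXY r X Y = ∑ p ∈ Fintype.piFinset t,
      ∏ k : Finset.Icc (0 : ℤ) r, rowTerm (X k) (fun j => X (-k - 1) (-j)) (Y k) (p k) := by
  rw [← Finset.prod_univ_sum, nXY, ← Finset.prod_coe_sort]
  refine Finset.prod_congr rfl fun k _ => ?_
  have hb : (fun j => X (-(k : ℤ) - 1) (-j)).support.Finite := by
    have := hX.negMat.finite_row (k + 1)
    simp only [negMat, neg_add'] at this
    exact this
  rw [nSeq_eq (hX.finite_row k) hb (hY.finite_row k) (hX.nonneg k), ← finsum_mem_coe_finset]
  · refine finsum_mem_congr ?_ fun _ _ => rfl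
    ext f
    rw [Finset.mem_coe, ht]
  · rw [total, finsum_neg_index (X (-(k : ℤ) - 1))]
    exact hrow k

/-- If `T_θ ≤ A`, sum `coef_eq` over the product description of the fibre. Otherwise the fibre is
empty and the symbol on the right is zero. -/
theorem sum_fibre (hd : 2 ≤ d) (hA : IsXi r d A) (hB : IsXi r d B)
    (htri : IsTridiagonal B) (hAB : rowC r A = colC r B) (hα : ∀ i, (α i : ℤ) = B i (i + 1))
    (hXY : (X, Y) ∈ indexXY r d A α) :
    ∑ᶠ q ∈ {q | q ∈ indexTS r B A ∧ (moveX q.1 q.2, negMat q.1) = (X, Y)},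
      (v ^ 2 - 1) ^ nS r q.2 * v ^ (2 * (lenABST r d A B q.2 q.1 - nS r q.2 - hST r q.2 q.1)) *
        brackAST r A q.2 q.1 =
      v ^ (2 * xi r (moveXY A X Y) X) * nXY r X Y * brackXY r (moveXY A X Y) X := by
  obtain ⟨hX, hY, hrel, hXα, hYα, -, hC⟩ := id hXY
  dsimp only at hX hY hrel hXα hYα hC
  have hsub := sub_theta_moveXY (A := A) hrel
  by_cases hθ : ∀ i j, theta (negMat Y) i j ≤ A i j
  · let t : Finset.Icc (0 : ℤ) r → Finset (ℤ → ℤ) := fun k =>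
      (finite_rowIndex (hX.finite_row k) (fun j => X (-k - 1) (-j)) (Y k)).toFinset
    have ht : ∀ k f, f ∈ t k ↔ f ∈ rowIndex (X k) (fun j => X (-k - 1) (-j)) (Y k) := fun k f =>
      Set.Finite.mem_toFinset _
    rw [nXY_eq hX hY (fun i => by rw [hXα, hYα]) t ht, ← finsum_mem_coe_finset]
    rw [finsum_mem_eq_of_bijOn _ (bijOn_fibre hα hXY hθ t ht) (g := fun p =>
      v ^ (2 * xi r (moveXY A X Y) X) * brackXY r (moveXY A X Y) X *
        ∏ k : Finset.Icc (0 : ℤ) r, rowTerm (X k) (fun j => X (-k - 1) (-j)) (Y k) (p k))]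
    · rw [← mul_finsum_mem]
      ring
    · rintro ⟨T, S⟩ ⟨⟨hT, hS⟩, h⟩
      obtain ⟨rfl, rfl⟩ := Prod.ext_iff.1 h
      dsimp only
      rw [coef_eq hd hA hB htri hAB hT hS, moveTS_eq_moveXY, ← Finset.prod_coe_sort]
  · have hempty : {q | q ∈ indexTS r B A ∧ (moveX q.1 q.2, negMat q.1) = (X, Y)} = ∅ := by
      refine Set.eq_empty_of_forall_notMem ?_
      rintro ⟨T, S⟩ ⟨⟨hT, hS⟩, h⟩
      obtain ⟨rfl, rfl⟩ := Prod.ext_iff.1 h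
      refine hθ ?_
      dsimp only
      rw [negMat_negMat]
      exact hT.2.1
    rw [hempty, finsum_mem_empty, brackXY_eq_zero hX hC, mul_zero]
    refine fun h => hθ fun i j => ?_
    have h1 := congrFun (congrFun hsub i) j
    have h2 := h i j
    simp only [Pi.sub_apply] at h1
    omega

end

theorem rhsTS_eq_rhsXY {r d : ℕ} {A B : ℤ → ℤ → ℤ} {α : ℤ → ℕ} (hd : 2 ≤ d) (hA : IsXi r d A)
    (hB : IsXi r d B) (htri : IsTridiagonal B) (hAB : rowC r A = colC r B)
    (hα : ∀ i, (α i : ℤ) = B i (i + 1)) : rhsTS r d B A = rhsXY r d A α := by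
  rw [rhsTS, rhsXY, finsum_mem_fiberwise (finite_indexTS hA) (finite_indexXY hA α)
    (φ := fun q => (moveX q.1 q.2, negMat q.1)) fun q hq => mem_indexXY hA hα hq.1 hq.2]
  refine finsum_mem_congr rfl ?_
  rintro ⟨X, Y⟩ hXY
  dsimp only
  rw [← sum_fibre hd hA hB htri hAB hα hXY]
  have hfin : {q | q ∈ indexTS r B A ∧ (moveX q.1 q.2, negMat q.1) = (X, Y)}.Finite :=
    (finite_indexTS hA).subset fun q hq => hq.1
  -- All terms of a fibre multiply the same basis vector, so the scalars can be added first.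
  have h := (LinearMap.toSpanSingleton K _ (e r d (moveXY A X Y))).toAddMonoidHom.map_finsum_mem
    (fun q : (ℤ → ℤ → ℤ) × (ℤ → ℤ → ℤ) => (v ^ 2 - 1) ^ nS r q.2 *
      v ^ (2 * (lenABST r d A B q.2 q.1 - nS r q.2 - hST r q.2 q.1)) * brackAST r A q.2 q.1) hfin
  refine Eq.trans (finsum_mem_congr rfl ?_) h.symm
  rintro ⟨T, S⟩ ⟨-, hq⟩
  obtain ⟨rfl, rfl⟩ := Prod.ext_iff.1 hq
  dsimp only
  rw [moveTS_eq_moveXY]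
  rfl

end AffineC

theorem mainTheorem11 (r d : ℕ) (hd : 2 ≤ d) (A B : ℤ → ℤ → ℤ)
    (hA : AffineC.IsXi r d A) (hB : AffineC.IsXi r d B) (htri : AffineC.IsTridiagonal B)
    (hAB : AffineC.rowC r A = AffineC.colC r B) :
    (AffineC.indexTS r B A).Finite ∧
    (∀ p ∈ AffineC.indexTS r B A, AffineC.IsXi r d (AffineC.moveTS A p.1 p.2)) ∧
    (∃ α : ℤ → ℕ, AffineC.IsOffDiag r B α) ∧
    ∀ α : ℤ → ℕ, AffineC.IsOffDiag r B α →
      (AffineC.indexXY r d A α).Finite ∧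
      AffineC.rhsTS r d B A = AffineC.rhsXY r d A α :=
  ⟨AffineC.finite_indexTS hA, fun _ hp => AffineC.isXi_moveTS hA hp.1 hp.2,
    AffineC.exists_isOffDiag hB htri, fun α hα => ⟨AffineC.finite_indexXY hA α,
      AffineC.rhsTS_eq_rhsXY hd hA hB htri hAB hα.eq⟩⟩
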